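/- **Setting.** Let $G$ be a connected compact semisimple Lie group with complexification $G^{\mathbb C}$, let $P\subset G^{\mathbb C}$ be a parabolic subgroup and $K=G\cap P$, so that $V=G^{\mathbb C}/P=G/K$ is a flag manifold. Let $\tau:P\to (T^m)^{\mathbb C}=(\mathbb C^*)^m$ be a surjective holomorphic homomorphism and $F$ a compact connected toric Kähler manifold with $\dim_{\mathbb C}F=m$, i.e. $(T^m)^{\mathbb C}$ acts holomorphically on $F$ and $T^m$ acts effectively, preserving a Kähler form and Hamiltonian for it. Let $M=G^{\mathbb C}\times_{P,\tau}F$, with complex structure $J$, and identify $F$ with the fiber of $M\to V$ over $eP$. Write $\hat X$ for the vector field on $M$ induced by $X\in\mathfrak g^{\mathbb C}=\mathrm{Lie}(G^{\mathbb C})$, and $\mathcal B$ for the Cartan–Killing form. Let $M_{\rm reg}$ be the set of $G$-principal points of $M$ and $F_{\rm reg}=F\cap M_{\rm reg}$. Put $\mathfrak l=\mathrm{Lie}(\ker\tau\cap G)$, $\mathfrak k=\mathrm{Lie}(K)$, and let $(Z_1,\dots,Z_m)$ be a basis of the $\mathcal B$-orthogonal complement of $\mathfrak l$ in the center $\mathfrak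 z(\mathfrak k)$ which is orthonormal for $-\mathcal B$. Let $\mathfrak h\subset\mathfrak k^{\mathbb C}$ be the complexified Lie algebra of a maximal torus of $G$ contained in $K$, and let $R_{\mathfrak m}^+$ be the set of roots $\alpha$ of $(\mathfrak g^{\mathbb C},\mathfrak h)$ whose root space is not contained in $\mathrm{Lie}(P)$. For $\alpha\in R_{\mathfrak m}^+$ let $E_{\pm\alpha}$ be root vectors for $\pm\alpha$ with $\mathcal B(E_\alpha,E_{-\alpha})=1$ and $E_\alpha-E_{-\alpha},\ i(E_\alpha+E_{-\alpha})\in\mathfrak g=\mathrm{Lie}(G)$; put $H_\alpha=[E_\alpha,E_{-\alpha}]$ (the $\mathcal B$-dual of $\alpha$), $F_\alpha=\frac1{\sqrt2}(E_\alpha-E_{-\alpha})$ and $$Z_V=-\frac1{2\pi}\sum_{\alpha\in R_{\mathfrak m}^+}iH_\alpha .$$ Let $n=m+|R_{\mathfrak m}^+|=\dim_{\mathbb C}M$, $F_i=Z_i$ for $1\le i\le m$, and let $F_{m+1},\dots,F_n$ be the $F_\alpha$, $\alpha\in R_{\mathfrak m}^+$. For a $G$-invariant Kähler form $\omega$ on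 $M$ put $$h=\omega^n(\hat F_1,J\hat F_1,\dots,\hat F_n,J\hat F_n):M\to\mathbb R,$$ and let $\rho=-\frac1{4\pi}dd^c\log\det(g_{a\bar b})$ be its Ricci form ($d^cu=-du\circ J$, $g=\omega(\cdot,J\cdot)$). The algebraic representative at $p\in M$ of a $G$-invariant closed 2-form $\psi$ is the unique $Z_\psi|_p\in\mathfrak g$ with $\psi_p(\hat X,\hat Y)=\mathcal B(Z_\psi|_p,[X,Y])$ for all $X,Y\in\mathfrak g$. **Proposition.** There is a real constant $K_0\neq0$, independent of $\omega$, such that the following holds for every $G$-invariant Kähler form $\omega$ on $M$. 1. At every point of $F_{\rm reg}$ the function $h$ is differentiable and does not vanish, and the algebraic representative of the Ricci form exists, is unique and equals $$Z_\rho=\sum_{i=1}^m\frac{J\hat Z_i(\log|h|)}{4\pi}\,Z_i+Z_V .$$ 2. If the restriction to $F$ of the algebraic representative of $\omega$ is $Z_\omega|_F=\sum_{i=1}^m f_iZ_i+I_\omega$ with functions $f_i:F\to\mathbb R$ and a constant $I_\omega\in\mathfrak l$, then on all of $F$ $$h=K_0\cdot\det(f_{i,j})\cdot\prod_{\alpha\in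 R_{\mathfrak m}^+}\Big(\sum_{i=1}^m a^i_\alpha f_i+b_\alpha\Big),\qquad f_{i,j}=J\hat Z_j(f_i),\quad a_\alpha^i=\alpha(iZ_i),\quad b_\alpha=\alpha(iI_\omega),$$ where $\alpha$ is evaluated by $\alpha(X)=\mathcal B(H_\alpha,X)$. -/

import Mathlib

open scoped Manifold ContDiff Topology

namespace HomogeneousToric

noncomputable section

/-! ### Two-forms, Kähler forms and Ricci forms on complex manifolds

A complex manifold is a space charted on a complex normed space `E` with holomorphic changes of
charts; the complex structure `J` of a tangent space is multiplication by `Complex.I`. -/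

section Forms

variable {E : Type*} [NormedAddCommGroup E] [NormedSpace ℂ E]
  {M : Type*} [TopologicalSpace M] [ChartedSpace E M]

variable (E M) in
/-- A field of real alternating 2-forms on (the real tangent spaces of) `M`. -/
abbrev TwoForm : Type _ := (p : M) → (TangentSpace 𝓘(ℂ, E) p) [⋀^Fin 2]→L[ℝ] ℝ

/-- The coordinate expression of `η` in the preferred chart at `p₀`: the pull-back of `η` by the
inverse of the chart. -/
def localForm (η : TwoForm E M) (p₀ : M) (z : E) : E [⋀^Fin 2]→L[ℝ] ℝ :=
  (η ((chartAt E p₀).symm z)).compContinuousLinearMap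
    ((mfderiv 𝓘(ℂ, E) 𝓘(ℂ, E) (chartAt E p₀).symm z).restrictScalars ℝ)

/-- Kähler forms: smooth closed real 2-forms of type (1,1) with `η (v, J v) > 0` for `v ≠ 0`. -/
structure IsKahlerForm (η : TwoForm E M) : Prop where
  smooth : ∀ p₀ : M, ContDiffOn ℝ ∞ (localForm η p₀) (chartAt E p₀).target
  closed : ∀ p₀ : M, ∀ z ∈ (chartAt E p₀).target, extDeriv (localForm η p₀) z = 0
  map_J : ∀ (p : M) (v w : TangentSpace 𝓘(ℂ, E) p),
    η p ![Complex.I • v, Complex.I • w] = η p ![v, w]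
  pos : ∀ (p : M) (v : TangentSpace 𝓘(ℂ, E) p), v ≠ 0 → 0 < η p ![v, Complex.I • v]

/-- Invariance of a 2-form under the transformations `s • ·` of `M`, `s ∈ A`. -/
def IsInvariantUnder {S : Type*} [SMul S M] (A : Set S) (η : TwoForm E M) : Prop :=
  ∀ s ∈ A, ∀ (p : M) (v w : TangentSpace 𝓘(ℂ, E) p),
    η (s • p) ![mfderiv 𝓘(ℂ, E) 𝓘(ℂ, E) (fun x : M => s • x) p v,
      mfderiv 𝓘(ℂ, E) 𝓘(ℂ, E) (fun x : M => s • x) p w] = η p ![v, w]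

/-- `d^c u = - du ∘ J` for a real function `u` on a complex vector space, so that
`dd^c = 2 i ∂ ∂bar`. -/
def dc (u : E → ℝ) (z : E) : E [⋀^Fin 1]→L[ℝ] ℝ :=
  ContinuousAlternatingMap.ofSubsingleton ℝ E ℝ (0 : Fin 1)
    (-((fderiv ℝ u z).comp ((Complex.I • ContinuousLinearMap.id ℂ E).restrictScalars ℝ)))

/-- The Hermitian matrix `g_{α, βbar} = g (∂_α, ∂_βbar)` in the chart at `p₀` of the metric
`g = η (·, J ·)` extended complex bilinearly, where `∂_α = (e_α - i J e_α) / 2` for a complex basis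
`e_α` of the model space. Written in terms of `η` it is
`(η (e_α, J e_β) - i η (e_α, e_β)) / 2`. -/
def metricMatrix [FiniteDimensional ℂ E] (η : TwoForm E M) (p₀ : M) (z : E) :
    Matrix (Fin (Module.finrank ℂ E)) (Fin (Module.finrank ℂ E)) ℂ :=
  Matrix.of fun a b =>
    (((localForm η p₀ z ![Module.finBasis ℂ E a, Complex.I • Module.finBasis ℂ E b] : ℝ) : ℂ)
      - Complex.I *
        ((localForm η p₀ z ![Module.finBasis ℂ E a, Module.finBasis ℂ E b] : ℝ) : ℂ)) / 2

/-- The Ricci form `ρ = -(1 / 4π) dd^c log det (g_{α, βbar})` of `η`, computed at `p` in the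
preferred holomorphic chart at `p`; it represents the first Chern class. -/
def ricciForm [FiniteDimensional ℂ E] (η : TwoForm E M) : TwoForm E M := fun p =>
  (-(1 / (4 * Real.pi))) •
    (extDeriv (dc fun z => Real.log (metricMatrix η p z).det.re)
      (chartAt E p p)).compContinuousLinearMap
      ((mfderiv 𝓘(ℂ, E) 𝓘(ℂ, E) (chartAt E p) p).restrictScalars ℝ)

/-- The derivative of a real function on `M` in the direction of a tangent vector. -/
def dirDeriv (f : M → ℝ) (p : M) (v : TangentSpace 𝓘(ℂ, E) p) : ℝ :=
  mfderiv 𝓘(ℝ, E) 𝓘(ℝ, ℝ) f p v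

open Classical in
/-- The value `θ^n (v₁, w₁, v₂, w₂, …)`, `n = |ι|`, of the `n`-th exterior power of a 2-form on
the `2n` vectors `v_i = v (i, 0)`, `w_i = v (i, 1)`. Permuting the pairs does not change the
value, hence no order on `ι` is needed. -/
def wedgePow {ι V : Type*} [Fintype ι] [AddCommGroup V] [Module ℝ V] [TopologicalSpace V]
    (θ : V [⋀^Fin 2]→L[ℝ] ℝ) (v : ι × Fin 2 → V) : ℝ :=
  (1 / 2 ^ Fintype.card ι) * ∑ σ : Equiv.Perm (ι × Fin 2),
    ((Equiv.Perm.sign σ : ℤ) : ℝ) * ∏ i : ι, θ ![v (σ (i, 0)), v (σ (i, 1))]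

end Forms

/-! ### The groups and their Lie algebras -/

section Groups

variable {E : Type*} [NormedAddCommGroup E] [NormedSpace ℂ E] [FiniteDimensional ℂ E]
  {Gc : Type*} [TopologicalSpace Gc] [ChartedSpace E Gc] [Group Gc]

instance : FiniteDimensional ℂ (GroupLieAlgebra 𝓘(ℂ, E) Gc) :=
  inferInstanceAs (FiniteDimensional ℂ E)

instance : CompleteSpace E := FiniteDimensional.complete ℂ E

variable (E) in
/-- The Lie algebra of a closed subgroup `S` of the complex Lie group `Gc`: the initial velocities
of the one-parameter subgroups of `Gc` that are contained in `S`. (For a closed subgroup these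
velocities already form a real subspace, so the span adds nothing.) -/
def lieAlg (S : Subgroup Gc) : Submodule ℝ (GroupLieAlgebra 𝓘(ℂ, E) Gc) :=
  Submodule.span ℝ {X | ∃ γ : ℝ → Gc, (∀ s t, γ (s + t) = γ s * γ t) ∧ (∀ t, γ t ∈ S) ∧
    MDifferentiableAt 𝓘(ℝ, ℝ) 𝓘(ℝ, E) γ 0 ∧
    (mfderiv 𝓘(ℝ, ℝ) 𝓘(ℝ, E) γ 0 (1 : ℝ) : E) = X}

variable (E) in
/-- `G` is a compact connected subgroup of `Gc` with `Lie Gc = Lie G ⊕ i Lie G`. For a connected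
complex Lie group `Gc` with semisimple Lie algebra this says that `G` is a compact connected
semisimple group and that `Gc` is its complexification. -/
structure IsCompactRealForm (G : Subgroup Gc) : Prop where
  isCompact : IsCompact (G : Set Gc)
  isConnected : IsConnected (G : Set Gc)
  complexification : ∀ X : GroupLieAlgebra 𝓘(ℂ, E) Gc,
    ∃! Y : GroupLieAlgebra 𝓘(ℂ, E) Gc × GroupLieAlgebra 𝓘(ℂ, E) Gc,
      Y.1 ∈ lieAlg E G ∧ Y.2 ∈ lieAlg E G ∧ X = Y.1 + Complex.I • Y.2

variable {m : ℕ} {P : Subgroup Gc}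

variable (E) in
/-- `τ : P → (ℂˣ)^m` is holomorphic: locally it is the restriction of a holomorphic map on `Gc`. -/
def IsHolomorphicHom (τ : P →* (Fin m → ℂˣ)) : Prop :=
  ∀ x : P, ∃ φ : Gc → (Fin m → ℂ),
    ContMDiffAt 𝓘(ℂ, E) 𝓘(ℂ, Fin m → ℂ) ω φ (x : Gc) ∧
    ∀ᶠ y in 𝓝 (x : Gc), ∀ hy : y ∈ P, ∀ j, φ y j = (τ ⟨y, hy⟩ j : ℂ)

/-- The subgroup `L = ker τ ∩ G` of `K = G ∩ P`. -/
def kerSubgroup (G : Subgroup Gc) (τ : P →* (Fin m → ℂˣ)) : Subgroup Gc :=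
  G ⊓ τ.ker.map P.subtype

variable [LieGroup 𝓘(ℂ, E) ω Gc]

variable (E) in
/-- Parabolic subgroups: closed subgroups whose Lie algebra contains a Borel subalgebra, i.e. a
maximal solvable subalgebra. -/
structure IsParabolic (P : Subgroup Gc) : Prop where
  isClosed : IsClosed (P : Set Gc)
  borel : ∃ b : LieSubalgebra ℂ (GroupLieAlgebra 𝓘(ℂ, E) Gc), LieAlgebra.IsSolvable b ∧
    (∀ b' : LieSubalgebra ℂ (GroupLieAlgebra 𝓘(ℂ, E) Gc),
      LieAlgebra.IsSolvable b' → b ≤ b' → b' = b) ∧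
    ∀ X ∈ b, X ∈ lieAlg E P

/-- `(Z_1, …, Z_m)` is an orthonormal basis, with respect to minus the Cartan-Killing form, of
the orthogonal complement of `Lie (ker τ ∩ G)` in the centre of `Lie K`, `K = G ∩ P`. -/
structure IsCentralBasis (G : Subgroup Gc) (τ : P →* (Fin m → ℂˣ))
    (Z : Fin m → GroupLieAlgebra 𝓘(ℂ, E) Gc) : Prop where
  mem : ∀ i, Z i ∈ lieAlg E (G ⊓ P)
  central : ∀ i, ∀ Y ∈ lieAlg E (G ⊓ P), ⁅Z i, Y⁆ = 0
  perp : ∀ i, ∀ Y ∈ lieAlg E (kerSubgroup G τ), killingForm ℂ _ (Z i) Y = 0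
  orthonormal : ∀ i j, killingForm ℂ _ (Z i) (Z j) = if i = j then -1 else 0
  spanning : ∀ W ∈ lieAlg E (G ⊓ P), (∀ Y ∈ lieAlg E (G ⊓ P), ⁅W, Y⁆ = 0) →
    (∀ Y ∈ lieAlg E (kerSubgroup G τ), killingForm ℂ _ W Y = 0) →
    ∃ c : Fin m → ℝ, W = ∑ i, (c i : ℂ) • Z i

/-- `H` is the complexification of its intersection with `Lie K`, `K = G ∩ P`. If `H` is a Cartan
subalgebra, `H` is thus the complexified Lie algebra of a maximal torus of `G` contained in `K`. -/
def IsComplexifiedTorus (G P : Subgroup Gc)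
    (H : LieSubalgebra ℂ (GroupLieAlgebra 𝓘(ℂ, E) Gc)) : Prop :=
  ∀ X ∈ H, ∃ Y ∈ H, ∃ W ∈ H, Y ∈ lieAlg E (G ⊓ P) ∧ W ∈ lieAlg E (G ⊓ P) ∧
    X = Y + Complex.I • W

/-- The set `R_m^+` of the roots whose root space is not contained in `Lie P`. They are the roots
`α` for which `E_α` is in the complexification of the complement of `Lie K` in `Lie G` and is of
type (1,0) for the complex structure of `G / K = Gc / P`, i.e. `Lie P = Lie K ⊗ ℂ + m^{(0,1)}`. -/
abbrev PosRoot (P : Subgroup Gc) (H : LieSubalgebra ℂ (GroupLieAlgebra 𝓘(ℂ, E) Gc))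
    [H.IsCartanSubalgebra] : Type _ :=
  {α : LieModule.Weight ℂ H (GroupLieAlgebra 𝓘(ℂ, E) Gc) //
    α.IsNonZero ∧ ∃ X ∈ LieAlgebra.rootSpace H α, X ∉ lieAlg E P}

instance (P : Subgroup Gc) (H : LieSubalgebra ℂ (GroupLieAlgebra 𝓘(ℂ, E) Gc))
    [H.IsCartanSubalgebra] : Fintype (PosRoot P H) :=
  Fintype.ofFinite _

section Roots

variable (G : Subgroup Gc) {H : LieSubalgebra ℂ (GroupLieAlgebra 𝓘(ℂ, E) Gc)}
  [H.IsCartanSubalgebra]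

/-- `Ep α = E_α` and `Em α = E_{-α}` are root vectors for `α` and `-α`, normalized by
`B (E_α, E_{-α}) = 1` and such that `E_α - E_{-α}` and `i (E_α + E_{-α})` are in `Lie G`. -/
structure IsRootBasis (Ep Em : PosRoot P H → GroupLieAlgebra 𝓘(ℂ, E) Gc) : Prop where
  mem_pos : ∀ α, Ep α ∈ LieAlgebra.rootSpace H α.1
  mem_neg : ∀ α, Em α ∈ LieAlgebra.rootSpace H (-(α.1 : H → ℂ))
  normalized : ∀ α, killingForm ℂ _ (Ep α) (Em α) = 1
  sub_mem : ∀ α, Ep α - Em α ∈ lieAlg E G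
  add_mem : ∀ α, Complex.I • (Ep α + Em α) ∈ lieAlg E G

variable (Ep Em : PosRoot P H → GroupLieAlgebra 𝓘(ℂ, E) Gc)

/-- `H_α = [E_α, E_{-α}]`, which is the dual of `α` with respect to the Cartan-Killing form. -/
def coH (α : PosRoot P H) : GroupLieAlgebra 𝓘(ℂ, E) Gc := ⁅Ep α, Em α⁆

/-- The value `α (X) = B (H_α, X)`. -/
def rootValue (α : PosRoot P H) (X : GroupLieAlgebra 𝓘(ℂ, E) Gc) : ℂ :=
  killingForm ℂ _ (coH Ep Em α) X

/-- `Z_V = -(1 / 2π) ∑_{α ∈ R_m^+} i H_α`. -/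
def ZV : GroupLieAlgebra 𝓘(ℂ, E) Gc :=
  (-(1 / (2 * (Real.pi : ℂ)))) • ∑ α : PosRoot P H, Complex.I • coH Ep Em α

/-- The vectors `F_1 = Z_1, …, F_m = Z_m` and `F_α = (E_α - E_{-α}) / √2`, `α ∈ R_m^+`. -/
def frame (Z : Fin m → GroupLieAlgebra 𝓘(ℂ, E) Gc) :
    Fin m ⊕ PosRoot P H → GroupLieAlgebra 𝓘(ℂ, E) Gc :=
  Sum.elim Z fun α => (1 / ((√2 : ℝ) : ℂ)) • (Ep α - Em α)

end Roots

end Groups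

/-! ### Toric manifolds, the bundle and the algebraic representatives -/

section Toric

/-- The point `(exp z_1, …, exp z_m)` of the complex torus `(ℂˣ)^m`. -/
def expTorus {m : ℕ} (z : Fin m → ℂ) : Fin m → ℂˣ :=
  fun j => Units.mk0 (Complex.exp (z j)) (Complex.exp_ne_zero _)

/-- The compact torus `T^m` in `(ℂˣ)^m`. -/
def compactTorus (m : ℕ) : Set (Fin m → ℂˣ) := {t | ∀ j, ‖(t j : ℂ)‖ = 1}

variable {E : Type*} [NormedAddCommGroup E] [NormedSpace ℂ E]

variable (E) in
/-- The complex manifold `F` with the given action of `(ℂˣ)^m` is a toric Kähler manifold: it has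
dimension `m`, the action is holomorphic, `T^m` acts effectively, and it preserves some Kähler form
`η` for which it is Hamiltonian, with moment map components `μ_j` such that
`dμ_j (v) = η (v, Ŵ_j)`, where `Ŵ_j` generates the action of the `j`-th circle of `T^m`.
(Holomorphy of the action is expressed through the surjective local biholomorphism
`exp : ℂ^m → (ℂˣ)^m`. Compactness and connectedness of `F` are stated separately.) -/
structure IsToricKahler (m : ℕ) (F : Type*) [TopologicalSpace F] [ChartedSpace E F]
    [MulAction (Fin m → ℂˣ) F] : Prop where
  dim : Module.finrank ℂ E = m
  holomorphic : ContMDiff (𝓘(ℂ, Fin m → ℂ).prod 𝓘(ℂ, E)) 𝓘(ℂ, E) ω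
    (fun z : (Fin m → ℂ) × F => expTorus z.1 • z.2)
  effective : ∀ t ∈ compactTorus m, (∀ x : F, t • x = x) → t = 1
  kahler : ∃ η : TwoForm E F, IsKahlerForm η ∧ IsInvariantUnder (compactTorus m) η ∧
    ∃ μ : Fin m → F → ℝ, ∀ j, ContMDiff 𝓘(ℝ, E) 𝓘(ℝ, ℝ) ∞ (μ j) ∧
      ∀ (x : F) (v : TangentSpace 𝓘(ℂ, E) x), dirDeriv (μ j) x v =
        η x ![v, (mfderiv 𝓘(ℂ, Fin m → ℂ) 𝓘(ℂ, E) (fun z : Fin m → ℂ => expTorus z • x) 0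
          (Pi.single j Complex.I : Fin m → ℂ) : E)]

variable {E' : Type*} [NormedAddCommGroup E'] [NormedSpace ℂ E']
  {E'' : Type*} [NormedAddCommGroup E''] [NormedSpace ℂ E'']
  {Gc : Type*} [TopologicalSpace Gc] [ChartedSpace E Gc] [Group Gc]
  {m : ℕ} {P : Subgroup Gc}
  {F : Type*} [TopologicalSpace F] [ChartedSpace E' F]
  {M : Type*} [TopologicalSpace M] [ChartedSpace E'' M] [MulAction Gc M]

variable (E E' E'') in
/-- `M` with its `Gc`-action is the complex manifold `Gc ×_{P,τ} F`, with quotient map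
`q : Gc × F → M`: `q` is a surjective holomorphic submersion whose fibres are the orbits of the
action of `P` on `Gc × F`, that is `q (g p, x) = q (g, τ p • x)`, and it is `Gc`-equivariant.
These properties determine the complex manifold `M` and the action of `Gc` on it. -/
structure IsAssociatedBundle [MulAction (Fin m → ℂˣ) F] (τ : P →* (Fin m → ℂˣ))
    (q : Gc × F → M) : Prop where
  holomorphic : ContMDiff (𝓘(ℂ, E).prod 𝓘(ℂ, E')) 𝓘(ℂ, E'') ω q
  surjective : Function.Surjective q
  submersion : ∀ y : Gc × F,
    Function.Surjective (mfderiv (𝓘(ℂ, E).prod 𝓘(ℂ, E')) 𝓘(ℂ, E'') q y)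
  fibres : ∀ (g g' : Gc) (x x' : F),
    q (g, x) = q (g', x') ↔ ∃ p : P, g' = g * p ∧ x = τ p • x'
  equivariant : ∀ (g g' : Gc) (x : F), g • q (g', x) = q (g * g', x)

variable (E'') in
/-- The fundamental vector field of `X ∈ Lie Gc` on `M`: the velocity of the orbit map. -/
def hat (X : GroupLieAlgebra 𝓘(ℂ, E) Gc) (p : M) : TangentSpace 𝓘(ℂ, E'') p :=
  (mfderiv 𝓘(ℂ, E) 𝓘(ℂ, E'') (fun g : Gc => g • p) 1 X : E'')

/-- The `G`-principal points of `M`: those whose isotropy group in `G` is, up to conjugation,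
contained in every other isotropy group. -/
def principalPoints (M : Type*) [MulAction Gc M] (G : Subgroup Gc) : Set M :=
  {p | ∀ y : M, ∃ g ∈ G, ∀ k ∈ G, k • p = p → (g * k * g⁻¹) • y = y}

/-- The function `h = η^n (F̂_1, J F̂_1, F̂_2, J F̂_2, …)` for a finite family of elements `F_i` of
the Lie algebra. -/
def volumeFunction {ι : Type*} [Fintype ι] (η : TwoForm E'' M)
    (fr : ι → GroupLieAlgebra 𝓘(ℂ, E) Gc) (p : M) : ℝ :=
  wedgePow (η p) fun j : ι × Fin 2 =>
    if j.2 = 0 then hat E'' (fr j.1) p else Complex.I • hat E'' (fr j.1) p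

/-- For `X` whose fundamental vector field is tangent to the fibre `{q (1, x)}`, the vector field
on `F` corresponding to it under the embedding `x ↦ q (1, x)` of the fibre. -/
def fibreField (q : Gc × F → M) (X : GroupLieAlgebra 𝓘(ℂ, E) Gc) (x : F) :
    TangentSpace 𝓘(ℂ, E') x :=
  Function.invFun (mfderiv 𝓘(ℂ, E') 𝓘(ℂ, E'') (fun y : F => q (1, y)) x)
    (hat E'' X (q (1, x)))

variable [FiniteDimensional ℂ E] [LieGroup 𝓘(ℂ, E) ω Gc]

/-- `W ∈ Lie G` is the value at `p` of the algebraic representative of the 2-form `ψ`: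
`ψ_p (X̂, Ŷ) = B (W, [X, Y])` for all `X, Y ∈ Lie G`. -/
def IsAlgRepAt (G : Subgroup Gc) (ψ : TwoForm E'' M) (p : M)
    (W : GroupLieAlgebra 𝓘(ℂ, E) Gc) : Prop :=
  W ∈ lieAlg E G ∧ ∀ X ∈ lieAlg E G, ∀ Y ∈ lieAlg E G,
    ((ψ p ![hat E'' X p, hat E'' Y p] : ℝ) : ℂ) = killingForm ℂ _ W ⁅X, Y⁆

end Toric

end

end HomogeneousToric

/-! Everything is linear algebra of fundamental fields at points of the fibre `F`, once four
structural facts are available. First, the orthogonal complement of `Lie P` lies in `Lie P`, because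
`Lie P` contains a maximal solvable subalgebra `b` and `b^⊥ ⊆ b` (`mem_of_perp_maximal_solvable`).
Hence every `E_{-α}` lies in `Lie P`; it is moreover a bracket there, so `dτ` kills it and its
fundamental field vanishes along `F`. Second, `dτ` identifies the complex span of the `Z_i` with the
Lie algebra of the complex torus. Third, along `F` the field `J F̂_α` is the fundamental field of
the real element `i (E_α + E_{-α}) / √2`. Fourth, at principal points the fields of `frame` form a
complex basis of the tangent space: the torus has a point with free infinitesimal action
(`IsToricKahler.exists_free`), and comparing dimensions of isotropy algebras carries freeness to
every principal point of `F`.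

Volume formula. On `F` the representative `W` of `ω` commutes with `Lie K`, hence lies in the Cartan
subalgebra. Orthogonality of root vectors then makes the `F̂_a` span an isotropic subspace and makes
the matrix `ω (F̂_a, J F̂_b)` block diagonal. The root block is diagonal with entries `α (i W) = ∑
a_α^i f_i + b_α`. In the central block, `f_i = -B (W, Z_i)`, and `d (ω (X̂, Ŷ))` is the contraction
of `ω` with the fundamental field of `[X, Y]`; since `Lie G` is spanned by brackets this yields the
entries `-f_{i,j}`. A Pfaffian computation turns `h` into a positive combinatorial constant times
the determinant of the whole matrix, so `K_0` is this constant times `(-1)^m`.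

Ricci form. Let `u` be the logarithm of the volume density in a holomorphic chart. A field `X̂`
preserving `ω` satisfies `du (X̂) = -2 Re div X̂`; substituting this into `dd^c u` gives `ρ (X̂, Ŷ)
= -(1 / 4π) Λ ([X, Y])` with `Λ (W) = du (J Ŵ) + 2 Re (i div Ŵ)` (`ricciForm_gen`). On the other
hand `log |h|` differs from `u` by a constant and the logarithm of the squared modulus of a
holomorphic determinant, which is the change from the coordinate frame to the fundamental frame. So
`d log |h|` is `du` plus twice the real part of the trace of the derivative of the frame, and the
same trace appears in the divergence of `Ŵ` together with the trace of `ad W` on the frame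
(`chartDivergence_eq`). The chart-dependent terms cancel. On the root part of `Lie G` the functional
`Λ` vanishes; on `Lie K` the trace of the isotropy representation is `B (W, ∑ H_α)`, which is the
source of `Z_V`, and the remaining term is the derivative of `log |h|` along `J Ẑ_i`. Uniqueness of
the representative follows from semisimplicity.

The technical layers supply the theory of closed subgroups (one-parameter subgroups,
`lie_mem_lieAlg`), the commutator of fundamental fields in a chart (`fderiv_genField_commutator`)
and holomorphy of the action on the bundle. -/

open scoped Manifold ContDiff Topology

namespace HomogeneousToric

noncomputable section

set_option linter.unusedSectionVars false

/-! ### Pfaffian sums -/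

section Pfaffian

open Matrix

variable {ι R : Type*} [Fintype ι] [DecidableEq ι] [CommRing R]

/-- The sum `∑ σ, sign σ ∏ i, A (σ (i, 0)) (σ (i, 1))`, a multiple of the Pfaffian of `A`. -/
def pfaffSum (A : Matrix (ι × Fin 2) (ι × Fin 2) R) : R :=
  ∑ σ : Equiv.Perm (ι × Fin 2), ((Equiv.Perm.sign σ : ℤ) : R) * ∏ i, A (σ (i, 0)) (σ (i, 1))

/-- Multilinear expansion writes the left side as a sum over functions `g` of a product of entries
of `A` times the determinant of the matrix of columns of `B` selected by `g`. That determinant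
vanishes unless `g` is a permutation, and then it is the sign of `g` times `det B`. -/
lemma pfaffSum_conj (A B : Matrix (ι × Fin 2) (ι × Fin 2) R) :
    pfaffSum (B * A * Bᵀ) = B.det * pfaffSum A := by
  have key : ∀ σ : Equiv.Perm (ι × Fin 2), ∏ i, (B * A * Bᵀ) (σ (i, 0)) (σ (i, 1)) =
      ∑ g : ι × Fin 2 → ι × Fin 2, (∏ x, B (σ x) (g x)) * ∏ i, A (g (i, 0)) (g (i, 1)) := by
    intro σ
    have h1 : ∀ i, (B * A * Bᵀ) (σ (i, 0)) (σ (i, 1)) = ∑ kl : Fin 2 → ι × Fin 2,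
        B (σ (i, 0)) (kl 0) * A (kl 0) (kl 1) * B (σ (i, 1)) (kl 1) := by
      intro i
      rw [← (finTwoArrowEquiv (ι × Fin 2)).symm.sum_comp]
      simp only [Matrix.mul_apply, Finset.sum_mul, transpose_apply, Fintype.sum_prod_type_right,
        finTwoArrowEquiv_symm_apply, Matrix.cons_val_zero, Matrix.cons_val_one]
    simp_rw [h1, Finset.prod_univ_sum, Fintype.piFinset_univ]
    rw [← (Equiv.curry ι (Fin 2) (ι × Fin 2)).sum_comp]
    refine Finset.sum_congr rfl fun g _ => ?_
    rw [Fintype.prod_prod_type]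
    simp only [Fin.prod_univ_two, Equiv.curry_apply, Function.curry_apply, ← Finset.prod_mul_distrib]
    refine Finset.prod_congr rfl fun i _ => by ring
  simp_rw [pfaffSum, key, Finset.mul_sum]
  rw [Finset.sum_comm]
  have h2 : ∀ g : ι × Fin 2 → ι × Fin 2,
      ∑ σ : Equiv.Perm (ι × Fin 2), ((Equiv.Perm.sign σ : ℤ) : R) *
        ((∏ x, B (σ x) (g x)) * ∏ i, A (g (i, 0)) (g (i, 1))) =
      (B.submatrix id g).det * ∏ i, A (g (i, 0)) (g (i, 1)) := by
    intro g
    rw [Matrix.det_apply', Finset.sum_mul]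
    refine Finset.sum_congr rfl fun σ _ => ?_
    simp [mul_assoc]
  simp_rw [h2]
  have h3 : ∀ g : ι × Fin 2 → ι × Fin 2, ¬ Function.Bijective g →
      (B.submatrix id g).det * ∏ i, A (g (i, 0)) (g (i, 1)) = 0 := by
    intro g hg
    have : ¬ Function.Injective g := fun h => hg (Finite.injective_iff_bijective.1 h)
    obtain ⟨i, j, hij, hne⟩ := Function.not_injective_iff.1 this
    rw [Matrix.det_zero_of_column_eq hne (fun k => by simp [hij]), zero_mul]
  rw [← Finset.sum_filter_of_ne (p := fun g => Function.Bijective g)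
    (fun g _ hg => by by_contra h; exact hg (h3 g h))]
  symm
  refine Finset.sum_bij (fun σ _ => (σ : ι × Fin 2 → ι × Fin 2)) ?_ ?_ ?_ ?_
  · intro σ _; simp
  · intro σ _ τ _ h; exact DFunLike.coe_injective h
  · intro g hg
    exact ⟨Equiv.ofBijective g (Finset.mem_filter.1 hg).2, Finset.mem_univ _, rfl⟩
  · intro σ _
    rw [Matrix.det_permute']
    ring

/-- The matrix of a 2-form in which the vectors of the first and of the second kind span isotropic
subspaces paired by `S`. -/
def pairing (S : Matrix ι ι R) : Matrix (ι × Fin 2) (ι × Fin 2) R :=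
  Matrix.of fun x y => if x.2 = 0 then (if y.2 = 0 then 0 else S x.1 y.1)
    else (if y.2 = 0 then - S y.1 x.1 else 0)

/-- The matrix `pairing S` is the conjugate of `pairing 1` by the block matrix with blocks `S` and
`1`. -/
lemma pfaffSum_pairing (S : Matrix ι ι R) :
    pfaffSum (pairing S) = S.det * pfaffSum (pairing (1 : Matrix ι ι R)) := by
  set B : Matrix (ι × Fin 2) (ι × Fin 2) R :=
    Matrix.blockDiagonal fun k : Fin 2 => if k = 0 then S else 1 with hB
  have hdet : B.det = S.det := by
    rw [hB, Matrix.det_blockDiagonal]; simp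
  rw [← hdet, ← pfaffSum_conj]
  congr 1
  ext ⟨a, i⟩ ⟨b, j⟩
  have e1 : ∀ (a : ι) (i : Fin 2) (y : ι × Fin 2),
      (B * pairing (1 : Matrix ι ι R)) (a, i) y = if i = 0 then (if y.2 = 0 then 0 else S a y.1)
        else (if y.2 = 0 then - (1 : Matrix ι ι R) y.1 a else 0) := by
    intro a i y
    rw [Matrix.mul_apply, Fintype.sum_prod_type]
    fin_cases i <;> simp [hB, pairing, Matrix.blockDiagonal_apply, Matrix.one_apply] <;>
      split_ifs <;> simp_all [eq_comm]
  rw [Matrix.mul_apply, Fintype.sum_prod_type]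
  simp only [e1, Fin.sum_univ_two, transpose_apply]
  fin_cases i <;> fin_cases j <;>
    simp [hB, pairing, Matrix.blockDiagonal_apply, Matrix.one_apply]

lemma pfaffSum_map {R' : Type*} [CommRing R'] (f : R →+* R')
    (A : Matrix (ι × Fin 2) (ι × Fin 2) R) : pfaffSum (A.map f) = f (pfaffSum A) := by
  simp [pfaffSum]

lemma pairing_map {R' : Type*} [CommRing R'] (f : R →+* R') (S : Matrix ι ι R) :
    (pairing S).map f = pairing (S.map f) := by
  ext x y
  simp only [pairing, Matrix.map_apply, Matrix.of_apply]
  split_ifs <;> simp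

/-- A permutation with nonzero contribution maps pairs to pairs. It permutes the pairs, which is
even because both members move together, and flips some of them; each flip changes the sign of the
permutation and the sign of one matrix entry. -/
lemma pfaffSum_pairing_one_term (σ : Equiv.Perm (ι × Fin 2))
    (h : ∏ i, pairing (1 : Matrix ι ι ℤ) (σ (i, 0)) (σ (i, 1)) ≠ 0) :
    (Equiv.Perm.sign σ : ℤ) * ∏ i, pairing (1 : Matrix ι ι ℤ) (σ (i, 0)) (σ (i, 1)) = 1 := by
  have h' : ∀ i, pairing (1 : Matrix ι ι ℤ) (σ (i, 0)) (σ (i, 1)) ≠ 0 :=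
    fun i => Finset.prod_ne_zero_iff.1 h i (Finset.mem_univ i)
  have hfst : ∀ i, (σ (i, 1)).1 = (σ (i, 0)).1 := by
    intro i
    by_contra hne
    apply h' i
    simp [pairing, Matrix.one_apply, hne, Ne.symm hne]
  have hsnd : ∀ i, (σ (i, 1)).2 ≠ (σ (i, 0)).2 := by
    intro i he
    apply h' i
    simp +contextual [pairing, he]
  have hπ : Function.Injective fun i => (σ (i, 0)).1 := by
    intro i j hij
    by_contra hne
    have hij' : (σ (i, 0)).1 = (σ (j, 0)).1 := hij
    by_cases h2 : (σ (i, 0)).2 = (σ (j, 0)).2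
    · have := σ.injective (Prod.ext hij' h2)
      exact hne (Prod.ext_iff.1 this).1
    · have h3 : (σ (i, 0)).2 = (σ (j, 1)).2 := by
        have := hsnd j; omega
      have := σ.injective (Prod.ext (hij'.trans (hfst j).symm) h3)
      exact hne (Prod.ext_iff.1 this).1
  set π : Equiv.Perm ι := Equiv.ofBijective _ (Finite.injective_iff_bijective.1 hπ) with hπdef
  set f : ι → Equiv.Perm (Fin 2) := fun i => if (σ (i, 0)).2 = 0 then 1 else Equiv.swap 0 1
    with hf
  -- The permutation `π` of the pairs and the flips `f` inside the pairs together recover `σ`.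
  have hσ : σ = (Equiv.prodCongrLeft fun _ : Fin 2 => π) * Equiv.prodCongrRight f := by
    ext1 ⟨i, j⟩
    have hi := hfst i
    have hs := hsnd i
    fin_cases j
    · ext1
      · simp [π]
      · simp only [Equiv.Perm.mul_apply, Equiv.prodCongrRight_apply, Equiv.prodCongrLeft_apply, hf]
        by_cases h0 : (σ (i, 0)).2 = 0
        · simp [h0]
        · have : (σ (i, 0)).2 = 1 := by omega
          simp [this]
    · ext1
      · simpa [π] using hi
      · simp only [Equiv.Perm.mul_apply, Equiv.prodCongrRight_apply, Equiv.prodCongrLeft_apply, hf]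
        by_cases h0 : (σ (i, 0)).2 = 0
        · have : (σ (i, 1)).2 = 1 := by omega
          simp [h0, this]
        · have : (σ (i, 1)).2 = 0 := by omega
          simp [h0, this]
  -- The permutation `π` acts on two copies of `ι`, so its sign enters squared.
  have hsign : (Equiv.Perm.sign σ : ℤ) = ∏ i, (Equiv.Perm.sign (f i) : ℤ) := by
    conv_lhs => rw [hσ]
    rw [Equiv.Perm.sign_mul, Equiv.Perm.sign_prodCongrLeft, Equiv.Perm.sign_prodCongrRight]
    simp
  rw [hsign, ← Finset.prod_mul_distrib]
  refine Finset.prod_eq_one fun i _ => ?_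
  have hi := hfst i
  have hs := hsnd i
  by_cases h0 : (σ (i, 0)).2 = 0
  · have h1 : (σ (i, 1)).2 ≠ 0 := by omega
    simp [hf, pairing, h0, h1, Matrix.one_apply, hi]
  · have h1 : (σ (i, 1)).2 = 0 := by omega
    simp [hf, pairing, h0, h1, Matrix.one_apply, hi]

-- All nonzero terms are `1` and the identity contributes one of them. Working over `ℤ` lets the
-- value be transported to any ring.
variable (ι) in
lemma pfaffSum_pairing_one_pos : 0 < pfaffSum (pairing (1 : Matrix ι ι ℤ)) := by
  rw [pfaffSum]
  refine Finset.sum_pos' (fun σ _ => ?_) ⟨1, Finset.mem_univ _, ?_⟩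
  · by_cases h : ∏ i, pairing (1 : Matrix ι ι ℤ) (σ (i, 0)) (σ (i, 1)) = 0
    · simp [h]
    · have := pfaffSum_pairing_one_term σ h
      simp only [Int.cast_id]
      omega
  · simp [pairing]

variable (ι) in
/-- The value of `wedgePow` on a standard symplectic basis. -/
def wedgeConst : ℝ := 1 / 2 ^ Fintype.card ι * pfaffSum (pairing (1 : Matrix ι ι ℝ))

variable (ι) in
lemma wedgeConst_pos : 0 < wedgeConst ι := by
  have h : pfaffSum (pairing (1 : Matrix ι ι ℝ)) =
      (pfaffSum (pairing (1 : Matrix ι ι ℤ)) : ℤ) := by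
    have := pfaffSum_map (Int.castRingHom ℝ) (pairing (1 : Matrix ι ι ℤ))
    rw [pairing_map, Matrix.map_one _ (map_zero _) (map_one _)] at this
    simpa using this
  rw [wedgeConst, h]
  have := pfaffSum_pairing_one_pos ι
  positivity

end Pfaffian

/-! ### Top powers of two-forms with complementary isotropic families -/

section WedgePow

open Matrix

variable {ι V : Type*} [Fintype ι] [DecidableEq ι] [AddCommGroup V] [Module ℝ V]
  [TopologicalSpace V]

lemma wedgePow_eq_pfaffSum (θ : V [⋀^Fin 2]→L[ℝ] ℝ) (v : ι × Fin 2 → V) :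
    wedgePow θ v = 1 / 2 ^ Fintype.card ι *
      pfaffSum (Matrix.of fun x y => θ ![v x, v y]) := by
  rw [wedgePow, pfaffSum]
  simp only [Matrix.of_apply]
  congr!

lemma twoForm_swap (θ : V [⋀^Fin 2]→L[ℝ] ℝ) (v w : V) : θ ![v, w] = - θ ![w, v] := by
  have := θ.toAlternatingMap.map_swap ![w, v] (i := 0) (j := 1) (by decide)
  have h2 : (![w, v] ∘ Equiv.swap (0 : Fin 2) 1) = ![v, w] := by
    ext i; fin_cases i <;> simp
  rw [h2] at this
  exact this

/-- With both families isotropic only the mixed values survive, so the matrix of `θ` is a `pairing`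
and the Pfaffian sum becomes a determinant. -/
lemma wedgePow_of_isotropic (θ : V [⋀^Fin 2]→L[ℝ] ℝ) (v w : ι → V)
    (hv : ∀ i j, θ ![v i, v j] = 0) (hw : ∀ i j, θ ![w i, w j] = 0) :
    wedgePow θ (fun j : ι × Fin 2 => if j.2 = 0 then v j.1 else w j.1) =
      wedgeConst ι * (Matrix.of fun i j => θ ![v i, w j]).det := by
  rw [wedgePow_eq_pfaffSum]
  have : (Matrix.of fun x y : ι × Fin 2 => θ ![(if x.2 = 0 then v x.1 else w x.1),
      (if y.2 = 0 then v y.1 else w y.1)]) = pairing (Matrix.of fun i j => θ ![v i, w j]) := by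
    ext x y
    simp only [pairing, Matrix.of_apply]
    split_ifs
    · exact hv _ _
    · rfl
    · exact twoForm_swap _ _ _
    · exact hw _ _
  rw [this, pfaffSum_pairing, wedgeConst]
  ring

end WedgePow

/-! ### Top powers of forms of type (1,1) and Hermitian determinants -/

section Hermitian

open Matrix

variable {ι V : Type*} [Fintype ι] [DecidableEq ι] [AddCommGroup V] [Module ℂ V] [Module ℝ V]
  [TopologicalSpace V]

/-- The Hermitian matrix `θ (v_i, J v_j) - i θ (v_i, v_j)`. -/
def hermGram (θ : V [⋀^Fin 2]→L[ℝ] ℝ) (v : ι → V) : Matrix ι ι ℂ :=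
  Matrix.of fun i j => (θ ![v i, Complex.I • v j] : ℂ) - Complex.I * (θ ![v i, v j] : ℂ)

lemma twoForm_I_left (θ : V [⋀^Fin 2]→L[ℝ] ℝ)
    (hJ : ∀ v w : V, θ ![Complex.I • v, Complex.I • w] = θ ![v, w]) (v w : V) :
    θ ![Complex.I • v, w] = - θ ![v, Complex.I • w] := by
  have h := hJ v (Complex.I • w)
  rw [smul_smul, Complex.I_mul_I, neg_smul, one_smul] at h
  rw [← h]
  have h2 : θ ![Complex.I • v, -w] = - θ ![Complex.I • v, w] := by
    have := θ.toMultilinearMap.map_update_neg ![Complex.I • v, w] 1 w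
    have e1 : Function.update ![Complex.I • v, w] 1 (-w) = ![Complex.I • v, -w] := by
      ext i; fin_cases i <;> simp
    have e2 : Function.update ![Complex.I • v, w] 1 w = ![Complex.I • v, w] := by
      ext i; fin_cases i <;> simp
    rw [e1, e2] at this
    exact this
  rw [h2, neg_neg]

/-- The top power of a form of type (1,1) on `v_1, J v_1, v_2, J v_2, …` is a constant multiple of
the determinant of the Hermitian matrix. -/
lemma wedgePow_eq_det_hermGram (θ : V [⋀^Fin 2]→L[ℝ] ℝ)
    (hJ : ∀ v w : V, θ ![Complex.I • v, Complex.I • w] = θ ![v, w]) (v : ι → V) :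
    ((wedgePow θ (fun j : ι × Fin 2 => if j.2 = 0 then v j.1 else Complex.I • v j.1) : ℝ) : ℂ) =
      wedgeConst ι * (hermGram θ v).det := by
  set A : Matrix (ι × Fin 2) (ι × Fin 2) ℝ :=
    Matrix.of fun x y => θ ![(if x.2 = 0 then v x.1 else Complex.I • v x.1),
      (if y.2 = 0 then v y.1 else Complex.I • v y.1)] with hA
  -- Change of basis to the vectors `v - i J v` and `v + i J v` of the complexification. Each family
  -- is isotropic for a form of type (1,1), so the conjugated matrix is a `pairing`.
  set U : Matrix (ι × Fin 2) (ι × Fin 2) ℂ :=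
    (1 : Matrix ι ι ℂ).kronecker !![1, -Complex.I; 1, Complex.I] with hU
  have hdetU : U.det = (2 * Complex.I) ^ Fintype.card ι := by
    rw [hU, Matrix.kronecker, Matrix.det_kronecker]
    simp [Matrix.det_fin_two_of]
    ring
  have hconj : U * A.map Complex.ofRealHom * Uᵀ =
      pairing ((2 * Complex.I) • hermGram θ v) := by
    have e1 : ∀ (a : ι) (i : Fin 2) (y : ι × Fin 2), (U * A.map Complex.ofRealHom) (a, i) y =
        if i = 0 then (A (a, 0) y : ℂ) - Complex.I * A (a, 1) y
        else (A (a, 0) y : ℂ) + Complex.I * A (a, 1) y := by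
      intro a i y
      rw [Matrix.mul_apply, Fintype.sum_prod_type]
      fin_cases i <;> simp [hU, Matrix.one_apply, sub_eq_add_neg,
        Matrix.kronecker]
    have e2 : ∀ (x y : ι × Fin 2), (U * A.map Complex.ofRealHom * Uᵀ) x y =
        if y.2 = 0 then (U * A.map Complex.ofRealHom) x (y.1, 0)
            - Complex.I * (U * A.map Complex.ofRealHom) x (y.1, 1)
        else (U * A.map Complex.ofRealHom) x (y.1, 0)
            + Complex.I * (U * A.map Complex.ofRealHom) x (y.1, 1) := by
      rintro x ⟨b, j⟩
      rw [Matrix.mul_apply, Fintype.sum_prod_type]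
      fin_cases j <;> simp [hU, Matrix.one_apply, sub_eq_add_neg,
        Matrix.kronecker, mul_comm]
    ext ⟨a, i⟩ ⟨b, j⟩
    rw [e2]
    simp only [e1]
    have a00 : A (a, 0) (b, 0) = θ ![v a, v b] := by simp [hA]
    have a01 : A (a, 0) (b, 1) = θ ![v a, Complex.I • v b] := by simp [hA]
    have a10 : A (a, 1) (b, 0) = - θ ![v a, Complex.I • v b] := by
      simp [hA, twoForm_I_left θ hJ]
    have a11 : A (a, 1) (b, 1) = θ ![v a, v b] := by simp [hA, hJ]
    have s0 : θ ![v b, v a] = - θ ![v a, v b] := twoForm_swap _ _ _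
    have s1 : θ ![v b, Complex.I • v a] = θ ![v a, Complex.I • v b] := by
      rw [twoForm_swap, twoForm_I_left θ hJ, neg_neg]
    rw [a00, a01, a10, a11]
    have hI : Complex.I * Complex.I = -1 := Complex.I_mul_I
    fin_cases i <;> fin_cases j <;>
      simp [pairing, hermGram, s0, s1] <;> ring_nf <;> simp [Complex.I_sq] <;> ring
  have hmain := pfaffSum_conj (A.map Complex.ofRealHom) U
  rw [hconj, pfaffSum_pairing, pfaffSum_map, hdetU, Matrix.det_smul, mul_assoc] at hmain
  -- The same power of `2 i` arises from `det U` and from the scalar in front of `hermGram`, so it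
  -- cancels.
  have h2 : (2 * Complex.I : ℂ) ^ Fintype.card ι ≠ 0 := by
    apply pow_ne_zero; simp
  have h3 := mul_left_cancel₀ h2 hmain
  have h4 : pfaffSum (pairing (1 : Matrix ι ι ℂ)) =
      (pfaffSum (pairing (1 : Matrix ι ι ℝ)) : ℝ) := by
    have := pfaffSum_map Complex.ofRealHom (pairing (1 : Matrix ι ι ℝ))
    rw [pairing_map, Matrix.map_one _ (map_zero _) (map_one _)] at this
    simpa using this
  rw [wedgePow_eq_pfaffSum, ← hA, wedgeConst]
  push_cast
  rw [← h4]
  simp only [Complex.ofRealHom_eq_coe] at h3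
  rw [← h3]
  ring

end Hermitian

/-! ### Borel and parabolic subalgebras -/

section Algebra

open LieAlgebra LieModule

universe u

variable {L : Type*} [LieRing L] [LieAlgebra ℂ L] [FiniteDimensional ℂ L]

lemma killingForm_lie_left (x y z : L) :
    killingForm ℂ L ⁅x, y⁆ z = killingForm ℂ L x ⁅y, z⁆ :=
  LieModule.traceForm_apply_lie_apply ℂ L L x y z

lemma isSolvable_of_isSolvable_derivedSeries_one {A : Type*} [LieRing A] [LieAlgebra ℂ A]
    (h : IsSolvable (derivedSeries ℂ A 1)) : IsSolvable A := by
  obtain ⟨k, hk⟩ := IsSolvable.solvable ℂ (derivedSeries ℂ A 1)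
  rw [LieIdeal.derivedSeries_eq_bot_iff] at hk
  refine IsSolvable.mk (R := ℂ) (k := k + 1) ?_
  rw [derivedSeries_def, derivedSeriesOfIdeal_add]
  exact hk

/-- Cartan's criterion for a subalgebra, in terms of the Killing form of the ambient algebra. -/
lemma isSolvable_of_killingForm_lie_eq_zero (b : LieSubalgebra ℂ L)
    (h : ∀ x ∈ b, ∀ y ∈ b, ∀ z ∈ b, killingForm ℂ L x ⁅y, z⁆ = 0) : IsSolvable b := by
  set D : LieIdeal ℂ b := derivedSeries ℂ b 1 with hD
  have hDmem : ∀ y : b, y ∈ D → ∀ x : b, killingForm ℂ L x y = 0 := by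
    intro y hy x
    have hy' : y ∈ LieSubmodule.toSubmodule ⁅(⊤ : LieIdeal ℂ b), (⊤ : LieIdeal ℂ b)⁆ := by
      simpa [hD, derivedSeries_def] using hy
    rw [LieSubmodule.lieIdeal_oper_eq_linear_span'] at hy'
    clear hy
    induction hy' using Submodule.span_induction with
    | mem y hy =>
      obtain ⟨u, -, v, -, rfl⟩ := hy
      exact h x x.2 u u.2 v v.2
    | zero => simp
    | add u v _ _ hu hv => simp [hu, hv]
    | smul c u _ hu => simp [hu]
  -- The ambient Killing form restricted to the derived algebra `D` is the trace form of the
  -- `D`-module `L`, to which Cartan's criterion applies.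
  have htf : LieModule.traceForm ℂ D L = 0 := by
    ext x y
    exact hDmem (y : b) y.2 (x : b)
  have hnil : LieModule.IsNilpotent (derivedSeries ℂ D 1) L :=
    LieModule.isNilpotent_derivedSeries_of_traceForm_eq_zero htf
  apply isSolvable_of_isSolvable_derivedSeries_one
  apply isSolvable_of_isSolvable_derivedSeries_one
  -- Engel's theorem: the adjoint action is the restriction of the nilpotent action on `L`.
  have : LieRing.IsNilpotent (derivedSeries ℂ D 1) := by
    rw [LieAlgebra.isNilpotent_iff_forall (R := ℂ)]
    intro x
    obtain ⟨k, hk⟩ := (LieModule.isNilpotent_iff_forall' (R := ℂ)).mp hnil x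
    refine ⟨k, ?_⟩
    ext1 y
    have key : ∀ (n : ℕ) (y : derivedSeries ℂ D 1),
        ((((ad ℂ (derivedSeries ℂ D 1) x ^ n) y : D) : b) : L) =
          (toEnd ℂ (derivedSeries ℂ D 1) L x ^ n) (((y : D) : b) : L) := by
      intro n
      induction n with
      | zero => intro y; simp
      | succ n ih =>
        intro y
        rw [pow_succ, pow_succ, Module.End.mul_apply, Module.End.mul_apply, ih]
        rfl
    have := key k y
    rw [hk] at this
    apply Subtype.ext; apply Subtype.ext; apply Subtype.ext
    simpa using this
  infer_instance

/-- Lie's theorem: there is a common eigenvector, on which the commutator `⁅y, z⁆` acts by zero, and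
one passes to the quotient by its line. The dimension is a parameter so that the induction can vary
the module. -/
lemma isNilpotent_toEnd_mul_toEnd_lie (b : Type*) [LieRing b] [LieAlgebra ℂ b] [IsSolvable b]
    (x y z : b) (n : ℕ) : ∀ (M : Type u) [AddCommGroup M] [Module ℂ M] [LieRingModule b M]
    [LieModule ℂ b M] [FiniteDimensional ℂ M], Module.finrank ℂ M = n →
    _root_.IsNilpotent (toEnd ℂ b M x * toEnd ℂ b M ⁅y, z⁆) := by
  induction n using Nat.strong_induction_on with
  | _ n ih =>
  intro M _ _ _ _ _ hn
  rcases subsingleton_or_nontrivial M with hM | hM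
  · exact ⟨1, Subsingleton.elim _ _⟩
  obtain ⟨χ, hχ⟩ := LieModule.exists_nontrivial_weightSpace_of_isSolvable ℂ b M
  obtain ⟨⟨v, hv⟩, hv0⟩ := exists_ne (0 : weightSpace M χ)
  have hv0' : v ≠ 0 := fun h => hv0 (Subtype.ext h)
  rw [mem_weightSpace] at hv
  let N : LieSubmodule ℂ b M :=
    { ℂ ∙ v with
      lie_mem := by
        intro w u hu
        obtain ⟨c, rfl⟩ := Submodule.mem_span_singleton.1 hu
        change ⁅w, c • v⁆ ∈ ℂ ∙ v
        rw [lie_smul, hv]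
        exact Submodule.smul_mem _ _ (Submodule.smul_mem _ _ (Submodule.mem_span_singleton_self v)) }
  have hvN : v ∈ N := Submodule.mem_span_singleton_self v
  have hlt : Module.finrank ℂ (M ⧸ N) < n := by
    have h1 := Submodule.finrank_quotient_add_finrank (N : Submodule ℂ M)
    have h2 : Module.finrank ℂ (N : Submodule ℂ M) = 1 := finrank_span_singleton hv0'
    have h3 : Module.finrank ℂ (M ⧸ N) = Module.finrank ℂ (M ⧸ (N : Submodule ℂ M)) := rfl
    omega
  obtain ⟨k, hk⟩ := ih _ hlt (M ⧸ N) rfl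
  refine ⟨k + 1, ?_⟩
  have hcomm : ∀ (j : ℕ) (u : M), (LieSubmodule.Quotient.mk
      (((toEnd ℂ b M x * toEnd ℂ b M ⁅y, z⁆) ^ j) u) : M ⧸ N) =
      ((toEnd ℂ b (M ⧸ N) x * toEnd ℂ b (M ⧸ N) ⁅y, z⁆) ^ j) (LieSubmodule.Quotient.mk u) := by
    intro j
    induction j with
    | zero => intro u; simp
    | succ j ihj =>
      intro u
      rw [pow_succ, Module.End.mul_apply, ihj, pow_succ, Module.End.mul_apply]
      rfl
  ext u
  have hu := hcomm k u
  rw [hk, LinearMap.zero_apply] at hu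
  have hu' : ((toEnd ℂ b M x * toEnd ℂ b M ⁅y, z⁆) ^ k) u ∈ N := by
    rwa [LieSubmodule.Quotient.mk_eq_zero'] at hu
  obtain ⟨c, hc⟩ := Submodule.mem_span_singleton.1 hu'
  -- The `k`-th power vanishes on the quotient, hence maps into the line of the eigenvector, where
  -- the scalars of `y` and `z` commute.
  rw [pow_succ', Module.End.mul_apply, ← hc]
  simp [hv, smul_smul, mul_comm]

/-- The product `ad x ∘ ad [y, z]` is nilpotent on the whole of `L` by Lie's theorem, so its trace
vanishes. This is the converse of Cartan's criterion. -/
lemma killingForm_lie_eq_zero_of_isSolvable (b : LieSubalgebra ℂ L) (hb : IsSolvable b)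
    {x y z : L} (hx : x ∈ b) (hy : y ∈ b) (hz : z ∈ b) : killingForm ℂ L x ⁅y, z⁆ = 0 := by
  have h := isNilpotent_toEnd_mul_toEnd_lie b ⟨x, hx⟩ ⟨y, hy⟩ ⟨z, hz⟩ _ L rfl
  exact (LinearMap.isNilpotent_trace_of_isNilpotent h).eq_zero

/-- The orthogonal complement of a maximal solvable subalgebra `b` is contained in `b`. -/
lemma mem_of_perp_maximal_solvable (b : LieSubalgebra ℂ L) (hb : IsSolvable b)
    (hmax : ∀ b' : LieSubalgebra ℂ L, IsSolvable b' → b ≤ b' → b' = b)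
    {x : L} (hx : ∀ y ∈ b, killingForm ℂ L x y = 0) : x ∈ b := by
  by_contra hxb
  have hB := fun x y z hx hy hz =>
    killingForm_lie_eq_zero_of_isSolvable b hb (x := x) (y := y) (z := z) hx hy hz
  -- the module `(b + b^⊥) / b`
  let W : LieSubmodule ℂ b L :=
    { carrier := {u | ∃ v ∈ b, ∀ y ∈ b, killingForm ℂ L (u - v) y = 0}
      add_mem' := by
        rintro u u' ⟨v, hv, h⟩ ⟨v', hv', h'⟩
        refine ⟨v + v', add_mem hv hv', fun y hy => ?_⟩
        rw [add_sub_add_comm, map_add, LinearMap.add_apply, h y hy, h' y hy, add_zero]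
      zero_mem' := ⟨0, zero_mem _, by simp⟩
      smul_mem' := by
        rintro c u ⟨v, hv, h⟩
        refine ⟨c • v, b.smul_mem c hv, fun y hy => ?_⟩
        rw [← smul_sub, map_smul, LinearMap.smul_apply, h y hy, smul_zero]
      lie_mem := by
        rintro w u ⟨v, hv, h⟩
        refine ⟨⁅(w : L), v⁆, b.lie_mem w.2 hv, fun y hy => ?_⟩
        have : (⁅w, u⁆ : L) = ⁅(w : L), u⁆ := rfl
        rw [this, ← lie_sub, ← lie_skew, map_neg, LinearMap.neg_apply, killingForm_lie_left,
          h _ (b.lie_mem w.2 hy), neg_zero] }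
  have hxW : x ∈ W := ⟨0, zero_mem _, by simpa using hx⟩
  let N : LieSubmodule ℂ b W :=
    { carrier := {u | (u : L) ∈ b}
      add_mem' := fun {_ _} h h' => b.add_mem h h'
      zero_mem' := b.zero_mem
      smul_mem' := fun c _ h => b.smul_mem c h
      lie_mem := fun {w _} h => b.lie_mem w.2 h }
  have : Nontrivial (W ⧸ N) := by
    refine ⟨LieSubmodule.Quotient.mk ⟨x, hxW⟩, 0, fun h => hxb ?_⟩
    rw [LieSubmodule.Quotient.mk_eq_zero'] at h
    exact h
  -- If `b^⊥` is not in `b`, then Lie's theorem gives a common eigenvector of `b` in `(b + b^⊥) /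
  -- b`.
  obtain ⟨χ, hχ⟩ := LieModule.exists_nontrivial_weightSpace_of_isSolvable ℂ b (W ⧸ N)
  obtain ⟨⟨u, hu⟩, hu0⟩ := exists_ne (0 : weightSpace (W ⧸ N) χ)
  rw [mem_weightSpace] at hu
  obtain ⟨⟨u, v, hv, huv⟩, rfl⟩ := LieSubmodule.Quotient.surjective_mk' N u
  have hub : u ∉ b := fun h => hu0 (Subtype.ext (LieSubmodule.Quotient.mk_eq_zero'.2 h))
  -- The eigenvector modulo `b` is represented by an element of `b^⊥`.
  set x₀ : L := u - v with hx₀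
  have hx₀b : x₀ ∉ b := fun h => hub (by simpa [hx₀] using b.add_mem h hv)
  have hact : ∀ (y : L) (hy : y ∈ b), ∃ w ∈ b, ⁅y, x₀⁆ = χ ⟨y, hy⟩ • x₀ + w := by
    intro y hy
    have h1 := hu ⟨y, hy⟩
    rw [LieSubmodule.Quotient.mk'_apply, ← sub_eq_zero] at h1
    have h2 : (⁅y, u⁆ - χ ⟨y, hy⟩ • u : L) ∈ b := LieSubmodule.Quotient.mk_eq_zero'.1 h1
    refine ⟨(⁅y, u⁆ - χ ⟨y, hy⟩ • u) + χ ⟨y, hy⟩ • v - ⁅y, v⁆,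
      b.sub_mem (b.add_mem h2 (b.smul_mem _ hv)) (b.lie_mem hy hv), ?_⟩
    rw [hx₀, lie_sub, smul_sub]
    abel
  have hmem : ∀ w : L, w ∈ (b.toSubmodule ⊔ ℂ ∙ x₀) ↔ ∃ y ∈ b, ∃ c : ℂ, w = y + c • x₀ := by
    intro w
    rw [Submodule.mem_sup]
    constructor
    · rintro ⟨y, hy, z, hz, rfl⟩
      obtain ⟨c, rfl⟩ := Submodule.mem_span_singleton.1 hz
      exact ⟨y, hy, c, rfl⟩
    · rintro ⟨y, hy, c, rfl⟩
      exact ⟨y, hy, c • x₀, Submodule.smul_mem _ _ (Submodule.mem_span_singleton_self _), rfl⟩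
  -- Because `x₀` is an eigenvector modulo `b`, adding its line to `b` gives a larger subalgebra.
  let b' : LieSubalgebra ℂ L :=
    { b.toSubmodule ⊔ ℂ ∙ x₀ with
      lie_mem' := by
        intro w w' hw hw'
        obtain ⟨y, hy, c, rfl⟩ := (hmem w).1 hw
        obtain ⟨y', hy', c', rfl⟩ := (hmem w').1 hw'
        obtain ⟨w₁, hw₁, e₁⟩ := hact y hy
        obtain ⟨w₂, hw₂, e₂⟩ := hact y' hy'
        refine (hmem _).2 ⟨⁅y, y'⁆ + c' • w₁ - c • w₂,
          b.sub_mem (b.add_mem (b.lie_mem hy hy') (b.smul_mem _ hw₁)) (b.smul_mem _ hw₂),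
          c' * χ ⟨y, hy⟩ - c * χ ⟨y', hy'⟩, ?_⟩
        have e₃ : ⁅x₀, y'⁆ = - ⁅y', x₀⁆ := (lie_skew _ _).symm
        simp only [lie_add, add_lie, lie_smul, smul_lie, lie_self, e₃, e₁, e₂]
        module }
  have hb'mem : ∀ w ∈ b', ∃ y ∈ b, ∃ c : ℂ, w = y + c • x₀ := fun w hw => (hmem w).1 hw
  -- Cartan's criterion applies to the enlarged algebra, contradicting maximality: the mixed terms
  -- vanish since `x₀` is orthogonal to `b` and `[x₀, x₀] = 0`.
  have hsolv : IsSolvable b' := by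
    apply isSolvable_of_killingForm_lie_eq_zero
    intro w₁ h₁ w₂ h₂ w₃ h₃
    obtain ⟨y₁, hy₁, c₁, rfl⟩ := hb'mem _ h₁
    obtain ⟨y₂, hy₂, c₂, rfl⟩ := hb'mem _ h₂
    obtain ⟨y₃, hy₃, c₃, rfl⟩ := hb'mem _ h₃
    have k1 := hB y₁ y₂ y₃ hy₁ hy₂ hy₃
    have k2 : killingForm ℂ L y₁ ⁅y₂, x₀⁆ = 0 := by
      rw [← killingForm_lie_left, LieModule.traceForm_comm]
      exact huv _ (b.lie_mem hy₁ hy₂)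
    have k3 : killingForm ℂ L y₁ ⁅x₀, y₃⁆ = 0 := by
      rw [← lie_skew, map_neg, ← killingForm_lie_left, LieModule.traceForm_comm]
      rw [neg_eq_zero]
      exact huv _ (b.lie_mem hy₁ hy₃)
    have k4 : killingForm ℂ L x₀ ⁅y₂, y₃⁆ = 0 := huv _ (b.lie_mem hy₂ hy₃)
    have k5 : killingForm ℂ L x₀ ⁅y₂, x₀⁆ = 0 := by
      rw [LieModule.traceForm_comm, killingForm_lie_left, lie_self, map_zero]
    have k6 : killingForm ℂ L x₀ ⁅x₀, y₃⁆ = 0 := by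
      rw [← killingForm_lie_left, lie_self, map_zero, LinearMap.zero_apply]
    simp [k1, k2, k3, k4, k5, k6]
  have hle : b ≤ b' := fun y hy => (hmem y).2 ⟨y, hy, 0, by simp⟩
  have hx₀' : x₀ ∈ b' := (hmem x₀).2 ⟨0, b.zero_mem, 1, by simp⟩
  rw [hmax b' hsolv hle] at hx₀'
  exact hx₀b hx₀'

/-! ### Root vectors and a subalgebra containing the Cartan subalgebra -/

variable {H : LieSubalgebra ℂ L} [H.IsCartanSubalgebra]

/-- An element that commutes with `H` normalizes it, and a Cartan subalgebra is its own normalizer.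
-/
lemma mem_cartan_of_lie_eq_zero {W : L} (h : ∀ X ∈ H, ⁅X, W⁆ = 0) : W ∈ H := by
  have : W ∈ H.normalizer := by
    rw [LieSubalgebra.mem_normalizer_iff]
    intro y hy
    rw [← lie_skew, h y hy, neg_zero]
    exact H.zero_mem
  rwa [LieSubalgebra.IsCartanSubalgebra.self_normalizing] at this

variable [IsKilling ℂ L]

lemma killingForm_eq_zero_of_rootSpace {α β : H → ℂ} {x y : L} (hx : x ∈ rootSpace H α)
    (hy : y ∈ rootSpace H β) (h : α + β ≠ 0) : killingForm ℂ L x y = 0 :=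
  LieAlgebra.killingForm_apply_eq_zero_of_mem_rootSpace_of_add_ne_zero ℂ L H hx hy h

lemma exists_smul_of_mem_rootSpace {α : Weight ℂ H L} (hα : α.IsNonZero) {x y : L}
    (hx : x ∈ rootSpace H α) (hx0 : x ≠ 0) (hy : y ∈ rootSpace H α) : ∃ c : ℂ, y = c • x := by
  have h1 := IsKilling.finrank_rootSpace_eq_one α hα
  obtain ⟨c, hc⟩ := (finrank_eq_one_iff_of_nonzero' (⟨x, hx⟩ : rootSpace H α)
    (fun h => hx0 (congrArg Subtype.val h))).1 h1 ⟨y, hy⟩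
  exact ⟨c, (congrArg Subtype.val hc).symm⟩

/-- If the root space of `α` is not contained in the subalgebra `p ⊇ H`, then the root space of
`-α` is orthogonal to `p`. -/
lemma killingForm_eq_zero_of_rootSpace_not_le (p : LieSubalgebra ℂ L) (hHp : H ≤ p)
    {α : Weight ℂ H L} (hα : α.IsNonZero) (hαp : ∃ X ∈ rootSpace H α, X ∉ p) {Y V : L}
    (hY : Y ∈ rootSpace H (-(α : H → ℂ))) (hV : V ∈ p) : killingForm ℂ L Y V = 0 := by
  let N : LieSubmodule ℂ H L :=
    { p.toSubmodule with lie_mem := fun {h _} hv => p.lie_mem (hHp h.2) hv }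
  have hVN : V ∈ N := hV
  -- As an `H`-submodule, `p` is the sum of its intersections with the weight spaces. Only the
  -- component in the root space of `α` can pair with `Y`, and if it were nonzero,
  -- one-dimensionality would put the whole root space into `p`.
  rw [eq_iSup_inf_genWeightSpace ℂ H L N] at hVN
  clear hV
  induction hVN using LieSubmodule.iSup_induction' with
  | zero => simp
  | add u v _ _ hu hv => simp [hu, hv]
  | mem β v hv =>
    obtain ⟨hvN, hvβ⟩ := hv
    by_cases h : (-(α : H → ℂ)) + β = 0
    · have hβα : (β : H → ℂ) = α := by
        rw [neg_add_eq_zero] at h; exact h.symm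
      rw [hβα] at hvβ
      by_cases hv0 : v = 0
      · simp [hv0]
      · obtain ⟨X, hX, hXp⟩ := hαp
        obtain ⟨c, rfl⟩ := exists_smul_of_mem_rootSpace hα hvβ hv0 hX
        exact absurd (p.smul_mem c hvN) hXp
    · exact killingForm_eq_zero_of_rootSpace hY hvβ h

/-- The roots whose root space is not contained in `p`. -/
abbrev RootsOutside (H : LieSubalgebra ℂ L) [H.IsCartanSubalgebra] (p : LieSubalgebra ℂ L) :
    Type _ :=
  {α : Weight ℂ H L // α.IsNonZero ∧ ∃ X ∈ rootSpace H α, X ∉ p}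

variable {p : LieSubalgebra ℂ L} {Ep Em : RootsOutside H p → L}

lemma killingForm_Em_eq_zero (hHp : H ≤ p)
    (hm : ∀ α, Em α ∈ rootSpace H (-(α.1 : H → ℂ))) (α : RootsOutside H p) {V : L} (hV : V ∈ p) :
    killingForm ℂ L V (Em α) = 0 := by
  rw [LieModule.traceForm_comm]
  exact killingForm_eq_zero_of_rootSpace_not_le p hHp α.2.1 α.2.2 (hm α) hV

/-- `E_{-α}` is orthogonal to `p`, and `p^⊥ ⊆ p`. -/
lemma Em_mem (hHp : H ≤ p) (hperp : ∀ x, (∀ y ∈ p, killingForm ℂ L x y = 0) → x ∈ p)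
    (hm : ∀ α, Em α ∈ rootSpace H (-(α.1 : H → ℂ))) (α : RootsOutside H p) : Em α ∈ p :=
  hperp _ fun y hy => by
    rw [LieModule.traceForm_comm]
    exact killingForm_Em_eq_zero hHp hm α hy

lemma killingForm_Ep_Em [Fintype (RootsOutside H p)] [DecidableEq (RootsOutside H p)]
    (hp : ∀ α, Ep α ∈ rootSpace H α.1)
    (hm : ∀ α, Em α ∈ rootSpace H (-(α.1 : H → ℂ)))
    (hn : ∀ α, killingForm ℂ L (Ep α) (Em α) = 1) (α β : RootsOutside H p) :
    killingForm ℂ L (Ep α) (Em β) = if α = β then 1 else 0 := by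
  split_ifs with h
  · rw [h, hn]
  · refine killingForm_eq_zero_of_rootSpace (hp α) (hm β) fun h' => h ?_
    rw [add_neg_eq_zero] at h'
    exact Subtype.ext (DFunLike.coe_injective h')

/-- The pairing could be nonzero only for `β = -α`; but then the root space of `β` is spanned by
`E_{-α}`, which lies in `p`, contrary to the choice of `β`. -/
lemma killingForm_Ep_Ep (hHp : H ≤ p)
    (hperp : ∀ x, (∀ y ∈ p, killingForm ℂ L x y = 0) → x ∈ p)
    (hp : ∀ α, Ep α ∈ rootSpace H α.1)
    (hm : ∀ α, Em α ∈ rootSpace H (-(α.1 : H → ℂ)))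
    (hn : ∀ α, killingForm ℂ L (Ep α) (Em α) = 1) (α β : RootsOutside H p) :
    killingForm ℂ L (Ep α) (Ep β) = 0 := by
  refine killingForm_eq_zero_of_rootSpace (hp α) (hp β) fun h => ?_
  have hβα : (-(α.1 : H → ℂ)) = β.1 := by
    rw [neg_eq_iff_add_eq_zero]; exact h
  have hEm0 : Em α ≠ 0 := fun h0 => by
    have := hn α
    rw [h0, map_zero] at this
    exact zero_ne_one this
  obtain ⟨X, hX, hXp⟩ := β.2.2
  obtain ⟨c, rfl⟩ := exists_smul_of_mem_rootSpace β.2.1 (hβα ▸ hm α) hEm0 hX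
  exact hXp (p.smul_mem c (Em_mem hHp hperp hm α))

/-- The projection of `Y` to the complement of `p` in terms of the root vectors. -/
lemma sub_sum_Ep_mem [Fintype (RootsOutside H p)] (hHp : H ≤ p)
    (hp : ∀ α, Ep α ∈ rootSpace H α.1)
    (hm : ∀ α, Em α ∈ rootSpace H (-(α.1 : H → ℂ)))
    (hn : ∀ α, killingForm ℂ L (Ep α) (Em α) = 1) (Y : L) :
    Y - ∑ α, killingForm ℂ L Y (Em α) • Ep α ∈ p := by
  classical
  have hY : Y ∈ (⨆ χ : Weight ℂ H L, genWeightSpace L χ) := by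
    rw [iSup_genWeightSpace_eq_top']; trivial
  induction hY using LieSubmodule.iSup_induction' with
  | zero => simp
  | add u v _ _ hu hv =>
    have : u + v - ∑ α, killingForm ℂ L (u + v) (Em α) • Ep α =
        (u - ∑ α, killingForm ℂ L u (Em α) • Ep α) +
          (v - ∑ α, killingForm ℂ L v (Em α) • Ep α) := by
      simp only [map_add, LinearMap.add_apply, add_smul, Finset.sum_add_distrib]
      abel
    rw [this]
    exact p.add_mem hu hv
  | mem β v hv =>
    have hz : ∀ α : RootsOutside H p, α.1 ≠ β → killingForm ℂ L v (Em α) = 0 := by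
      intro α hα
      refine killingForm_eq_zero_of_rootSpace hv (hm α) fun h' => hα ?_
      rw [add_neg_eq_zero] at h'
      exact DFunLike.coe_injective h'.symm
    by_cases hβ : β.IsNonZero ∧ ∃ X ∈ rootSpace H β, X ∉ p
    · have hEp0 : Ep ⟨β, hβ⟩ ≠ 0 := fun h0 => by
        have := hn ⟨β, hβ⟩
        rw [h0, map_zero, LinearMap.zero_apply] at this
        exact zero_ne_one this
      obtain ⟨c, rfl⟩ := exists_smul_of_mem_rootSpace hβ.1 (hp ⟨β, hβ⟩) hEp0 hv
      rw [Finset.sum_eq_single ⟨β, hβ⟩]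
      · simp [hn]
      · intro α _ hα
        rw [hz α (fun h => hα (Subtype.ext h)), zero_smul]
      · simp
    · rw [Finset.sum_eq_zero, sub_zero]
      -- The zero weight space is `H`, which is in `p`; any other weight space not counted by the
      -- sum is in `p` by definition of the index set.
      · by_cases h0 : β.IsZero
        · refine hHp ?_
          have h0' : (β : H → ℂ) = 0 := h0
          rw [h0'] at hv
          have hv' : v ∈ rootSpace H (0 : H → ℂ) := hv
          rw [LieAlgebra.rootSpace_zero_eq ℂ L H] at hv'
          exact hv'
        · by_contra hvp
          exact hβ ⟨h0, v, hv, hvp⟩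
      · intro α _
        rw [hz α (fun h => hβ (h ▸ α.2)), zero_smul]

lemma lie_Ep_Em_mem (hp : ∀ α, Ep α ∈ rootSpace H α.1)
    (hm : ∀ α, Em α ∈ rootSpace H (-(α.1 : H → ℂ))) (α : RootsOutside H p) : ⁅Ep α, Em α⁆ ∈ H := by
  have h := LieAlgebra.lie_mem_genWeightSpace_of_mem_genWeightSpace (hp α) (hm α)
  rw [add_neg_cancel] at h
  have h' : ⁅Ep α, Em α⁆ ∈ rootSpace H (0 : H → ℂ) := h
  rw [LieAlgebra.rootSpace_zero_eq ℂ L H] at h'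
  exact h'

/-- By invariance and the normalization `B (E_α, E_{-α}) = 1`, the element `[E_α, E_{-α}]` is dual
to `α`, so pairing with it gives the eigenvalue. -/
lemma lie_Ep (hp : ∀ α, Ep α ∈ rootSpace H α.1)
    (hm : ∀ α, Em α ∈ rootSpace H (-(α.1 : H → ℂ)))
    (hn : ∀ α, killingForm ℂ L (Ep α) (Em α) = 1) (α : RootsOutside H p) {W : L} (hW : W ∈ H) :
    ⁅W, Ep α⁆ = killingForm ℂ L ⁅Ep α, Em α⁆ W • Ep α ∧
      ⁅W, Em α⁆ = -killingForm ℂ L ⁅Ep α, Em α⁆ W • Em α := by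
  have h1 : ⁅W, Ep α⁆ = α.1 ⟨W, hW⟩ • Ep α :=
    IsKilling.lie_eq_smul_of_mem_rootSpace (hp α) ⟨W, hW⟩
  have h2 : ⁅W, Em α⁆ = (-(α.1 : H → ℂ)) ⟨W, hW⟩ • Em α :=
    IsKilling.lie_eq_smul_of_mem_rootSpace (hm α) ⟨W, hW⟩
  have h3 : killingForm ℂ L ⁅Ep α, Em α⁆ W = α.1 ⟨W, hW⟩ := by
    rw [LieModule.traceForm_comm, ← killingForm_lie_left, h1, map_smul, LinearMap.smul_apply, hn]
    simp
  rw [h3, h1, h2]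
  exact ⟨rfl, rfl⟩

/-- Exhibits `E_{-α}` as a bracket with an element of the Cartan subalgebra, so that differentials
of homomorphisms to a torus vanish on it. -/
lemma exists_lie_Em (hm : ∀ α, Em α ∈ rootSpace H (-(α.1 : H → ℂ))) (α : RootsOutside H p) :
    ∃ h ∈ H, ⁅h, Em α⁆ = Em α := by
  obtain ⟨h, hh⟩ : ∃ h : H, α.1 h ≠ 0 := by
    by_contra! hc
    exact α.2.1 (funext hc)
  refine ⟨(-(α.1 h)⁻¹) • (h : L), H.smul_mem _ h.2, ?_⟩
  have h2 : ⁅(h : L), Em α⁆ = (-(α.1 : H → ℂ)) h • Em α :=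
    IsKilling.lie_eq_smul_of_mem_rootSpace (hm α) h
  rw [smul_lie, h2, smul_smul]
  simp [hh]

/-! ### Real forms -/

variable [Module ℝ L] [IsScalarTower ℝ ℂ L]

/-- The uniqueness of algebraic representatives. An element orthogonal to all brackets of a real
form is orthogonal to all brackets, so by invariance and nondegeneracy it is central, hence zero. -/
lemma eq_zero_of_killingForm_lie_eq_zero {gR : Submodule ℝ L}
    (hdec : ∀ X : L, ∃ Y ∈ gR, ∃ W ∈ gR, X = Y + Complex.I • W) {W : L}
    (h : ∀ X ∈ gR, ∀ Y ∈ gR, killingForm ℂ L W ⁅X, Y⁆ = 0) : W = 0 := by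
  have h1 : ∀ X Y : L, killingForm ℂ L W ⁅X, Y⁆ = 0 := by
    intro X Y
    obtain ⟨a, ha, b, hb, rfl⟩ := hdec X
    obtain ⟨c, hc, d, hd, rfl⟩ := hdec Y
    simp [h a ha c hc, h a ha d hd, h b hb c hc, h b hb d hd]
  have h2 : ∀ X : L, ⁅W, X⁆ = 0 := by
    intro X
    refine (LieAlgebra.IsKilling.killingForm_nondegenerate ℂ L).1 _ fun Y => ?_
    rw [killingForm_lie_left, h1]
  have h3 : W ∈ LieAlgebra.center ℂ L := by
    rw [LieModule.mem_maxTrivSubmodule]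
    intro X
    rw [← lie_skew, h2, neg_zero]
  simpa using h3

/-- A real basis of the real form is a complex basis of `L`, in which the adjoint maps of real
elements have real matrices; the trace of their product is therefore real. -/
lemma killingForm_real {gR : Submodule ℝ L}
    (hdec : ∀ X : L, ∃! Y : L × L, Y.1 ∈ gR ∧ Y.2 ∈ gR ∧ X = Y.1 + Complex.I • Y.2)
    (hlie : ∀ X ∈ gR, ∀ Y ∈ gR, ⁅X, Y⁆ ∈ gR) {X Y : L} (hX : X ∈ gR) (hY : Y ∈ gR) :
    ((killingForm ℂ L X Y).re : ℂ) = killingForm ℂ L X Y := by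
  have hreal : ∀ (r : ℝ) (x : L), (r : ℂ) • x = r • x := fun r x => by
    rw [← Complex.coe_algebraMap, algebraMap_smul]
  have huniq : ∀ {a b c d : L}, a ∈ gR → b ∈ gR → c ∈ gR → d ∈ gR →
      a + Complex.I • b = c + Complex.I • d → a = c ∧ b = d := by
    intro a b c d ha hb hc hd h
    have := (hdec (a + Complex.I • b)).unique (y₁ := (a, b)) (y₂ := (c, d)) ⟨ha, hb, rfl⟩
      ⟨hc, hd, h⟩
    exact Prod.ext_iff.1 this
  have : FiniteDimensional ℝ L := Module.Finite.trans ℂ L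
  let b := Module.finBasis ℝ gR
  set n := Module.finrank ℝ gR
  let v : Fin n → L := fun i => (b i : L)
  have hsplit : ∀ c : Fin n → ℂ, ∑ i, c i • v i =
      ((∑ i, (c i).re • b i : gR) : L) + Complex.I • ((∑ i, (c i).im • b i : gR) : L) := by
    intro c
    rw [Submodule.coe_sum, Submodule.coe_sum, Finset.smul_sum, ← Finset.sum_add_distrib]
    refine Finset.sum_congr rfl fun i _ => ?_
    rw [Submodule.coe_smul, Submodule.coe_smul, ← hreal, ← hreal, smul_smul, ← add_smul]
    congr 1
    rw [mul_comm]; exact (Complex.re_add_im _).symm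
  have hli : LinearIndependent ℂ v := by
    rw [Fintype.linearIndependent_iff]
    intro c hc i
    rw [hsplit] at hc
    have h0 : (0 : L) = 0 + Complex.I • (0 : L) := by simp
    rw [h0] at hc
    obtain ⟨h1, h2⟩ := huniq (Subtype.mem _) (Subtype.mem _) gR.zero_mem gR.zero_mem hc
    have h1' : ∑ i, (c i).re • b i = 0 := Subtype.ext h1
    have h2' : ∑ i, (c i).im • b i = 0 := Subtype.ext h2
    have := Fintype.linearIndependent_iff.1 b.linearIndependent _ h1' i
    have := Fintype.linearIndependent_iff.1 b.linearIndependent _ h2' i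
    exact Complex.ext (by assumption) (by assumption)
  have hsp : ⊤ ≤ Submodule.span ℂ (Set.range v) := by
    rintro x -
    have hg : ∀ y ∈ gR, y ∈ Submodule.span ℂ (Set.range v) := by
      intro y hy
      have h1 := b.sum_repr ⟨y, hy⟩
      have h2 : y = ∑ i, ((b.repr ⟨y, hy⟩ i : ℝ) : ℂ) • v i := by
        conv_lhs => rw [show y = ((⟨y, hy⟩ : gR) : L) from rfl, ← h1, Submodule.coe_sum]
        refine Finset.sum_congr rfl fun i _ => ?_
        rw [hreal]; rfl
      rw [h2]
      exact Submodule.sum_mem _ fun i _ => Submodule.smul_mem _ _ (Submodule.subset_span ⟨i, rfl⟩)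
    obtain ⟨⟨y, z⟩, ⟨hy, hz, rfl⟩, -⟩ := hdec x
    exact Submodule.add_mem _ (hg y hy) (Submodule.smul_mem _ _ (hg z hz))
  let bc : Module.Basis (Fin n) ℂ L := Module.Basis.mk hli hsp
  have hrepr : ∀ (y : L) (hy : y ∈ gR) (i : Fin n), bc.repr y i = ((b.repr ⟨y, hy⟩ i : ℝ) : ℂ) := by
    intro y hy i
    have h1 := b.sum_repr ⟨y, hy⟩
    have h2 : y = ∑ i, ((b.repr ⟨y, hy⟩ i : ℝ) : ℂ) • bc i := by
      conv_lhs => rw [show y = ((⟨y, hy⟩ : gR) : L) from rfl, ← h1, Submodule.coe_sum]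
      refine Finset.sum_congr rfl fun i _ => ?_
      rw [hreal, Module.Basis.mk_apply]; rfl
    conv_lhs => rw [h2]
    exact congrFun (bc.repr_sum_self _) i
  rw [killingForm_apply_apply, LinearMap.trace_eq_matrix_trace ℂ bc, Matrix.trace]
  rw [← Complex.conj_eq_iff_re, map_sum]
  refine Finset.sum_congr rfl fun i _ => ?_
  rw [Matrix.diag_apply, LinearMap.toMatrix_apply]
  have hi : bc i ∈ gR := by
    rw [Module.Basis.mk_apply]; exact (b i).2
  have hr := hrepr _ (hlie X hX _ (hlie Y hY _ hi)) i
  change (starRingEnd ℂ) (bc.repr ⁅X, ⁅Y, bc i⁆⁆ i) = bc.repr ⁅X, ⁅Y, bc i⁆⁆ i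
  rw [hr, Complex.conj_ofReal]

/-- The real form is perfect. A complex functional killing its brackets is `B (W, ·)`, and `W`
vanishes by uniqueness of representatives; so brackets span `L` over `ℂ`, and comparing real parts
in `L = g ⊕ i g` gives the real span. -/
lemma mem_span_lie_of_mem {gR : Submodule ℝ L}
    (hdec : ∀ X : L, ∃! Y : L × L, Y.1 ∈ gR ∧ Y.2 ∈ gR ∧ X = Y.1 + Complex.I • Y.2)
    (hlie : ∀ X ∈ gR, ∀ Y ∈ gR, ⁅X, Y⁆ ∈ gR) {X : L} (hX : X ∈ gR) :
    X ∈ Submodule.span ℝ {Z : L | ∃ A ∈ gR, ∃ B ∈ gR, ⁅A, B⁆ = Z} := by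
  have hreal : ∀ (r : ℝ) (x : L), (r : ℂ) • x = r • x := fun r x => by
    rw [← Complex.coe_algebraMap, algebraMap_smul]
  set S : Set L := {Z : L | ∃ A ∈ gR, ∃ B ∈ gR, ⁅A, B⁆ = Z} with hS
  have hSg : Submodule.span ℝ S ≤ gR := by
    rw [Submodule.span_le]
    rintro _ ⟨A, hA, B, hB, rfl⟩
    exact hlie A hA B hB
  have htop : Submodule.span ℂ S = ⊤ := by
    by_contra hne
    obtain ⟨f, hf0, hf⟩ := Submodule.exists_le_ker_of_lt_top _ (lt_top_iff_ne_top.2 hne)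
    obtain ⟨W, rfl⟩ := (LinearMap.BilinForm.toDual (killingForm ℂ L)
      (LieAlgebra.IsKilling.killingForm_nondegenerate ℂ L)).surjective f
    have : W = 0 := by
      refine eq_zero_of_killingForm_lie_eq_zero (gR := gR) (fun X => ?_) fun A hA B hB => ?_
      · obtain ⟨⟨y, z⟩, ⟨hy, hz, h⟩, -⟩ := hdec X
        exact ⟨y, hy, z, hz, h⟩
      · have := hf (Submodule.subset_span ⟨A, hA, B, hB, rfl⟩)
        rwa [LinearMap.mem_ker, LinearMap.BilinForm.toDual_def] at this
    exact hf0 (by rw [this, map_zero])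
  have key : ∀ u ∈ Submodule.span ℂ S, ∃ y ∈ Submodule.span ℝ S, ∃ z ∈ Submodule.span ℝ S,
      u = y + Complex.I • z := by
    intro u hu
    induction hu using Submodule.span_induction with
    | mem u hu => exact ⟨u, Submodule.subset_span hu, 0, zero_mem _, by simp⟩
    | zero => exact ⟨0, zero_mem _, 0, zero_mem _, by simp⟩
    | add u v _ _ hu hv =>
      obtain ⟨y, hy, z, hz, rfl⟩ := hu
      obtain ⟨y', hy', z', hz', rfl⟩ := hv
      exact ⟨y + y', add_mem hy hy', z + z', add_mem hz hz', by module⟩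
    | smul c u _ hu =>
      obtain ⟨y, hy, z, hz, rfl⟩ := hu
      refine ⟨c.re • y - c.im • z, sub_mem (Submodule.smul_mem _ _ hy) (Submodule.smul_mem _ _ hz),
        c.im • y + c.re • z, add_mem (Submodule.smul_mem _ _ hy) (Submodule.smul_mem _ _ hz), ?_⟩
      conv_lhs => rw [← Complex.re_add_im c]
      simp only [← hreal, add_smul, smul_add, smul_smul, add_mul, sub_eq_add_neg]
      have e : (c.im : ℂ) * Complex.I * Complex.I = -c.im := by
        rw [mul_assoc, Complex.I_mul_I]; ring
      rw [e, mul_comm Complex.I, mul_comm Complex.I]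
      module
  obtain ⟨y, hy, z, hz, h⟩ := key X (htop ▸ Submodule.mem_top)
  have := (hdec X).unique (y₁ := (X, 0)) (y₂ := (y, z)) ⟨hX, gR.zero_mem, by simp⟩
    ⟨hSg hy, hSg hz, h⟩
  have hXy : X = y := congrArg Prod.fst this
  exact hXy ▸ hy

end Algebra

/-! ### Calculus of two-forms on a complex vector space -/

section TwoFormCalculus

variable {E : Type*} [NormedAddCommGroup E] [NormedSpace ℝ E]
  {E₀ : Type*} [NormedAddCommGroup E₀] [NormedSpace ℝ E₀]

lemma twoForm_add_left (θ : E [⋀^Fin 2]→L[ℝ] ℝ) (a a' b : E) :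
    θ ![a + a', b] = θ ![a, b] + θ ![a', b] := by
  have := θ.toMultilinearMap.map_update_add ![a, b] 0 a a'
  have e : ∀ x, Function.update ![a, b] 0 x = ![x, b] := by
    intro x; ext i; fin_cases i <;> simp
  simp only [e] at this
  exact this

lemma twoForm_smul_left (θ : E [⋀^Fin 2]→L[ℝ] ℝ) (c : ℝ) (a b : E) :
    θ ![c • a, b] = c * θ ![a, b] := by
  have := θ.toMultilinearMap.map_update_smul ![a, b] 0 c a
  have e : ∀ x, Function.update ![a, b] 0 x = ![x, b] := by
    intro x; ext i; fin_cases i <;> simp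
  simp only [e] at this
  exact this

lemma twoForm_add_right (θ : E [⋀^Fin 2]→L[ℝ] ℝ) (a b b' : E) :
    θ ![a, b + b'] = θ ![a, b] + θ ![a, b'] := by
  rw [twoForm_swap, twoForm_add_left, twoForm_swap θ b, twoForm_swap θ b']; ring

lemma twoForm_smul_right (θ : E [⋀^Fin 2]→L[ℝ] ℝ) (c : ℝ) (a b : E) :
    θ ![a, c • b] = c * θ ![a, b] := by
  rw [twoForm_swap, twoForm_smul_left, twoForm_swap θ b]; ring

/-- A two-form as a bilinear map. -/
def twoFormBilin (θ : E [⋀^Fin 2]→L[ℝ] ℝ) : E →ₗ[ℝ] E →ₗ[ℝ] ℝ :=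
  LinearMap.mk₂ ℝ (fun a b => θ ![a, b]) (twoForm_add_left θ) (twoForm_smul_left θ)
    (twoForm_add_right θ) (fun c a b => twoForm_smul_right θ c a b)

lemma twoForm_sub_left (θ : E [⋀^Fin 2]→L[ℝ] ℝ) (a a' b : E) :
    θ ![a - a', b] = θ ![a, b] - θ ![a', b] :=
  LinearMap.map_sub₂ (twoFormBilin θ) a a' b

lemma twoForm_sub_right (θ : E [⋀^Fin 2]→L[ℝ] ℝ) (a b b' : E) :
    θ ![a, b - b'] = θ ![a, b] - θ ![a, b'] :=
  (twoFormBilin θ a).map_sub b b'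

lemma twoForm_neg_right (θ : E [⋀^Fin 2]→L[ℝ] ℝ) (a b : E) : θ ![a, -b] = - θ ![a, b] :=
  (twoFormBilin θ a).map_neg b

lemma twoForm_sum_left {κ : Type*} (s : Finset κ) (θ : E [⋀^Fin 2]→L[ℝ] ℝ) (a : κ → E) (b : E) :
    θ ![∑ k ∈ s, a k, b] = ∑ k ∈ s, θ ![a k, b] :=
  LinearMap.map_sum₂ (twoFormBilin θ) s a b

lemma twoForm_zero_left (θ : E [⋀^Fin 2]→L[ℝ] ℝ) (b : E) : θ ![0, b] = 0 :=
  LinearMap.map_zero₂ (twoFormBilin θ) b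

lemma twoForm_zero_right (θ : E [⋀^Fin 2]→L[ℝ] ℝ) (b : E) : θ ![b, 0] = 0 :=
  (twoFormBilin θ b).map_zero

lemma twoForm_self (θ : E [⋀^Fin 2]→L[ℝ] ℝ) (b : E) : θ ![b, b] = 0 := by
  have := twoForm_swap θ b b
  linarith

lemma hasFDerivAt_twoForm_apply {θ : E₀ → E [⋀^Fin 2]→L[ℝ] ℝ}
    {θ' : E₀ →L[ℝ] E [⋀^Fin 2]→L[ℝ] ℝ} {a b : E₀ → E} {a' b' : E₀ →L[ℝ] E} {z : E₀}
    (hθ : HasFDerivAt θ θ' z) (ha : HasFDerivAt a a' z) (hb : HasFDerivAt b b' z) :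
    ∃ f' : E₀ →L[ℝ] ℝ, HasFDerivAt (fun y => θ y ![a y, b y]) f' z ∧
      ∀ v, f' v = θ' v ![a z, b z] + θ z ![a' v, b z] + θ z ![a z, b' v] := by
  have h := HasFDerivAt.continuousAlternatingMap_apply (f := θ) (g := ![a, b]) (g' := ![a', b'])
    hθ (by intro i; fin_cases i <;> assumption)
  have e : ∀ y, (fun i => (![a, b] : Fin 2 → E₀ → E) i y) = ![a y, b y] := by
    intro y; ext i; fin_cases i <;> simp
  simp only [e] at h
  refine ⟨_, h, fun v => ?_⟩
  have e0 : ∀ w, Function.update ![a z, b z] 0 w = ![w, b z] := by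
    intro x; ext i; fin_cases i <;> simp
  have e1 : ∀ w, Function.update ![a z, b z] 1 w = ![a z, w] := by
    intro x; ext i; fin_cases i <;> simp
  simp only [Fin.sum_univ_two, add_apply, ContinuousLinearMap.comp_apply,
    ContinuousAlternatingMap.apply_apply, Matrix.cons_val_zero, Matrix.cons_val_one]
  rw [add_assoc]
  congr 2
  · exact congrArg (θ z) (e0 (a' v))
  · exact congrArg (θ z) (e1 (b' v))

lemma extDeriv_two_apply {θ : E → E [⋀^Fin 2]→L[ℝ] ℝ} {z : E} (h : DifferentiableAt ℝ θ z)
    (a b c : E) : extDeriv θ z ![a, b, c] = fderiv ℝ θ z a ![b, c] - fderiv ℝ θ z b ![a, c] +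
      fderiv ℝ θ z c ![a, b] := by
  rw [extDeriv_apply h, Fin.sum_univ_three]
  have e0 : (0 : Fin 3).removeNth ![a, b, c] = ![b, c] := by ext i; fin_cases i <;> rfl
  have e1 : (1 : Fin 3).removeNth ![a, b, c] = ![a, c] := by ext i; fin_cases i <;> rfl
  have e2 : (2 : Fin 3).removeNth ![a, b, c] = ![a, b] := by ext i; fin_cases i <;> rfl
  rw [e0, e1, e2]
  simp only [fderiv_continuousAlternatingMap_apply_const_apply h]
  simp
  ring

lemma extDeriv_one_apply {θ : E → E [⋀^Fin 1]→L[ℝ] ℝ} {z : E} (h : DifferentiableAt ℝ θ z)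
    (a b : E) : extDeriv θ z ![a, b] = fderiv ℝ θ z a ![b] - fderiv ℝ θ z b ![a] := by
  rw [extDeriv_apply h, Fin.sum_univ_two]
  have e0 : (0 : Fin 2).removeNth ![a, b] = ![b] := by ext i; fin_cases i; rfl
  have e1 : (1 : Fin 2).removeNth ![a, b] = ![a] := by ext i; fin_cases i; rfl
  rw [e0, e1]
  simp only [fderiv_continuousAlternatingMap_apply_const_apply h]
  simp
  ring

/-- The Lie derivative of `θ` along the vector field `v` vanishes at `z`. -/
def LieInvariantAt (θ : E → E [⋀^Fin 2]→L[ℝ] ℝ) (v : E → E) (z : E) : Prop :=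
  ∀ a b, fderiv ℝ θ z (v z) ![a, b] + θ z ![fderiv ℝ v z a, b] + θ z ![a, fderiv ℝ v z b] = 0

/-- For a closed form `θ` invariant under the fields `v` and `w`, the function `θ (v, w)` is a
Hamiltonian function of a commutator. -/
lemma fderiv_twoForm_of_lieInvariantAt {θ : E → E [⋀^Fin 2]→L[ℝ] ℝ} {v w : E → E} {z : E}
    (hθ : DifferentiableAt ℝ θ z) (hv : DifferentiableAt ℝ v z) (hw : DifferentiableAt ℝ w z)
    (hclosed : extDeriv θ z = 0) (hLv : LieInvariantAt θ v z) (hLw : LieInvariantAt θ w z) :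
    ∃ f' : E →L[ℝ] ℝ, HasFDerivAt (fun y => θ y ![v y, w y]) f' z ∧
      ∀ a, f' a = θ z ![fderiv ℝ v z (w z) - fderiv ℝ w z (v z), a] := by
  obtain ⟨f', hf', hf⟩ := hasFDerivAt_twoForm_apply hθ.hasFDerivAt hv.hasFDerivAt hw.hasFDerivAt
  refine ⟨f', hf', fun a => ?_⟩
  rw [hf]
  -- Invariance along `v`, invariance along `w` and closedness are evaluated so that every
  -- derivative of `θ` cancels and only the commutator remains.
  have h1 := hLv a (w z)
  have h2 := hLw a (v z)
  have h3 := extDeriv_two_apply hθ a (v z) (w z)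
  rw [hclosed] at h3
  rw [show (0 : E [⋀^Fin 3]→L[ℝ] ℝ) ![a, v z, w z] = 0 from rfl] at h3
  rw [twoForm_sub_left, twoForm_swap _ (fderiv ℝ v z (w z)), twoForm_swap _ (fderiv ℝ w z (v z))]
  rw [twoForm_swap (θ z) (v z) (fderiv ℝ w z a)]
  linarith

end TwoFormCalculus

/-! ### The derivative of the determinant -/

section Det

open Matrix

variable {n : Type*} [Fintype n] [DecidableEq n]

lemma differentiable_det : Differentiable ℂ (fun B : n → n → ℂ => (Matrix.of B).det) := by
  simp only [Matrix.det_apply', Matrix.of_apply]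
  fun_prop

/-- Jacobi's formula, from `det (A + t B) = det A · det (1 + t A⁻¹ B)` and the fact that the linear
coefficient of `det (1 + t M)` is the trace of `M`. -/
lemma fderiv_det (A B : n → n → ℂ) (hA : IsUnit (Matrix.of A).det) :
    fderiv ℂ (fun B : n → n → ℂ => (Matrix.of B).det) A B =
      (Matrix.of A).det * ((Matrix.of A)⁻¹ * Matrix.of B).trace := by
  have h1 : HasDerivAt (fun t : ℂ => (Matrix.of (A + t • B)).det)
      (fderiv ℂ (fun B : n → n → ℂ => (Matrix.of B).det) A B) 0 := by
    have h := (differentiable_det (n := n) A).hasFDerivAt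
    have hl : HasDerivAt (fun t : ℂ => A + t • B) B 0 := by
      simpa using ((hasDerivAt_id (0 : ℂ)).smul_const B).const_add A
    have h' : HasFDerivAt (fun B : n → n → ℂ => (Matrix.of B).det)
        (fderiv ℂ (fun B : n → n → ℂ => (Matrix.of B).det) A) (A + (0 : ℂ) • B) := by
      simpa using h
    exact h'.comp_hasDerivAt (0 : ℂ) hl
  set M : Matrix n n ℂ := (Matrix.of A)⁻¹ * Matrix.of B with hM
  have h2 : ∀ t : ℂ, (Matrix.of (A + t • B)).det = (Matrix.of A).det *
      (1 + M.trace * t + (det (1 + (Polynomial.X : Polynomial ℂ) • M.map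
        Polynomial.C)).divX.divX.eval t * t ^ 2) := by
    intro t
    rw [← Matrix.det_one_add_smul, ← Matrix.det_mul, hM, mul_add, mul_one, mul_smul_comm,
      ← mul_assoc, Matrix.mul_nonsing_inv _ hA, one_mul]
    rfl
  have h3 : HasDerivAt (fun t : ℂ => (Matrix.of (A + t • B)).det)
      ((Matrix.of A).det * M.trace) 0 := by
    simp_rw [h2]
    refine HasDerivAt.const_mul _ ?_
    have ha : HasDerivAt (fun t : ℂ => 1 + M.trace * t) (M.trace) 0 := by
      simpa using ((hasDerivAt_id (0 : ℂ)).const_mul M.trace).const_add 1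
    have hb := ((Polynomial.hasDerivAt (det (1 + (Polynomial.X : Polynomial ℂ) • M.map
        Polynomial.C)).divX.divX (0 : ℂ))).mul (hasDerivAt_pow 2 (0 : ℂ))
    have hc := ha.add hb
    convert! hc using 1
    simp
  exact h1.unique h3

variable {𝕜 E : Type*} [NontriviallyNormedField 𝕜] [NormedAddCommGroup E] [NormedSpace 𝕜 E]
  [NormedAlgebra 𝕜 ℂ]

/-- The scalar field is left free: it is `ℝ` for Gram matrices of forms, and `ℂ` for the holomorphic
coefficients of frames. -/
lemma hasFDerivAt_det {A : E → Matrix n n ℂ} {A' : n → n → E →L[𝕜] ℂ} {z : E}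
    (hA : ∀ i j, HasFDerivAt (fun y => A y i j) (A' i j) z) (hu : IsUnit (A z).det) :
    ∃ f' : E →L[𝕜] ℂ, HasFDerivAt (fun y => (A y).det) f' z ∧
      ∀ v, f' v = (A z).det * ((A z)⁻¹ * Matrix.of fun i j => A' i j v).trace := by
  have h1 : HasFDerivAt (fun y => (fun i j => A y i j : n → n → ℂ))
      (ContinuousLinearMap.pi fun i => ContinuousLinearMap.pi fun j => A' i j) z :=
    hasFDerivAt_pi.2 fun i => hasFDerivAt_pi.2 fun j => hA i j
  have h2 := ((differentiable_det (n := n) (fun i j => A z i j)).hasFDerivAt.restrictScalars 𝕜)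
  have h3 := h2.comp z h1
  refine ⟨_, h3, fun v => ?_⟩
  have := fderiv_det (fun i j => A z i j) (fun i j => A' i j v) hu
  exact this

end Det

/-! ### The Hermitian form of a two-form and its change under a change of basis -/

section HermGram

open Matrix

variable {E : Type*} [NormedAddCommGroup E] [NormedSpace ℂ E] {ι κ : Type*} [Fintype ι]
  [DecidableEq ι] [Fintype κ] [DecidableEq κ]

/-- The sesquilinear form `θ (v, J w) - i θ (v, w)` of a two-form. -/
def herm (θ : E [⋀^Fin 2]→L[ℝ] ℝ) (v w : E) : ℂ :=
  (θ ![v, Complex.I • w] : ℂ) - Complex.I * (θ ![v, w] : ℂ)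

lemma hermGram_apply (θ : E [⋀^Fin 2]→L[ℝ] ℝ) (v : ι → E) (i j : ι) :
    hermGram θ v i j = herm θ (v i) (v j) := rfl

lemma herm_add_left (θ : E [⋀^Fin 2]→L[ℝ] ℝ) (v v' w : E) :
    herm θ (v + v') w = herm θ v w + herm θ v' w := by
  simp only [herm, twoForm_add_left]; push_cast; ring

lemma herm_add_right (θ : E [⋀^Fin 2]→L[ℝ] ℝ) (v w w' : E) :
    herm θ v (w + w') = herm θ v w + herm θ v w' := by
  simp only [herm, smul_add, twoForm_add_right]; push_cast; ring

lemma smul_eq_re_add_im (c : ℂ) (v : E) : c • v = c.re • v + c.im • (Complex.I • v) := by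
  conv_lhs => rw [← Complex.re_add_im c]
  rw [add_smul, mul_smul, Complex.coe_smul, Complex.coe_smul]

lemma herm_smul_left (θ : E [⋀^Fin 2]→L[ℝ] ℝ)
    (hJ : ∀ v w : E, θ ![Complex.I • v, Complex.I • w] = θ ![v, w]) (c : ℂ) (v w : E) :
    herm θ (c • v) w = c * herm θ v w := by
  rw [smul_eq_re_add_im]
  simp only [herm, twoForm_add_left, twoForm_smul_left, hJ, twoForm_I_left θ hJ]
  conv_rhs => rw [← Complex.re_add_im c]
  push_cast
  have := Complex.I_sq
  linear_combination ((c.im : ℂ) * (θ ![v, w] : ℂ)) * this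

lemma herm_smul_right (θ : E [⋀^Fin 2]→L[ℝ] ℝ) (c : ℂ) (v w : E) :
    herm θ v (c • w) = (starRingEnd ℂ) c * herm θ v w := by
  have e : (starRingEnd ℂ) c = c.re - c.im * Complex.I := by
    apply Complex.ext <;> simp
  have e2 : Complex.I • c • w = c.re • (Complex.I • w) - c.im • w := by
    rw [smul_comm, smul_eq_re_add_im, smul_smul Complex.I Complex.I, Complex.I_mul_I]
    module
  rw [herm, e2, smul_eq_re_add_im c w, e, herm]
  simp only [twoForm_add_right, twoForm_smul_right, twoForm_sub_right]
  push_cast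
  have := Complex.I_sq
  linear_combination (-(c.im : ℂ) * (θ ![v, w] : ℂ)) * this

lemma herm_sum_left {ι : Type*} (s : Finset ι) (θ : E [⋀^Fin 2]→L[ℝ] ℝ) (v : ι → E) (w : E) :
    herm θ (∑ i ∈ s, v i) w = ∑ i ∈ s, herm θ (v i) w := by
  induction s using Finset.cons_induction with
  | empty => simp [herm, twoForm_zero_left]
  | cons a s ha ih => rw [Finset.sum_cons, Finset.sum_cons, herm_add_left, ih]

lemma herm_sum_right {ι : Type*} (s : Finset ι) (θ : E [⋀^Fin 2]→L[ℝ] ℝ) (v : ι → E) (w : E) :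
    herm θ w (∑ i ∈ s, v i) = ∑ i ∈ s, herm θ w (v i) := by
  induction s using Finset.cons_induction with
  | empty => simp [herm, twoForm_zero_right]
  | cons a s ha ih => rw [Finset.sum_cons, Finset.sum_cons, herm_add_right, ih]

lemma hermGram_sum (θ : E [⋀^Fin 2]→L[ℝ] ℝ)
    (hJ : ∀ v w : E, θ ![Complex.I • v, Complex.I • w] = θ ![v, w]) (e : ι → E)
    (C : Matrix ι ι ℂ) :
    hermGram θ (fun i => ∑ j, C i j • e j) = C * hermGram θ e * Cᴴ := by
  ext i j
  rw [hermGram_apply, herm_sum_left, Matrix.mul_apply]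
  simp only [herm_smul_left θ hJ, herm_sum_right, herm_smul_right, Matrix.mul_apply,
    Matrix.conjTranspose_apply, hermGram_apply, Finset.mul_sum, Finset.sum_mul]
  rw [Finset.sum_comm]
  refine Finset.sum_congr rfl fun k _ => Finset.sum_congr rfl fun l _ => ?_
  rw [Complex.star_def]
  ring

/-- A vector in the kernel of the Gram matrix gives a combination `w` of the basis vectors that is
orthogonal to all of them, hence to itself; positivity forces `w = 0`. -/
lemma det_hermGram_ne_zero (θ : E [⋀^Fin 2]→L[ℝ] ℝ)
    (hJ : ∀ v w : E, θ ![Complex.I • v, Complex.I • w] = θ ![v, w])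
    (hpos : ∀ v : E, v ≠ 0 → 0 < θ ![v, Complex.I • v]) {e : ι → E}
    (he : LinearIndependent ℂ e) : (hermGram θ e).det ≠ 0 := by
  intro h0
  obtain ⟨c, hc0, hc⟩ := Matrix.exists_vecMul_eq_zero_iff.2 h0
  set w : E := ∑ i, c i • e i with hw
  have h1 : ∀ j, herm θ w (e j) = 0 := by
    intro j
    rw [hw, herm_sum_left]
    simp only [herm_smul_left θ hJ]
    exact congrFun hc j
  have h2 : herm θ w w = 0 := by
    conv_lhs => rw [hw]
    rw [← hw, herm_sum_right]
    simp only [herm_smul_right, h1, mul_zero, Finset.sum_const_zero]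
  have h3 : θ ![w, Complex.I • w] = 0 := by
    have := congrArg Complex.re h2
    simpa [herm, twoForm_self] using this
  by_cases hw0 : w = 0
  · exact hc0 (funext fun i => Fintype.linearIndependent_iff.1 he c hw0 i)
  · exact (hpos w hw0).ne' h3

/-- Up to the nonzero real constant `wedgeConst`, the determinant is the value of a real top power.
-/
lemma det_hermGram_real (θ : E [⋀^Fin 2]→L[ℝ] ℝ)
    (hJ : ∀ v w : E, θ ![Complex.I • v, Complex.I • w] = θ ![v, w]) (e : ι → E) :
    (((hermGram θ e).det.re : ℝ) : ℂ) = (hermGram θ e).det := by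
  have h := wedgePow_eq_det_hermGram θ hJ e
  have hc : (wedgeConst ι : ℂ) ≠ 0 := by exact_mod_cast (wedgeConst_pos ι).ne'
  rw [mul_comm, ← div_eq_iff hc, ← Complex.ofReal_div] at h
  rw [← h, Complex.ofReal_re]

lemma det_hermGram_sum (θ : E [⋀^Fin 2]→L[ℝ] ℝ)
    (hJ : ∀ v w : E, θ ![Complex.I • v, Complex.I • w] = θ ![v, w]) (e : ι → E)
    (C : Matrix ι ι ℂ) :
    (hermGram θ (fun i => ∑ j, C i j • e j)).det.re =
      ‖C.det‖ ^ 2 * (hermGram θ e).det.re := by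
  rw [hermGram_sum θ hJ, Matrix.det_mul, Matrix.det_mul, Matrix.det_conjTranspose,
    ← det_hermGram_real θ hJ e, mul_right_comm, Complex.star_def, Complex.mul_conj,
    ← Complex.ofReal_mul, Complex.ofReal_re, Complex.normSq_eq_norm_sq, Complex.ofReal_re]

end HermGram

/-! ### The logarithm of the volume density, its `dd^c`, and divergences -/

section LogDet

open Matrix

variable {E : Type*} [NormedAddCommGroup E] [NormedSpace ℂ E] [FiniteDimensional ℂ E]
  {ι κ : Type*} [Fintype ι] [DecidableEq ι] [Fintype κ] [DecidableEq κ]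

/-- The logarithm of the volume density in a basis. -/
def logDet (θ : E → E [⋀^Fin 2]→L[ℝ] ℝ) (e : ι → E) (z : E) : ℝ :=
  Real.log (hermGram (θ z) e).det.re

lemma contDiffAt_hermGram_det {θ : E → E [⋀^Fin 2]→L[ℝ] ℝ} {z : E}
    (hθ : ContDiffAt ℝ ∞ θ z) (e : ι → E) :
    ContDiffAt ℝ ∞ (fun y => (hermGram (θ y) e).det) z := by
  have h : ∀ a b : E, ContDiffAt ℝ ∞ (fun y => (θ y ![a, b] : ℂ)) z := by
    intro a b
    exact Complex.ofRealCLM.contDiff.contDiffAt.comp z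
      ((ContinuousAlternatingMap.apply ℝ E ℝ ![a, b]).contDiff.contDiffAt.comp z hθ)
  have h2 : ∀ i j, ContDiffAt ℝ ∞ (fun y => hermGram (θ y) e i j) z := by
    intro i j
    exact (h _ _).sub (contDiffAt_const.mul (h _ _))
  simp only [Matrix.det_apply']
  exact ContDiffAt.sum fun σ _ => contDiffAt_const.mul (contDiffAt_prod fun i _ => h2 _ _)

lemma contDiffAt_logDet {θ : E → E [⋀^Fin 2]→L[ℝ] ℝ} {z : E} (hθ : ContDiffAt ℝ ∞ θ z) {e : ι → E}
    (h0 : (hermGram (θ z) e).det.re ≠ 0) : ContDiffAt ℝ ∞ (logDet θ e) z :=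
  ((Complex.reCLM.contDiff.contDiffAt.comp z (contDiffAt_hermGram_det hθ e))).log h0

/-- The logarithm of the volume density changes by the divergence along a field preserving the
two-form. -/
lemma fderiv_logDet_of_lieInvariantAt {θ : E → E [⋀^Fin 2]→L[ℝ] ℝ} {v : E → E} {z : E}
    (hθ : ContDiffAt ℝ ∞ θ z) (hv : DifferentiableAt ℂ v z)
    (hJ : ∀ a b : E, θ z ![Complex.I • a, Complex.I • b] = θ z ![a, b])
    (hL : LieInvariantAt θ v z) (e : Module.Basis ι ℂ E)
    (h0 : (hermGram (θ z) e).det ≠ 0) :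
    fderiv ℝ (logDet θ e) z (v z) = - 2 * (LinearMap.trace ℂ E (fderiv ℂ v z)).re := by
  have hθd : HasFDerivAt θ (fderiv ℝ θ z) z := (hθ.differentiableAt (by simp)).hasFDerivAt
  set D : E →L[ℂ] E := fderiv ℂ v z with hD
  have hDR : ∀ a, fderiv ℝ v z a = D a := fun a => by
    rw [hv.fderiv_restrictScalars ℝ]; rfl
  set M : Matrix ι ι ℂ := Matrix.of fun a c => e.repr (D (e a)) c with hM
  have hDe : ∀ a, D (e a) = ∑ c, M a c • e c := fun a => (e.sum_repr (D (e a))).symm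
  have htr : LinearMap.trace ℂ E (D : E →ₗ[ℂ] E) = M.trace := by
    rw [LinearMap.trace_eq_matrix_trace ℂ e, Matrix.trace, Matrix.trace]
    refine Finset.sum_congr rfl fun i _ => ?_
    rw [Matrix.diag_apply, LinearMap.toMatrix_apply]
    rfl
  set G := hermGram (θ z) e with hG
  have hap : ∀ a b : E, HasFDerivAt (fun y => (θ y ![a, b] : ℂ))
      (Complex.ofRealCLM ∘L (ContinuousAlternatingMap.apply ℝ E ℝ ![a, b]) ∘L fderiv ℝ θ z) z :=
    fun a b => Complex.ofRealCLM.hasFDerivAt.comp z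
      ((ContinuousAlternatingMap.apply ℝ E ℝ ![a, b]).hasFDerivAt.comp z hθd)
  have hent : ∀ i j, HasFDerivAt (fun y => hermGram (θ y) e i j) _ z := fun i j =>
    (hap (e i) (Complex.I • e j)).sub ((hap (e i) (e j)).const_mul Complex.I)
  obtain ⟨f', hf', hf⟩ := hasFDerivAt_det hent (isUnit_iff_ne_zero.2 h0)
  -- Invariance of `θ` replaces its derivative along `v` by the action of the derivative of `v` on
  -- the two arguments, which the matrix `M` expresses in the basis `e`.
  have hval : (Matrix.of fun i j => (Complex.ofRealCLM ∘L
      (ContinuousAlternatingMap.apply ℝ E ℝ ![e i, Complex.I • e j]) ∘L fderiv ℝ θ z -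
      Complex.I • (Complex.ofRealCLM ∘L (ContinuousAlternatingMap.apply ℝ E ℝ ![e i, e j]) ∘L
        fderiv ℝ θ z)) (v z)) = - (M * G + G * Mᴴ) := by
    ext i j
    have h1 := hL (e i) (Complex.I • e j)
    have h2 := hL (e i) (e j)
    rw [hDR, hDR] at h1 h2
    have e1 : ((fderiv ℝ θ z (v z) ![e i, Complex.I • e j] : ℝ) : ℂ) -
        Complex.I * ((fderiv ℝ θ z (v z) ![e i, e j] : ℝ) : ℂ) =
        - (herm (θ z) (D (e i)) (e j) + herm (θ z) (e i) (D (e j))) := by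
      rw [show fderiv ℝ θ z (v z) ![e i, Complex.I • e j] =
        - (θ z ![D (e i), Complex.I • e j] + θ z ![e i, D (Complex.I • e j)]) by linarith,
        show fderiv ℝ θ z (v z) ![e i, e j] =
        - (θ z ![D (e i), e j] + θ z ![e i, D (e j)]) by linarith, map_smul]
      simp only [herm]
      push_cast
      ring
    refine e1.trans ?_
    rw [Matrix.neg_apply, Matrix.add_apply, Matrix.mul_apply, Matrix.mul_apply, hDe, hDe,
      herm_sum_left, herm_sum_right]
    congr 2
    · refine Finset.sum_congr rfl fun k _ => ?_
      rw [herm_smul_left _ hJ]; rfl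
    · refine Finset.sum_congr rfl fun k _ => ?_
      rw [herm_smul_right, mul_comm]; rfl
  have hfv := hf (v z)
  rw [hval] at hfv
  have hGu : IsUnit G.det := isUnit_iff_ne_zero.2 h0
  -- Cyclicity of the trace removes `G`, leaving `-(tr M + conj (tr M))`.
  have htrace : (G⁻¹ * -(M * G + G * Mᴴ)).trace = ((-2 * M.trace.re : ℝ) : ℂ) := by
    rw [mul_neg, mul_add, Matrix.trace_neg, Matrix.trace_add, Matrix.trace_mul_comm,
      mul_assoc, Matrix.mul_nonsing_inv _ hGu, mul_one, ← mul_assoc, Matrix.nonsing_inv_mul _ hGu,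
      one_mul, Matrix.trace_conjTranspose, Complex.star_def, Complex.add_conj]
    push_cast; ring
  rw [htrace] at hfv
  have hreal := det_hermGram_real (θ z) hJ e
  have h0' : (hermGram (θ z) e).det.re ≠ 0 := fun h => h0 (by
    rw [← hG] at hreal h; rw [← hreal, h, Complex.ofReal_zero])
  have hlog := ((Complex.reCLM.hasFDerivAt.comp z hf').log h0').fderiv
  have hlog' : fderiv ℝ (logDet θ e) z = _ := hlog
  rw [hlog', htr]
  change ((hermGram (θ z) e).det.re)⁻¹ * (f' (v z)).re = _
  rw [hfv]
  rw [Complex.re_mul_ofReal]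
  field_simp

/-- The form `dd^c u` in terms of the second derivative of `u`. -/
lemma extDeriv_dc_apply {u : E → ℝ} {z : E} (hu : ContDiffAt ℝ 2 u z) (a b : E) :
    extDeriv (dc u) z ![a, b] = - fderiv ℝ (fderiv ℝ u) z a (Complex.I • b) +
      fderiv ℝ (fderiv ℝ u) z b (Complex.I • a) := by
  have hd : HasFDerivAt (fderiv ℝ u) (fderiv ℝ (fderiv ℝ u) z) z :=
    ((hu.fderiv_right (m := 1) le_rfl).differentiableAt one_ne_zero).hasFDerivAt
  set Jr : E →L[ℝ] E := (Complex.I • ContinuousLinearMap.id ℂ E).restrictScalars ℝ with hJr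
  have h1 : HasFDerivAt (fun y => -((fderiv ℝ u y).comp Jr))
      (-(((ContinuousLinearMap.compL ℝ E E ℝ).flip Jr) ∘L (fderiv ℝ (fderiv ℝ u) z))) z :=
    (((ContinuousLinearMap.compL ℝ E E ℝ).flip Jr).hasFDerivAt.comp z hd).neg
  let T : (E →L[ℝ] ℝ) →L[ℝ] (E [⋀^Fin 1]→L[ℝ] ℝ) :=
    (ContinuousAlternatingMap.ofSubsingletonLIE (𝕜 := ℝ) (E := E) (F := ℝ)
      (0 : Fin 1)).toContinuousLinearEquiv.toContinuousLinearMap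
  have h2 : HasFDerivAt (dc u) _ z := T.hasFDerivAt.comp z h1
  rw [extDeriv_one_apply h2.differentiableAt, h2.fderiv]
  change -(fderiv ℝ (fderiv ℝ u) z a (Complex.I • b)) -
    -(fderiv ℝ (fderiv ℝ u) z b (Complex.I • a)) = _
  ring

/-- If `u` changes by minus twice the real part of the divergence along the holomorphic fields `v`
and `w`, then `dd^c u (v, w)` is a divergence of their commutator. -/
lemma extDeriv_dc_of_divergence {u : E → ℝ} {v w : E → E} {z : E} (hu : ContDiffAt ℝ 2 u z)
    (hv : ContDiffAt ℂ 2 v z) (hw : ContDiffAt ℂ 2 w z)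
    (hdv : ∀ᶠ y in 𝓝 z, fderiv ℝ u y (v y) = - 2 * (LinearMap.trace ℂ E (fderiv ℂ v y)).re)
    (hdw : ∀ᶠ y in 𝓝 z, fderiv ℝ u y (w y) = - 2 * (LinearMap.trace ℂ E (fderiv ℂ w y)).re) :
    extDeriv (dc u) z ![v z, w z] =
      fderiv ℝ u z (Complex.I • (fderiv ℂ v z (w z) - fderiv ℂ w z (v z))) +
      2 * (Complex.I * LinearMap.trace ℂ E
        (fderiv ℂ (fun y => fderiv ℂ v y (w y) - fderiv ℂ w y (v y)) z)).re := by
  rw [extDeriv_dc_apply hu]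
  have hdu : HasFDerivAt (fderiv ℝ u) (fderiv ℝ (fderiv ℝ u) z) z :=
    ((hu.fderiv_right (m := 1) le_rfl).differentiableAt one_ne_zero).hasFDerivAt
  let T : (E →L[ℂ] E) →L[ℂ] ℂ :=
    LinearMap.toContinuousLinearMap (LinearMap.trace ℂ E ∘ₗ ContinuousLinearMap.coeLM ℂ)
  have hT : ∀ f : E →L[ℂ] E, T f = LinearMap.trace ℂ E f := fun f => rfl
  -- The divergence identity holds in a neighbourhood, so it can be differentiated in the direction
  -- `a`; this expresses the second derivative of `u` by first-order data.
  have key : ∀ (x : E → E), ContDiffAt ℂ 2 x z →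
      (∀ᶠ y in 𝓝 z, fderiv ℝ u y (x y) = - 2 * (LinearMap.trace ℂ E (fderiv ℂ x y)).re) →
      ∀ a, fderiv ℝ (fderiv ℝ u) z a (x z) = - fderiv ℝ u z (fderiv ℂ x z a)
        - 2 * (T (fderiv ℂ (fderiv ℂ x) z a)).re := by
    intro x hx hdx a
    have hx1 : HasFDerivAt x ((fderiv ℂ x z).restrictScalars ℝ) z :=
      (hx.differentiableAt two_ne_zero).hasFDerivAt.restrictScalars ℝ
    have hx2 : HasFDerivAt (fderiv ℂ x) ((fderiv ℂ (fderiv ℂ x) z).restrictScalars ℝ) z :=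
      ((hx.fderiv_right (m := 1) le_rfl).differentiableAt one_ne_zero).hasFDerivAt.restrictScalars ℝ
    have hl := hdu.clm_apply hx1
    have hr : HasFDerivAt (fun y => - 2 * (T (fderiv ℂ x y)).re)
        ((-2 : ℝ) • (Complex.reCLM ∘L (T.restrictScalars ℝ) ∘L
          ((fderiv ℂ (fderiv ℂ x) z).restrictScalars ℝ))) z :=
      (Complex.reCLM.hasFDerivAt.comp z ((T.restrictScalars ℝ).hasFDerivAt.comp z hx2)).const_mul _
    have := congrArg (fun L => L a) (hl.unique (hr.congr_of_eventuallyEq hdx))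
    have h' : fderiv ℝ u z (fderiv ℂ x z a) + fderiv ℝ (fderiv ℝ u) z a (x z) =
      -2 * (T (fderiv ℂ (fderiv ℂ x) z a)).re := this
    linarith
  have hsu := (hu.isSymmSndFDerivAt (by simp))
  have hsv := (hv.isSymmSndFDerivAt (by simp))
  have hsw := (hw.isSymmSndFDerivAt (by simp))
  rw [hsu (v z), hsu (w z), key v hv hdv, key w hw hdw]
  have hv1 : HasFDerivAt v (fderiv ℂ v z) z := (hv.differentiableAt two_ne_zero).hasFDerivAt
  have hw1 : HasFDerivAt w (fderiv ℂ w z) z := (hw.differentiableAt two_ne_zero).hasFDerivAt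
  have hv2 : HasFDerivAt (fderiv ℂ v) (fderiv ℂ (fderiv ℂ v) z) z :=
      ((hv.fderiv_right (m := 1) le_rfl).differentiableAt one_ne_zero).hasFDerivAt
  have hw2 : HasFDerivAt (fderiv ℂ w) (fderiv ℂ (fderiv ℂ w) z) z :=
      ((hw.fderiv_right (m := 1) le_rfl).differentiableAt one_ne_zero).hasFDerivAt
  have hc := ((hv2.clm_apply hw1).sub (hw2.clm_apply hv1)).fderiv
  have htr : LinearMap.trace ℂ E
        (fderiv ℂ (fun y => fderiv ℂ v y (w y) - fderiv ℂ w y (v y)) z) =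
      T (fderiv ℂ (fderiv ℂ v) z (w z)) - T (fderiv ℂ (fderiv ℂ w) z (v z)) := by
    have hc' : fderiv ℂ (fun y => fderiv ℂ v y (w y) - fderiv ℂ w y (v y)) z =
        (fderiv ℂ v z ∘L fderiv ℂ w z + fderiv ℂ (fderiv ℂ v) z (w z)) -
        (fderiv ℂ w z ∘L fderiv ℂ v z + fderiv ℂ (fderiv ℂ w) z (v z)) := by
      refine hc.trans ?_
      ext a
      change (fderiv ℂ v z (fderiv ℂ w z a) + fderiv ℂ (fderiv ℂ v) z a (w z)) -
        (fderiv ℂ w z (fderiv ℂ v z a) + fderiv ℂ (fderiv ℂ w) z a (v z)) = _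
      rw [hsv a (w z), hsw a (v z)]
      rfl
    rw [hc', ← hT, map_sub, map_add, map_add]
    -- The products of first derivatives form a commutator of endomorphisms and have no trace; the
    -- second derivatives are what remains of the divergence of the commutator field.
    have hcomm : T (fderiv ℂ v z ∘L fderiv ℂ w z) = T (fderiv ℂ w z ∘L fderiv ℂ v z) :=
      LinearMap.trace_mul_comm ℂ (fderiv ℂ v z : E →ₗ[ℂ] E) (fderiv ℂ w z : E →ₗ[ℂ] E)
    rw [hcomm]; ring
  rw [htr]
  simp only [map_smul, smul_sub, map_sub, mul_sub, Complex.sub_re, smul_eq_mul]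
  ring

/-- The logarithmic derivative of the volume function of a holomorphic frame. -/
lemma fderiv_log_det_hermGram_frame {θ : E → E [⋀^Fin 2]→L[ℝ] ℝ} {z : E}
    (hθ : ContDiffAt ℝ ∞ θ z) (hJ : ∀ᶠ y in 𝓝 z, ∀ a b : E,
      θ y ![Complex.I • a, Complex.I • b] = θ y ![a, b])
    (hpos : ∀ v : E, v ≠ 0 → 0 < θ z ![v, Complex.I • v])
    (e : Module.Basis κ ℂ E) (b : Module.Basis ι ℂ E) {F : ι → E → E}
    (hF : ∀ a, DifferentiableAt ℂ (F a) z) (hFb : ∀ a, F a z = b a) (c : ℝ) (hc : c ≠ 0) :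
    ∃ f' : E →L[ℝ] ℝ,
      HasFDerivAt (fun y => Real.log |c * (hermGram (θ y) fun a => F a y).det.re|) f' z ∧
      ∀ v, f' v = fderiv ℝ (logDet θ e) z v + 2 * (∑ a, b.repr (fderiv ℂ (F a) z v) a).re := by
  set D : E → ℝ := fun y => (hermGram (θ y) e).det.re with hD
  -- The coefficients of the frame in its own value at `z`. The matrix is complex differentiable at
  -- `z` and equals `1` there, so the derivative of its determinant is a trace.
  set Φ : E → Matrix ι ι ℂ := fun y => Matrix.of fun a k => b.repr (F a y) k with hΦ
  have hD0 : D z ≠ 0 := fun h => det_hermGram_ne_zero (θ z) hJ.self_of_nhds hpos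
    e.linearIndependent (by rw [← det_hermGram_real (θ z) hJ.self_of_nhds e]; simpa [hD] using h)
  have hDc : ContDiffAt ℝ ∞ D z :=
    Complex.reCLM.contDiff.contDiffAt.comp z (contDiffAt_hermGram_det hθ e)
  have hΦz : Φ z = 1 := by
    ext a k
    simp [hΦ, hFb, Matrix.one_apply, Finsupp.single_apply]
  have hent : ∀ a k, HasFDerivAt (fun y => Φ y a k)
      (LinearMap.toContinuousLinearMap (b.coord k) ∘L fderiv ℂ (F a) z) z := fun a k =>
    (LinearMap.toContinuousLinearMap (b.coord k)).hasFDerivAt.comp z (hF a).hasFDerivAt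
  obtain ⟨d', hd', hd⟩ := hasFDerivAt_det hent (by rw [hΦz]; simp)
  have hdz : (Φ z).det = 1 := by rw [hΦz, Matrix.det_one]
  -- At `z` the determinant is `1`, inside the domain of the principal logarithm.
  have hlog := hd'.clog (by rw [hdz]; exact Complex.one_mem_slitPlane)
  have hlogD : HasFDerivAt (fun y => Real.log (D y)) (fderiv ℝ (logDet θ e) z) z :=
    ((hDc.log hD0).differentiableAt (by simp)).hasFDerivAt
  -- The bases `b` and `e` have different index types; the fixed change of basis `C` contributes
  -- only a constant to the logarithm.
  let σ := b.indexEquiv e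
  set C : Matrix ι ι ℂ := Matrix.of fun i j => e.repr (b i) (σ j) with hC
  have hbC : ∀ i, b i = ∑ j, C i j • e (σ j) := fun i => by
    rw [← e.sum_repr (b i)]
    exact (Equiv.sum_comp σ fun k => e.repr (b i) k • e k).symm
  have hFΦ : ∀ y a, F a y = ∑ k, Φ y a k • b k := fun y a => (b.sum_repr (F a y)).symm
  have hdet : ∀ᶠ y in 𝓝 z, (hermGram (θ y) fun a => F a y).det.re =
      ‖(Φ y).det‖ ^ 2 * (‖C.det‖ ^ 2 * D y) := by
    filter_upwards [hJ] with y hy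
    have h1 : (fun a => F a y) = fun a => ∑ k, Φ y a k • b k := funext (hFΦ y)
    have h2 : (b : ι → E) = fun i => ∑ j, C i j • (e ∘ σ) j := funext hbC
    have h3 : hermGram (θ y) (e ∘ σ) = (hermGram (θ y) e).submatrix σ σ := rfl
    rw [h1, det_hermGram_sum (θ y) hy]
    conv_lhs => rw [h2]
    rw [det_hermGram_sum (θ y) hy, h3, Matrix.det_submatrix_equiv_self]
  have hC0 : C.det ≠ 0 := by
    intro h
    have h1 := hdet.self_of_nhds
    rw [h] at h1
    apply det_hermGram_ne_zero (θ z) hJ.self_of_nhds hpos b.linearIndependent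
    rw [← det_hermGram_real (θ z) hJ.self_of_nhds b]
    simp only [hFb] at h1
    rw [h1]; simp
  -- The logarithm splits into a constant, the coordinate volume density and `log |det Φ|² = 2 Re
  -- log det Φ`.
  have hev : (fun y => Real.log |c * (hermGram (θ y) fun a => F a y).det.re|) =ᶠ[𝓝 z]
      fun y => Real.log (c * ‖C.det‖ ^ 2) + Real.log (D y) +
        2 * (Complex.log (Φ y).det).re := by
    filter_upwards [hdet, hDc.continuousAt.eventually_ne hD0,
      hd'.continuousAt.eventually_ne (by rw [hdz]; exact one_ne_zero)] with y h1 h2 h3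
    have h3' : ‖(Φ y).det‖ ≠ 0 := norm_ne_zero_iff.2 h3
    have hC0' : ‖C.det‖ ≠ 0 := norm_ne_zero_iff.2 hC0
    rw [h1, Real.log_abs, Complex.log_re,
      show c * (‖(Φ y).det‖ ^ 2 * (‖C.det‖ ^ 2 * D y)) =
        (c * ‖C.det‖ ^ 2) * D y * ‖(Φ y).det‖ ^ 2 by ring,
      Real.log_mul (by positivity) (by positivity), Real.log_mul (by positivity) h2,
      Real.log_pow]
    push_cast; ring
  refine ⟨_, ((hlogD.const_add (Real.log (c * ‖C.det‖ ^ 2))).add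
    ((Complex.reCLM.hasFDerivAt.comp z (hlog.restrictScalars ℝ)).const_mul 2)).congr_of_eventuallyEq
      hev, fun v => ?_⟩
  change fderiv ℝ (logDet θ e) z v + 2 * ((Φ z).det⁻¹ * d' v).re = _
  rw [hd, hdz, hΦz]
  simp [Matrix.trace]

end LogDet

/-! ### Velocities of curves in complex manifolds -/

section Velocity

variable {E : Type*} [NormedAddCommGroup E] [NormedSpace ℂ E]
  {M : Type*} [TopologicalSpace M] [ChartedSpace E M]
  {E' : Type*} [NormedAddCommGroup E'] [NormedSpace ℂ E']
  {N : Type*} [TopologicalSpace N] [ChartedSpace E' N]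
  {E'' : Type*} [NormedAddCommGroup E''] [NormedSpace ℂ E'']
  {Q : Type*} [TopologicalSpace Q] [ChartedSpace E'' Q]

/-- The curve `c` passes through `p` at time `0` with velocity `v`. -/
def HasVelocity (c : ℝ → M) (p : M) (v : E) : Prop :=
  c 0 = p ∧ ContinuousAt c 0 ∧ HasDerivAt (fun s => chartAt E p (c s)) v 0

lemma subset_range_modelWithCornersSelf {𝕜 : Type*} [NontriviallyNormedField 𝕜] {E : Type*}
    [NormedAddCommGroup E] [NormedSpace 𝕜 E] : Set.univ ⊆ Set.range 𝓘(𝕜, E) :=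
  fun x _ => ⟨x, rfl⟩

lemma subset_range_modelWithCornersSelf_prod {𝕜 : Type*} [NontriviallyNormedField 𝕜] {E E' : Type*}
    [NormedAddCommGroup E] [NormedSpace 𝕜 E] [NormedAddCommGroup E'] [NormedSpace 𝕜 E'] :
    Set.univ ⊆ Set.range (𝓘(𝕜, E).prod 𝓘(𝕜, E')) :=
  fun x _ => ⟨x, rfl⟩

variable (E E') in
/-- The derivative of a map between complex manifolds, in terms of the model spaces. -/
def tmap (f : M → N) (p : M) : E →L[ℂ] E' := mfderiv 𝓘(ℂ, E) 𝓘(ℂ, E') f p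

variable (E E' E'') in
/-- The derivative of a map from a product of complex manifolds, in terms of the model spaces. -/
def tmap₂ (f : M × N → Q) (p : M × N) : E × E' →L[ℂ] E'' :=
  mfderiv (𝓘(ℂ, E).prod 𝓘(ℂ, E')) 𝓘(ℂ, E'') f p

variable (E) in
/-- The differential of a real function on a complex manifold, in terms of the model spaces. -/
def tmapReal (u : M → ℝ) (p : M) : E →L[ℝ] ℝ := mfderiv 𝓘(ℝ, E) 𝓘(ℝ, ℝ) u p

/-- Connects velocities in the preferred chart with the manifold derivative used in the definition
of `lieAlg`. -/
lemma hasVelocity_iff_mfderiv {c : ℝ → M} {p : M} {v : E} (h0 : c 0 = p) :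
    HasVelocity c p v ↔ MDifferentiableAt 𝓘(ℝ, ℝ) 𝓘(ℝ, E) c 0 ∧
      (mfderiv 𝓘(ℝ, ℝ) 𝓘(ℝ, E) c 0 (1 : ℝ) : E) = v := by
  subst h0
  constructor
  · rintro ⟨-, hc, hd⟩
    have h : HasMFDerivAt 𝓘(ℝ, ℝ) 𝓘(ℝ, E) c 0
        (ContinuousLinearMap.toSpanSingleton ℝ v : ℝ →L[ℝ] E) :=
      ⟨hc, (hd.hasFDerivAt.hasFDerivWithinAt (s := Set.range 𝓘(ℝ, ℝ)) :)⟩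
    refine ⟨h.mdifferentiableAt, ?_⟩
    rw [h.mfderiv]
    exact one_smul ℝ v
  · rintro ⟨h, hv⟩
    have h' := h.hasMFDerivAt
    refine ⟨rfl, h'.1, ?_⟩
    let L : ℝ →L[ℝ] E := mfderiv 𝓘(ℝ, ℝ) 𝓘(ℝ, E) c 0
    have h2 : HasFDerivWithinAt (fun s => chartAt E (c 0) (c s)) L Set.univ 0 :=
      h'.2.mono subset_range_modelWithCornersSelf
    have h4 := (hasFDerivWithinAt_univ.1 h2).hasDerivAt
    exact hv ▸ h4

lemma hasFDerivAt_of_mdifferentiableAt {f : M → N} {p : M}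
    (h : MDifferentiableAt 𝓘(ℂ, E) 𝓘(ℂ, E') f p) :
    HasFDerivAt (fun z => chartAt E' (f p) (f ((chartAt E p).symm z)))
      (tmap E E' f p) (chartAt E p p) :=
  hasFDerivWithinAt_univ.1
    (h.hasMFDerivAt.2.mono subset_range_modelWithCornersSelf :
      HasFDerivWithinAt _ (tmap E E' f p) Set.univ (chartAt E p p))

lemma hasFDerivAt_of_mdifferentiableAt_prod {f : M × N → Q} {p : M × N}
    (h : MDifferentiableAt (𝓘(ℂ, E).prod 𝓘(ℂ, E')) 𝓘(ℂ, E'') f p) :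
    HasFDerivAt (fun z : E × E' => chartAt E'' (f p)
        (f ((chartAt E p.1).symm z.1, (chartAt E' p.2).symm z.2)))
      (tmap₂ E E' E'' f p) (chartAt E p.1 p.1, chartAt E' p.2 p.2) :=
  hasFDerivWithinAt_univ.1
    (h.hasMFDerivAt.2.mono subset_range_modelWithCornersSelf_prod :
      HasFDerivWithinAt _ (tmap₂ E E' E'' f p) Set.univ (chartAt E p.1 p.1, chartAt E' p.2 p.2))

lemma hasFDerivAt_of_mdifferentiableAt_real {u : M → ℝ} {p : M}
    (h : MDifferentiableAt 𝓘(ℝ, E) 𝓘(ℝ, ℝ) u p) :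
    HasFDerivAt (fun z => u ((chartAt E p).symm z)) (tmapReal E u p) (chartAt E p p) :=
  hasFDerivWithinAt_univ.1
    (h.hasMFDerivAt.2.mono subset_range_modelWithCornersSelf :
      HasFDerivWithinAt _ (tmapReal E u p) Set.univ (chartAt E p p))

lemma contDiffAt_of_contMDiffAt_prod {f : M × N → Q} {p : M × N} {n : WithTop ℕ∞}
    (h : ContMDiffAt (𝓘(ℂ, E).prod 𝓘(ℂ, E')) 𝓘(ℂ, E'') n f p) :
    ContDiffAt ℂ n (fun z : E × E' => chartAt E'' (f p)
        (f ((chartAt E p.1).symm z.1, (chartAt E' p.2).symm z.2)))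
      (chartAt E p.1 p.1, chartAt E' p.2 p.2) := by
  have := (contMDiffAt_iff.1 h).2
  rw [← contDiffWithinAt_univ]
  simpa [writtenInExtChartAt, extChartAt, Function.comp_def] using! this

lemma HasVelocity.continuousAt {c : ℝ → M} {p : M} {v : E} (h : HasVelocity c p v) :
    ContinuousAt c 0 := h.2.1

lemma HasVelocity.tendsto {c : ℝ → M} {p : M} {v : E} (h : HasVelocity c p v) :
    Filter.Tendsto c (𝓝 0) (𝓝 p) := by
  have := h.2.1.tendsto
  rwa [h.1] at this

lemma HasVelocity.unique {c : ℝ → M} {p : M} {v w : E} (h : HasVelocity c p v)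
    (h' : HasVelocity c p w) : v = w := h.2.2.unique h'.2.2

lemma HasVelocity.congr {c c' : ℝ → M} {p : M} {v : E} (h : HasVelocity c p v)
    (hc : c' =ᶠ[𝓝 0] c) : HasVelocity c' p v :=
  ⟨hc.self_of_nhds.trans h.1, h.2.1.congr hc.symm, h.2.2.congr_of_eventuallyEq
    (hc.fun_comp (chartAt E p))⟩

lemma hasVelocity_const (p : M) : HasVelocity (fun _ => p) p (0 : E) :=
  ⟨rfl, continuousAt_const, hasDerivAt_const _ _⟩

lemma hasVelocity_self {c : ℝ → E} {p v : E} :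
    HasVelocity c p v ↔ c 0 = p ∧ HasDerivAt c v 0 :=
  ⟨fun h => ⟨h.1, h.2.2⟩, fun h => ⟨h.1, h.2.continuousAt, h.2⟩⟩

lemma HasVelocity.eventually_chart {c : ℝ → M} {p : M} {v : E} (h : HasVelocity c p v) :
    ∀ᶠ s in 𝓝 0, (chartAt E p).symm (chartAt E p (c s)) = c s := by
  filter_upwards [h.tendsto ((chartAt E p).open_source.mem_nhds (mem_chart_source E p))] with s hs
  exact (chartAt E p).left_inv hs

lemma HasVelocity.comp {c : ℝ → M} {p : M} {v : E} (h : HasVelocity c p v) {f : M → N}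
    (hf : MDifferentiableAt 𝓘(ℂ, E) 𝓘(ℂ, E') f p) :
    HasVelocity (fun s => f (c s)) (f p) (tmap E E' f p v) := by
  refine ⟨congrArg f h.1, ContinuousAt.comp (by rw [h.1]; exact hf.continuousAt) h.2.1, ?_⟩
  have h1 := (hasFDerivAt_of_mdifferentiableAt hf).restrictScalars ℝ
  have h2 : chartAt E p (c 0) = chartAt E p p := by rw [h.1]
  rw [← h2] at h1
  have h3 := HasFDerivAt.comp_hasDerivAt (0 : ℝ) h1 h.2.2
  refine h3.congr_of_eventuallyEq ?_
  filter_upwards [h.eventually_chart] with s hs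
  simp only [Function.comp_apply, hs]

lemma HasVelocity.comp₂ {c : ℝ → M} {p : M} {v : E} (h : HasVelocity c p v)
    {c' : ℝ → N} {p' : N} {v' : E'} (h' : HasVelocity c' p' v') {f : M × N → Q}
    (hf : MDifferentiableAt (𝓘(ℂ, E).prod 𝓘(ℂ, E')) 𝓘(ℂ, E'') f (p, p')) :
    HasVelocity (fun s => f (c s, c' s)) (f (p, p'))
      (tmap₂ E E' E'' f (p, p') (v, v')) := by
  refine ⟨by simp only [h.1, h'.1], ContinuousAt.comp (f := fun s => (c s, c' s))
    (by rw [h.1, h'.1]; exact hf.continuousAt) (h.2.1.prodMk h'.2.1), ?_⟩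
  have h1 := (hasFDerivAt_of_mdifferentiableAt_prod hf).restrictScalars ℝ
  have h2 : (chartAt E p p, chartAt E' p' p') = (chartAt E p (c 0), chartAt E' p' (c' 0)) := by
    rw [h.1, h'.1]
  change HasFDerivAt _ _ (chartAt E p p, chartAt E' p' p') at h1
  rw [h2] at h1
  have h3 := HasFDerivAt.comp_hasDerivAt (0 : ℝ) h1 (h.2.2.prodMk h'.2.2)
  refine h3.congr_of_eventuallyEq ?_
  filter_upwards [h.eventually_chart, h'.eventually_chart] with s hs hs'
  simp only [Function.comp_apply, hs, hs']

/-- A straight line in the chart. It allows identities between differentials to be proved by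
comparing velocities of curves. -/
lemma exists_hasVelocity (p : M) (v : E) : ∃ c : ℝ → M, HasVelocity c p v := by
  have h1 : HasDerivAt (fun s : ℝ => chartAt E p p + s • v) v 0 := by
    simpa using ((hasDerivAt_id (0 : ℝ)).smul_const v).const_add (chartAt E p p)
  have h0 : chartAt E p p + (0 : ℝ) • v = chartAt E p p := by simp
  have hm : chartAt E p p ∈ (chartAt E p).target :=
    (chartAt E p).map_source (mem_chart_source E p)
  refine ⟨fun s => (chartAt E p).symm (chartAt E p p + s • v), ?_, ?_, ?_⟩
  · simp only [h0]
    exact (chartAt E p).left_inv (mem_chart_source E p)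
  · refine ContinuousAt.comp ?_ h1.continuousAt
    rw [h0]
    exact (chartAt E p).symm.continuousAt hm
  · refine h1.congr_of_eventuallyEq ?_
    have h2 := h1.continuousAt.tendsto
    rw [h0] at h2
    filter_upwards [h2 ((chartAt E p).open_target.mem_nhds hm)] with s hs
    exact (chartAt E p).right_inv hs

lemma HasVelocity.comp_real {c : ℝ → M} {p : M} {v : E} (h : HasVelocity c p v) {u : M → ℝ}
    (hu : MDifferentiableAt 𝓘(ℝ, E) 𝓘(ℝ, ℝ) u p) :
    HasDerivAt (fun s => u (c s)) (dirDeriv u p v) 0 := by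
  have h1 := hasFDerivAt_of_mdifferentiableAt_real hu
  rw [show chartAt E p p = chartAt E p (c 0) by rw [h.1]] at h1
  refine (HasFDerivAt.comp_hasDerivAt (0 : ℝ) h1 h.2.2).congr_of_eventuallyEq ?_
  filter_upwards [h.eventually_chart] with s hs
  simp only [Function.comp_apply, hs]

lemma mdifferentiableAt_real_iff {u : M → ℝ} {p : M} :
    MDifferentiableAt 𝓘(ℝ, E) 𝓘(ℝ, ℝ) u p ↔ ContinuousAt u p ∧
      DifferentiableAt ℝ (fun z => u ((chartAt E p).symm z)) (chartAt E p p) := by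
  rw [mdifferentiableAt_iff, ← differentiableWithinAt_univ]
  simp only [writtenInExtChartAt, extChartAt, Function.comp_def, chartAt_self_eq]
  simp

lemma dirDeriv_eq {u : M → ℝ} {p : M} (hu : MDifferentiableAt 𝓘(ℝ, E) 𝓘(ℝ, ℝ) u p) (v : E) :
    dirDeriv u p v = fderiv ℝ (fun z => u ((chartAt E p).symm z)) (chartAt E p p) v := by
  have h1 := hasFDerivAt_of_mdifferentiableAt_real hu
  rw [h1.fderiv]
  rfl

end Velocity

/-! ### Mixed second derivatives of local group laws and local actions -/

section LocalGroupCalculus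

variable {E : Type*} [NormedAddCommGroup E] [NormedSpace ℂ E]
  {F : Type*} [NormedAddCommGroup F] [NormedSpace ℂ F]
  {V : Type*} [NormedAddCommGroup V] [NormedSpace ℂ V]

lemma hasFDerivAt_fderiv_apply {f : E → V} {x : E} (hf : ContDiffAt ℂ 2 f x) (v : E) :
    HasFDerivAt (fun y => fderiv ℂ f y v) ((fderiv ℂ (fderiv ℂ f) x).flip v) x :=
  ((ContinuousLinearMap.apply ℂ V v).hasFDerivAt.comp x
    (((hf.fderiv_right (m := 1) le_rfl).differentiableAt one_ne_zero).hasFDerivAt) :)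

lemma symm_fderiv_fderiv {f : E → V} {x : E} (hf : ContDiffAt ℂ 2 f x) (v w : E) :
    fderiv ℂ (fderiv ℂ f) x v w = fderiv ℂ (fderiv ℂ f) x w v :=
  hf.isSymmSndFDerivAt (by simp) v w

lemma hasFDerivAt_partial_left {f : E × F → V} {f' : E × F →L[ℂ] V} {a : E} {b : F}
    (h : HasFDerivAt f f' (a, b)) :
    HasFDerivAt (fun x => f (x, b)) (f' ∘L ContinuousLinearMap.inl ℂ E F) a :=
  HasFDerivAt.comp (f := fun x => (x, b)) a h (hasFDerivAt_prodMk_left a b)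

lemma hasFDerivAt_partial_right {f : E × F → V} {f' : E × F →L[ℂ] V} {a : E} {b : F}
    (h : HasFDerivAt f f' (a, b)) :
    HasFDerivAt (fun y => f (a, y)) (f' ∘L ContinuousLinearMap.inr ℂ E F) b :=
  HasFDerivAt.comp (f := fun y => (a, y)) b h (hasFDerivAt_prodMk_right a b)

lemma eventually_differentiableAt {f : E → V} {x : E} (hf : ContDiffAt ℂ 2 f x) :
    ∀ᶠ y in 𝓝 x, DifferentiableAt ℂ f y := by
  filter_upwards [hf.eventually (by simp)] with y hy
  exact hy.differentiableAt two_ne_zero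

/-- In terms of the mixed second derivatives of the group law, infinitesimal generators of an
action form an antihomomorphism of Lie algebras. -/
lemma fderiv_generator_commutator {μ : E × E → E} {A : E × F → F} {e : E} {z : F}
    (hμ : ContDiffAt ℂ 2 μ (e, e)) (hA : ContDiffAt ℂ 2 A (e, z))
    (hμe : ∀ᶠ a in 𝓝 e, μ (a, e) = a) (heμ : ∀ᶠ a in 𝓝 e, μ (e, a) = a)
    (hAe : A (e, z) = z)
    (hass : ∀ᶠ x in 𝓝 ((e, e) : E × E), A (μ x, z) = A (x.1, A (x.2, z))) (X Y : E) :
    fderiv ℂ (fun y => fderiv ℂ A (e, y) (X, 0)) z (fderiv ℂ A (e, z) (Y, 0)) -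
      fderiv ℂ (fun y => fderiv ℂ A (e, y) (Y, 0)) z (fderiv ℂ A (e, z) (X, 0)) =
    fderiv ℂ A (e, z) (fderiv ℂ (fderiv ℂ μ) (e, e) (X, 0) (0, Y) -
      fderiv ℂ (fderiv ℂ μ) (e, e) (Y, 0) (0, X), 0) := by
  have hgen : ∀ W : E, HasFDerivAt (fun y => fderiv ℂ A (e, y) (W, 0))
      ((fderiv ℂ (fderiv ℂ A) (e, z)).flip (W, 0) ∘L ContinuousLinearMap.inr ℂ E F) z := fun W =>
    hasFDerivAt_partial_right (hasFDerivAt_fderiv_apply hA ((W, 0) : E × F))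
  have hμd := eventually_differentiableAt hμ
  have hAd := eventually_differentiableAt hA
  have hμW : ∀ W, fderiv ℂ μ (e, e) (0, W) = W := by
    intro W
    have d : HasFDerivAt (fun b => μ (e, b)) _ e :=
      hasFDerivAt_partial_right hμd.self_of_nhds.hasFDerivAt
    have := congrArg (fun L => L W) (d.unique ((hasFDerivAt_id e).congr_of_eventuallyEq heμ))
    simpa using this
  -- Differentiate the action law `A (μ (a, b), z) = A (a, A (b, z))` in `b` at `e` along `W`, and
  -- the result in `a` at `e` along `U`.
  have key : ∀ U W : E, fderiv ℂ (fderiv ℂ A) (e, z) (U, 0) (W, 0) +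
      fderiv ℂ A (e, z) (fderiv ℂ (fderiv ℂ μ) (e, e) (U, 0) (0, W), 0) =
      fderiv ℂ (fderiv ℂ A) (e, z) (U, 0) (0, fderiv ℂ A (e, z) (W, 0)) := by
    intro U W
    have h1 : ∀ᶠ a in 𝓝 e, fderiv ℂ A (a, z) (fderiv ℂ μ (a, e) (0, W), 0) =
        fderiv ℂ A (a, z) (0, fderiv ℂ A (e, z) (W, 0)) := by
      have t1 : Filter.Tendsto (fun a : E => (a, e)) (𝓝 e) (𝓝 (e, e)) :=
        (Continuous.prodMk_left e).tendsto e
      have t2 : Filter.Tendsto (fun a : E => (a, z)) (𝓝 e) (𝓝 (e, z)) :=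
        (Continuous.prodMk_left z).tendsto e
      filter_upwards [t1.eventually hμd, t2.eventually hAd, hμe,
        t1.eventually hass.eventually_nhds] with a ha1 ha2 ha3 ha4
      have d1 : HasFDerivAt (fun b => A (μ (a, b), z)) _ e :=
        (ha3.symm ▸ ha2.hasFDerivAt : HasFDerivAt A (fderiv ℂ A (a, z)) (μ (a, e), z)).comp e
          ((hasFDerivAt_partial_right ha1.hasFDerivAt).prodMk (hasFDerivAt_const z e))
      have d2 : HasFDerivAt (fun b => A (a, A (b, z))) _ e :=
        (hAe.symm ▸ ha2.hasFDerivAt : HasFDerivAt A (fderiv ℂ A (a, z)) (a, A (e, z))).comp e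
          ((hasFDerivAt_const a e).prodMk
            (hasFDerivAt_partial_left hAd.self_of_nhds.hasFDerivAt))
      have h3 : (fun b => A (μ (a, b), z)) =ᶠ[𝓝 e] fun b => A (a, A (b, z)) :=
        ((Continuous.prodMk_right a).tendsto e).eventually ha4
      have := congrArg (fun L => L W) (d1.unique (d2.congr_of_eventuallyEq h3))
      simpa using this
    have hAa : HasFDerivAt (fun a : E => fderiv ℂ A (a, z))
        (fderiv ℂ (fderiv ℂ A) (e, z) ∘L ContinuousLinearMap.inl ℂ E F) e :=
      hasFDerivAt_partial_left
        ((hA.fderiv_right (m := 1) le_rfl).differentiableAt one_ne_zero).hasFDerivAt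
    have hμa : HasFDerivAt (fun a : E => fderiv ℂ μ (a, e) (0, W))
        ((fderiv ℂ (fderiv ℂ μ) (e, e)).flip (0, W) ∘L ContinuousLinearMap.inl ℂ E E) e :=
      hasFDerivAt_partial_left (hasFDerivAt_fderiv_apply hμ ((0, W) : E × E))
    have l := hAa.clm_apply (hμa.prodMk (hasFDerivAt_const (0 : F) e))
    have r := hAa.clm_apply (hasFDerivAt_const ((0, fderiv ℂ A (e, z) (W, 0)) : E × F) e)
    have := congrArg (fun L => L U) (l.unique (r.congr_of_eventuallyEq h1))
    simp [hμW] at this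
    rw [← this]
    abel
  rw [(hgen X).fderiv, (hgen Y).fderiv]
  have kX := key X Y
  have kY := key Y X
  have sA := symm_fderiv_fderiv hA
  simp only [ContinuousLinearMap.comp_apply, ContinuousLinearMap.flip_apply,
    ContinuousLinearMap.inr_apply]
  rw [sA (0, _) (X, 0), sA (0, _) (Y, 0), ← kX, ← kY, sA (Y, 0) (X, 0)]
  rw [show ((fderiv ℂ (fderiv ℂ μ) (e, e) (X, 0) (0, Y) -
      fderiv ℂ (fderiv ℂ μ) (e, e) (Y, 0) (0, X), 0) : E × F) =
      (fderiv ℂ (fderiv ℂ μ) (e, e) (X, 0) (0, Y), 0) -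
      (fderiv ℂ (fderiv ℂ μ) (e, e) (Y, 0) (0, X), 0) by simp, map_sub]
  abel

/-- The derivative of the adjoint representation in terms of the group law. -/
lemma hasFDerivAt_adjoint {μ c : E × E → E} {e : E}
    (hμ : ContDiffAt ℂ 2 μ (e, e)) (hc : ContDiffAt ℂ 2 c (e, e))
    (hμe : ∀ᶠ a in 𝓝 e, μ (a, e) = a)
    (hce : ∀ᶠ a in 𝓝 e, c (a, e) = e) (hec : ∀ᶠ a in 𝓝 e, c (e, a) = a)
    (hconj : ∀ᶠ x in 𝓝 ((e, e) : E × E), μ (c x, x.1) = μ x) (X Y : E) :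
    fderiv ℂ (fun a => fderiv ℂ c (a, e) (0, Y)) e X =
      fderiv ℂ (fderiv ℂ μ) (e, e) (X, 0) (0, Y) - fderiv ℂ (fderiv ℂ μ) (e, e) (Y, 0) (0, X) := by
  have hμd := eventually_differentiableAt hμ
  have hcd := eventually_differentiableAt hc
  have t1 : Filter.Tendsto (fun a : E => (a, e)) (𝓝 e) (𝓝 (e, e)) :=
    (Continuous.prodMk_left e).tendsto e
  have t2 : Filter.Tendsto (fun a : E => (e, a)) (𝓝 e) (𝓝 (e, e)) :=
    (Continuous.prodMk_right e).tendsto e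
  -- The relation `(a b a⁻¹) a = a b`, differentiated in `b` at the identity; differentiating it
  -- once more in `a` gives the claim.
  have h1 : ∀ᶠ a in 𝓝 e, fderiv ℂ μ (e, a) (fderiv ℂ c (a, e) (0, Y), 0) =
      fderiv ℂ μ (a, e) (0, Y) := by
    filter_upwards [t1.eventually hμd, t2.eventually hμd, t1.eventually hcd, hce,
        t1.eventually hconj.eventually_nhds] with a ha1 ha2 ha3 ha4 ha5
    have d1 : HasFDerivAt (fun b => μ (c (a, b), a)) _ e :=
      (ha4.symm ▸ ha2.hasFDerivAt : HasFDerivAt μ (fderiv ℂ μ (e, a)) (c (a, e), a)).comp e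
        ((hasFDerivAt_partial_right ha3.hasFDerivAt).prodMk (hasFDerivAt_const a e))
    have d2 : HasFDerivAt (fun b => μ (a, b)) _ e :=
      hasFDerivAt_partial_right ha1.hasFDerivAt
    have h3 : (fun b => μ (c (a, b), a)) =ᶠ[𝓝 e] fun b => μ (a, b) :=
      ((Continuous.prodMk_right a).tendsto e).eventually ha5
    have := congrArg (fun L => L Y) (d1.unique (d2.congr_of_eventuallyEq h3))
    simpa using this
  have hl : HasFDerivAt (fun a : E => fderiv ℂ μ (e, a))
      (fderiv ℂ (fderiv ℂ μ) (e, e) ∘L ContinuousLinearMap.inr ℂ E E) e :=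
    hasFDerivAt_partial_right
      ((hμ.fderiv_right (m := 1) le_rfl).differentiableAt one_ne_zero).hasFDerivAt
  have hr : HasFDerivAt (fun a : E => fderiv ℂ μ (a, e) (0, Y))
      ((fderiv ℂ (fderiv ℂ μ) (e, e)).flip (0, Y) ∘L ContinuousLinearMap.inl ℂ E E) e :=
    hasFDerivAt_partial_left (hasFDerivAt_fderiv_apply hμ ((0, Y) : E × E))
  have hca : HasFDerivAt (fun a : E => fderiv ℂ c (a, e) (0, Y))
      ((fderiv ℂ (fderiv ℂ c) (e, e)).flip (0, Y) ∘L ContinuousLinearMap.inl ℂ E E) e :=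
    hasFDerivAt_partial_left (hasFDerivAt_fderiv_apply hc ((0, Y) : E × E))
  have hcY : fderiv ℂ c (e, e) (0, Y) = Y := by
    have d : HasFDerivAt (fun b => c (e, b)) _ e :=
      hasFDerivAt_partial_right hcd.self_of_nhds.hasFDerivAt
    have := congrArg (fun L => L Y) (d.unique ((hasFDerivAt_id e).congr_of_eventuallyEq hec))
    simpa using this
  have hμV : ∀ V, fderiv ℂ μ (e, e) (V, 0) = V := by
    intro V
    have d : HasFDerivAt (fun b => μ (b, e)) _ e :=
      hasFDerivAt_partial_left hμd.self_of_nhds.hasFDerivAt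
    have := congrArg (fun L => L V) (d.unique ((hasFDerivAt_id e).congr_of_eventuallyEq hμe))
    simpa using this
  have l := hl.clm_apply (hca.prodMk (hasFDerivAt_const (0 : E) e))
  have := congrArg (fun L => L X) (l.unique (hr.congr_of_eventuallyEq h1))
  rw [hca.fderiv]
  simp [hcY, hμV] at this
  rw [symm_fderiv_fderiv hμ (Y, 0) (0, X)]
  simp
  rw [← this]
  abel

end LocalGroupCalculus

/-! ### Complex Lie groups in the chart at the identity -/

section ChartAtOne

variable {E : Type*} [NormedAddCommGroup E] [NormedSpace ℂ E]
  {Gc : Type*} [TopologicalSpace Gc] [ChartedSpace E Gc] [Group Gc] [LieGroup 𝓘(ℂ, E) ω Gc]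

variable (E Gc) in
/-- The coordinates of the identity in the preferred chart. -/
def coordOne : E := chartAt E (1 : Gc) 1

variable (E Gc) in
/-- The group law in the preferred chart at the identity. -/
def localMul (x : E × E) : E :=
  chartAt E (1 : Gc) ((chartAt E (1 : Gc)).symm x.1 * (chartAt E (1 : Gc)).symm x.2)

variable (E Gc) in
/-- Conjugation in the preferred chart at the identity. -/
def localConj (x : E × E) : E :=
  chartAt E (1 : Gc) ((chartAt E (1 : Gc)).symm x.1 * (chartAt E (1 : Gc)).symm x.2 *
    ((chartAt E (1 : Gc)).symm x.1)⁻¹)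

lemma contMDiff_mul_pair : ContMDiff (𝓘(ℂ, E).prod 𝓘(ℂ, E)) 𝓘(ℂ, E) ω
    (fun x : Gc × Gc => x.1 * x.2) := contMDiff_mul 𝓘(ℂ, E) ω

lemma contMDiff_conj_pair : ContMDiff (𝓘(ℂ, E).prod 𝓘(ℂ, E)) 𝓘(ℂ, E) ω
    (fun x : Gc × Gc => x.1 * x.2 * x.1⁻¹) :=
  (contMDiff_fst.mul contMDiff_snd).mul contMDiff_fst.inv

lemma contDiffAt_localMul :
    ContDiffAt ℂ ω (localMul E Gc) (coordOne E Gc, coordOne E Gc) := by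
  have := contDiffAt_of_contMDiffAt_prod
    ((contMDiff_mul_pair (E := E) (Gc := Gc)).contMDiffAt (x := (1, 1)))
  simpa only [mul_one] using! this

lemma contDiffAt_localConj :
    ContDiffAt ℂ ω (localConj E Gc) (coordOne E Gc, coordOne E Gc) := by
  have := contDiffAt_of_contMDiffAt_prod
    ((contMDiff_conj_pair (E := E) (Gc := Gc)).contMDiffAt (x := (1, 1)))
  simpa only [mul_one, inv_one] using! this

lemma coordOne_mem : coordOne E Gc ∈ (chartAt E (1 : Gc)).target :=
  (chartAt E (1 : Gc)).map_source (mem_chart_source E 1)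

lemma chart_symm_coordOne : (chartAt E (1 : Gc)).symm (coordOne E Gc) = 1 :=
  (chartAt E (1 : Gc)).left_inv (mem_chart_source E 1)

lemma tendsto_chart_symm_one :
    Filter.Tendsto (chartAt E (1 : Gc)).symm (𝓝 (coordOne E Gc)) (𝓝 1) := by
  have := ((chartAt E (1 : Gc)).symm.continuousAt (x := coordOne E Gc) coordOne_mem).tendsto
  rwa [chart_symm_coordOne] at this

lemma eventually_mem_target : ∀ᶠ a in 𝓝 (coordOne E Gc), a ∈ (chartAt E (1 : Gc)).target :=
  (chartAt E (1 : Gc)).open_target.mem_nhds coordOne_mem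

lemma localMul_coordOne_right : ∀ᶠ a in 𝓝 (coordOne E Gc),
    localMul E Gc (a, coordOne E Gc) = a := by
  filter_upwards [eventually_mem_target (E := E) (Gc := Gc)] with a ha
  simp only [localMul, chart_symm_coordOne, mul_one]
  exact (chartAt E (1 : Gc)).right_inv ha

lemma localMul_coordOne_left : ∀ᶠ a in 𝓝 (coordOne E Gc),
    localMul E Gc (coordOne E Gc, a) = a := by
  filter_upwards [eventually_mem_target (E := E) (Gc := Gc)] with a ha
  simp only [localMul, chart_symm_coordOne, one_mul]
  exact (chartAt E (1 : Gc)).right_inv ha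

lemma localConj_coordOne_left : ∀ᶠ a in 𝓝 (coordOne E Gc),
    localConj E Gc (coordOne E Gc, a) = a := by
  filter_upwards [eventually_mem_target (E := E) (Gc := Gc)] with a ha
  simp only [localConj, chart_symm_coordOne, one_mul, inv_one, mul_one]
  exact (chartAt E (1 : Gc)).right_inv ha

lemma localConj_coordOne_right (a : E) :
    localConj E Gc (a, coordOne E Gc) = coordOne E Gc := by
  simp only [localConj, chart_symm_coordOne, mul_one, mul_inv_cancel]
  rfl

lemma tendsto_chart_symm_prod :
    Filter.Tendsto (fun x : E × E => ((chartAt E (1 : Gc)).symm x.1, (chartAt E (1 : Gc)).symm x.2))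
      (𝓝 (coordOne E Gc, coordOne E Gc)) (𝓝 ((1 : Gc), (1 : Gc))) := by
  rw [nhds_prod_eq, nhds_prod_eq]
  exact tendsto_chart_symm_one.prodMap tendsto_chart_symm_one

variable (E) in
lemma eventually_mem_source_of_continuous {Y : Type*} [TopologicalSpace Y] {f : Y → Gc} {y : Y}
    (hf : ContinuousAt f y) (h1 : f y = 1) : ∀ᶠ x in 𝓝 y, f x ∈ (chartAt E (1 : Gc)).source :=
  hf.eventually_mem ((chartAt E (1 : Gc)).open_source.mem_nhds
    (by rw [h1]; exact mem_chart_source E (1 : Gc)))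

lemma chart_symm_localMul : ∀ᶠ x in 𝓝 (coordOne E Gc, coordOne E Gc),
    (chartAt E (1 : Gc)).symm (localMul E Gc x) =
      (chartAt E (1 : Gc)).symm x.1 * (chartAt E (1 : Gc)).symm x.2 := by
  have := (tendsto_chart_symm_prod (E := E) (Gc := Gc)).eventually
    (eventually_mem_source_of_continuous E (y := ((1 : Gc), (1 : Gc)))
      (contMDiff_mul_pair (E := E) (Gc := Gc)).continuous.continuousAt (mul_one (1 : Gc)))
  filter_upwards [this] with x hx
  exact (chartAt E (1 : Gc)).left_inv hx

lemma chart_symm_localConj : ∀ᶠ x in 𝓝 (coordOne E Gc, coordOne E Gc),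
    (chartAt E (1 : Gc)).symm (localConj E Gc x) =
      (chartAt E (1 : Gc)).symm x.1 * (chartAt E (1 : Gc)).symm x.2 *
        ((chartAt E (1 : Gc)).symm x.1)⁻¹ := by
  have := (tendsto_chart_symm_prod (E := E) (Gc := Gc)).eventually
    (eventually_mem_source_of_continuous E (y := ((1 : Gc), (1 : Gc)))
      (contMDiff_conj_pair (E := E) (Gc := Gc)).continuous.continuousAt (by simp))
  filter_upwards [this] with x hx
  exact (chartAt E (1 : Gc)).left_inv hx

lemma localMul_localConj : ∀ᶠ x in 𝓝 (coordOne E Gc, coordOne E Gc),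
    localMul E Gc (localConj E Gc x, x.1) = localMul E Gc x := by
  filter_upwards [chart_symm_localConj (E := E) (Gc := Gc)] with x hx
  simp only [localMul, hx]
  rw [inv_mul_cancel_right]

variable (E Gc) in
/-- The second derivative of the group law. -/
def mulHess (X Y : E) : E :=
  fderiv ℂ (fderiv ℂ (localMul E Gc)) (coordOne E Gc, coordOne E Gc) (X, 0) (0, Y)

variable [CompleteSpace E]

/-- The left-invariant field is the velocity of `g c (s)` for a curve `c` through `1`, so in the
chart it is a partial derivative of the local group law. -/
lemma mulInvariantVectorField_eq {g : Gc} (hg : g ∈ (chartAt E (1 : Gc)).source)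
    (hd : DifferentiableAt ℂ (localMul E Gc) (chartAt E (1 : Gc) g, coordOne E Gc)) (Y : E) :
    (mfderiv 𝓘(ℂ, E) 𝓘(ℂ, E) (chartAt E (1 : Gc)) g : E →L[ℂ] E)
      (mulInvariantVectorField (I := 𝓘(ℂ, E)) (Y : GroupLieAlgebra 𝓘(ℂ, E) Gc) g : E) =
    fderiv ℂ (localMul E Gc) (chartAt E (1 : Gc) g, coordOne E Gc) (0, Y) := by
  obtain ⟨c, hc⟩ := exists_hasVelocity (1 : Gc) Y
  have h1 : MDifferentiableAt 𝓘(ℂ, E) 𝓘(ℂ, E) (fun h : Gc => g * h) 1 :=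
    (contMDiff_mul_left (I := 𝓘(ℂ, E)) (n := ω)).mdifferentiableAt (by simp)
  have h2 : MDifferentiableAt 𝓘(ℂ, E) 𝓘(ℂ, E) (chartAt E (1 : Gc)) (g * 1) := by
    rw [mul_one]
    exact (mdifferentiable_chart (I := 𝓘(ℂ, E)) (1 : Gc)).mdifferentiableAt hg
  have v1 := ((hc.comp h1).comp h2).2.2
  have h3 := (hasFDerivAt_partial_right hd.hasFDerivAt).restrictScalars ℝ
  rw [show coordOne E Gc = chartAt E (1 : Gc) (c 0) by rw [hc.1]; rfl] at h3
  have v2 := h3.comp_hasDerivAt (0 : ℝ) hc.2.2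
  have v3 := v1.unique (v2.congr_of_eventuallyEq (by
    filter_upwards [hc.eventually_chart] with s hs
    simp only [chartAt_self_eq, OpenPartialHomeomorph.refl_apply, Function.comp_apply, localMul, hs]
    rw [(chartAt E (1 : Gc)).left_inv hg]; rfl))
  rw [hc.1] at v3
  simp only [mul_one] at v3
  exact v3

/-- The bracket of the Lie algebra in terms of the group law. -/
lemma lie_eq_mulHess (X Y : GroupLieAlgebra 𝓘(ℂ, E) Gc) :
    (⁅X, Y⁆ : GroupLieAlgebra 𝓘(ℂ, E) Gc) = (mulHess E Gc X Y - mulHess E Gc Y X : E) := by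
  have hd := eventually_differentiableAt
    (contDiffAt_localMul (E := E) (Gc := Gc) |>.of_le (m := 2) le_top)
  have t1 : Filter.Tendsto (fun a : E => (a, coordOne E Gc)) (𝓝 (coordOne E Gc))
      (𝓝 (coordOne E Gc, coordOne E Gc)) := (Continuous.prodMk_left _).tendsto _
  -- Near the identity, pulling the invariant fields back to the chart gives partial derivatives of
  -- the local group law, so the bracket of fields can be computed in the model space.
  have field : ∀ Y : GroupLieAlgebra 𝓘(ℂ, E) Gc,
      (VectorField.mpullbackWithin 𝓘(ℂ, E) 𝓘(ℂ, E) (extChartAt 𝓘(ℂ, E) (1 : Gc)).symm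
        (mulInvariantVectorField Y) (Set.range 𝓘(ℂ, E)) : E → E) =ᶠ[𝓝 (coordOne E Gc)]
      fun a => fderiv ℂ (localMul E Gc) (a, coordOne E Gc) (0, Y) := by
    intro Y
    filter_upwards [eventually_mem_target (E := E) (Gc := Gc), t1.eventually hd] with a ha hda
    have hs : (chartAt E (1 : Gc)).symm a ∈ (chartAt E (1 : Gc)).source :=
      (chartAt E (1 : Gc)).map_target ha
    have hr := (chartAt E (1 : Gc)).right_inv ha
    have h1 := mulInvariantVectorField_eq hs (by rw [hr]; exact hda) Y
    rw [hr] at h1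
    rw [← h1]
    have ha' : a ∈ (extChartAt 𝓘(ℂ, E) (1 : Gc)).target := by simpa using! ha
    have i1 := mfderiv_extChartAt_comp_mfderivWithin_extChartAt_symm ha'
    have i2 := mfderivWithin_extChartAt_symm_comp_mfderiv_extChartAt (I := 𝓘(ℂ, E)) ha'
    have i3 := ContinuousLinearMap.inverse_eq i2 i1
    exact congrArg (fun L : E →L[ℂ] E => L
      (mulInvariantVectorField Y ((chartAt E (1 : Gc)).symm a) : E)) i3
  have hder : ∀ X Y : E, fderiv ℂ (fun a => fderiv ℂ (localMul E Gc) (a, coordOne E Gc) (0, Y))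
      (coordOne E Gc) X = mulHess E Gc X Y := by
    intro X Y
    rw [(hasFDerivAt_partial_left (hasFDerivAt_fderiv_apply
      (contDiffAt_localMul (E := E) (Gc := Gc) |>.of_le (m := 2) le_top) ((0, Y) : E × E))).fderiv]
    rfl
  have hval : ∀ Y : E, fderiv ℂ (localMul E Gc) (coordOne E Gc, coordOne E Gc) (0, Y) = Y := by
    intro W
    have d := hasFDerivAt_partial_right (t1.eventually hd).self_of_nhds.hasFDerivAt
    have := congrArg (fun L => L W)
      (d.unique ((hasFDerivAt_id _).congr_of_eventuallyEq localMul_coordOne_left))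
    simpa using this
  let v : GroupLieAlgebra 𝓘(ℂ, E) Gc → E → E := fun Y =>
    VectorField.mpullbackWithin 𝓘(ℂ, E) 𝓘(ℂ, E) (extChartAt 𝓘(ℂ, E) (1 : Gc)).symm
      (mulInvariantVectorField Y) (Set.range 𝓘(ℂ, E))
  have hS : (extChartAt 𝓘(ℂ, E) (1 : Gc)).symm ⁻¹' Set.univ ∩ Set.range 𝓘(ℂ, E) = Set.univ := by
    simp
  have hb : VectorField.lieBracketWithin ℂ (v X) (v Y)
      ((extChartAt 𝓘(ℂ, E) (1 : Gc)).symm ⁻¹' Set.univ ∩ Set.range 𝓘(ℂ, E)) (coordOne E Gc) =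
      mulHess E Gc X Y - mulHess E Gc Y X := by
    rw [hS, VectorField.lieBracketWithin_univ,
      ((field X).lieBracket_vectorField_eq (𝕜 := ℂ) (field Y) :
        VectorField.lieBracket ℂ (v X) (v Y) (coordOne E Gc) = _), VectorField.lieBracket]
    exact congrArg₂ (fun a b : E => a - b) ((congrArg _ (hval X)).trans (hder X Y))
      ((congrArg _ (hval Y)).trans (hder Y X))
  have hinv : ∀ w : E, ((mfderiv 𝓘(ℂ, E) 𝓘(ℂ, E) (extChartAt 𝓘(ℂ, E) (1 : Gc)) 1).inverse :
      E →L[ℂ] E) w = w := by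
    intro w
    rw [mfderiv_extChartAt_self]
    exact congrArg (fun L : E →L[ℂ] E => L w) ContinuousLinearMap.inverse_id
  exact (congrArg ((mfderiv 𝓘(ℂ, E) 𝓘(ℂ, E) (extChartAt 𝓘(ℂ, E) (1 : Gc)) 1).inverse :
      E →L[ℂ] E) hb).trans (hinv _)

/-- The derivative of the adjoint representation is the bracket. -/
lemma fderiv_localConj (X Y : GroupLieAlgebra 𝓘(ℂ, E) Gc) :
    fderiv ℂ (fun a => fderiv ℂ (localConj E Gc) (a, coordOne E Gc) ((0, Y) : E × E))
      (coordOne E Gc) (X : E) = (⁅X, Y⁆ : GroupLieAlgebra 𝓘(ℂ, E) Gc) :=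
  (hasFDerivAt_adjoint (E := E) (contDiffAt_localMul.of_le le_top) (contDiffAt_localConj.of_le le_top)
    localMul_coordOne_right (.of_forall localConj_coordOne_right) localConj_coordOne_left
    localMul_localConj X Y).trans (lie_eq_mulHess X Y).symm

lemma tmap₂_mul (X Y : E) :
    tmap₂ E E E (fun x : Gc × Gc => x.1 * x.2) (1, 1) (X, Y) = X + Y := by
  have h := hasFDerivAt_of_mdifferentiableAt_prod
    ((contMDiff_mul_pair (E := E) (Gc := Gc)).mdifferentiableAt (x := (1, 1)) (by simp))
  set L := tmap₂ E E E (fun x : Gc × Gc => x.1 * x.2) (1, 1) with hL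
  simp only [mul_one] at h
  have h' : HasFDerivAt (localMul E Gc) L (coordOne E Gc, coordOne E Gc) := h
  have d1 := hasFDerivAt_partial_left h'
  have d2 := hasFDerivAt_partial_right h'
  have e1 := congrArg (fun L => L X)
      (d1.unique ((hasFDerivAt_id _).congr_of_eventuallyEq localMul_coordOne_right))
  have e2 := congrArg (fun L => L Y)
      (d2.unique ((hasFDerivAt_id _).congr_of_eventuallyEq localMul_coordOne_left))
  have e3 : L (X, Y) = L (X, 0) + L (0, Y) := by rw [← map_add]; simp
  rw [e3]
  exact congrArg₂ (· + ·) e1 e2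

lemma HasVelocity.mul {c c' : ℝ → Gc} {X Y : E} (h : HasVelocity c 1 X) (h' : HasVelocity c' 1 Y) :
    HasVelocity (fun s => c s * c' s) 1 (X + Y) := by
  have := h.comp₂ h' ((contMDiff_mul_pair (E := E) (Gc := Gc)).mdifferentiableAt
    (x := (1, 1)) (by simp))
  rw [tmap₂_mul] at this
  simpa using this

lemma HasVelocity.comp_mul {M : Type*} [TopologicalSpace M] [ChartedSpace E M] {c : ℝ → M} {p : M}
    {X : E} (h : HasVelocity c p X) (r : ℝ) : HasVelocity (fun s => c (r * s)) p (r • X) := by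
  refine ⟨by simp only [mul_zero, h.1], ContinuousAt.comp (f := fun s => r * s)
    (by rw [mul_zero]; exact h.2.1) (by fun_prop), ?_⟩
  have h1 : HasDerivAt (fun s : ℝ => r * s) r 0 := by simpa using (hasDerivAt_id (0 : ℝ)).const_mul r
  have h2 : HasDerivAt (fun s => chartAt E p (c s)) X (r * 0) := by rw [mul_zero]; exact h.2.2
  exact h2.scomp (0 : ℝ) h1

/-! ### One-parameter subgroups -/

/-- `γ` is the one-parameter subgroup with initial velocity `X`. -/
def IsOneParam (γ : ℝ → Gc) (X : E) : Prop :=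
  (∀ s t, γ (s + t) = γ s * γ t) ∧ HasVelocity γ 1 X

lemma map_zero_of_map_add {γ : ℝ → Gc} (h : ∀ s t, γ (s + t) = γ s * γ t) : γ 0 = 1 := by
  have := h 0 0
  rw [add_zero] at this
  exact left_eq_mul.1 this

lemma map_neg_of_map_add {γ : ℝ → Gc} (h : ∀ s t, γ (s + t) = γ s * γ t) (t : ℝ) :
    γ (-t) = (γ t)⁻¹ := by
  rw [eq_inv_iff_mul_eq_one, ← h, neg_add_cancel, map_zero_of_map_add h]

lemma map_natCast_mul_of_map_add {γ : ℝ → Gc} (h : ∀ s t, γ (s + t) = γ s * γ t) (n : ℕ) (t : ℝ) :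
    γ (n * t) = γ t ^ n := by
  induction n with
  | zero => simp [map_zero_of_map_add h]
  | succ n ih => rw [Nat.cast_succ, add_mul, one_mul, h, ih, pow_succ]

lemma IsOneParam.smul {γ : ℝ → Gc} {X : E} (h : IsOneParam γ X) (r : ℝ) :
    IsOneParam (fun s => γ (r * s)) (r • X) :=
  ⟨fun s t => by simp only [mul_add, h.1], h.2.comp_mul r⟩

/-- Near the identity, multiplication and conjugation are Lipschitz in the chart. -/
lemma exists_lipschitz_nhds_one : ∃ K : ℝ, 0 ≤ K ∧ ∃ N ∈ 𝓝 (1 : Gc), ∀ g ∈ N, ∀ h ∈ N,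
    g * h ∈ (chartAt E (1 : Gc)).source ∧ g * h * g⁻¹ ∈ (chartAt E (1 : Gc)).source ∧
    ‖chartAt E (1 : Gc) (g * h) - chartAt E (1 : Gc) g‖ ≤
      K * ‖chartAt E (1 : Gc) h - coordOne E Gc‖ ∧
    ‖chartAt E (1 : Gc) (g * h * g⁻¹) - coordOne E Gc‖ ≤
      K * ‖chartAt E (1 : Gc) h - coordOne E Gc‖ := by
  obtain ⟨K₁, t₁, ht₁, hK₁⟩ := ((contDiffAt_localMul (E := E) (Gc := Gc)).of_le
    (m := 1) le_top).exists_lipschitzOnWith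
  obtain ⟨K₂, t₂, ht₂, hK₂⟩ := ((contDiffAt_localConj (E := E) (Gc := Gc)).of_le
    (m := 1) le_top).exists_lipschitzOnWith
  have s₁ := eventually_mem_source_of_continuous E (y := ((1 : Gc), (1 : Gc)))
      (contMDiff_mul_pair (E := E) (Gc := Gc)).continuous.continuousAt (mul_one (1 : Gc))
  have s₂ := eventually_mem_source_of_continuous E (y := ((1 : Gc), (1 : Gc)))
      (contMDiff_conj_pair (E := E) (Gc := Gc)).continuous.continuousAt (by simp)
  have hc : Filter.Tendsto (fun x : Gc × Gc => (chartAt E (1 : Gc) x.1, chartAt E (1 : Gc) x.2))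
      (𝓝 (1, 1)) (𝓝 (coordOne E Gc, coordOne E Gc)) := by
    rw [nhds_prod_eq, nhds_prod_eq]
    have := ((chartAt E (1 : Gc)).continuousAt (mem_chart_source E (1 : Gc))).tendsto
    exact this.prodMap this
  have hall := ((s₁.and s₂).and (hc.eventually (Filter.inter_mem ht₁ ht₂)))
  rw [nhds_prod_eq] at hall
  obtain ⟨N, hN, hall⟩ := Filter.eventually_prod_self_iff'.1 hall
  have hsrc : (chartAt E (1 : Gc)).source ∈ 𝓝 (1 : Gc) :=
    (chartAt E (1 : Gc)).open_source.mem_nhds (mem_chart_source E (1 : Gc))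
  refine ⟨max K₁ K₂, le_max_of_le_left K₁.2, N ∩ (chartAt E (1 : Gc)).source,
    Filter.inter_mem hN hsrc, fun g hg h hh => ?_⟩
  obtain ⟨⟨a₁, a₂⟩, a₃, a₄⟩ := hall g hg.1 h hh.1
  have h1 : (1 : Gc) ∈ N := mem_of_mem_nhds hN
  obtain ⟨-, b₃, b₄⟩ := hall g hg.1 1 h1
  have lg := (chartAt E (1 : Gc)).left_inv hg.2
  have lh := (chartAt E (1 : Gc)).left_inv hh.2
  have l1 := (chartAt E (1 : Gc)).left_inv (mem_chart_source E (1 : Gc))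
  have d : dist (chartAt E (1 : Gc) g, chartAt E (1 : Gc) h)
      (chartAt E (1 : Gc) g, chartAt E (1 : Gc) 1) = ‖chartAt E (1 : Gc) h - coordOne E Gc‖ := by
    rw [Prod.dist_eq, dist_self, dist_eq_norm]
    exact max_eq_right (norm_nonneg _)
  refine ⟨a₁, a₂, ?_, ?_⟩
  · have := hK₁.dist_le_mul _ a₃ _ b₃
    rw [d, dist_eq_norm] at this
    simp only [localMul, lg, lh, l1, mul_one] at this
    exact this.trans (mul_le_mul_of_nonneg_right (le_max_left _ _) (norm_nonneg _))
  · have := hK₂.dist_le_mul _ a₄ _ b₄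
    rw [d, dist_eq_norm] at this
    simp only [localConj, lg, lh, l1, mul_one, mul_inv_cancel] at this
    exact this.trans (mul_le_mul_of_nonneg_right (le_max_right _ _) (norm_nonneg _))

end ChartAtOne

/-! ### Closed subgroups and their Lie algebras -/

section ClosedSubgroup

variable {E : Type*} [NormedAddCommGroup E] [NormedSpace ℂ E]
  {Gc : Type*} [TopologicalSpace Gc] [ChartedSpace E Gc] [Group Gc] [LieGroup 𝓘(ℂ, E) ω Gc]
  [CompleteSpace E]

/-- If a curve in a closed subgroup has the same velocity at `1` as a one-parameter subgroup, then
the one-parameter subgroup is contained in the closed subgroup. -/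
lemma IsOneParam.mem_of_hasVelocity {γ c : ℝ → Gc} {X : E} (hγ : IsOneParam γ X)
    (hc : HasVelocity c 1 X) {S : Subgroup Gc} (hS : IsClosed (S : Set Gc))
    (hcS : ∀ᶠ s in 𝓝 0, c s ∈ S) (t : ℝ) : γ t ∈ S := by
  obtain ⟨K, hK0, N, hN, hKN⟩ := exists_lipschitz_nhds_one (E := E) (Gc := Gc)
  set ψ := chartAt E (1 : Gc) with hψ
  set z := coordOne E Gc with hz
  -- a neighbourhood in the chart that is contained in `N`
  obtain ⟨r, hr, hrN⟩ : ∃ r > 0, ∀ g ∈ ψ.source, ‖ψ g - z‖ < r → g ∈ N := by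
    have h1 := (tendsto_chart_symm_one (E := E) (Gc := Gc)).eventually hN
    obtain ⟨r, hr, h2⟩ := Metric.eventually_nhds_iff.1 h1
    refine ⟨r, hr, fun g hg hgr => ?_⟩
    have := h2 (y := ψ g) (by rwa [dist_eq_norm])
    rwa [ψ.left_inv hg] at this
  obtain ⟨T, hT, hTN⟩ : ∃ T > 0, ∀ s : ℝ, |s| ≤ T → γ s ∈ N := by
    obtain ⟨T, hT, h⟩ := Metric.eventually_nhds_iff.1 (hγ.2.tendsto.eventually hN)
    refine ⟨T / 2, by positivity, fun s hs => h ?_⟩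
    rw [Real.dist_eq, sub_zero]
    linarith
  -- The discrepancy of one step. Its velocity vanishes, so it is `o (s)` in the chart, and `n`
  -- steps of length `t / n` accumulate an error tending to zero: `c (t / n) ^ n → γ t`.
  set d : ℝ → Gc := fun s => c s * γ (-s) with hd
  have hdv : HasVelocity d 1 (0 : E) := by
    have h1 := (hγ.2.comp_mul (-1))
    have h2 := hc.mul h1
    simpa [hd] using h2
  have hdsrc : ∀ᶠ s in 𝓝 0, d s ∈ ψ.source ∧ d s ∈ N :=
    (hdv.tendsto.eventually (ψ.open_source.mem_nhds (mem_chart_source E (1 : Gc)))).and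
      (hdv.tendsto.eventually hN)
  have hsmall : ∀ s : ℝ, |s| ≤ T → γ s ∈ S := by
    intro t ht
    have htn : Filter.Tendsto (fun n : ℕ => t / n) Filter.atTop (𝓝 0) :=
      tendsto_const_div_atTop_nhds_zero_nat t
    -- the error of one step
    have herr : Filter.Tendsto (fun n : ℕ => (n : ℝ) * ‖ψ (d (t / n)) - z‖) Filter.atTop (𝓝 0) := by
      have hlit := hdv.2.2.hasFDerivAt.isLittleO
      have h1 : (fun s => ψ (d s) - z) =o[𝓝 0] fun s : ℝ => s := by
        have h0 : ψ (d 0) = z := by rw [hdv.1]; rfl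
        refine (hlit.congr (fun s => ?_) (fun s => ?_))
        · simp [← h0, hψ]
        · simp
      have h2 := h1.comp_tendsto htn
      rw [Asymptotics.isLittleO_iff] at h2
      rw [Metric.tendsto_nhds]
      intro ε hε
      have hc' : 0 < ε / (|t| + 1) := by positivity
      filter_upwards [h2 hc', Filter.eventually_gt_atTop 0] with n hn hn0
      have hn' : (0 : ℝ) < n := by exact_mod_cast hn0
      simp only [Function.comp_apply, norm_div, Real.norm_eq_abs, Nat.abs_cast] at hn
      rw [Real.dist_eq, sub_zero, abs_of_nonneg (by positivity)]
      calc (n : ℝ) * ‖ψ (d (t / n)) - z‖ ≤ n * (ε / (|t| + 1) * (|t| / n)) := by gcongr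
        _ = ε * (|t| / (|t| + 1)) := by field_simp
        _ < ε * 1 := by
          gcongr
          rw [div_lt_one (by positivity)]
          linarith
        _ = ε := mul_one ε
    have hstep : ∀ᶠ n : ℕ in Filter.atTop, c (t / n) ^ n * γ (-t) ∈ ψ.source ∧
        ‖ψ (c (t / n) ^ n * γ (-t)) - z‖ ≤ K * K * (n * ‖ψ (d (t / n)) - z‖) := by
      have e1 := (herr.const_mul (K * K + K)).eventually_lt_const (u := r) (by simpa using hr)
      filter_upwards [e1, htn.eventually hdsrc, Filter.eventually_gt_atTop 0] with n hn hdn hn0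
      have hn' : (1 : ℝ) ≤ n := by exact_mod_cast hn0
      set s := t / n with hs
      set δ := ‖ψ (d s) - z‖ with hδ
      have hδ0 : 0 ≤ δ := norm_nonneg _
      have hKδ : K * δ < r := by
        have : K * δ ≤ (K * K + K) * (n * δ) := by
          calc K * δ = K * (1 * δ) := by ring
            _ ≤ (K * K + K) * (n * δ) := by gcongr; nlinarith [mul_nonneg hK0 hK0]
        linarith
      have hind : ∀ k : ℕ, k ≤ n → c s ^ k * γ (-(k * s)) ∈ ψ.source ∧
          ‖ψ (c s ^ k * γ (-(k * s))) - z‖ ≤ k * (K * K * δ) := by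
        intro k
        induction k with
        | zero =>
          intro _
          simp only [pow_zero, CharP.cast_eq_zero, zero_mul, neg_zero, map_zero_of_map_add hγ.1,
            mul_one]
          refine ⟨mem_chart_source E (1 : Gc), ?_⟩
          rw [show ψ 1 = z from rfl]
          simp
        | succ k ih =>
          intro hk
          obtain ⟨i1, i2⟩ := ih (by omega)
          have hkn : (k : ℝ) ≤ n := by exact_mod_cast (by omega : k ≤ n)
          have hgN : γ (k * s) ∈ N := by
            apply hTN
            rw [abs_mul, Nat.abs_cast]
            calc (k : ℝ) * |s| ≤ n * |s| := by gcongr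
              _ = |t| := by
                rw [hs, abs_div, Nat.abs_cast]
                field_simp
              _ ≤ T := ht
          have heN : c s ^ k * γ (-(k * s)) ∈ N := by
            apply hrN _ i1
            calc _ ≤ (k : ℝ) * (K * K * δ) := i2
              _ ≤ n * (K * K * δ) := by gcongr
              _ ≤ (K * K + K) * (n * δ) := by
                have : 0 ≤ K * (n * δ) := by positivity
                nlinarith
              _ < r := hn
          obtain ⟨-, c1, -, c2⟩ := hKN _ hgN _ hdn.2
          have huN : γ (k * s) * d s * (γ (k * s))⁻¹ ∈ N := hrN _ c1 (c2.trans_lt hKδ)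
          obtain ⟨m1, -, m2, -⟩ := hKN _ heN _ huN
          -- Passing from `k` to `k + 1` multiplies the accumulated error by a conjugate of the
          -- one-step error, and both operations are Lipschitz near `1`.
          have heq : c s ^ k * γ (-(k * s)) * (γ (k * s) * d s * (γ (k * s))⁻¹) =
              c s ^ (k + 1) * γ (-((k + 1 : ℕ) * s)) := by
            have : (-(((k + 1 : ℕ) : ℝ) * s)) = -s + -(k * s) := by push_cast; ring
            rw [this, hγ.1, map_neg_of_map_add hγ.1 (k * s), hd, pow_succ]
            group
          rw [heq] at m1 m2
          refine ⟨m1, ?_⟩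
          calc _ ≤ ‖ψ (c s ^ (k + 1) * γ (-((k + 1 : ℕ) * s))) - ψ (c s ^ k * γ (-(k * s)))‖ +
                ‖ψ (c s ^ k * γ (-(k * s))) - z‖ := norm_sub_le_norm_sub_add_norm_sub _ _ _
            _ ≤ K * (K * δ) + k * (K * K * δ) := by
                refine add_le_add (m2.trans ?_) i2
                gcongr
            _ = _ := by push_cast; ring
      have := hind n le_rfl
      rw [show (n : ℝ) * s = t by rw [hs]; field_simp] at this
      refine ⟨this.1, this.2.trans_eq (by ring)⟩
    have hlim : Filter.Tendsto (fun n : ℕ => c (t / n) ^ n * γ (-t)) Filter.atTop (𝓝 1) := by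
      have h1 : Filter.Tendsto (fun n : ℕ => ψ (c (t / n) ^ n * γ (-t))) Filter.atTop (𝓝 z) := by
        rw [tendsto_iff_norm_sub_tendsto_zero]
        have h2 := herr.const_mul (K * K)
        rw [mul_zero] at h2
        exact tendsto_of_tendsto_of_tendsto_of_le_of_le' tendsto_const_nhds h2
          (.of_forall fun _ => norm_nonneg _) (hstep.mono fun n h => h.2)
      refine ((tendsto_chart_symm_one (E := E) (Gc := Gc)).comp h1).congr' ?_
      filter_upwards [hstep] with n hn
      exact ψ.left_inv hn.1
    have hlim2 : Filter.Tendsto (fun n : ℕ => c (t / n) ^ n) Filter.atTop (𝓝 (γ t)) := by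
      have hcont : Continuous fun g : Gc => g * γ t :=
        (contMDiff_mul_right (I := 𝓘(ℂ, E)) (n := ω)).continuous
      have h1 := (hcont.tendsto 1).comp hlim
      rw [one_mul] at h1
      refine h1.congr fun n => ?_
      simp [map_neg_of_map_add hγ.1]
    refine hS.mem_of_tendsto hlim2 ?_
    filter_upwards [htn.eventually hcS] with n hn
    exact S.pow_mem hn n
  -- A general time is reached as a power of a small one.
  obtain ⟨n, hn⟩ := exists_nat_gt (|t| / T)
  have hn0 : (0 : ℝ) < n := lt_of_le_of_lt (by positivity) hn
  have h1 : γ (t / n) ∈ S := by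
    apply hsmall
    rw [abs_div, Nat.abs_cast, div_le_iff₀ hn0]
    rw [div_lt_iff₀ hT] at hn
    linarith
  have h2 := map_natCast_mul_of_map_add hγ.1 n (t / n)
  rw [mul_div_cancel₀ _ hn0.ne'] at h2
  rw [h2]
  exact S.pow_mem h1 n

end ClosedSubgroup

/-! ### Existence of one-parameter subgroups -/

section Existence

variable {E : Type*} [NormedAddCommGroup E] [NormedSpace ℂ E]
  {Gc : Type*} [TopologicalSpace Gc] [ChartedSpace E Gc] [Group Gc]

lemma contMDiff_restrictScalars {E' : Type*} [NormedAddCommGroup E'] [NormedSpace ℂ E']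
    {M N : Type*} [TopologicalSpace M] [ChartedSpace E M] [TopologicalSpace N] [ChartedSpace E' N]
    {f : M → N} {n : WithTop ℕ∞} (h : ContMDiff 𝓘(ℂ, E) 𝓘(ℂ, E') n f) :
    ContMDiff 𝓘(ℝ, E) 𝓘(ℝ, E') n f := fun x => by
  have h1 := contMDiffAt_iff.1 (h x)
  exact contMDiffAt_iff.2 ⟨h1.1, (h1.2.restrict_scalars ℝ :)⟩

lemma contMDiff_prod_restrictScalars {E' E'' : Type*} [NormedAddCommGroup E'] [NormedSpace ℂ E']
    [NormedAddCommGroup E''] [NormedSpace ℂ E'']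
    {M N Q : Type*} [TopologicalSpace M] [ChartedSpace E M] [TopologicalSpace N] [ChartedSpace E' N]
    [TopologicalSpace Q] [ChartedSpace E'' Q]
    {f : M × N → Q} {n : WithTop ℕ∞} (h : ContMDiff (𝓘(ℂ, E).prod 𝓘(ℂ, E')) 𝓘(ℂ, E'') n f) :
    ContMDiff (𝓘(ℝ, E).prod 𝓘(ℝ, E')) 𝓘(ℝ, E'') n f := fun x => by
  have h1 := contMDiffAt_iff.1 (h x)
  exact contMDiffAt_iff.2 ⟨h1.1, (h1.2.restrict_scalars ℝ :)⟩

lemma isManifold_restrictScalars {M : Type*} [TopologicalSpace M] [ChartedSpace E M]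
    {n : WithTop ℕ∞} [IsManifold 𝓘(ℂ, E) n M] : IsManifold 𝓘(ℝ, E) n M := by
  refine isManifold_of_contDiffOn _ _ _ fun e e' he he' => ?_
  have h := (HasGroupoid.compatible (G := contDiffGroupoid n 𝓘(ℂ, E)) he he')
  exact ((mem_groupoid_of_pregroupoid.1 h).1.restrict_scalars ℝ :)

lemma lieGroup_restrictScalars [LieGroup 𝓘(ℂ, E) ω Gc] : LieGroup 𝓘(ℝ, E) ω Gc :=
  { isManifold_restrictScalars with
    contMDiff_mul := contMDiff_prod_restrictScalars (contMDiff_mul 𝓘(ℂ, E) ω)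
    contMDiff_inv := contMDiff_restrictScalars (contMDiff_inv 𝓘(ℂ, E) ω) }

lemma mdifferentiableAt_mul_left_real [LieGroup 𝓘(ℝ, E) ω Gc] (g h : Gc) :
    MDifferentiableAt 𝓘(ℝ, E) 𝓘(ℝ, E) (fun x : Gc => g * x) h :=
  (contMDiff_mul_left (I := 𝓘(ℝ, E)) (n := ω)).mdifferentiableAt (by simp)

lemma mulInvariantVectorField_mul [LieGroup 𝓘(ℝ, E) ω Gc] (X : GroupLieAlgebra 𝓘(ℝ, E) Gc)
    (g h : Gc) : (mfderiv 𝓘(ℝ, E) 𝓘(ℝ, E) (fun x : Gc => g * x) h : E →L[ℝ] E)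
      (mulInvariantVectorField (I := 𝓘(ℝ, E)) X h : E) =
      (mulInvariantVectorField (I := 𝓘(ℝ, E)) X (g * h) : E) := by
  have h1 : (fun x : Gc => g * h * x) = (fun x => g * x) ∘ fun x => h * x := by
    ext x; simp [mul_assoc]
  have h2 := mfderiv_comp (I' := 𝓘(ℝ, E)) (1 : Gc) (mdifferentiableAt_mul_left_real g (h * 1))
    (mdifferentiableAt_mul_left_real h 1)
  rw [← h1] at h2
  have h3 : ∀ k, k = h → (mfderiv 𝓘(ℝ, E) 𝓘(ℝ, E) (fun x : Gc => g * x) k : E →L[ℝ] E) =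
      mfderiv 𝓘(ℝ, E) 𝓘(ℝ, E) (fun x : Gc => g * x) h := by
    rintro _ rfl; rfl
  have h4 := congrArg (fun L : E →L[ℝ] E => L X) h2
  exact (h4.trans (congrArg (fun L : E →L[ℝ] E => L (mulInvariantVectorField X h : E))
    (h3 _ (mul_one h)))).symm

lemma IsMIntegralCurveOn.const_mul [LieGroup 𝓘(ℝ, E) ω Gc] {γ : ℝ → Gc}
    {X : GroupLieAlgebra 𝓘(ℝ, E) Gc} {s : Set ℝ}
    (h : IsMIntegralCurveOn (I := 𝓘(ℝ, E)) γ (mulInvariantVectorField X) s) (g : Gc) :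
    IsMIntegralCurveOn (I := 𝓘(ℝ, E)) (fun t => g * γ t) (mulInvariantVectorField X) s := by
  intro t ht
  have h1 := (mdifferentiableAt_mul_left_real g (γ t)).hasMFDerivAt.comp_hasMFDerivWithinAt t (h t ht)
  have h2 : ((mfderiv 𝓘(ℝ, E) 𝓘(ℝ, E) (fun x : Gc => g * x) (γ t) : E →L[ℝ] E) ∘L
      ((1 : ℝ →L[ℝ] ℝ).smulRight (mulInvariantVectorField (I := 𝓘(ℝ, E)) X (γ t) : E))) =
      (1 : ℝ →L[ℝ] ℝ).smulRight (mulInvariantVectorField (I := 𝓘(ℝ, E)) X (g * γ t) : E) := by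
    ext
    simp only [ContinuousLinearMap.comp_apply, ContinuousLinearMap.smulRight_apply, map_smul,
      mulInvariantVectorField_mul]
  exact (h2 ▸ h1 :)

/-- Every element of the Lie algebra generates a one-parameter subgroup. -/
lemma exists_isOneParam [LieGroup 𝓘(ℂ, E) ω Gc] [T2Space Gc] [CompleteSpace E] (X : E) :
    ∃ γ : ℝ → Gc, IsOneParam γ X := by
  have : LieGroup 𝓘(ℝ, E) ω Gc := lieGroup_restrictScalars
  have : LieGroup 𝓘(ℝ, E) (minSmoothness ℝ 3) Gc := LieGroup.of_le (n := ω) le_top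
  have : IsManifold 𝓘(ℝ, E) 1 Gc := IsManifold.of_le (n := ω) le_top
  let X' : GroupLieAlgebra 𝓘(ℝ, E) Gc := X
  have hsm : ContMDiff 𝓘(ℝ, E) (𝓘(ℝ, E).tangent) 1
      (fun g => (⟨g, mulInvariantVectorField X' g⟩ : TangentBundle 𝓘(ℝ, E) Gc)) :=
    (contMDiff_mulInvariantVectorField X').of_le (by simp)
  obtain ⟨γ₀, h0, hγ₀⟩ := exists_isMIntegralCurveAt_of_contMDiffAt_boundaryless (t₀ := 0)
    (hsm.contMDiffAt (x := 1))
  obtain ⟨ε, hε, hγ₁⟩ := isMIntegralCurveAt_iff'.1 hγ₀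
  -- Left translation moves one local integral curve to every point with the same `ε`; this uniform
  -- existence time makes the field complete.
  have hloc : ∀ g : Gc, ∃ γ : ℝ → Gc, γ 0 = g ∧
      IsMIntegralCurveOn (I := 𝓘(ℝ, E)) γ (mulInvariantVectorField X') (Set.Ioo (-ε) ε) := by
    intro g
    refine ⟨fun t => g * γ₀ t, by simp [h0], ?_⟩
    refine IsMIntegralCurveOn.const_mul ?_ g
    simpa [Real.ball_eq_Ioo] using hγ₁
  obtain ⟨γ, hγ0, hγ⟩ := exists_isMIntegralCurve_of_isMIntegralCurveOn hsm hε hloc 1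
  -- Both sides are integral curves in `t` with the same initial value.
  have hmul : ∀ s t, γ (s + t) = γ s * γ t := by
    intro s t
    have i1 : IsMIntegralCurve (I := 𝓘(ℝ, E)) (fun t => γ s * γ t) (mulInvariantVectorField X') := by
      rw [isMIntegralCurve_iff_isMIntegralCurveOn]
      exact IsMIntegralCurveOn.const_mul (isMIntegralCurve_iff_isMIntegralCurveOn.1 hγ) _
    have i2 : IsMIntegralCurve (I := 𝓘(ℝ, E)) (γ ∘ (· + s)) (mulInvariantVectorField X') :=
      hγ.comp_add s
    have := isMIntegralCurve_Ioo_eq_of_contMDiff_boundaryless (t₀ := 0) hsm i1 i2 (by simp [hγ0])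
    have h := congrFun this t
    simp only [Function.comp_apply, add_comm t s] at h
    exact h.symm
  refine ⟨γ, hmul, (hasVelocity_iff_mfderiv hγ0).2 ⟨(hγ 0).mdifferentiableAt, ?_⟩⟩
  rw [(hγ 0).mfderiv]
  have h1 : (mulInvariantVectorField (I := 𝓘(ℝ, E)) X' (γ 0) : E) = X := by
    have h2 : (fun x : Gc => γ 0 * x) = id := by ext x; simp [hγ0]
    have h3 : mfderiv 𝓘(ℝ, E) 𝓘(ℝ, E) (fun x : Gc => γ 0 * x) 1 =
        mfderiv 𝓘(ℝ, E) 𝓘(ℝ, E) id (1 : Gc) := by rw [h2]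
    have h4 := congrArg (fun L : E →L[ℝ] E => L X) (h3.trans mfderiv_id)
    exact h4
  exact (one_smul ℝ _).trans h1

end Existence

/-! ### Lie algebras of closed subgroups -/

section LieAlgebraOfSubgroup

variable {E : Type*} [NormedAddCommGroup E] [NormedSpace ℂ E] [FiniteDimensional ℂ E]
  {Gc : Type*} [TopologicalSpace Gc] [ChartedSpace E Gc] [Group Gc] [LieGroup 𝓘(ℂ, E) ω Gc]
  [T2Space Gc]

lemma IsOneParam.mem_lieAlg {γ : ℝ → Gc} {X : GroupLieAlgebra 𝓘(ℂ, E) Gc} (h : IsOneParam (E := E) γ X)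
    {S : Subgroup Gc} (hS : ∀ t, γ t ∈ S) : X ∈ lieAlg E S :=
  Submodule.subset_span ⟨γ, h.1, hS,
    (hasVelocity_iff_mfderiv (map_zero_of_map_add h.1)).1 h.2⟩

/-- The velocity of a curve in a closed subgroup belongs to the Lie algebra. -/
lemma mem_lieAlg_of_hasVelocity {S : Subgroup Gc} (hS : IsClosed (S : Set Gc)) {c : ℝ → Gc}
    {X : GroupLieAlgebra 𝓘(ℂ, E) Gc} (hc : HasVelocity (E := E) c 1 X) (hcS : ∀ᶠ s in 𝓝 0, c s ∈ S) :
    X ∈ lieAlg E S := by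
  obtain ⟨γ, hγ⟩ := exists_isOneParam (E := E) (Gc := Gc) X
  exact hγ.mem_lieAlg (hγ.mem_of_hasVelocity hc hS hcS)

/-- The span in the definition of `lieAlg` adds nothing: a sum of two velocities is the velocity of
the pointwise product of the curves, and closedness puts the corresponding one-parameter subgroup
into `S`. -/
lemma exists_isOneParam_of_mem_lieAlg {S : Subgroup Gc} (hS : IsClosed (S : Set Gc))
    {X : GroupLieAlgebra 𝓘(ℂ, E) Gc} (hX : X ∈ lieAlg E S) :
    ∃ γ : ℝ → Gc, IsOneParam (E := E) γ X ∧ ∀ t, γ t ∈ S := by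
  induction hX using Submodule.span_induction with
  | mem X hX =>
    obtain ⟨γ, h1, h2, h3⟩ := hX
    exact ⟨γ, ⟨h1, (hasVelocity_iff_mfderiv (map_zero_of_map_add h1)).2 h3⟩, h2⟩
  | zero => exact ⟨fun _ => 1, ⟨by simp, hasVelocity_const 1⟩, fun _ => S.one_mem⟩
  | add X Y _ _ hX hY =>
    obtain ⟨γ, h1, h2⟩ := hX
    obtain ⟨γ', h1', h2'⟩ := hY
    obtain ⟨δ, hδ⟩ := exists_isOneParam (E := E) (Gc := Gc) (X + Y)
    exact ⟨δ, hδ, hδ.mem_of_hasVelocity (h1.2.mul h1'.2) hS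
      (.of_forall fun s => S.mul_mem (h2 s) (h2' s))⟩
  | smul r X _ hX =>
    obtain ⟨γ, h1, h2⟩ := hX
    exact ⟨fun s => γ (r * s), h1.smul r, fun s => h2 _⟩

lemma mem_lieAlg_inf {S S' : Subgroup Gc} (hS : IsClosed (S : Set Gc))
    (hS' : IsClosed (S' : Set Gc)) {X : GroupLieAlgebra 𝓘(ℂ, E) Gc} (hX : X ∈ lieAlg E S)
    (hX' : X ∈ lieAlg E S') : X ∈ lieAlg E (S ⊓ S') := by
  obtain ⟨γ, h1, h2⟩ := exists_isOneParam_of_mem_lieAlg hS hX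
  obtain ⟨γ', h1', h2'⟩ := exists_isOneParam_of_mem_lieAlg hS' hX'
  exact h1.mem_lieAlg fun t =>
    ⟨h2 t, h1.mem_of_hasVelocity h1'.2 hS' (.of_forall h2') t⟩

lemma lieAlg_mono {S S' : Subgroup Gc} (h : S ≤ S') : lieAlg E S ≤ lieAlg E S' :=
  Submodule.span_mono fun _ ⟨γ, h1, h2, h3⟩ => ⟨γ, h1, fun t => h (h2 t), h3⟩

/-- The adjoint action of an element in the domain of the chart at `1`. -/
lemma IsOneParam.conj {γ : ℝ → Gc} {Y : E} (h : IsOneParam γ Y) (g : Gc) :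
    ∃ Z : E, IsOneParam (fun s => g * γ s * g⁻¹) Z := by
  have h1 : MDifferentiableAt 𝓘(ℂ, E) 𝓘(ℂ, E) (fun x : Gc => g * x * g⁻¹) 1 :=
    ((contMDiff_const.mul contMDiff_id).mul contMDiff_const : ContMDiff 𝓘(ℂ, E) 𝓘(ℂ, E) ω
      (fun x : Gc => g * x * g⁻¹)).mdifferentiableAt (by simp)
  refine ⟨tmap E E (fun x : Gc => g * x * g⁻¹) 1 Y, fun s t => by simp [h.1], ?_⟩
  simpa using h.2.comp h1

/-- The derivative of the adjoint action of a one-parameter subgroup. -/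
lemma IsOneParam.exists_adjoint {γ δ : ℝ → Gc} {X Y : E} (hγ : IsOneParam γ X)
    (hδ : IsOneParam δ Y) :
    ∃ a : ℝ → E, (∀ᶠ t in 𝓝 0, IsOneParam (fun s => γ t * δ s * (γ t)⁻¹) (a t)) ∧
      a 0 = Y ∧ HasDerivAt a (Bracket.bracket (L := GroupLieAlgebra 𝓘(ℂ, E) Gc)
        (M := GroupLieAlgebra 𝓘(ℂ, E) Gc) X Y) 0 := by
  have hd := eventually_differentiableAt
    (contDiffAt_localConj (E := E) (Gc := Gc) |>.of_le (m := 2) le_top)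
  have t1 : Filter.Tendsto (fun a : E => (a, coordOne E Gc)) (𝓝 (coordOne E Gc))
      (𝓝 (coordOne E Gc, coordOne E Gc)) := (Continuous.prodMk_left _).tendsto _
  have hγψ : Filter.Tendsto (fun t => chartAt E (1 : Gc) (γ t)) (𝓝 0) (𝓝 (coordOne E Gc)) := by
    have := hγ.2.2.2.continuousAt.tendsto
    rwa [hγ.2.1] at this
  refine ⟨fun t => fderiv ℂ (localConj E Gc) (chartAt E (1 : Gc) (γ t), coordOne E Gc) (0, Y), ?_, ?_, ?_⟩
  · filter_upwards [hγψ.eventually (t1.eventually hd), hγ.2.eventually_chart] with t ht ht2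
    obtain ⟨Z, hZ⟩ := hδ.conj (γ t)
    have e0 : coordOne E Gc = chartAt E (1 : Gc) (δ 0) := by rw [hδ.2.1]; rfl
    have d1 := (hasFDerivAt_partial_right ht.hasFDerivAt).restrictScalars ℝ
    rw [e0] at d1
    have d2 := d1.comp_hasDerivAt (0 : ℝ) hδ.2.2.2
    have d3 := d2.congr_of_eventuallyEq (f₁ := fun s => chartAt E (1 : Gc) (γ t * δ s * (γ t)⁻¹)) (by
      filter_upwards [hδ.2.eventually_chart] with s hs
      simp only [Function.comp_apply, localConj, ht2, hs])
    have d4 := hZ.2.2.2.unique d3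
    rw [← e0] at d4
    have d5 : Z = fderiv ℂ (localConj E Gc) (chartAt E (1 : Gc) (γ t), coordOne E Gc) (0, Y) := d4
    rwa [← d5]
  · have d := hasFDerivAt_partial_right (t1.eventually hd).self_of_nhds.hasFDerivAt
    have := congrArg (fun L : E →L[ℂ] E => L Y)
      (d.unique ((hasFDerivAt_id _).congr_of_eventuallyEq localConj_coordOne_left))
    simp only [hγ.2.1]
    exact this
  · have d := hasFDerivAt_partial_left (hasFDerivAt_fderiv_apply
      (contDiffAt_localConj (E := E) (Gc := Gc) |>.of_le (m := 2) le_top) ((0, Y) : E × E))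
    have e := fderiv_localConj (Gc := Gc) X Y
    rw [d.fderiv] at e
    have d' := d.restrictScalars ℝ
    rw [show coordOne E Gc = chartAt E (1 : Gc) (γ 0) by rw [hγ.2.1]; rfl] at d'
    have d2 := d'.comp_hasDerivAt (0 : ℝ) hγ.2.2.2
    rw [← show coordOne E Gc = chartAt E (1 : Gc) (γ 0) by rw [hγ.2.1]; rfl] at d2
    exact e ▸ d2

/-- The Lie algebra of a closed subgroup is closed under the bracket. -/
lemma lie_mem_lieAlg {S : Subgroup Gc} (hS : IsClosed (S : Set Gc))
    {X Y : GroupLieAlgebra 𝓘(ℂ, E) Gc} (hX : X ∈ lieAlg E S) (hY : Y ∈ lieAlg E S) :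
    ⁅X, Y⁆ ∈ lieAlg E S := by
  obtain ⟨γ, h1, h2⟩ := exists_isOneParam_of_mem_lieAlg hS hX
  obtain ⟨δ, h3, h4⟩ := exists_isOneParam_of_mem_lieAlg hS hY
  let V : Submodule ℝ E := lieAlg E S
  obtain ⟨a, ha, ha0, had⟩ := h1.exists_adjoint h3
  have hmem : ∀ᶠ t in 𝓝 0, a t ∈ V := by
    filter_upwards [ha] with t ht
    exact ht.mem_lieAlg fun s => S.mul_mem (S.mul_mem (h2 t) (h4 s)) (S.inv_mem (h2 t))
  have : FiniteDimensional ℝ E := FiniteDimensional.complexToReal E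
  have hV : IsClosed (V : Set E) := V.closed_of_finiteDimensional
  -- The bracket is the derivative of the curve `Ad (γ t) Y`, which stays in the closed subspace
  -- `V`; hence so does its derivative.
  have hlim := had.tendsto_slope_zero
  refine hV.mem_of_tendsto hlim ?_
  have h0 : a 0 ∈ V := hmem.self_of_nhds
  filter_upwards [(eventually_nhdsWithin_of_eventually_nhds hmem)] with t ht
  rw [zero_add]
  exact V.smul_mem _ (V.sub_mem ht h0)

end LieAlgebraOfSubgroup

/-! ### Derivatives of maps of complex manifolds in terms of the model spaces -/

section Tmap

variable {E : Type*} [NormedAddCommGroup E] [NormedSpace ℂ E]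
  {M : Type*} [TopologicalSpace M] [ChartedSpace E M]
  {E' : Type*} [NormedAddCommGroup E'] [NormedSpace ℂ E']
  {N : Type*} [TopologicalSpace N] [ChartedSpace E' N]
  {E'' : Type*} [NormedAddCommGroup E''] [NormedSpace ℂ E'']
  {Q : Type*} [TopologicalSpace Q] [ChartedSpace E'' Q]

lemma tmap_comp {g : N → Q} {f : M → N} {p : M}
    (hg : MDifferentiableAt 𝓘(ℂ, E') 𝓘(ℂ, E'') g (f p))
    (hf : MDifferentiableAt 𝓘(ℂ, E) 𝓘(ℂ, E') f p) :
    tmap E E'' (fun x => g (f x)) p = tmap E' E'' g (f p) ∘L tmap E E' f p :=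
  mfderiv_comp p hg hf

lemma tmap_eq_fderiv (f : E → E') (z : E) : tmap E E' f z = fderiv ℂ f z :=
  mfderiv_eq_fderiv

variable [IsManifold 𝓘(ℂ, E) ω M] [IsManifold 𝓘(ℂ, E') ω N]

lemma mdifferentiableAt_chart {p₀ p : M} (hp : p ∈ (chartAt E p₀).source) :
    MDifferentiableAt 𝓘(ℂ, E) 𝓘(ℂ, E) (chartAt E p₀) p :=
  (mdifferentiable_chart (I := 𝓘(ℂ, E)) p₀).mdifferentiableAt hp

lemma mdifferentiableAt_chart_symm {p₀ : M} {z : E} (hz : z ∈ (chartAt E p₀).target) :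
    MDifferentiableAt 𝓘(ℂ, E) 𝓘(ℂ, E) (chartAt E p₀).symm z :=
  (mdifferentiable_chart (I := 𝓘(ℂ, E)) p₀).mdifferentiableAt_symm hz

lemma tmap_chart_symm_comp {p₀ p : M} (hp : p ∈ (chartAt E p₀).source) :
    tmap E E (chartAt E p₀).symm (chartAt E p₀ p) ∘L tmap E E (chartAt E p₀) p =
      ContinuousLinearMap.id ℂ E :=
  (mdifferentiable_chart (I := 𝓘(ℂ, E)) p₀).symm_comp_deriv hp

lemma tmap_chart_comp_symm {p₀ : M} {z : E} (hz : z ∈ (chartAt E p₀).target) :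
    tmap E E (chartAt E p₀) ((chartAt E p₀).symm z) ∘L tmap E E (chartAt E p₀).symm z =
      ContinuousLinearMap.id ℂ E :=
  (mdifferentiable_chart (I := 𝓘(ℂ, E)) p₀).comp_symm_deriv hz

lemma tmap_chart_self (p : M) : tmap E E (chartAt E p) p = ContinuousLinearMap.id ℂ E :=
  mfderiv_extChartAt_self (I := 𝓘(ℂ, E)) (x := p)

/-- The derivative of the coordinate expression of a map. -/
lemma fderiv_chart_comp {f : M → N} {p₀ : M} {q₀ : N} {z : E} (hz : z ∈ (chartAt E p₀).target)
    (hf : MDifferentiableAt 𝓘(ℂ, E) 𝓘(ℂ, E') f ((chartAt E p₀).symm z))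
    (hq : f ((chartAt E p₀).symm z) ∈ (chartAt E' q₀).source) :
    fderiv ℂ (fun y => chartAt E' q₀ (f ((chartAt E p₀).symm y))) z =
      tmap E' E' (chartAt E' q₀) (f ((chartAt E p₀).symm z)) ∘L
        tmap E E' f ((chartAt E p₀).symm z) ∘L tmap E E (chartAt E p₀).symm z := by
  rw [← tmap_eq_fderiv]
  have h1 := mdifferentiableAt_chart_symm hz
  have h2 := tmap_comp (f := (chartAt E p₀).symm) hf h1
  rw [← h2]
  exact tmap_comp (f := fun y => f ((chartAt E p₀).symm y)) (mdifferentiableAt_chart hq)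
    (hf.comp z h1)

lemma localForm_apply (η : TwoForm E M) (p₀ : M) (z a b : E) :
    localForm η p₀ z ![a, b] = (η ((chartAt E p₀).symm z) : E [⋀^Fin 2]→L[ℝ] ℝ)
      ![tmap E E (chartAt E p₀).symm z a, tmap E E (chartAt E p₀).symm z b] := by
  have h : ∀ (θ : E [⋀^Fin 2]→L[ℝ] ℝ) (L : E →L[ℝ] E),
      θ.compContinuousLinearMap L ![a, b] = θ ![L a, L b] := by
    intro θ L
    rw [ContinuousAlternatingMap.compContinuousLinearMap_apply]
    congr 1
    ext i; fin_cases i <;> rfl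
  exact h _ _

/-- The value of a two-form in terms of its expression in a chart. -/
lemma localForm_chart (η : TwoForm E M) {p₀ p : M} (hp : p ∈ (chartAt E p₀).source) (v w : E) :
    localForm η p₀ (chartAt E p₀ p) ![tmap E E (chartAt E p₀) p v, tmap E E (chartAt E p₀) p w] =
      (η p : E [⋀^Fin 2]→L[ℝ] ℝ) ![v, w] := by
  have h := tmap_chart_symm_comp (E := E) hp
  have h1 : ∀ v, tmap E E (chartAt E p₀).symm (chartAt E p₀ p) (tmap E E (chartAt E p₀) p v) = v :=
    fun v => congrArg (fun L : E →L[ℂ] E => L v) h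
  rw [localForm_apply, h1, h1, (chartAt E p₀).left_inv hp]

end Tmap

/-! ### Local sections of submersions and holomorphy of the action -/

section Action

variable {EG : Type*} [NormedAddCommGroup EG] [NormedSpace ℂ EG] [FiniteDimensional ℂ EG]
  {Gc : Type*} [TopologicalSpace Gc] [ChartedSpace EG Gc] [Group Gc] [LieGroup 𝓘(ℂ, EG) ω Gc]
  {P : Subgroup Gc} {m : ℕ} {τ : P →* (Fin m → ℂˣ)}
  {EF : Type*} [NormedAddCommGroup EF] [NormedSpace ℂ EF] [FiniteDimensional ℂ EF]
  {F : Type*} [TopologicalSpace F] [ChartedSpace EF F] [IsManifold 𝓘(ℂ, EF) ω F]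
  [MulAction (Fin m → ℂˣ) F]
  {EM : Type*} [NormedAddCommGroup EM] [NormedSpace ℂ EM] [FiniteDimensional ℂ EM]
  {M : Type*} [TopologicalSpace M] [ChartedSpace EM M] [IsManifold 𝓘(ℂ, EM) ω M]
  [MulAction Gc M] {q : Gc × F → M}

/-- A holomorphic submersion of a vector space has a local holomorphic right inverse. -/
lemma exists_rightInverse_of_surjective {E E' : Type*} [NormedAddCommGroup E] [NormedSpace ℂ E]
    [NormedAddCommGroup E'] [NormedSpace ℂ E'] [FiniteDimensional ℂ E'] {Q : E → E'} {y : E}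
    (hQ : ContDiffAt ℂ ω Q y) (hs : Function.Surjective (fderiv ℂ Q y)) :
    ∃ s : E' → E, s (Q y) = y ∧ ContDiffAt ℂ ω s (Q y) ∧ ∀ᶠ z in 𝓝 (Q y), Q (s z) = z := by
  obtain ⟨R, hR⟩ := (fderiv ℂ Q y : E →ₗ[ℂ] E').exists_rightInverse_of_surjective
    (LinearMap.range_eq_top.2 hs)
  let R' : E' →L[ℂ] E := LinearMap.toContinuousLinearMap R
  have hRR : ∀ v, fderiv ℂ Q y (R' v) = v := fun v => congrArg (fun L : E' →ₗ[ℂ] E' => L v) hR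
  -- Restricting `Q` to the affine image of a linear right inverse gives a map with derivative the
  -- identity, which the inverse function theorem inverts.
  let f : E' → E' := fun z => Q (y + R' z)
  have h0 : y + R' 0 = y := by simp
  have hg : ContDiffAt ℂ ω (fun z : E' => y + R' z) 0 := by fun_prop
  have hf : ContDiffAt ℂ ω f 0 := ContDiffAt.comp (g := Q) (f := fun z => y + R' z) 0 (by rwa [h0]) hg
  have hf0 : f 0 = Q y := by simp [f]
  have hfd : HasFDerivAt f ((ContinuousLinearEquiv.refl ℂ E' : E' ≃L[ℂ] E') : E' →L[ℂ] E') 0 := by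
    have h1 : HasFDerivAt Q (fderiv ℂ Q y) (y + R' 0) := by
      rw [h0]; exact (hQ.differentiableAt (by simp)).hasFDerivAt
    have h2 := h1.comp (0 : E') (R'.hasFDerivAt.const_add y)
    rwa [show fderiv ℂ Q y ∘L R' = ((ContinuousLinearEquiv.refl ℂ E' : E' ≃L[ℂ] E') : E' →L[ℂ] E')
      from ContinuousLinearMap.ext hRR] at h2
  have hn : (ω : WithTop ℕ∞) ≠ 0 := by simp
  refine ⟨fun z => y + R' (hf.localInverse hfd hn z), ?_, ?_, ?_⟩
  · have : hf.localInverse hfd hn (f 0) = 0 := hf.localInverse_apply_image hfd hn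
    rw [hf0] at this
    simp [this]
  · have h3 := hf.to_localInverse hfd hn
    rw [hf0] at h3
    exact contDiffAt_const.add (R'.contDiff.contDiffAt.comp _ h3)
  · have h4 := hf.hasStrictFDerivAt' hfd hn |>.eventually_right_inverse
    rw [hf0] at h4
    exact h4

/-- The right inverse of the submersion in charts, transported back to the manifolds. Lifting points
of `M` to `Gc × F` holomorphically is what makes the action on `M` accessible. -/
lemma IsAssociatedBundle.exists_section (hM : IsAssociatedBundle EG EF EM τ q) (y : Gc × F) :
    ∃ (s₁ : M → Gc) (s₂ : M → F), s₁ (q y) = y.1 ∧ s₂ (q y) = y.2 ∧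
      ContMDiffAt 𝓘(ℂ, EM) 𝓘(ℂ, EG) ω s₁ (q y) ∧ ContMDiffAt 𝓘(ℂ, EM) 𝓘(ℂ, EF) ω s₂ (q y) ∧
      ∀ᶠ p in 𝓝 (q y), q (s₁ p, s₂ p) = p := by
  have hc := contDiffAt_of_contMDiffAt_prod (hM.holomorphic y)
  have hd := hasFDerivAt_of_mdifferentiableAt_prod ((hM.holomorphic y).mdifferentiableAt (by simp))
  set Q : EG × EF → EM := fun z => chartAt EM (q y) (q ((chartAt EG y.1).symm z.1,
    (chartAt EF y.2).symm z.2)) with hQ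
  have l1 := (chartAt EG y.1).left_inv (mem_chart_source EG y.1)
  have l2 := (chartAt EF y.2).left_inv (mem_chart_source EF y.2)
  have hQy : Q (chartAt EG y.1 y.1, chartAt EF y.2 y.2) = chartAt EM (q y) (q y) := by
    simp only [hQ, l1, l2]
  obtain ⟨s, hs0, hs1, hs2⟩ := exists_rightInverse_of_surjective hc (by
    rw [hd.fderiv]; exact hM.submersion y)
  change s (Q _) = _ at hs0
  change ContDiffAt ℂ ω s (Q _) at hs1
  change ∀ᶠ z in 𝓝 (Q _), _ at hs2
  rw [hQy] at hs0 hs1 hs2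
  have hch : ContMDiffAt 𝓘(ℂ, EM) 𝓘(ℂ, EM) ω (chartAt EM (q y)) (q y) :=
    contMDiffAt_extChartAt (I := 𝓘(ℂ, EM))
  have hsm : ContMDiffAt 𝓘(ℂ, EM) 𝓘(ℂ, EG × EF) ω (fun p => s (chartAt EM (q y) p)) (q y) :=
    hs1.contMDiffAt.comp (q y) hch
  have hsG : ContMDiffAt 𝓘(ℂ, EG) 𝓘(ℂ, EG) ω (chartAt EG y.1).symm (chartAt EG y.1 y.1) :=
    (contMDiffOn_chart_symm (I := 𝓘(ℂ, EG)) (x := y.1)).contMDiffAt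
      ((chartAt EG y.1).open_target.mem_nhds ((chartAt EG y.1).map_source (mem_chart_source EG y.1)))
  have hsF : ContMDiffAt 𝓘(ℂ, EF) 𝓘(ℂ, EF) ω (chartAt EF y.2).symm (chartAt EF y.2 y.2) :=
    (contMDiffOn_chart_symm (I := 𝓘(ℂ, EF)) (x := y.2)).contMDiffAt
      ((chartAt EF y.2).open_target.mem_nhds ((chartAt EF y.2).map_source (mem_chart_source EF y.2)))
  have hfst : ContMDiffAt 𝓘(ℂ, EM) 𝓘(ℂ, EG) ω (fun p => (s (chartAt EM (q y) p)).1) (q y) :=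
    (contDiff_fst.contMDiff (n := ω)).contMDiffAt.comp (q y) hsm
  have hsnd : ContMDiffAt 𝓘(ℂ, EM) 𝓘(ℂ, EF) ω (fun p => (s (chartAt EM (q y) p)).2) (q y) :=
    (contDiff_snd.contMDiff (n := ω)).contMDiffAt.comp (q y) hsm
  refine ⟨fun p => (chartAt EG y.1).symm (s (chartAt EM (q y) p)).1,
    fun p => (chartAt EF y.2).symm (s (chartAt EM (q y) p)).2, by simp only [hs0, l1],
    by simp only [hs0, l2], ?_, ?_, ?_⟩
  · exact ContMDiffAt.comp (g := (chartAt EG y.1).symm) (q y) (by rw [hs0]; exact hsG) hfst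
  · exact ContMDiffAt.comp (g := (chartAt EF y.2).symm) (q y) (by rw [hs0]; exact hsF) hsnd
  · have hcont : ContinuousAt (fun p => q ((chartAt EG y.1).symm (s (chartAt EM (q y) p)).1,
        (chartAt EF y.2).symm (s (chartAt EM (q y) p)).2)) (q y) := by
      have h1 : ContinuousAt (fun p => (chartAt EG y.1).symm (s (chartAt EM (q y) p)).1) (q y) :=
        (ContMDiffAt.comp (g := (chartAt EG y.1).symm) (q y) (by rw [hs0]; exact hsG) hfst).continuousAt
      have h2 : ContinuousAt (fun p => (chartAt EF y.2).symm (s (chartAt EM (q y) p)).2) (q y) :=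
        (ContMDiffAt.comp (g := (chartAt EF y.2).symm) (q y) (by rw [hs0]; exact hsF) hsnd).continuousAt
      exact hM.holomorphic.continuous.continuousAt.comp (h1.prodMk h2)
    have hval : q ((chartAt EG y.1).symm (s (chartAt EM (q y) (q y))).1,
        (chartAt EF y.2).symm (s (chartAt EM (q y) (q y))).2) = q y := by
      rw [hs0]; simp only [l1, l2]
    have hsrc := (chartAt EM (q y)).open_source.mem_nhds (mem_chart_source EM (q y))
    have e1 := hcont.eventually_mem (s := (chartAt EM (q y)).source) (by rw [hval]; exact hsrc)
    have e2 := hch.continuousAt.eventually hs2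
    filter_upwards [e1, e2, hsrc] with p h1 h2 h3
    exact (chartAt EM (q y)).injOn h1 h3 h2

/-- The action of the group on the associated bundle is holomorphic. -/
lemma IsAssociatedBundle.contMDiff_smul (hM : IsAssociatedBundle EG EF EM τ q) :
    ContMDiff (𝓘(ℂ, EG).prod 𝓘(ℂ, EM)) 𝓘(ℂ, EM) ω (fun x : Gc × M => x.1 • x.2) := by
  rintro ⟨g, p⟩
  obtain ⟨y, rfl⟩ := hM.surjective p
  -- Locally `g • p = q (g s₁ (p), s₂ (p))`, a composition of holomorphic maps.
  obtain ⟨s₁, s₂, h1, h2, hs₁, hs₂, hs⟩ := hM.exists_section y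
  have hsnd : ContMDiffAt (𝓘(ℂ, EG).prod 𝓘(ℂ, EM)) 𝓘(ℂ, EM) ω (Prod.snd : Gc × M → M) (g, q y) :=
    contMDiffAt_snd
  have t1 : ContMDiffAt (𝓘(ℂ, EG).prod 𝓘(ℂ, EM)) 𝓘(ℂ, EG) ω (fun x : Gc × M => s₁ x.2) (g, q y) :=
    ContMDiffAt.comp (g := s₁) (f := Prod.snd) (g, q y) hs₁ hsnd
  have t2 : ContMDiffAt (𝓘(ℂ, EG).prod 𝓘(ℂ, EM)) 𝓘(ℂ, EF) ω (fun x : Gc × M => s₂ x.2) (g, q y) :=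
    ContMDiffAt.comp (g := s₂) (f := Prod.snd) (g, q y) hs₂ hsnd
  have t3 : ContMDiffAt (𝓘(ℂ, EG).prod 𝓘(ℂ, EM)) 𝓘(ℂ, EG) ω
      (fun x : Gc × M => x.1 * s₁ x.2) (g, q y) := contMDiffAt_fst.mul t1
  have t4 : ContMDiffAt (𝓘(ℂ, EG).prod 𝓘(ℂ, EM)) 𝓘(ℂ, EM) ω
      (fun x : Gc × M => q (x.1 * s₁ x.2, s₂ x.2)) (g, q y) :=
    ContMDiffAt.comp (g := q) (g, q y) (hM.holomorphic _) (t3.prodMk t2)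
  refine t4.congr_of_eventuallyEq ?_
  have : Filter.Tendsto (Prod.snd : Gc × M → M) (𝓝 (g, q y)) (𝓝 (q y)) := continuous_snd.tendsto _
  filter_upwards [this.eventually hs] with x hx
  rw [← hM.equivariant, hx]

end Action

/-! ### Fundamental vector fields in a chart -/

section Generators

variable {E : Type*} [NormedAddCommGroup E] [NormedSpace ℂ E] [FiniteDimensional ℂ E]
  {Gc : Type*} [TopologicalSpace Gc] [ChartedSpace E Gc] [Group Gc] [LieGroup 𝓘(ℂ, E) ω Gc]
  {E' : Type*} [NormedAddCommGroup E'] [NormedSpace ℂ E'] [FiniteDimensional ℂ E']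
  {M : Type*} [TopologicalSpace M] [ChartedSpace E' M] [IsManifold 𝓘(ℂ, E') ω M]
  [MulAction Gc M]

variable (E E' Gc) in
/-- The action in the charts at `1` and `p`. -/
def localAct (p : M) (x : E × E') : E' :=
  chartAt E' p ((chartAt E (1 : Gc)).symm x.1 • (chartAt E' p).symm x.2)

variable (Gc E') in
/-- The fundamental vector field of `X` in the chart at `p`. -/
def genField (p : M) (X : E) (z : E') : E' :=
  fderiv ℂ (localAct E Gc E' p) (coordOne E Gc, z) (X, 0)

lemma contDiffAt_localAct
    (hact : ContMDiff (𝓘(ℂ, E).prod 𝓘(ℂ, E')) 𝓘(ℂ, E') ω (fun x : Gc × M => x.1 • x.2)) (p : M) :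
    ContDiffAt ℂ ω (localAct E Gc E' p) (coordOne E Gc, chartAt E' p p) := by
  have := contDiffAt_of_contMDiffAt_prod (hact (1, p))
  simpa only [one_smul] using! this

lemma eventually_contDiffAt_localAct
    (hact : ContMDiff (𝓘(ℂ, E).prod 𝓘(ℂ, E')) 𝓘(ℂ, E') ω (fun x : Gc × M => x.1 • x.2)) (p : M) :
    ∀ᶠ z in 𝓝 (chartAt E' p p), ContDiffAt ℂ ω (localAct E Gc E' p) (coordOne E Gc, z) :=
  ((Continuous.prodMk_right (coordOne E Gc)).tendsto (chartAt E' p p)).eventually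
    ((contDiffAt_localAct hact p).eventually (by simp))

lemma localAct_coordOne {p : M} {z : E'} (hz : z ∈ (chartAt E' p).target) :
    localAct E Gc E' p (coordOne E Gc, z) = z := by
  simp only [localAct, chart_symm_coordOne, one_smul]
  exact (chartAt E' p).right_inv hz

lemma eventually_localAct_mem
    (hact : ContMDiff (𝓘(ℂ, E).prod 𝓘(ℂ, E')) 𝓘(ℂ, E') ω (fun x : Gc × M => x.1 • x.2))
    {p : M} {z : E'} (hz : z ∈ (chartAt E' p).target) :
    ∀ᶠ x in 𝓝 ((coordOne E Gc, z) : E × E'),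
      (chartAt E (1 : Gc)).symm x.1 • (chartAt E' p).symm x.2 ∈ (chartAt E' p).source := by
  have h1 : Filter.Tendsto (fun x : E × E' => ((chartAt E (1 : Gc)).symm x.1, (chartAt E' p).symm x.2))
      (𝓝 (coordOne E Gc, z)) (𝓝 ((1 : Gc), (chartAt E' p).symm z)) := by
    rw [nhds_prod_eq, nhds_prod_eq]
    exact tendsto_chart_symm_one.prodMap ((chartAt E' p).symm.continuousAt hz).tendsto
  have h2 := (hact.continuous.tendsto ((1 : Gc), (chartAt E' p).symm z)).comp h1
  refine h2.eventually_mem ((chartAt E' p).open_source.mem_nhds ?_)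
  simp only [one_smul]
  exact (chartAt E' p).map_target hz

lemma eventually_chart_symm_localAct
    (hact : ContMDiff (𝓘(ℂ, E).prod 𝓘(ℂ, E')) 𝓘(ℂ, E') ω (fun x : Gc × M => x.1 • x.2))
    {p : M} {z : E'} (hz : z ∈ (chartAt E' p).target) :
    ∀ᶠ x in 𝓝 ((coordOne E Gc, z) : E × E'), (chartAt E' p).symm (localAct E Gc E' p x) =
      (chartAt E (1 : Gc)).symm x.1 • (chartAt E' p).symm x.2 := by
  filter_upwards [eventually_localAct_mem hact hz] with x hx
  exact (chartAt E' p).left_inv hx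

lemma contDiffAt_genField
    (hact : ContMDiff (𝓘(ℂ, E).prod 𝓘(ℂ, E')) 𝓘(ℂ, E') ω (fun x : Gc × M => x.1 • x.2)) (p : M)
    (X : E) : ContDiffAt ℂ ω (genField Gc E' p X) (chartAt E' p p) := by
  have h1 := (contDiffAt_localAct hact p).fderiv_right (m := ω) (by simp)
  exact (h1.comp (chartAt E' p p) (contDiffAt_const.prodMk contDiffAt_id)).clm_apply contDiffAt_const

lemma genField_add (p : M) (X Y : E) (z : E') :
    genField Gc E' p (X + Y) z = genField Gc E' p X z + genField Gc E' p Y z := by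
  simp only [genField]
  rw [← map_add]; simp

lemma genField_smul (p : M) (c : ℂ) (X : E) (z : E') :
    genField Gc E' p (c • X) z = c • genField Gc E' p X z := by
  simp only [genField]
  rw [← map_smul]; simp

variable (Gc E') in
/-- The fundamental vector field of `X`, in terms of the model spaces. -/
def gen (X : E) (p : M) : E' := tmap E E' (fun g : Gc => g • p) 1 X

lemma contMDiff_smul_const
    (hact : ContMDiff (𝓘(ℂ, E).prod 𝓘(ℂ, E')) 𝓘(ℂ, E') ω (fun x : Gc × M => x.1 • x.2)) (p : M) :
    ContMDiff 𝓘(ℂ, E) 𝓘(ℂ, E') ω (fun g : Gc => g • p) :=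
  hact.comp (contMDiff_id.prodMk contMDiff_const)

lemma contMDiff_const_smul_of_prod
    (hact : ContMDiff (𝓘(ℂ, E).prod 𝓘(ℂ, E')) 𝓘(ℂ, E') ω (fun x : Gc × M => x.1 • x.2)) (g : Gc) :
    ContMDiff 𝓘(ℂ, E') 𝓘(ℂ, E') ω (fun p : M => g • p) :=
  hact.comp (contMDiff_const.prodMk contMDiff_id)

/-- The fundamental field at a point in terms of the chart at another point. -/
lemma tmap_chart_gen
    (hact : ContMDiff (𝓘(ℂ, E).prod 𝓘(ℂ, E')) 𝓘(ℂ, E') ω (fun x : Gc × M => x.1 • x.2))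
    {p₀ p : M} (hp : p ∈ (chartAt E' p₀).source)
    (hd : DifferentiableAt ℂ (localAct E Gc E' p₀) (coordOne E Gc, chartAt E' p₀ p)) (X : E) :
    tmap E' E' (chartAt E' p₀) p (gen Gc E' X p) =
      genField Gc E' p₀ X (chartAt E' p₀ p) := by
  have h1 : MDifferentiableAt 𝓘(ℂ, E) 𝓘(ℂ, E') (fun g : Gc => g • p) 1 :=
    (contMDiff_smul_const hact p).mdifferentiableAt (by simp)
  have h2 : MDifferentiableAt 𝓘(ℂ, E') 𝓘(ℂ, E') (chartAt E' p₀) ((1 : Gc) • p) := by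
    rw [one_smul]; exact mdifferentiableAt_chart hp
  have h3 := hasFDerivAt_of_mdifferentiableAt (h2.comp (1 : Gc) h1)
  have h4 := hasFDerivAt_partial_left hd.hasFDerivAt
  have h5 : (fun a => localAct E Gc E' p₀ (a, chartAt E' p₀ p)) =
      fun a => chartAt E' p₀ ((chartAt E (1 : Gc)).symm a • p) := by
    ext a
    simp only [localAct, (chartAt E' p₀).left_inv hp]
  rw [h5] at h4
  have h6 := congrArg (fun L : E →L[ℂ] E' => L X) (h3.unique h4)
  have h7 := congrArg (fun L : E →L[ℂ] E' => L X) (tmap_comp (f := fun g : Gc => g • p) h2 h1)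
  have h8 := h7.symm.trans h6
  simp only [one_smul] at h8
  exact h8

/-- The neighbourhood does not depend on `X`, so whole frames of fundamental fields can be compared
in one chart. -/
lemma eventually_tmap_chart_gen
    (hact : ContMDiff (𝓘(ℂ, E).prod 𝓘(ℂ, E')) 𝓘(ℂ, E') ω (fun x : Gc × M => x.1 • x.2)) (p₀ : M) :
    ∀ᶠ p in 𝓝 p₀, p ∈ (chartAt E' p₀).source ∧ ∀ X : E,
      tmap E' E' (chartAt E' p₀) p (gen Gc E' X p) =
        genField Gc E' p₀ X (chartAt E' p₀ p) := by
  have h1 := ((chartAt E' p₀).continuousAt (mem_chart_source E' p₀)).eventually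
    (eventually_contDiffAt_localAct hact p₀)
  filter_upwards [h1, (chartAt E' p₀).open_source.mem_nhds (mem_chart_source E' p₀)] with p h2 h3
  exact ⟨h3, tmap_chart_gen hact h3 (h2.differentiableAt (by simp))⟩

lemma gen_eq_genField
    (hact : ContMDiff (𝓘(ℂ, E).prod 𝓘(ℂ, E')) 𝓘(ℂ, E') ω (fun x : Gc × M => x.1 • x.2)) (p : M)
    (X : E) : gen Gc E' X p =
      genField Gc E' p X (chartAt E' p p) := by
  have h := (eventually_tmap_chart_gen hact p).self_of_nhds.2 X
  rwa [tmap_chart_self] at h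

/-- The commutator of fundamental fields. -/
lemma fderiv_genField_commutator
    (hact : ContMDiff (𝓘(ℂ, E).prod 𝓘(ℂ, E')) 𝓘(ℂ, E') ω (fun x : Gc × M => x.1 • x.2))
    {p : M} {z : E'} (hz : z ∈ (chartAt E' p).target)
    (hd : ContDiffAt ℂ ω (localAct E Gc E' p) (coordOne E Gc, z))
    (X Y : E) :
    fderiv ℂ (genField Gc E' p X) z (genField Gc E' p Y z) -
      fderiv ℂ (genField Gc E' p Y) z (genField Gc E' p X z) =
    genField (E := E) Gc E' p (Bracket.bracket (L := GroupLieAlgebra 𝓘(ℂ, E) Gc)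
      (M := GroupLieAlgebra 𝓘(ℂ, E) Gc) X Y) z := by
  have hass : ∀ᶠ x in 𝓝 ((coordOne E Gc, coordOne E Gc) : E × E),
      localAct E Gc E' p (localMul E Gc x, z) =
        localAct E Gc E' p (x.1, localAct E Gc E' p (x.2, z)) := by
    have t : Filter.Tendsto (fun x : E × E => (x.2, z)) (𝓝 (coordOne E Gc, coordOne E Gc))
        (𝓝 (coordOne E Gc, z)) :=
      (continuous_snd.prodMk continuous_const).tendsto (coordOne E Gc, coordOne E Gc)
    filter_upwards [chart_symm_localMul (E := E) (Gc := Gc),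
      t.eventually (eventually_chart_symm_localAct hact hz)] with x h1 h2
    simp only [localAct, h1, mul_smul]
    simp only [localAct] at h2
    rw [h2]
  have := fderiv_generator_commutator (contDiffAt_localMul.of_le le_top) (hd.of_le le_top)
    localMul_coordOne_right localMul_coordOne_left (localAct_coordOne hz) hass X Y
  refine this.trans ?_
  exact congrArg (fun W : E => genField Gc E' p W z) (lie_eq_mulHess X Y).symm

end Generators

/-! ### Invariant Kähler forms in a chart -/

section KahlerChart

variable {E' : Type*} [NormedAddCommGroup E'] [NormedSpace ℂ E']
  {M : Type*} [TopologicalSpace M] [ChartedSpace E' M] [IsManifold 𝓘(ℂ, E') ω M]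

lemma chart_mem_target (p : M) : chartAt E' p p ∈ (chartAt E' p).target :=
  (chartAt E' p).map_source (mem_chart_source E' p)

lemma eventually_mem_chart_target (p : M) :
    ∀ᶠ z in 𝓝 (chartAt E' p p), z ∈ (chartAt E' p).target :=
  (chartAt E' p).open_target.mem_nhds (chart_mem_target p)

lemma IsKahlerForm.localForm_map_J {η : TwoForm E' M} (hη : IsKahlerForm η) (p : M) (z v w : E') :
    localForm η p z ![Complex.I • v, Complex.I • w] = localForm η p z ![v, w] := by
  rw [localForm_apply, localForm_apply, map_smul, map_smul]
  exact hη.map_J _ _ _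

lemma IsKahlerForm.localForm_pos {η : TwoForm E' M} (hη : IsKahlerForm η) {p : M} {z : E'}
    (hz : z ∈ (chartAt E' p).target) {v : E'} (hv : v ≠ 0) :
    0 < localForm η p z ![v, Complex.I • v] := by
  rw [localForm_apply, map_smul]
  refine hη.pos _ _ fun h0 => hv ?_
  have h := congrArg (fun L : E' →L[ℂ] E' => L v) (tmap_chart_comp_symm hz)
  have h1 : tmap E' E' (chartAt E' p) ((chartAt E' p).symm z)
    (tmap E' E' (chartAt E' p).symm z v) = v := h
  rw [← h1, show tmap E' E' (chartAt E' p).symm z v = 0 from h0, map_zero]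

lemma IsKahlerForm.contDiffAt_localForm {η : TwoForm E' M} (hη : IsKahlerForm η) {p : M} {z : E'}
    (hz : z ∈ (chartAt E' p).target) : ContDiffAt ℝ ∞ (localForm η p) z :=
  (hη.smooth p).contDiffAt ((chartAt E' p).open_target.mem_nhds hz)

lemma localForm_self (η : TwoForm E' M) (p : M) (v w : E') :
    localForm η p (chartAt E' p p) ![v, w] = (η p : E' [⋀^Fin 2]→L[ℝ] ℝ) ![v, w] := by
  have := localForm_chart η (mem_chart_source E' p) v w
  rwa [tmap_chart_self] at this

/-- The Ricci form in terms of the logarithm of the volume density in the chart. -/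
lemma ricciForm_apply [FiniteDimensional ℂ E'] {η : TwoForm E' M} (hη : IsKahlerForm η) (p : M)
    (v w : E') : (ricciForm η p : E' [⋀^Fin 2]→L[ℝ] ℝ) ![v, w] = -(1 / (4 * Real.pi)) *
      extDeriv (dc (logDet (localForm η p) (Module.finBasis ℂ E'))) (chartAt E' p p) ![v, w] := by
  set e := Module.finBasis ℂ E'
  -- The normalizing factor of the metric matrix only adds a constant to the logarithm of the
  -- determinant, so it disappears under `dd^c`.
  have hmat : ∀ z, metricMatrix η p z = ((1 / 2 : ℝ) : ℂ) • hermGram (localForm η p z) e := by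
    intro z
    ext a b
    simp only [metricMatrix, Matrix.of_apply, Matrix.smul_apply, hermGram_apply, herm, smul_eq_mul]
    push_cast
    ring
  have hlog : (fun z => Real.log (metricMatrix η p z).det.re) =ᶠ[𝓝 (chartAt E' p p)]
      fun z => Real.log ((1 / 2 : ℝ) ^ Module.finrank ℂ E') + logDet (localForm η p) e z := by
    filter_upwards [eventually_mem_chart_target (E' := E') p] with z hz
    have h0 := det_hermGram_ne_zero (localForm η p z) (hη.localForm_map_J p z)
      (fun v hv => hη.localForm_pos hz hv) e.linearIndependent
    have hr := det_hermGram_real (localForm η p z) (hη.localForm_map_J p z) e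
    have h0' : (hermGram (localForm η p z) e).det.re ≠ 0 := fun h => h0 (by
      rw [← hr, h, Complex.ofReal_zero])
    rw [hmat, Matrix.det_smul, Fintype.card_fin, ← Complex.ofReal_pow, ← hr, ← Complex.ofReal_mul,
      Complex.ofReal_re, Real.log_mul (by positivity) h0', logDet]
  have hdc : dc (fun z => Real.log (metricMatrix η p z).det.re) =ᶠ[𝓝 (chartAt E' p p)]
      dc (logDet (localForm η p) e) := by
    have h1 := hlog.fderiv (𝕜 := ℝ)
    filter_upwards [h1] with z hz
    rw [dc, dc, hz, fderiv_const_add]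
  have hext := hdc.extDeriv_eq
  have h : ∀ (θ : E' [⋀^Fin 2]→L[ℝ] ℝ) (L : E' →L[ℂ] E'), L = ContinuousLinearMap.id ℂ E' →
      ((-(1 / (4 * Real.pi))) • θ.compContinuousLinearMap (L.restrictScalars ℝ)) ![v, w] =
        -(1 / (4 * Real.pi)) * θ ![v, w] := by
    rintro θ _ rfl
    rfl
  refine (h _ _ (tmap_chart_self p)).trans ?_
  rw [hext]

end KahlerChart

/-! ### Invariant Kähler forms evaluated on fundamental fields -/

section Invariance

variable {E : Type*} [NormedAddCommGroup E] [NormedSpace ℂ E] [FiniteDimensional ℂ E]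
  {Gc : Type*} [TopologicalSpace Gc] [ChartedSpace E Gc] [Group Gc] [LieGroup 𝓘(ℂ, E) ω Gc]
  {E' : Type*} [NormedAddCommGroup E'] [NormedSpace ℂ E'] [FiniteDimensional ℂ E']
  {M : Type*} [TopologicalSpace M] [ChartedSpace E' M] [IsManifold 𝓘(ℂ, E') ω M]
  [MulAction Gc M]

/-- A form that is invariant under a one-parameter subgroup has vanishing Lie derivative along the
generator. -/
lemma lieInvariantAt_genField
    (hact : ContMDiff (𝓘(ℂ, E).prod 𝓘(ℂ, E')) 𝓘(ℂ, E') ω (fun x : Gc × M => x.1 • x.2))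
    {p : M} {z : E'} (hz : z ∈ (chartAt E' p).target)
    (hd : ContDiffAt ℂ ω (localAct E Gc E' p) (coordOne E Gc, z)) {η : TwoForm E' M}
    (hη : DifferentiableAt ℝ (localForm η p) z) {A : Set Gc} (hA : IsInvariantUnder A η)
    {γ : ℝ → Gc} {X : E} (hγ : IsOneParam γ X) (hγA : ∀ t, γ t ∈ A) :
    LieInvariantAt (localForm η p) (genField Gc E' p X) z := by
  set f := localAct E Gc E' p with hf
  have hd2 : ContDiffAt ℂ 2 f (coordOne E Gc, z) := hd.of_le le_top
  have hfz : f (coordOne E Gc, z) = z := localAct_coordOne hz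
  have hγ0 : chartAt E (1 : Gc) (γ 0) = coordOne E Gc := by rw [hγ.2.1]; rfl
  -- the derivative of `t ↦ γ t • y` and of its differential in `y`
  have hgen : HasFDerivAt (genField Gc E' p X)
      ((fderiv ℂ (fderiv ℂ f) (coordOne E Gc, z)).flip (X, 0) ∘L ContinuousLinearMap.inr ℂ E E') z :=
    hasFDerivAt_partial_right (hasFDerivAt_fderiv_apply hd2 ((X, 0) : E × E'))
  have hu : HasDerivAt (fun t => f (chartAt E (1 : Gc) (γ t), z)) (genField Gc E' p X z) 0 := by
    have h1 := (hasFDerivAt_partial_left (hd2.differentiableAt two_ne_zero).hasFDerivAt).restrictScalars ℝ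
    rw [← hγ0] at h1
    have h2 := h1.comp_hasDerivAt (0 : ℝ) hγ.2.2.2
    rw [hγ0] at h2
    exact h2
  have hD : ∀ a : E', HasDerivAt (fun t => fderiv ℂ f (chartAt E (1 : Gc) (γ t), z) (0, a))
      (fderiv ℂ (genField Gc E' p X) z a) 0 := by
    intro a
    have h1 := (hasFDerivAt_partial_left (hasFDerivAt_fderiv_apply hd2 ((0, a) : E × E'))).restrictScalars ℝ
    rw [← hγ0] at h1
    have h2 := h1.comp_hasDerivAt (0 : ℝ) hγ.2.2.2
    rw [hγ0] at h2
    rw [hgen.fderiv]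
    refine h2.congr_deriv ?_
    -- Differentiating in time the differential of the flow equals differentiating in space the
    -- generator, by symmetry of second derivatives.
    exact symm_fderiv_fderiv hd2 (X, 0) (0, a)
  have hDf0 : ∀ a : E', fderiv ℂ f (coordOne E Gc, z) (0, a) = a := by
    intro a
    have d := hasFDerivAt_partial_right (hd2.differentiableAt two_ne_zero).hasFDerivAt
    have e : (fun y => f (coordOne E Gc, y)) =ᶠ[𝓝 z] id := by
      filter_upwards [(chartAt E' p).open_target.mem_nhds hz] with y hy
      exact localAct_coordOne hy
    have := congrArg (fun L : E' →L[ℂ] E' => L a)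
      (d.unique ((hasFDerivAt_id _).congr_of_eventuallyEq e))
    exact this
  -- invariance in the chart
  have hγψ : Filter.Tendsto (fun t => (chartAt E (1 : Gc) (γ t), z)) (𝓝 0) (𝓝 (coordOne E Gc, z)) := by
    have := hγ.2.2.2.continuousAt.tendsto
    rw [hγ0] at this
    exact this.prodMk_nhds tendsto_const_nhds
  have hinv : ∀ a b, (fun t => localForm η p (f (chartAt E (1 : Gc) (γ t), z))
      ![fderiv ℂ f (chartAt E (1 : Gc) (γ t), z) (0, a),
        fderiv ℂ f (chartAt E (1 : Gc) (γ t), z) (0, b)]) =ᶠ[𝓝 0]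
      fun _ => localForm η p z ![a, b] := by
    intro a b
    filter_upwards [hγψ.eventually (eventually_localAct_mem hact hz), hγ.2.eventually_chart,
      hγψ.eventually (eventually_differentiableAt hd2)] with t h1 h2 h3
    simp only [h2] at h1
    have hsm : MDifferentiableAt 𝓘(ℂ, E') 𝓘(ℂ, E') (fun x : M => γ t • x) ((chartAt E' p).symm z) :=
      (contMDiff_const_smul_of_prod hact (γ t)).mdifferentiableAt (by simp)
    have h4 := fderiv_chart_comp hz hsm h1
    have h5 : ∀ a, fderiv ℂ f (chartAt E (1 : Gc) (γ t), z) (0, a) =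
        tmap E' E' (chartAt E' p) (γ t • (chartAt E' p).symm z)
          (tmap E' E' (fun x : M => γ t • x) ((chartAt E' p).symm z)
            (tmap E' E' (chartAt E' p).symm z a)) := by
      intro a
      have h6 := (hasFDerivAt_partial_right h3.hasFDerivAt).fderiv
      have h7 : (fun y => f (chartAt E (1 : Gc) (γ t), y)) =
          fun y => chartAt E' p (γ t • (chartAt E' p).symm y) := by
        ext y
        simp only [hf, localAct, h2]
      rw [h7, h4] at h6
      exact (congrArg (fun L : E' →L[ℂ] E' => L a) h6).symm
    have h8 : f (chartAt E (1 : Gc) (γ t), z) = chartAt E' p (γ t • (chartAt E' p).symm z) := by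
      simp only [hf, localAct, h2]
    rw [h5, h5, h8, localForm_chart η h1, localForm_apply]
    exact hA (γ t) (hγA t) _ _ _
  intro a b
  have hθ : HasDerivAt (fun t => localForm η p (f (chartAt E (1 : Gc) (γ t), z)))
      (fderiv ℝ (localForm η p) z (genField Gc E' p X z)) 0 := by
    have h1 := hη.hasFDerivAt
    have h0 : f (chartAt E (1 : Gc) (γ 0), z) = z := by rw [hγ0, hfz]
    rw [← h0] at h1
    have h2 := h1.comp_hasDerivAt (0 : ℝ) hu
    rw [h0] at h2
    exact h2
  -- The pulled-back form is constant in time, so the product rule at time zero is exactly the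
  -- vanishing of the Lie derivative.
  obtain ⟨f', hf', hfv⟩ := hasFDerivAt_twoForm_apply hθ.hasFDerivAt (hD a).hasFDerivAt
    (hD b).hasFDerivAt
  have h0 : f' = 0 :=
    hf'.unique ((hasFDerivAt_const (localForm η p z ![a, b]) (0 : ℝ)).congr_of_eventuallyEq (hinv a b))
  have h1 := hfv 1
  rw [h0, hγ0, hfz, hDf0, hDf0] at h1
  simp only [ContinuousLinearMap.toSpanSingleton_apply, one_smul] at h1
  have hR : ∀ a, fderiv ℝ (genField Gc E' p X) z a = fderiv ℂ (genField Gc E' p X) z a := fun a => by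
    rw [hgen.differentiableAt.fderiv_restrictScalars ℝ]; rfl
  rw [hR, hR, ← h1]
  rfl

variable [T2Space Gc]

lemma lieInvariantAt_of_mem_lieAlg
    (hact : ContMDiff (𝓘(ℂ, E).prod 𝓘(ℂ, E')) 𝓘(ℂ, E') ω (fun x : Gc × M => x.1 • x.2))
    {G : Subgroup Gc} (hG : IsClosed (G : Set Gc)) {η : TwoForm E' M} (hη : IsKahlerForm η)
    (hinv : IsInvariantUnder (G : Set Gc) η) {p : M} {z : E'} (hz : z ∈ (chartAt E' p).target)
    (hd : ContDiffAt ℂ ω (localAct E Gc E' p) (coordOne E Gc, z)) {X : E}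
    (hX : X ∈ lieAlg (Gc := Gc) E G) : LieInvariantAt (localForm η p) (genField Gc E' p X) z := by
  obtain ⟨γ, h1, h2⟩ := exists_isOneParam_of_mem_lieAlg hG hX
  exact lieInvariantAt_genField hact hz hd
    ((hη.contDiffAt_localForm hz).differentiableAt (by simp)) hinv h1 h2

variable (Gc) in
/-- The bracket of the Lie algebra, in terms of the model space. -/
def lieBr (X Y : E) : E :=
  Bracket.bracket (L := GroupLieAlgebra 𝓘(ℂ, E) Gc) (M := GroupLieAlgebra 𝓘(ℂ, E) Gc) X Y

lemma differentiableAt_genField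
    (hact : ContMDiff (𝓘(ℂ, E).prod 𝓘(ℂ, E')) 𝓘(ℂ, E') ω (fun x : Gc × M => x.1 • x.2)) (p : M)
    (X : E) : DifferentiableAt ℂ (genField Gc E' p X) (chartAt E' p p) :=
  (contDiffAt_genField hact p X).differentiableAt (by simp)

/-- The differential of `η (X̂, Ŷ)` is the contraction of `η` with the fundamental field of
`[X, Y]`. -/
lemma dirDeriv_apply_gen
    (hact : ContMDiff (𝓘(ℂ, E).prod 𝓘(ℂ, E')) 𝓘(ℂ, E') ω (fun x : Gc × M => x.1 • x.2))
    {G : Subgroup Gc} (hG : IsClosed (G : Set Gc)) {η : TwoForm E' M} (hη : IsKahlerForm η)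
    (hinv : IsInvariantUnder (G : Set Gc) η) {X Y : E} (hX : X ∈ lieAlg (Gc := Gc) E G)
    (hY : Y ∈ lieAlg (Gc := Gc) E G) (p : M) :
    MDifferentiableAt 𝓘(ℝ, E') 𝓘(ℝ, ℝ)
      (fun x => (η x : E' [⋀^Fin 2]→L[ℝ] ℝ) ![gen Gc E' X x, gen Gc E' Y x]) p ∧
    ∀ v : E', dirDeriv (fun x => (η x : E' [⋀^Fin 2]→L[ℝ] ℝ) ![gen Gc E' X x, gen Gc E' Y x]) p v =
      (η p : E' [⋀^Fin 2]→L[ℝ] ℝ) ![gen Gc E' (lieBr Gc X Y) p, v] := by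
  have hz := chart_mem_target (E' := E') p
  have hd := contDiffAt_localAct hact p
  obtain ⟨f', hf', hfv⟩ := fderiv_twoForm_of_lieInvariantAt
    ((hη.contDiffAt_localForm hz).differentiableAt (by simp))
    ((differentiableAt_genField hact p X).restrictScalars ℝ)
    ((differentiableAt_genField hact p Y).restrictScalars ℝ) (hη.closed p _ hz)
    (lieInvariantAt_of_mem_lieAlg hact hG hη hinv hz hd hX)
    (lieInvariantAt_of_mem_lieAlg hact hG hη hinv hz hd hY)
  set u : M → ℝ := fun x => (η x : E' [⋀^Fin 2]→L[ℝ] ℝ) ![gen Gc E' X x, gen Gc E' Y x] with hu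
  have hup : u =ᶠ[𝓝 p] fun x => localForm η p (chartAt E' p x)
      ![genField Gc E' p X (chartAt E' p x), genField Gc E' p Y (chartAt E' p x)] := by
    filter_upwards [eventually_tmap_chart_gen hact p] with x hx
    rw [← hx.2 X, ← hx.2 Y, localForm_chart η hx.1]
  have hsymm : Filter.Tendsto (chartAt E' p).symm (𝓝 (chartAt E' p p)) (𝓝 p) := by
    have := ((chartAt E' p).symm.continuousAt hz).tendsto
    rwa [(chartAt E' p).left_inv (mem_chart_source E' p)] at this
  have huz : (fun z => u ((chartAt E' p).symm z)) =ᶠ[𝓝 (chartAt E' p p)]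
      fun z => localForm η p z ![genField Gc E' p X z, genField Gc E' p Y z] := by
    filter_upwards [hsymm.eventually hup, eventually_mem_chart_target (E' := E') p] with z h1 h2
    rw [h1, (chartAt E' p).right_inv h2]
  have hder := hf'.congr_of_eventuallyEq huz
  have hmd : MDifferentiableAt 𝓘(ℝ, E') 𝓘(ℝ, ℝ) u p := by
    rw [mdifferentiableAt_real_iff]
    refine ⟨?_, hder.differentiableAt⟩
    have h1 : ContinuousAt (fun x => (fun z => localForm η p z
        ![genField Gc E' p X z, genField Gc E' p Y z]) (chartAt E' p x)) p :=
      ContinuousAt.comp hf'.continuousAt ((chartAt E' p).continuousAt (mem_chart_source E' p))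
    exact h1.congr hup.symm
  refine ⟨hmd, fun v => ?_⟩
  rw [dirDeriv_eq hmd, hder.fderiv, hfv, ← localForm_self]
  have hR : ∀ X a, fderiv ℝ (genField Gc E' p X) (chartAt E' p p) a =
      fderiv ℂ (genField Gc E' p X) (chartAt E' p p) a := fun X a => by
    rw [(differentiableAt_genField hact p X).fderiv_restrictScalars ℝ]; rfl
  rw [hR, hR, gen_eq_genField hact]
  rw [fderiv_genField_commutator hact hz hd X Y]
  rfl

/-- The Ricci form on fundamental fields, as minus `1 / 4π` times the value on the bracket of a
linear functional. -/
def ricciPotential (η : TwoForm E' M) (p : M) (X : E) : ℝ :=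
  fderiv ℝ (logDet (localForm η p) (Module.finBasis ℂ E')) (chartAt E' p p)
      (Complex.I • gen Gc E' X p) +
    2 * (Complex.I * LinearMap.trace ℂ E' (fderiv ℂ (genField Gc E' p X) (chartAt E' p p))).re

/-- Since `X̂` and `Ŷ` preserve `η`, the logarithm of the volume density changes along them by minus
twice the real part of the divergence. Then `extDeriv_dc_of_divergence` depends only on their
commutator, which is the fundamental field of `[X, Y]`. -/
lemma ricciForm_gen
    (hact : ContMDiff (𝓘(ℂ, E).prod 𝓘(ℂ, E')) 𝓘(ℂ, E') ω (fun x : Gc × M => x.1 • x.2))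
    {G : Subgroup Gc} (hG : IsClosed (G : Set Gc)) {η : TwoForm E' M} (hη : IsKahlerForm η)
    (hinv : IsInvariantUnder (G : Set Gc) η) {X Y : E} (hX : X ∈ lieAlg (Gc := Gc) E G)
    (hY : Y ∈ lieAlg (Gc := Gc) E G) (p : M) :
    (ricciForm η p : E' [⋀^Fin 2]→L[ℝ] ℝ) ![gen Gc E' X p, gen Gc E' Y p] =
      -(1 / (4 * Real.pi)) * ricciPotential (Gc := Gc) η p (lieBr Gc X Y) := by
  have hz := chart_mem_target (E' := E') p
  set e := Module.finBasis ℂ E' with he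
  set u := logDet (localForm η p) e with hu
  have hne : ∀ z ∈ (chartAt E' p).target, (hermGram (localForm η p z) e).det ≠ 0 := fun z hz =>
    det_hermGram_ne_zero (localForm η p z) (hη.localForm_map_J p z)
      (fun v hv => hη.localForm_pos hz hv) e.linearIndependent
  have hne' : (hermGram (localForm η p (chartAt E' p p)) e).det.re ≠ 0 := fun h => hne _ hz (by
    rw [← det_hermGram_real _ (hη.localForm_map_J p _) e, h, Complex.ofReal_zero])
  have hu2 : ContDiffAt ℝ 2 u (chartAt E' p p) :=
    (contDiffAt_logDet (hη.contDiffAt_localForm hz) hne').of_le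
      (WithTop.coe_le_coe.2 (le_top (a := (2 : ℕ∞))))
  have hdiv : ∀ X : E, X ∈ lieAlg (Gc := Gc) E G → ∀ᶠ z in 𝓝 (chartAt E' p p),
      fderiv ℝ u z (genField Gc E' p X z) =
        - 2 * (LinearMap.trace ℂ E' (fderiv ℂ (genField Gc E' p X) z)).re := by
    intro X hX
    filter_upwards [eventually_mem_chart_target (E' := E') p,
      eventually_contDiffAt_localAct hact p,
      (contDiffAt_genField hact p X).eventually (by simp)] with z h1 h2 h3
    exact fderiv_logDet_of_lieInvariantAt (hη.contDiffAt_localForm h1)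
      (h3.differentiableAt (by simp)) (hη.localForm_map_J p z)
      (lieInvariantAt_of_mem_lieAlg hact hG hη hinv h1 h2 hX) e (hne z h1)
  have hcomm : (fun y => fderiv ℂ (genField Gc E' p X) y (genField Gc E' p Y y) -
      fderiv ℂ (genField Gc E' p Y) y (genField Gc E' p X y)) =ᶠ[𝓝 (chartAt E' p p)]
      genField Gc E' p (lieBr Gc X Y) := by
    filter_upwards [eventually_mem_chart_target (E' := E') p,
      eventually_contDiffAt_localAct hact p] with z h1 h2
    exact fderiv_genField_commutator hact h1 h2 X Y
  rw [ricciForm_apply hη, gen_eq_genField hact, gen_eq_genField hact,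
    extDeriv_dc_of_divergence hu2 ((contDiffAt_genField hact p X).of_le le_top)
      ((contDiffAt_genField hact p Y).of_le le_top) (hdiv X hX) (hdiv Y hY), hcomm.fderiv_eq,
    fderiv_genField_commutator hact hz (contDiffAt_localAct hact p) X Y, ricciPotential,
    gen_eq_genField hact]
  rfl

end Invariance

/-! ### The differential of a holomorphic homomorphism to a torus -/

section TorusHom

variable {E : Type*} [NormedAddCommGroup E] [NormedSpace ℂ E] [FiniteDimensional ℂ E]
  {Gc : Type*} [TopologicalSpace Gc] [ChartedSpace E Gc] [Group Gc]
  {m : ℕ} {P : Subgroup Gc} {τ : P →* (Fin m → ℂˣ)}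

lemma expTorus_add (a b : Fin m → ℂ) : expTorus (a + b) = expTorus a * expTorus b := by
  ext j
  exact Complex.exp_add _ _

lemma expTorus_zero : expTorus (0 : Fin m → ℂ) = 1 := by
  ext j
  simp [expTorus]

lemma expTorus_apply (a : Fin m → ℂ) (j : Fin m) : (expTorus a j : ℂ) = Complex.exp (a j) := rfl

lemma hasDerivAt_exp_smul (c : ℂ) (t : ℝ) :
    HasDerivAt (fun t : ℝ => Complex.exp (t • c)) (Complex.exp (t • c) * c) t := by
  have h : HasDerivAt (fun t : ℝ => t • c) c t := by
    simpa using (hasDerivAt_id t).smul_const c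
  exact h.cexp

/-- A one-parameter subgroup of the torus determines its velocity. -/
lemma eq_of_expTorus_smul_eq {a b : Fin m → ℂ}
    (h : ∀ t : ℝ, expTorus (t • a) = expTorus (t • b)) : a = b := by
  funext j
  have h1 := hasDerivAt_exp_smul (a j) 0
  have h2 := hasDerivAt_exp_smul (b j) 0
  have h3 : (fun t : ℝ => Complex.exp (t • a j)) = fun t : ℝ => Complex.exp (t • b j) := by
    funext t
    exact congrArg Units.val (congrFun (h t) j)
  rw [h3] at h1
  simpa using h1.unique h2

/-- `D` is the differential of the homomorphism `τ` in the coordinates of `ℂ^m` given by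
`expTorus`. -/
def IsTorusDifferential (τ : P →* (Fin m → ℂˣ)) (D : E →L[ℂ] (Fin m → ℂ)) : Prop :=
  ∀ (c : ℝ → Gc) (X : E), HasVelocity c 1 X → (∀ᶠ s in 𝓝 0, c s ∈ P) →
    ∃ u : ℝ → (Fin m → ℂ), u 0 = 0 ∧ HasDerivAt u (D X) 0 ∧
      ∀ᶠ s in 𝓝 0, ∀ h : c s ∈ P, τ ⟨c s, h⟩ = expTorus (u s)

/-- The differential is that of a local holomorphic extension of `τ` at `1`. Off `Lie P` it may
depend on the extension; the defining property only tests curves in `P`, whose images are lifted to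
`ℂ^m` by the principal logarithm. -/
lemma IsHolomorphicHom.exists_differential (hτ : IsHolomorphicHom E τ) :
    ∃ D : E →L[ℂ] (Fin m → ℂ), IsTorusDifferential τ D := by
  obtain ⟨φ, hφ, hφτ⟩ := hτ 1
  refine ⟨tmap E (Fin m → ℂ) φ 1, fun c X hc hcP => ?_⟩
  have h1 := hc.comp (f := φ) (hφ.mdifferentiableAt (by simp))
  obtain ⟨h2, h3⟩ := hasVelocity_self.1 h1
  have hφ1 : ∀ j, φ 1 j = 1 := fun j => by
    have := hφτ.self_of_nhds P.one_mem j
    refine this.trans ?_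
    rw [show (⟨((1 : P) : Gc), P.one_mem⟩ : P) = 1 from rfl, map_one]; rfl
  have hc0 : c 0 = 1 := hc.1
  refine ⟨fun s j => Complex.log (φ (c s) j), ?_, ?_, ?_⟩
  · funext j
    simp [hc0, hφ1]
  · rw [hasDerivAt_pi]
    intro j
    have h4 := (hasDerivAt_pi.1 h3 j).clog_real (by rw [hc0, hφ1]; exact Complex.one_mem_slitPlane)
    simpa only [hc0, hφ1, div_one] using h4
  · filter_upwards [hc.tendsto.eventually hφτ] with s hs h
    ext j
    rw [expTorus_apply, hs h j, Complex.exp_log (Units.ne_zero _)]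

/-- Each coordinate `v` of the image is multiplicative with derivative `D X j` at zero, so it solves
`v' = v · D X j`. -/
lemma IsTorusDifferential.apply_oneParam {D : E →L[ℂ] (Fin m → ℂ)} (hD : IsTorusDifferential τ D)
    {γ : ℝ → Gc} {X : E} (hγ : IsOneParam γ X) (hγP : ∀ t, γ t ∈ P) (t : ℝ) :
    τ ⟨γ t, hγP t⟩ = expTorus (t • D X) := by
  obtain ⟨u, hu0, hu, hτu⟩ := hD γ X hγ.2 (Filter.Eventually.of_forall hγP)
  ext j
  rw [expTorus_apply]
  set v : ℝ → ℂ := fun t => (τ ⟨γ t, hγP t⟩ j : ℂ) with hv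
  have hv0 : v 0 = 1 := by
    have : (⟨γ 0, hγP 0⟩ : P) = 1 := Subtype.ext (map_zero_of_map_add hγ.1)
    simp [hv, this]
  have hadd : ∀ s t, v (s + t) = v s * v t := by
    intro s t
    have : (⟨γ (s + t), hγP (s + t)⟩ : P) = ⟨γ s, hγP s⟩ * ⟨γ t, hγP t⟩ := Subtype.ext (hγ.1 s t)
    simp only [hv]
    rw [this, map_mul]
    rfl
  have hd0 : HasDerivAt v (D X j) 0 := by
    have h1 := (hasDerivAt_pi.1 hu j).cexp
    rw [hu0] at h1
    simp only [Pi.zero_apply, Complex.exp_zero, one_mul] at h1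
    refine h1.congr_of_eventuallyEq ?_
    filter_upwards [hτu] with s hs
    exact congrArg Units.val (congrFun (hs (hγP s)) j)
  have hd : ∀ t, HasDerivAt v (v t * D X j) t := by
    intro t
    have h1 : HasDerivAt (fun s => v t * v (s - t)) (v t * D X j) t := by
      have : HasDerivAt (fun s => v (s - t)) (D X j) t := by
        have h0 : HasDerivAt v (D X j) (t - t) := by rwa [sub_self]
        exact h0.comp_sub_const t t
      exact this.const_mul _
    refine h1.congr_of_eventuallyEq (Filter.Eventually.of_forall fun s => ?_)
    simp only [← hadd]
    congr 1
    ring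
  -- Multiplying by the inverse exponential gives a constant function, which identifies `v`.
  have hw : ∀ t, HasDerivAt (fun t : ℝ => v t * Complex.exp (t • (-D X j))) 0 t := by
    intro t
    refine ((hd t).mul (hasDerivAt_exp_smul (-D X j) t)).congr_deriv ?_
    ring
  have hconst := is_const_of_deriv_eq_zero (fun t => (hw t).differentiableAt)
    (fun t => (hw t).deriv) t 0
  simp only [hv0, zero_smul, Complex.exp_zero, one_mul] at hconst
  have h5 : Complex.exp (t • (-D X j)) * Complex.exp (t • D X j) = 1 := by
    rw [← Complex.exp_add]; simp
  calc v t = v t * (Complex.exp (t • (-D X j)) * Complex.exp (t • D X j)) := by rw [h5, mul_one]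
    _ = Complex.exp ((t • D X) j) := by rw [← mul_assoc, hconst, one_mul]; rfl

variable [LieGroup 𝓘(ℂ, E) ω Gc] [T2Space Gc]

/-- The torus is abelian, so `D` is constant along `Ad (γ t) Y`, and the derivative of this curve at
zero is the bracket. -/
lemma IsTorusDifferential.apply_lie {D : E →L[ℂ] (Fin m → ℂ)} (hD : IsTorusDifferential τ D)
    (hP : IsClosed (P : Set Gc)) {X Y : E} (hX : X ∈ lieAlg (Gc := Gc) E P)
    (hY : Y ∈ lieAlg (Gc := Gc) E P) : D (lieBr Gc X Y) = 0 := by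
  obtain ⟨γ, hγ, hγP⟩ := exists_isOneParam_of_mem_lieAlg hP hX
  obtain ⟨δ, hδ, hδP⟩ := exists_isOneParam_of_mem_lieAlg hP hY
  obtain ⟨a, ha, ha0, had⟩ := hγ.exists_adjoint hδ
  have h1 : (fun t => D (a t)) =ᶠ[𝓝 0] fun _ => D Y := by
    filter_upwards [ha] with t ht
    refine eq_of_expTorus_smul_eq fun s => ?_
    have hmem : ∀ s, γ t * δ s * (γ t)⁻¹ ∈ P := fun s =>
      P.mul_mem (P.mul_mem (hγP t) (hδP s)) (P.inv_mem (hγP t))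
    rw [← hD.apply_oneParam ht hmem, ← hD.apply_oneParam hδ hδP]
    have : (⟨γ t * δ s * (γ t)⁻¹, hmem s⟩ : P) =
        ⟨γ t, hγP t⟩ * ⟨δ s, hδP s⟩ * (⟨γ t, hγP t⟩ : P)⁻¹ := rfl
    rw [this, map_mul, map_mul, map_inv, mul_comm, inv_mul_cancel_left]
  have h2 : HasDerivAt (fun t => D (a t)) (D (lieBr Gc X Y)) 0 :=
    (D.restrictScalars ℝ).hasFDerivAt.comp_hasDerivAt (0 : ℝ) had
  exact h2.unique ((hasDerivAt_const (0 : ℝ) (D Y)).congr_of_eventuallyEq h1)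

/-- The differential of `τ` vanishes on the Lie algebra of `ker τ ∩ G`. -/
lemma IsTorusDifferential.apply_eq_zero_of_mem_kerSubgroup {D : E →L[ℂ] (Fin m → ℂ)}
    (hD : IsTorusDifferential τ D) {G : Subgroup Gc} {X : E}
    (hX : X ∈ lieAlg (Gc := Gc) E (kerSubgroup G τ)) : D X = 0 := by
  have h : lieAlg (Gc := Gc) E (kerSubgroup G τ) ≤
      (LinearMap.ker (D.restrictScalars ℝ : E →ₗ[ℝ] (Fin m → ℂ)) : Submodule ℝ E) := by
    refine Submodule.span_le.2 ?_
    rintro X ⟨γ, hγ, hγS, hγ'⟩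
    have hv : IsOneParam (E := E) γ X :=
      ⟨hγ, (hasVelocity_iff_mfderiv (map_zero_of_map_add hγ)).2 hγ'⟩
    have hker : ∀ t, ∃ h : γ t ∈ P, τ ⟨γ t, h⟩ = 1 := fun t => by
      obtain ⟨p, hp, hpt⟩ := (hγS t).2
      obtain ⟨p, hp'⟩ := p
      change p = γ t at hpt
      subst hpt
      exact ⟨hp', hp⟩
    change D X = 0
    refine eq_of_expTorus_smul_eq fun t => ?_
    rw [← hD.apply_oneParam hv (fun t => (hker t).1), (hker t).2, smul_zero, expTorus_zero]
  exact h hX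

/-- The image of the one-parameter subgroup is the exponential of a multiple of `D X`, hence
trivial. -/
lemma IsTorusDifferential.mem_kerSubgroup {D : E →L[ℂ] (Fin m → ℂ)}
    (hD : IsTorusDifferential τ D) {G : Subgroup Gc} (hG : IsClosed (G : Set Gc))
    (hP : IsClosed (P : Set Gc)) {X : E} (hX : X ∈ lieAlg (Gc := Gc) E (G ⊓ P))
    (hDX : D X = 0) : X ∈ lieAlg (Gc := Gc) E (kerSubgroup G τ) := by
  obtain ⟨γ, hγ, hγP⟩ := exists_isOneParam_of_mem_lieAlg
    (S := G ⊓ P) (hG.inter hP) hX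
  refine hγ.mem_lieAlg fun t => ⟨(hγP t).1, ⟨γ t, (hγP t).2⟩, ?_, rfl⟩
  have := hD.apply_oneParam hγ (fun t => (hγP t).2) t
  rw [hDX, smul_zero, expTorus_zero] at this
  exact this

lemma IsHolomorphicHom.continuous (hτ : IsHolomorphicHom E τ) (j : Fin m) :
    Continuous fun x : P => (τ x j : ℂ) := by
  rw [continuous_iff_continuousAt]
  intro x
  obtain ⟨φ, hφ, hφτ⟩ := hτ x
  have h1 : ContinuousAt (fun y : P => φ y j) x :=
    (continuous_apply j).continuousAt.comp (hφ.continuousAt.comp continuous_subtype_val.continuousAt)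
  refine h1.congr ?_
  have h2 : Filter.Tendsto (fun y : P => (y : Gc)) (𝓝 x) (𝓝 x) := continuous_subtype_val.tendsto x
  filter_upwards [h2.eventually hφτ] with y hy
  exact hy y.2 j

/-- The differential of `τ` is imaginary on the Lie algebra of `G ∩ P`. -/
lemma IsTorusDifferential.re_eq_zero {D : E →L[ℂ] (Fin m → ℂ)}
    (hD : IsTorusDifferential τ D) (hτ : IsHolomorphicHom E τ) {G : Subgroup Gc}
    (hG : IsCompact (G : Set Gc))
    (hP : IsClosed (P : Set Gc)) {X : E} (hX : X ∈ lieAlg (Gc := Gc) E (G ⊓ P)) (j : Fin m) :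
    (D X j).re = 0 := by
  obtain ⟨γ, hγ, hγP⟩ := exists_isOneParam_of_mem_lieAlg
    (S := G ⊓ P) (hG.isClosed.inter hP) hX
  have hK : IsCompact ((↑) ⁻¹' (G : Set Gc) : Set P) :=
    hP.isClosedEmbedding_subtypeVal.isCompact_preimage hG
  obtain ⟨C, hC⟩ := hK.exists_bound_of_continuousOn (hτ.continuous j).continuousOn
  -- The image of the compact group `G ∩ P` is bounded, whereas an exponential with nonzero real
  -- exponent is not.
  have hb : ∀ t : ℝ, Real.exp (t * (D X j).re) ≤ C := fun t => by
    have h1 := hC ⟨γ t, (hγP t).2⟩ (hγP t).1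
    rw [hD.apply_oneParam hγ (fun t => (hγP t).2) t, expTorus_apply, Complex.norm_exp] at h1
    simpa using h1
  by_contra h0
  have h1 := hb ((C + 1) / (D X j).re)
  rw [div_mul_cancel₀ _ h0] at h1
  linarith [Real.add_one_le_exp (C + 1)]

end TorusHom

/-! ### The universal cover of the complex torus and its action -/

section TorusCover

/-- The universal cover of `(ℂˣ)^m`, written multiplicatively. -/
def TorusCover (m : ℕ) : Type := Multiplicative (Fin m → ℂ)

variable {m : ℕ}

instance : CommGroup (TorusCover m) := inferInstanceAs (CommGroup (Multiplicative (Fin m → ℂ)))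

instance : TopologicalSpace (TorusCover m) := inferInstanceAs (TopologicalSpace (Fin m → ℂ))

instance : ChartedSpace (Fin m → ℂ) (TorusCover m) :=
  inferInstanceAs (ChartedSpace (Fin m → ℂ) (Fin m → ℂ))

instance : IsManifold 𝓘(ℂ, Fin m → ℂ) ω (TorusCover m) :=
  inferInstanceAs (IsManifold 𝓘(ℂ, Fin m → ℂ) ω (Fin m → ℂ))

instance : LieGroup 𝓘(ℂ, Fin m → ℂ) ω (TorusCover m) where
  contMDiff_mul := contMDiff_add 𝓘(ℂ, Fin m → ℂ) ω (G := Fin m → ℂ)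
  contMDiff_inv := contMDiff_neg 𝓘(ℂ, Fin m → ℂ) ω (G := Fin m → ℂ)

/-- The element of the cover with the given coordinates. -/
def TorusCover.of (z : Fin m → ℂ) : TorusCover m := Multiplicative.ofAdd z

/-- The covering homomorphism. -/
def TorusCover.hom : TorusCover m →* (Fin m → ℂˣ) where
  toFun z := expTorus (Multiplicative.toAdd z)
  map_one' := expTorus_zero
  map_mul' a b := expTorus_add (Multiplicative.toAdd a) (Multiplicative.toAdd b)

variable {F : Type*} [MulAction (Fin m → ℂˣ) F]

instance : MulAction (TorusCover m) F := MulAction.compHom F TorusCover.hom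

lemma TorusCover.hasVelocity_of {u : ℝ → Fin m → ℂ} {c : Fin m → ℂ} (h0 : u 0 = 0)
    (hu : HasDerivAt u c 0) : HasVelocity (fun t => TorusCover.of (u t)) 1 c :=
  hasVelocity_self.2 ⟨h0, hu⟩

end TorusCover

/-! ### Fundamental fields along the fibre of the associated bundle -/

section Bundle

variable {EG : Type*} [NormedAddCommGroup EG] [NormedSpace ℂ EG] [FiniteDimensional ℂ EG]
  {Gc : Type*} [TopologicalSpace Gc] [ChartedSpace EG Gc] [Group Gc] [LieGroup 𝓘(ℂ, EG) ω Gc]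
  {P : Subgroup Gc} {m : ℕ} {τ : P →* (Fin m → ℂˣ)}
  {EF : Type*} [NormedAddCommGroup EF] [NormedSpace ℂ EF] [FiniteDimensional ℂ EF]
  {F : Type*} [TopologicalSpace F] [ChartedSpace EF F] [IsManifold 𝓘(ℂ, EF) ω F]
  [MulAction (Fin m → ℂˣ) F]
  {EM : Type*} [NormedAddCommGroup EM] [NormedSpace ℂ EM] [FiniteDimensional ℂ EM]
  {M : Type*} [TopologicalSpace M] [ChartedSpace EM M] [IsManifold 𝓘(ℂ, EM) ω M]
  [MulAction Gc M] {q : Gc × F → M}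

/-- A tangent vector in the kernel of the differential of a submersion is the velocity of a curve
in the fibre. -/
lemma exists_curve_of_fderiv_eq_zero {E E' : Type*} [NormedAddCommGroup E] [NormedSpace ℂ E]
    [CompleteSpace E] [NormedAddCommGroup E'] [NormedSpace ℂ E'] [FiniteDimensional ℂ E']
    {Q : E → E'} {y : E} (hQ : ContDiffAt ℂ ω Q y) (hs : Function.Surjective (fderiv ℂ Q y)) {v : E}
    (hv : fderiv ℂ Q y v = 0) :
    ∃ c : ℝ → E, c 0 = y ∧ HasDerivAt c v 0 ∧ ∀ᶠ s in 𝓝 0, Q (c s) = Q y := by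
  have h := hQ.hasStrictFDerivAt (by simp : (ω : WithTop ℕ∞) ≠ 0)
  have hr : (fderiv ℂ Q y).range = ⊤ := LinearMap.range_eq_top.2 hs
  have h1 := (h.to_implicitFunction hr).hasFDerivAt.restrictScalars ℝ
  let w : (fderiv ℂ Q y).ker := ⟨v, hv⟩
  have hw : HasDerivAt (fun s : ℝ => s • w) w 0 := by
    simpa using (hasDerivAt_id (0 : ℝ)).smul_const w
  have hw0 : (0 : ℝ) • w = 0 := zero_smul _ _
  -- The implicit function theorem parametrizes the level set by the kernel; the curve is the image
  -- of the line through `w`.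
  refine ⟨fun s => h.implicitFunction Q _ hr (Q y) (s • w), ?_, ?_, ?_⟩
  · simp only [hw0]
    exact h.implicitFunction_apply_image hr
  · rw [← hw0] at h1
    exact h1.comp_hasDerivAt (0 : ℝ) hw
  · have h2 := h.map_implicitFunction_eq hr
    have h3 : Filter.Tendsto (fun s : ℝ => (Q y, s • w)) (𝓝 0) (𝓝 (Q y, 0)) := by
      have := hw.continuousAt.tendsto
      rw [hw0] at this
      exact tendsto_const_nhds.prodMk_nhds this
    exact h3.eventually h2

lemma IsAssociatedBundle.mdifferentiableAt (hM : IsAssociatedBundle EG EF EM τ q) (y : Gc × F) :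
    MDifferentiableAt (𝓘(ℂ, EG).prod 𝓘(ℂ, EF)) 𝓘(ℂ, EM) q y :=
  (hM.holomorphic y).mdifferentiableAt (by simp)

lemma IsAssociatedBundle.mdifferentiableAt_fibre (hM : IsAssociatedBundle EG EF EM τ q) (x : F) :
    MDifferentiableAt 𝓘(ℂ, EF) 𝓘(ℂ, EM) (fun y : F => q (1, y)) x :=
  (hM.holomorphic.comp (contMDiff_const.prodMk contMDiff_id) x).mdifferentiableAt (by simp)

/-- By equivariance `g • q (1, x) = q (g, x)`, so the fundamental field is the partial derivative of
`q` in the group direction. -/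
lemma IsAssociatedBundle.gen_eq (hM : IsAssociatedBundle EG EF EM τ q) (X : EG) (x : F) :
    gen Gc EM X (q (1, x)) = tmap₂ EG EF EM q (1, x) (X, 0) := by
  obtain ⟨c, hc⟩ := exists_hasVelocity (1 : Gc) X
  have h1 := hc.comp (f := fun g : Gc => g • q (1, x))
    ((contMDiff_smul_const hM.contMDiff_smul (q (1, x))).mdifferentiableAt (by simp))
  have h2 := hc.comp₂ (hasVelocity_const (E := EF) x) (hM.mdifferentiableAt (1, x))
  have h3 : (fun s => c s • q (1, x)) = fun s => q (c s, x) := by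
    funext s
    rw [hM.equivariant, mul_one]
  simp only [one_smul] at h1
  rw [h3] at h1
  exact h1.unique h2

lemma IsAssociatedBundle.tmap_fibre_eq (hM : IsAssociatedBundle EG EF EM τ q) (ξ : EF) (x : F) :
    tmap EF EM (fun y : F => q (1, y)) x ξ = tmap₂ EG EF EM q (1, x) (0, ξ) := by
  obtain ⟨c, hc⟩ := exists_hasVelocity x ξ
  have h1 := hc.comp (hM.mdifferentiableAt_fibre x)
  have h2 := (hasVelocity_const (E := EG) (1 : Gc)).comp₂ hc (hM.mdifferentiableAt (1, x))
  exact h1.unique h2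

lemma IsAssociatedBundle.tmap₂_eq (hM : IsAssociatedBundle EG EF EM τ q) (X : EG) (ξ : EF)
    (x : F) : tmap₂ EG EF EM q (1, x) (X, ξ) =
      gen Gc EM X (q (1, x)) + tmap EF EM (fun y : F => q (1, y)) x ξ := by
  rw [hM.gen_eq, hM.tmap_fibre_eq, ← map_add]
  simp

lemma IsAssociatedBundle.apply_mem (hM : IsAssociatedBundle EG EF EM τ q) {g : Gc} (hg : g ∈ P)
    (x : F) : q (g, x) = q (1, τ ⟨g, hg⟩ • x) :=
  ((hM.fibres 1 g (τ ⟨g, hg⟩ • x) x).2 ⟨⟨g, hg⟩, (one_mul g).symm, rfl⟩).symm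

variable (EF) in
/-- The vector field on the toric manifold generated by an element of the Lie algebra of the
torus. -/
def torusGen (c : Fin m → ℂ) (x : F) : EF := gen (TorusCover m) EF c x

lemma torusGen_smul (a : ℂ) (c : Fin m → ℂ) (x : F) :
    torusGen EF (a • c) x = a • torusGen EF c x := map_smul _ _ _

lemma torusGen_neg (c : Fin m → ℂ) (x : F) :
    torusGen EF (-c) x = -torusGen EF c x := map_neg _ _

lemma torusGen_add (c d : Fin m → ℂ) (x : F) :
    torusGen EF (c + d) x = torusGen EF c x + torusGen EF d x := map_add _ _ _

lemma torusGen_zero (x : F) : torusGen EF (0 : Fin m → ℂ) x = 0 := map_zero _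

lemma contMDiff_torusCover_smul
    (hT : ContMDiff (𝓘(ℂ, Fin m → ℂ).prod 𝓘(ℂ, EF)) 𝓘(ℂ, EF) ω
      (fun z : (Fin m → ℂ) × F => expTorus z.1 • z.2)) :
    ContMDiff (𝓘(ℂ, Fin m → ℂ).prod 𝓘(ℂ, EF)) 𝓘(ℂ, EF) ω
      (fun z : TorusCover m × F => z.1 • z.2) := hT

lemma hasVelocity_expTorus_smul (hT : ContMDiff (𝓘(ℂ, Fin m → ℂ).prod 𝓘(ℂ, EF)) 𝓘(ℂ, EF) ω
    (fun z : (Fin m → ℂ) × F => expTorus z.1 • z.2)) {u : ℝ → Fin m → ℂ} {c : Fin m → ℂ}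
    (h0 : u 0 = 0) (hu : HasDerivAt u c 0) (x : F) :
    HasVelocity (fun t => expTorus (u t) • x) x (torusGen EF c x) := by
  have h1 := (TorusCover.hasVelocity_of h0 hu).comp (f := fun g : TorusCover m => g • x)
    ((contMDiff_smul_const (contMDiff_torusCover_smul hT) x).mdifferentiableAt (by simp))
  simp only [one_smul] at h1
  exact h1

lemma hasDerivAt_smul_zero (c : Fin m → ℂ) : HasDerivAt (fun t : ℝ => t • c) c 0 := by
  simpa using (hasDerivAt_id (0 : ℝ)).smul_const c

variable [T2Space Gc] {D : EG →L[ℂ] (Fin m → ℂ)}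

/-- The fundamental field of an element of the Lie algebra of `P` is tangent to the fibre. -/
lemma IsAssociatedBundle.gen_of_mem (hM : IsAssociatedBundle EG EF EM τ q)
    (hT : ContMDiff (𝓘(ℂ, Fin m → ℂ).prod 𝓘(ℂ, EF)) 𝓘(ℂ, EF) ω
      (fun z : (Fin m → ℂ) × F => expTorus z.1 • z.2))
    (hD : IsTorusDifferential τ D) (hP : IsClosed (P : Set Gc)) {Y : EG}
    (hY : Y ∈ lieAlg (Gc := Gc) EG P) (x : F) :
    gen Gc EM Y (q (1, x)) = tmap EF EM (fun y : F => q (1, y)) x (torusGen EF (D Y) x) := by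
  obtain ⟨γ, hγ, hγP⟩ := exists_isOneParam_of_mem_lieAlg hP hY
  have h1 := hγ.2.comp₂ (hasVelocity_const (E := EF) x) (hM.mdifferentiableAt (1, x))
  have h2 := (hasVelocity_expTorus_smul hT (by simp) (hasDerivAt_smul_zero (D Y)) x).comp
    (hM.mdifferentiableAt_fibre x)
  have h3 : (fun t => q (γ t, x)) = fun t => q (1, expTorus (t • D Y) • x) := by
    funext t
    rw [hM.apply_mem (hγP t), hD.apply_oneParam hγ hγP]
  rw [h3, ← hM.gen_eq] at h1
  exact h1.unique h2

lemma HasVelocity.of_chart {E : Type*} [NormedAddCommGroup E] [NormedSpace ℂ E] {N : Type*}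
    [TopologicalSpace N] [ChartedSpace E N] [IsManifold 𝓘(ℂ, E) ω N] {p : N} {a : ℝ → E} {v : E}
    (ha : HasVelocity a (chartAt E p p) v) : HasVelocity (fun s => (chartAt E p).symm (a s)) p v := by
  have h1 := ha.comp (mdifferentiableAt_chart_symm (chart_mem_target p))
  have h2 := congrArg (fun L : E →L[ℂ] E => L v) (tmap_chart_symm_comp (mem_chart_source E p))
  rw [tmap_chart_self] at h2
  have h3 : tmap E E (chartAt E p).symm (chartAt E p p) v = v := h2
  rw [h3, (chartAt E p).left_inv (mem_chart_source E p)] at h1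
  exact h1

lemma IsAssociatedBundle.exists_curve (hM : IsAssociatedBundle EG EF EM τ q) {Y : EG} {ξ : EF}
    {x : F} (h : tmap₂ EG EF EM q (1, x) (Y, ξ) = 0) :
    ∃ (g : ℝ → Gc) (y : ℝ → F), HasVelocity g 1 Y ∧ HasVelocity y x ξ ∧
      ∀ᶠ s in 𝓝 0, q (g s, y s) = q (1, x) := by
  have hc := contDiffAt_of_contMDiffAt_prod (hM.holomorphic (1, x))
  have hd := hasFDerivAt_of_mdifferentiableAt_prod (hM.mdifferentiableAt (1, x))
  have hsurj : Function.Surjective (tmap₂ EG EF EM q (1, x)) := hM.submersion (1, x)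
  have := FiniteDimensional.complete ℂ (EG × EF)
  obtain ⟨c, hc0, hcd, hcq⟩ := exists_curve_of_fderiv_eq_zero hc (by rw [hd.fderiv]; exact hsurj)
    (v := (Y, ξ)) (by rw [hd.fderiv]; exact h)
  have hg : HasVelocity (fun s => (c s).1) (chartAt EG (1 : Gc) 1) Y :=
    hasVelocity_self.2 ⟨by rw [hc0], hcd.fst⟩
  have hy : HasVelocity (fun s => (c s).2) (chartAt EF x x) ξ :=
    hasVelocity_self.2 ⟨by rw [hc0], hcd.snd⟩
  have hg' := hg.of_chart
  have hy' := hy.of_chart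
  refine ⟨_, _, hg', hy', ?_⟩
  have hq := (hg'.comp₂ hy' (hM.mdifferentiableAt (1, x))).tendsto
  filter_upwards [hcq, hq.eventually_mem ((chartAt EM (q (1, x))).open_source.mem_nhds
    (mem_chart_source EM (q (1, x))))] with s h1 h2
  refine (chartAt EM (q (1, x))).injOn h2 (mem_chart_source EM _) ?_
  simp only [(chartAt EG (1 : Gc)).left_inv (mem_chart_source EG (1 : Gc)),
    (chartAt EF x).left_inv (mem_chart_source EF x)] at h1
  exact h1

/-- The kernel of the differential of the quotient map. -/
lemma IsAssociatedBundle.of_tmap₂_eq_zero (hM : IsAssociatedBundle EG EF EM τ q)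
    (hT : ContMDiff (𝓘(ℂ, Fin m → ℂ).prod 𝓘(ℂ, EF)) 𝓘(ℂ, EF) ω
      (fun z : (Fin m → ℂ) × F => expTorus z.1 • z.2))
    (hD : IsTorusDifferential τ D) (hP : IsClosed (P : Set Gc)) {Y : EG} {ξ : EF}
    {x : F} (h : tmap₂ EG EF EM q (1, x) (Y, ξ) = 0) :
    Y ∈ lieAlg (Gc := Gc) EG P ∧ ξ = -torusGen EF (D Y) x := by
  obtain ⟨g, y, hg, hy, hgy⟩ := hM.exists_curve h
  -- A curve in a fibre of `q` moves along a `P`-orbit: its group part stays in `P` and its part in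
  -- `F` is carried along by `τ`.
  have hfib : ∀ᶠ s in 𝓝 0, ∃ h : g s ∈ P, x = τ ⟨g s, h⟩ • y s := by
    filter_upwards [hgy] with s hs
    obtain ⟨p, hp, hx⟩ := (hM.fibres 1 (g s) x (y s)).1 hs.symm
    have hp' : g s = p := by rw [hp, one_mul]
    have hmem : g s ∈ P := by rw [hp']; exact p.2
    refine ⟨hmem, ?_⟩
    rwa [show (⟨g s, hmem⟩ : P) = p from Subtype.ext hp']
  have hgP : ∀ᶠ s in 𝓝 0, g s ∈ P := hfib.mono fun s hs => hs.1
  obtain ⟨u, hu0, hu, hτu⟩ := hD g Y hg hgP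
  refine ⟨mem_lieAlg_of_hasVelocity hP hg hgP, ?_⟩
  have h1 := hasVelocity_expTorus_smul hT (u := fun s => -u s) (by simp [hu0]) hu.neg x
  have h2 : y =ᶠ[𝓝 0] fun s => expTorus (-u s) • x := by
    filter_upwards [hfib, hτu] with s ⟨h3, h4⟩ h5
    have h6 : expTorus (-u s) * expTorus (u s) = 1 := by
      rw [← expTorus_add, neg_add_cancel, expTorus_zero]
    rw [h5 h3] at h4
    change y s = expTorus (-u s) • x
    conv_rhs => rw [h4]
    rw [smul_smul, h6, one_smul]
  rw [← torusGen_neg]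
  exact hy.unique (h1.congr h2)

/-- A vertical vector in the kernel has group component zero, and its component in `F` is the torus
field of `D 0`. This makes `Function.invFun` in `fibreField` a genuine inverse on the tangent space
of the fibre. -/
lemma IsAssociatedBundle.tmap_fibre_injective (hM : IsAssociatedBundle EG EF EM τ q)
    (hT : ContMDiff (𝓘(ℂ, Fin m → ℂ).prod 𝓘(ℂ, EF)) 𝓘(ℂ, EF) ω
      (fun z : (Fin m → ℂ) × F => expTorus z.1 • z.2))
    (hD : IsTorusDifferential τ D) (hP : IsClosed (P : Set Gc)) (x : F) :
    Function.Injective (tmap EF EM (fun y : F => q (1, y)) x) := by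
  refine (injective_iff_map_eq_zero _).2 fun ξ hξ => ?_
  rw [hM.tmap_fibre_eq] at hξ
  have := (hM.of_tmap₂_eq_zero hT hD hP hξ).2
  rwa [map_zero, torusGen_zero, neg_zero] at this

/-- If `Ŷ` agrees with a vector tangent to the fibre, their difference lies in the kernel of the
differential of `q`, whose group component is in `Lie P`. -/
lemma IsAssociatedBundle.mem_of_gen_eq (hM : IsAssociatedBundle EG EF EM τ q)
    (hT : ContMDiff (𝓘(ℂ, Fin m → ℂ).prod 𝓘(ℂ, EF)) 𝓘(ℂ, EF) ω
      (fun z : (Fin m → ℂ) × F => expTorus z.1 • z.2))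
    (hD : IsTorusDifferential τ D) (hP : IsClosed (P : Set Gc)) {Y : EG} {ξ : EF} {x : F}
    (h : gen Gc EM Y (q (1, x)) = tmap EF EM (fun y : F => q (1, y)) x ξ) :
    Y ∈ lieAlg (Gc := Gc) EG P := by
  refine (hM.of_tmap₂_eq_zero hT hD hP (Y := Y) (ξ := -ξ) (x := x) ?_).1
  rw [hM.tmap₂_eq, map_neg, h, add_neg_cancel]

/-- The elements of the Lie algebra that fix a point of the fibre infinitesimally. -/
lemma IsAssociatedBundle.gen_eq_zero_iff (hM : IsAssociatedBundle EG EF EM τ q)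
    (hT : ContMDiff (𝓘(ℂ, Fin m → ℂ).prod 𝓘(ℂ, EF)) 𝓘(ℂ, EF) ω
      (fun z : (Fin m → ℂ) × F => expTorus z.1 • z.2))
    (hD : IsTorusDifferential τ D) (hP : IsClosed (P : Set Gc)) {Y : EG} {x : F} :
    gen Gc EM Y (q (1, x)) = 0 ↔ Y ∈ lieAlg (Gc := Gc) EG P ∧ torusGen EF (D Y) x = 0 := by
  constructor
  · intro h
    have hY : Y ∈ lieAlg (Gc := Gc) EG P := hM.mem_of_gen_eq hT hD hP (ξ := 0) (x := x) (by simpa)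
    refine ⟨hY, ?_⟩
    rw [hM.gen_of_mem hT hD hP hY] at h
    exact (injective_iff_map_eq_zero _).1 (hM.tmap_fibre_injective hT hD hP x) _ h
  · rintro ⟨hY, h⟩
    rw [hM.gen_of_mem hT hD hP hY, h, map_zero]

/-- The Lie algebra of `P` is a complex subspace. -/
lemma IsAssociatedBundle.smul_mem (hM : IsAssociatedBundle EG EF EM τ q)
    (hT : ContMDiff (𝓘(ℂ, Fin m → ℂ).prod 𝓘(ℂ, EF)) 𝓘(ℂ, EF) ω
      (fun z : (Fin m → ℂ) × F => expTorus z.1 • z.2))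
    (hD : IsTorusDifferential τ D) (hP : IsClosed (P : Set Gc)) [Nonempty F] (a : ℂ) {Y : EG}
    (hY : Y ∈ lieAlg (Gc := Gc) EG P) : a • Y ∈ lieAlg (Gc := Gc) EG P := by
  obtain ⟨x⟩ := ‹Nonempty F›
  -- Membership in `Lie P` is tangency to the fibre, and the tangent space of the fibre is complex.
  refine hM.mem_of_gen_eq hT hD hP (ξ := a • torusGen EF (D Y) x) (x := x) ?_
  rw [map_smul, ← hM.gen_of_mem hT hD hP hY]
  exact map_smul (tmap EG EM (fun g : Gc => g • q (1, x)) 1) a Y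

lemma IsAssociatedBundle.fibreField_eq (hM : IsAssociatedBundle EG EF EM τ q)
    (hT : ContMDiff (𝓘(ℂ, Fin m → ℂ).prod 𝓘(ℂ, EF)) 𝓘(ℂ, EF) ω
      (fun z : (Fin m → ℂ) × F => expTorus z.1 • z.2))
    (hD : IsTorusDifferential τ D) (hP : IsClosed (P : Set Gc)) {Y : EG}
    (hY : Y ∈ lieAlg (Gc := Gc) EG P) (x : F) :
    fibreField (E := EG) (E' := EF) (E'' := EM) q Y x = torusGen EF (D Y) x := by
  have h1 := hM.gen_of_mem hT hD hP hY x
  have h2 := Function.leftInverse_invFun (hM.tmap_fibre_injective hT hD hP x) (torusGen EF (D Y) x)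
  rw [← h1] at h2
  exact h2

end Bundle

/-! ### Toric manifolds -/

section ConstantCurve

variable {E : Type*} [NormedAddCommGroup E] [NormedSpace ℂ E]
  {M : Type*} [TopologicalSpace M] [ChartedSpace E M] [IsManifold 𝓘(ℂ, E) ω M]

lemma tmap_chart_injective {p₀ p : M} (hp : p ∈ (chartAt E p₀).source) :
    Function.Injective (tmap E E (chartAt E p₀) p) := by
  have h := tmap_chart_symm_comp (E := E) hp
  exact Function.LeftInverse.injective (g := tmap E E (chartAt E p₀).symm (chartAt E p₀ p))
    fun v => congrArg (fun L : E →L[ℂ] E => L v) h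

/-- A curve with vanishing velocity is constant. -/
lemma eq_of_hasVelocity_zero {c : ℝ → M}
    (hc : ∀ t, HasVelocity (fun s => c (s + t)) (c t) (0 : E)) (t : ℝ) : c t = c 0 := by
  have hcont : Continuous c := by
    rw [continuous_iff_continuousAt]
    intro t
    have h1 : ContinuousAt (fun s => c (s + t)) (t - t) := by
      rw [sub_self]; exact (hc t).continuousAt
    have h2 := h1.comp (f := fun s : ℝ => s - t) (by fun_prop)
    simpa [Function.comp_def] using h2
  have hloc : IsLocallyConstant c := by
    refine (IsLocallyConstant.iff_eventually_eq c).2 fun t₀ => ?_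
    have hsrc : c ⁻¹' (chartAt E (c t₀)).source ∈ 𝓝 t₀ :=
      hcont.continuousAt.preimage_mem_nhds
        ((chartAt E (c t₀)).open_source.mem_nhds (mem_chart_source E _))
    obtain ⟨ε, hε, hball⟩ := Metric.mem_nhds_iff.1 hsrc
    have hd : ∀ t ∈ Metric.ball t₀ ε, HasDerivAt (fun s => chartAt E (c t₀) (c s)) 0 t := by
      intro t ht
      have h1 := (hc t).comp (mdifferentiableAt_chart (E := E) (hball ht))
      rw [map_zero] at h1
      have h2 := (hasVelocity_self.1 h1).2
      have h3 : HasDerivAt (fun s => chartAt E (c t₀) (c (s + t))) 0 (t - t) := by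
        rwa [sub_self]
      have h4 := h3.comp_sub_const t t
      simpa using h4
    -- In a chart the derivative vanishes on an interval, so the curve is locally constant, and `ℝ`
    -- is connected.
    have hconst := fun x hx => Metric.isOpen_ball.is_const_of_deriv_eq_zero (x := x)
      (convex_ball t₀ ε).isPreconnected
      (fun t ht => (hd t ht).differentiableAt.differentiableWithinAt)
      (fun t ht => (hd t ht).deriv) hx (Metric.mem_ball_self hε)
    filter_upwards [Metric.ball_mem_nhds t₀ hε] with t ht
    exact (chartAt E (c t₀)).injOn (hball ht) (mem_chart_source E _)
      (hconst t ht)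
  exact hloc.apply_eq_of_preconnectedSpace t 0

end ConstantCurve

section Toric

variable {m : ℕ} {EF : Type*} [NormedAddCommGroup EF] [NormedSpace ℂ EF] [FiniteDimensional ℂ EF]
  {F : Type*} [TopologicalSpace F] [ChartedSpace EF F] [IsManifold 𝓘(ℂ, EF) ω F]
  [MulAction (Fin m → ℂˣ) F]

lemma hasVelocity_expTorus_smul_add (hT : ContMDiff (𝓘(ℂ, Fin m → ℂ).prod 𝓘(ℂ, EF)) 𝓘(ℂ, EF) ω
    (fun z : (Fin m → ℂ) × F => expTorus z.1 • z.2)) (c : Fin m → ℂ) (x : F) (t : ℝ) :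
    HasVelocity (fun s : ℝ => expTorus ((s + t) • c) • x) (expTorus (t • c) • x)
      (torusGen EF c (expTorus (t • c) • x)) := by
  have h := hasVelocity_expTorus_smul hT (by simp) (hasDerivAt_smul_zero c) (expTorus (t • c) • x)
  have e : (fun s : ℝ => expTorus ((s + t) • c) • x) =
      fun s : ℝ => expTorus (s • c) • expTorus (t • c) • x := by
    funext s
    rw [smul_smul, ← expTorus_add, ← add_smul]
  rwa [e]

/-- The torus is commutative, so its action preserves its own generators. -/
lemma torusGen_expTorus_smul (hT : ContMDiff (𝓘(ℂ, Fin m → ℂ).prod 𝓘(ℂ, EF)) 𝓘(ℂ, EF) ω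
    (fun z : (Fin m → ℂ) × F => expTorus z.1 • z.2)) (c z : Fin m → ℂ) (x : F) :
    tmap EF EF (fun y : F => expTorus z • y) x (torusGen EF c x) =
      torusGen EF c (expTorus z • x) := by
  have h0 : MDifferentiableAt 𝓘(ℂ, EF) 𝓘(ℂ, EF) (fun y : F => expTorus z • y) x :=
    (contMDiff_const_smul_of_prod (contMDiff_torusCover_smul hT)
      (TorusCover.of z)).mdifferentiableAt (by simp)
  have h1 := (hasVelocity_expTorus_smul hT (by simp) (hasDerivAt_smul_zero c) x).comp h0
  have h2 := hasVelocity_expTorus_smul hT (by simp) (hasDerivAt_smul_zero c) (expTorus z • x)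
  have e : (fun t : ℝ => expTorus z • expTorus (t • c) • x) =
      fun t : ℝ => expTorus (t • c) • expTorus z • x := by
    funext t
    rw [smul_smul, smul_smul, mul_comm]
  rw [e] at h1
  exact h1.unique h2

lemma expTorus_smul_eq_of_torusGen_eq_zero
    (hT : ContMDiff (𝓘(ℂ, Fin m → ℂ).prod 𝓘(ℂ, EF)) 𝓘(ℂ, EF) ω
      (fun z : (Fin m → ℂ) × F => expTorus z.1 • z.2)) {c : Fin m → ℂ} {x : F}
    (h : torusGen EF c x = 0) (t : ℝ) : expTorus (t • c) • x = x := by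
  have h1 := eq_of_hasVelocity_zero (E := EF) (c := fun t : ℝ => expTorus (t • c) • x) (fun t => by
    have h2 := hasVelocity_expTorus_smul_add hT c x t
    rwa [← torusGen_expTorus_smul hT, h, map_zero] at h2) t
  simpa [expTorus_zero] using h1

lemma expTorus_mem_compactTorus {c : Fin m → ℂ} (hc : ∀ j, (c j).re = 0) :
    expTorus c ∈ compactTorus m := fun j => by
  rw [expTorus_apply, Complex.norm_exp, hc j, Real.exp_zero]

/-- The orbits of the compact torus are isotropic: generators of the circles. -/
lemma IsToricKahler.exists_isotropic (hF : IsToricKahler EF m F) :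
    ∃ η : TwoForm EF F, IsKahlerForm η ∧ ∀ (x : F) (j k : Fin m),
      (η x : EF [⋀^Fin 2]→L[ℝ] ℝ) ![torusGen EF (Pi.single j Complex.I) x,
        torusGen EF (Pi.single k Complex.I) x] = 0 := by
  obtain ⟨η, hη, hinv, μ, hμ⟩ := hF.kahler
  have hT := hF.holomorphic
  refine ⟨η, hη, fun x j k => ?_⟩
  set c : Fin m → ℂ := Pi.single j Complex.I with hc
  set d : Fin m → ℂ := Pi.single k Complex.I with hd
  have hμ' : ∀ (x : F) (v : EF), dirDeriv (μ k) x v =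
      (η x : EF [⋀^Fin 2]→L[ℝ] ℝ) ![v, torusGen EF d x] := fun x v => (hμ k).2 x v
  have hc' : ∀ t : ℝ, expTorus (t • c) ∈ compactTorus m := fun t => by
    refine expTorus_mem_compactTorus fun i => ?_
    by_cases h : i = j
    · subst h; simp [hc]
    · simp [hc, h]
  set a := (η x : EF [⋀^Fin 2]→L[ℝ] ℝ) ![torusGen EF c x, torusGen EF d x] with ha
  -- Along the flow of the `j`-th circle the `k`-th moment function has derivative `η (Ŵ_j, Ŵ_k)`,
  -- constant because form and generators are invariant.
  have hder : ∀ t : ℝ, HasDerivAt (fun t : ℝ => μ k (expTorus (t • c) • x)) a t := by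
    intro t
    have h1 := (hasVelocity_expTorus_smul_add hT c x t).comp_real
      (((hμ k).1 _).mdifferentiableAt (by simp) : MDifferentiableAt 𝓘(ℝ, EF) 𝓘(ℝ, ℝ) (μ k) _)
    have h2 : dirDeriv (μ k) (expTorus (t • c) • x) (torusGen EF c (expTorus (t • c) • x)) = a := by
      rw [hμ', ← torusGen_expTorus_smul hT, ← torusGen_expTorus_smul hT d]
      exact hinv _ (hc' t) x _ _
    rw [h2] at h1
    have h3 : HasDerivAt (fun s : ℝ => μ k (expTorus ((s + t) • c) • x)) a (t - t) := by
      rwa [sub_self]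
    have h4 := h3.comp_sub_const t t
    simpa using h4
  have hlin : ∀ t : ℝ, HasDerivAt (fun t : ℝ => μ k (expTorus (t • c) • x) - t * a) 0 t := by
    intro t
    have h := (hder t).sub ((hasDerivAt_id t).mul_const a)
    simp only [one_mul, sub_self] at h
    exact h
  have hconst := is_const_of_deriv_eq_zero (fun t => (hlin t).differentiableAt)
    (fun t => (hlin t).deriv) (2 * Real.pi) 0
  -- The flow is periodic, and an affine periodic function has zero slope.
  have hper : expTorus ((2 * Real.pi) • c) = 1 := by
    ext i
    rw [expTorus_apply]
    by_cases h : i = j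
    · subst h
      have : (2 * Real.pi) • c i = 2 * Real.pi * Complex.I := by simp [hc]
      rw [Pi.smul_apply, this, Complex.exp_two_pi_mul_I]; rfl
    · simp [hc, h]
  simp only [hper, zero_smul, expTorus_zero, zero_mul, sub_zero] at hconst
  have : 2 * Real.pi * a = 0 := by linarith
  simpa [Real.pi_ne_zero] using this

/-- Orbits of the compact torus are isotropic for a Kähler form, hence totally real. If the real and
imaginary contributions cancel, then `w` and `J w` are both tangent to the orbit, so the form
vanishes on them and `w = 0` by positivity. -/
lemma IsToricKahler.torusGen_re_im_eq_zero (hF : IsToricKahler EF m F) {c : Fin m → ℂ} {x : F}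
    (h : torusGen EF c x = 0) : torusGen EF (fun j => ((c j).re : ℂ)) x = 0 ∧
      torusGen EF (fun j => ((c j).im : ℂ)) x = 0 := by
  obtain ⟨η, hη, hiso⟩ := hF.exists_isotropic
  have hsum : ∀ b : Fin m → ℝ, torusGen EF (Complex.I • fun j => (b j : ℂ)) x =
      ∑ j, b j • torusGen EF (Pi.single j Complex.I) x := by
    intro b
    have h1 : (Complex.I • fun j => (b j : ℂ)) =
        ∑ j, (b j : ℂ) • (Pi.single j Complex.I : Fin m → ℂ) := by
      funext i
      simp [Finset.sum_apply, Pi.single_apply, mul_comm]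
    rw [h1]
    refine (map_sum (tmap (Fin m → ℂ) EF (fun g : TorusCover m => g • x) 1) _ _).trans
      (Finset.sum_congr rfl fun j _ => ?_)
    exact (map_smul (tmap (Fin m → ℂ) EF (fun g : TorusCover m => g • x) 1) _ _)
  obtain ⟨θ, hθ, hpos⟩ : ∃ θ : EF [⋀^Fin 2]→L[ℝ] ℝ, (∀ j k : Fin m,
      θ ![torusGen EF (Pi.single j Complex.I) x, torusGen EF (Pi.single k Complex.I) x] = 0) ∧
      ∀ v : EF, v ≠ 0 → 0 < θ ![v, Complex.I • v] := ⟨η x, hiso x, hη.pos x⟩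
  have hiso' : ∀ a b : Fin m → ℝ, θ
      ![torusGen EF (Complex.I • fun j => (a j : ℂ)) x,
        torusGen EF (Complex.I • fun j => (b j : ℂ)) x] = 0 := by
    intro a b
    rw [hsum, hsum, twoForm_sum_left]
    refine Finset.sum_eq_zero fun i _ => ?_
    rw [twoForm_smul_left, twoForm_swap, twoForm_sum_left, Finset.sum_eq_zero, neg_zero, mul_zero]
    intro j _
    rw [twoForm_smul_left, hθ, mul_zero]
  set a : Fin m → ℝ := fun j => (c j).re
  set b : Fin m → ℝ := fun j => (c j).im
  have hcab : c = (fun j => (a j : ℂ)) + Complex.I • fun j => (b j : ℂ) := by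
    funext j
    simp only [Pi.add_apply, Pi.smul_apply, smul_eq_mul, a, b]
    rw [mul_comm, Complex.re_add_im]
  set u := torusGen EF (fun j => (a j : ℂ)) x
  set w := torusGen EF (Complex.I • fun j => (b j : ℂ)) x with hw
  have huw : u = -w := by
    rw [hcab, torusGen_add] at h
    exact eq_neg_of_add_eq_zero_left h
  have hIu : torusGen EF (Complex.I • fun j => (a j : ℂ)) x = Complex.I • u := torusGen_smul _ _ _
  have hw0 : w = 0 := by
    by_contra h0
    have h1 := hpos w h0
    have h2 := hiso' b a
    rw [hIu, huw, smul_neg, twoForm_neg_right] at h2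
    exact h1.ne' (neg_eq_zero.1 h2)
  refine ⟨by rw [huw, hw0, neg_zero], ?_⟩
  rw [hw, torusGen_smul] at hw0
  exact (smul_eq_zero.1 hw0).resolve_left Complex.I_ne_zero

/-- A generator that vanishes on an open set vanishes identically. -/
lemma torusGen_eq_zero_of_eventually [ConnectedSpace F]
    (hT : ContMDiff (𝓘(ℂ, Fin m → ℂ).prod 𝓘(ℂ, EF)) 𝓘(ℂ, EF) ω
      (fun z : (Fin m → ℂ) × F => expTorus z.1 • z.2)) {c : Fin m → ℂ} {x₀ : F}
    (h : ∀ᶠ x in 𝓝 x₀, torusGen EF c x = 0) (x : F) : torusGen EF c x = 0 := by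
  set A : Set F := {x | ∀ᶠ y in 𝓝 x, torusGen EF c y = 0} with hA
  have hopen : IsOpen A := isOpen_iff_mem_nhds.2 fun x hx => eventually_eventually_nhds.2 hx
  have hclosed : IsClosed A := by
    refine isClosed_of_closure_subset fun x₁ hx₁ => ?_
    have hact := contMDiff_torusCover_smul hT
    have hev := eventually_tmap_chart_gen hact x₁
    obtain ⟨U, hU, hUo, hxU⟩ := eventually_nhds_iff.1 hev
    have han := (contDiffAt_genField hact x₁ c).eventually (by simp)
    have hsymm : Filter.Tendsto (chartAt EF x₁).symm (𝓝 (chartAt EF x₁ x₁)) (𝓝 x₁) := by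
      have := ((chartAt EF x₁).symm.continuousAt (chart_mem_target x₁)).tendsto
      rwa [(chartAt EF x₁).left_inv (mem_chart_source EF x₁)] at this
    obtain ⟨r, hr, hball⟩ := Metric.eventually_nhds_iff_ball.1 ((han.and
      (eventually_mem_chart_target (E' := EF) x₁)).and (hsymm.eventually (hUo.mem_nhds hxU)))
    have hV : (chartAt EF x₁).source ∩ chartAt EF x₁ ⁻¹' Metric.ball (chartAt EF x₁ x₁) r ∈ 𝓝 x₁ :=
      ((chartAt EF x₁).isOpen_inter_preimage Metric.isOpen_ball).mem_nhds
        ⟨mem_chart_source EF x₁, Metric.mem_ball_self hr⟩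
    obtain ⟨y, ⟨hy1, hy2⟩, hyA⟩ := mem_closure_iff_nhds.1 hx₁ _ hV
    have hsy : Filter.Tendsto (chartAt EF x₁).symm (𝓝 (chartAt EF x₁ y)) (𝓝 y) := by
      have := ((chartAt EF x₁).symm.continuousAt ((chartAt EF x₁).map_source hy1)).tendsto
      rwa [(chartAt EF x₁).left_inv hy1] at this
    have hz : genField (TorusCover m) EF x₁ c =ᶠ[𝓝 (chartAt EF x₁ y)] 0 := by
      filter_upwards [hsy.eventually hyA, Metric.isOpen_ball.mem_nhds hy2] with z h1 h2
      obtain ⟨⟨_, h3⟩, h4⟩ := hball z h2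
      have h5 := (hU _ h4).2 c
      rw [(chartAt EF x₁).right_inv h3] at h5
      rw [← h5, Pi.zero_apply, show gen (TorusCover m) EF c ((chartAt EF x₁).symm z) = 0 from h1,
        map_zero]
    -- Identity theorem: the generator is analytic on a chart ball that meets the open zero set, so
    -- it vanishes on the ball. Hence the interior of the zero set is closed.
    have hzero := AnalyticOnNhd.eqOn_zero_of_preconnected_of_eventuallyEq_zero (𝕜 := ℂ)
      (U := Metric.ball (chartAt EF x₁ x₁) r)
      (fun z hz => (hball z hz).1.1.analyticAt)
      (convex_ball _ _).isPreconnected hy2 hz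
    filter_upwards [hV, hUo.mem_nhds hxU] with p hp hpU
    have h6 := (hU p hpU).2 c
    rw [hzero hp.2, Pi.zero_apply] at h6
    exact (injective_iff_map_eq_zero _).1 (tmap_chart_injective hp.1) _ h6
  have huniv : A = Set.univ := IsClopen.eq_univ ⟨hclosed, hopen⟩ ⟨x₀, h⟩
  have : x ∈ A := huniv ▸ Set.mem_univ x
  exact this.self_of_nhds

/-- The one-parameter subgroup of the compact torus with velocity `i b` fixes every point, so it is
trivial by effectiveness. -/
lemma IsToricKahler.eq_zero_of_torusGen_eq_zero (hF : IsToricKahler EF m F) {b : Fin m → ℝ}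
    (h : ∀ x : F, torusGen EF (fun j => (b j : ℂ)) x = 0) : b = 0 := by
  have h1 : (Complex.I • fun j => (b j : ℂ)) = (0 : Fin m → ℂ) := by
    refine eq_of_expTorus_smul_eq fun t => ?_
    rw [smul_zero, expTorus_zero]
    refine hF.effective _ (expTorus_mem_compactTorus fun j => by simp) fun x => ?_
    refine expTorus_smul_eq_of_torusGen_eq_zero hF.holomorphic ?_ t
    rw [torusGen_smul, h x, smul_zero]
  funext j
  have := congrFun h1 j
  simpa using this

/-- A holomorphic function with real values is locally constant. -/
lemma eventually_eq_of_im_eq_zero {E : Type*} [NormedAddCommGroup E] [NormedSpace ℂ E] {f : E → ℂ}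
    {z : E} (hf : ∀ᶠ y in 𝓝 z, DifferentiableAt ℂ f y) (him : ∀ᶠ y in 𝓝 z, (f y).im = 0) :
    ∀ᶠ y in 𝓝 z, f y = f z := by
  have hd : ∀ᶠ y in 𝓝 z, fderiv ℂ f y = 0 := by
    filter_upwards [hf, him.eventually_nhds] with y h1 h2
    have h3 : ∀ v, (fderiv ℂ f y v).im = 0 := by
      have h4 : HasFDerivAt (fun y => (f y).im)
          (Complex.imCLM ∘L (fderiv ℂ f y).restrictScalars ℝ) y :=
        Complex.imCLM.hasFDerivAt.comp y (h1.hasFDerivAt.restrictScalars ℝ)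
      have h5 := h4.unique ((hasFDerivAt_const (0 : ℝ) y).congr_of_eventuallyEq h2)
      exact fun v => congrArg (fun L : E →L[ℝ] ℝ => L v) h5
    ext v
    refine Complex.ext ?_ (h3 v)
    have h6 := h3 (Complex.I • v)
    simpa using h6
  obtain ⟨r, hr, hball⟩ := Metric.eventually_nhds_iff_ball.1 (hf.and hd)
  filter_upwards [Metric.ball_mem_nhds z hr] with y hy
  exact Metric.isOpen_ball.is_const_of_fderiv_eq_zero (𝕜 := ℂ) (convex_ball z r).isPreconnected
    (fun y hy => (hball y hy).1.differentiableWithinAt) (fun y hy => (hball y hy).2) hy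
    (Metric.mem_ball_self hr)

end Toric

/-! ### Points of the toric manifold with free infinitesimal action -/

section Toric

variable {m : ℕ} {EF : Type*} [NormedAddCommGroup EF] [NormedSpace ℂ EF] [FiniteDimensional ℂ EF]
  {F : Type*} [TopologicalSpace F] [ChartedSpace EF F] [IsManifold 𝓘(ℂ, EF) ω F]
  [MulAction (Fin m → ℂˣ) F]

/-- Holomorphic dependence of the coefficients in a linear relation. -/
lemma exists_holomorphic_coefficients {E V κ : Type*} [NormedAddCommGroup E] [NormedSpace ℂ E]
    [NormedAddCommGroup V] [NormedSpace ℂ V] [FiniteDimensional ℂ V] [Fintype κ] [DecidableEq κ]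
    {w : κ → E → V} {u : E → V} {z₀ : E} (hw : ∀ j, ∀ᶠ z in 𝓝 z₀, DifferentiableAt ℂ (w j) z)
    (hu : ∀ᶠ z in 𝓝 z₀, DifferentiableAt ℂ u z) (hli : LinearIndependent ℂ fun j => w j z₀) :
    ∃ a : E → κ → ℂ, ∀ᶠ z in 𝓝 z₀, (∀ j, DifferentiableAt ℂ (fun z => a z j) z) ∧
      (∀ s : κ → ℂ, ∑ j, s j • w j z = u z → s = a z) ∧
      ∀ s : κ → ℂ, ∑ j, s j • w j z = 0 → s = 0 := by
  obtain ⟨L', hL'⟩ := (Fintype.linearCombination ℂ fun j => w j z₀).exists_leftInverse_of_injective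
    (LinearMap.ker_eq_bot'.2 fun s hs => funext (Fintype.linearIndependent_iff.1 hli s hs))
  let L : V →L[ℂ] (κ → ℂ) := LinearMap.toContinuousLinearMap L'
  -- Composing with a left inverse at `z₀` gives a square system that is the identity at `z₀`, hence
  -- invertible nearby; inverting it gives differentiable coefficients.
  let B : E → (κ → ℂ) →L[ℂ] (κ → ℂ) := fun z =>
    ∑ j, ContinuousLinearMap.smulRightL ℂ (κ → ℂ) (κ → ℂ) (ContinuousLinearMap.proj j) (L (w j z))
  have hB : ∀ z s, B z s = L (∑ j, s j • w j z) := by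
    intro z s
    simp [B]
  have hB0 : B z₀ = 1 := by
    ext s : 1
    rw [hB]
    have := congrArg (fun f : (κ → ℂ) →ₗ[ℂ] (κ → ℂ) => f s) hL'
    exact this
  have hBd : ∀ᶠ z in 𝓝 z₀, DifferentiableAt ℂ B z := by
    filter_upwards [Filter.eventually_all.2 hw] with z hz
    refine DifferentiableAt.fun_sum fun j _ => ?_
    exact (ContinuousLinearMap.differentiableAt _).comp z (L.differentiableAt.comp z (hz j))
  have hunit : ∀ᶠ z in 𝓝 z₀, IsUnit (B z) := by
    refine hBd.self_of_nhds.continuousAt.eventually_mem (s := {x | IsUnit x})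
      (Units.isOpen.mem_nhds ?_)
    rw [hB0]
    exact isUnit_one
  have hinv : ∀ z, IsUnit (B z) → ∀ s, Ring.inverse (B z) (B z s) = s := fun z hz s =>
    congrArg (fun f : (κ → ℂ) →L[ℂ] (κ → ℂ) => f s) (Ring.inverse_mul_cancel (B z) hz)
  refine ⟨fun z => Ring.inverse (B z) (L (u z)), ?_⟩
  filter_upwards [hBd, hunit, hu] with z h1 h2 h3
  refine ⟨fun j => ?_, fun s hs => ?_, fun s hs => ?_⟩
  · have h4 : DifferentiableAt ℂ (fun z => Ring.inverse (B z)) z :=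
      (differentiableAt_inverse h2).comp z h1
    have h5 := h4.clm_apply (L.differentiableAt.comp z h3)
    exact differentiableAt_pi.1 h5 j
  · rw [← hs, ← hB, hinv z h2]
  · have := hinv z h2 s
    rw [hB, hs, map_zero, map_zero] at this
    exact this.symm

lemma torusGen_sub_sum {κ : Type*} [Fintype κ] (c : Fin m → ℂ) (s : κ → ℂ) (d : κ → Fin m → ℂ)
    (x : F) : torusGen EF (c - ∑ j, s j • d j) x =
      torusGen EF c x - ∑ j, s j • torusGen EF (d j) x := by
  have h : torusGen EF (c - ∑ j, s j • d j) x = torusGen EF c x - torusGen EF (∑ j, s j • d j) x :=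
    map_sub _ _ _
  rw [h]
  congr 1
  refine (map_sum (tmap (Fin m → ℂ) EF (fun g : TorusCover m => g • x) 1) _ _).trans
    (Finset.sum_congr rfl fun j _ => ?_)
  exact (map_smul (tmap (Fin m → ℂ) EF (fun g : TorusCover m => g • x) 1) _ _)

/-- There is a point where the torus acts infinitesimally freely. -/
lemma IsToricKahler.exists_free [ConnectedSpace F] (hF : IsToricKahler EF m F) :
    ∃ x : F, ∀ c : Fin m → ℂ, torusGen EF c x = 0 → c = 0 := by
  classical
  have hact := contMDiff_torusCover_smul hF.holomorphic
  obtain ⟨x₁⟩ : Nonempty F := inferInstance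
  set v : F → Fin m → EF := fun x j => torusGen EF (Pi.single j 1) x with hv
  -- A set of coordinate generators that is independent at some point and maximal with this
  -- property. If it omits `k`, the `k`-th generator depends on it near `x₀`.
  obtain ⟨S, hS⟩ := (Set.toFinite {S : Set (Fin m) | ∃ x, LinearIndepOn ℂ (v x) S}).exists_maximal
    ⟨∅, x₁, linearIndepOn_empty _ _⟩
  obtain ⟨x₀, hx₀⟩ := hS.prop
  by_cases hSu : S = Set.univ
  · refine ⟨x₀, fun c hc => ?_⟩
    rw [hSu, linearIndepOn_univ_iff] at hx₀
    have h1 := torusGen_sub_sum (EF := EF) (0 : Fin m → ℂ) c (fun j => Pi.single j 1) x₀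
    have h2 : (0 : Fin m → ℂ) - ∑ j, c j • (Pi.single j 1 : Fin m → ℂ) = -c := by
      rw [zero_sub]
      congr 1
      funext i
      simp [Finset.sum_apply, Pi.single_apply]
    rw [h2, torusGen_neg, hc, torusGen_zero, neg_zero, zero_sub, eq_comm, neg_eq_zero] at h1
    exact funext (Fintype.linearIndependent_iff.1 hx₀ c h1)
  exfalso
  obtain ⟨k, hk⟩ := (Set.ne_univ_iff_exists_notMem S).1 hSu
  have hgf : ∀ j : Fin m, ∀ᶠ z in 𝓝 (chartAt EF x₀ x₀),
      DifferentiableAt ℂ (genField (TorusCover m) EF x₀ (Pi.single j 1 : Fin m → ℂ)) z := fun j =>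
    ((contDiffAt_genField hact x₀ (Pi.single j 1 : Fin m → ℂ)).eventually (by simp)).mono
      fun z hz => hz.differentiableAt (by simp)
  have hgv : ∀ j : Fin m, genField (TorusCover m) EF x₀ (Pi.single j 1 : Fin m → ℂ)
      (chartAt EF x₀ x₀) = v x₀ j := fun j => (gen_eq_genField hact x₀ _).symm
  obtain ⟨a, ha⟩ := exists_holomorphic_coefficients (κ := S)
    (w := fun j => genField (TorusCover m) EF x₀ (Pi.single (j : Fin m) 1 : Fin m → ℂ))
    (u := genField (TorusCover m) EF x₀ (Pi.single k 1 : Fin m → ℂ)) (fun j => hgf j) (hgf k)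
    (by simp only [hgv]; exact hx₀)
  have hchart : Filter.Tendsto (chartAt EF x₀) (𝓝 x₀) (𝓝 (chartAt EF x₀ x₀)) :=
    ((chartAt EF x₀).continuousAt (mem_chart_source EF x₀)).tendsto
  have hsymm : Filter.Tendsto (chartAt EF x₀).symm (𝓝 (chartAt EF x₀ x₀)) (𝓝 x₀) := by
    have := ((chartAt EF x₀).symm.continuousAt (chart_mem_target x₀)).tendsto
    rwa [(chartAt EF x₀).left_inv (mem_chart_source EF x₀)] at this
  -- The coefficients are real: the real part of the relation is also a relation, and the
  -- coefficients are unique.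
  have key : ∀ᶠ y in 𝓝 x₀, (∑ j : S, a (chartAt EF x₀ y) j • v y j = v y k) ∧
      ∀ j, (a (chartAt EF x₀ y) j).im = 0 := by
    filter_upwards [hchart.eventually ha, eventually_tmap_chart_gen hact x₀] with y h1 h2
    obtain ⟨-, h3, h4⟩ := h1
    have hT : ∀ j : Fin m, tmap EF EF (chartAt EF x₀) y (v y j) =
        genField (TorusCover m) EF x₀ (Pi.single j 1 : Fin m → ℂ) (chartAt EF x₀ y) :=
      fun j => h2.2 _
    have hTs : ∀ s : S → ℂ, tmap EF EF (chartAt EF x₀) y (∑ j : S, s j • v y j) =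
        ∑ j : S, s j • genField (TorusCover m) EF x₀ (Pi.single (j : Fin m) 1 : Fin m → ℂ)
          (chartAt EF x₀ y) := fun s => by
      rw [map_sum]
      exact Finset.sum_congr rfl fun j _ => by rw [map_smul, hT]
    have hli : ∀ s : S → ℂ, ∑ j : S, s j • v y j = 0 → s = 0 := fun s hs =>
      h4 s (by rw [← hTs, hs, map_zero])
    have hun : ∀ s : S → ℂ, ∑ j : S, s j • v y j = v y k → s = a (chartAt EF x₀ y) := fun s hs =>
      h3 s (by rw [← hTs, hs, hT])
    have hLI : LinearIndepOn ℂ (v y) S :=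
      Fintype.linearIndependent_iff.2 fun s hs => congrFun (hli s hs)
    have hspan : v y k ∈ Submodule.span ℂ (v y '' S) := by
      by_contra h5
      have h6 := hLI.insert h5
      exact hk (hS.le_of_ge ⟨y, h6⟩ (Set.subset_insert k S) (Set.mem_insert k S))
    rw [Set.image_eq_range, ← Fintype.range_linearCombination] at hspan
    obtain ⟨s, hs⟩ := hspan
    have hs' : ∑ j : S, s j • v y j = v y k := hs
    have hsa := hun s hs'
    refine ⟨hsa ▸ hs', ?_⟩
    have h7 := torusGen_sub_sum (EF := EF) (Pi.single k 1 : Fin m → ℂ) s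
      (fun j => Pi.single (j : Fin m) 1) y
    rw [show ∑ j, s j • torusGen EF (Pi.single (j : Fin m) 1 : Fin m → ℂ) y = v y k from hs',
      show torusGen EF (Pi.single k 1 : Fin m → ℂ) y = v y k from rfl, sub_self] at h7
    have h8 := (hF.torusGen_re_im_eq_zero h7).1
    have h9 : (fun i => (((Pi.single k 1 - ∑ j : S, s j • (Pi.single (j : Fin m) 1) :
        Fin m → ℂ) i).re : ℂ)) = (Pi.single k 1 : Fin m → ℂ) -
          ∑ j : S, ((s j).re : ℂ) • (Pi.single (j : Fin m) 1 : Fin m → ℂ) := by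
      funext i
      simp [Finset.sum_apply, Pi.single_apply, apply_ite Complex.re, apply_ite Complex.ofReal]
    rw [h9, torusGen_sub_sum, sub_eq_zero] at h8
    have h10 := hun (fun j => ((s j).re : ℂ)) h8.symm
    intro j
    rw [← congrFun h10 j]
    exact Complex.ofReal_im _
  -- Holomorphic and real, so the coefficients are constant near `x₀`. A fixed real combination of
  -- generators then vanishes near `x₀`, hence on `F`, although its `k`-th coefficient is `1`: this
  -- contradicts effectiveness.
  have hconst : ∀ᶠ z in 𝓝 (chartAt EF x₀ x₀), ∀ j, a z j = a (chartAt EF x₀ x₀) j := by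
    refine Filter.eventually_all.2 fun j => eventually_eq_of_im_eq_zero (ha.mono fun z hz => hz.1 j) ?_
    filter_upwards [hsymm.eventually key, eventually_mem_chart_target (E' := EF) x₀] with z h1 h2
    rw [(chartAt EF x₀).right_inv h2] at h1
    exact h1.2 j
  set b : Fin m → ℝ := fun i => ((Pi.single k 1 - ∑ j : S, a (chartAt EF x₀ x₀) j •
    (Pi.single (j : Fin m) 1) : Fin m → ℂ) i).re with hb
  have hbz : ∀ᶠ y in 𝓝 x₀, torusGen EF (fun i => (b i : ℂ)) y = 0 := by
    filter_upwards [key, hchart.eventually hconst] with y h1 h2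
    refine (hF.torusGen_re_im_eq_zero ?_).1
    rw [torusGen_sub_sum]
    simp only [h2] at h1
    exact sub_eq_zero.2 h1.1.symm
  have hb0 := hF.eq_zero_of_torusGen_eq_zero
    (fun x => torusGen_eq_zero_of_eventually hF.holomorphic hbz x)
  have hbk := congrFun hb0 k
  have hne : ∀ j : S, k ≠ j := fun j h => hk (h ▸ j.2)
  simp [hb, Finset.sum_apply, Pi.single_apply, hne] at hbk

end Toric

/-! ### Isotropy groups and principal points -/

section Isotropy

variable {E : Type*} [NormedAddCommGroup E] [NormedSpace ℂ E] [FiniteDimensional ℂ E]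
  {Gc : Type*} [TopologicalSpace Gc] [ChartedSpace E Gc] [Group Gc] [LieGroup 𝓘(ℂ, E) ω Gc]
  [T2Space Gc]
  {E' : Type*} [NormedAddCommGroup E'] [NormedSpace ℂ E'] [FiniteDimensional ℂ E']
  {M : Type*} [TopologicalSpace M] [ChartedSpace E' M] [IsManifold 𝓘(ℂ, E') ω M]
  [MulAction Gc M]

/-- The isotropy group in `G` of a point. -/
def isotropy (G : Subgroup Gc) (p : M) : Subgroup Gc := G ⊓ MulAction.stabilizer Gc p

lemma isClosed_isotropy [T2Space M]
    (hact : ContMDiff (𝓘(ℂ, E).prod 𝓘(ℂ, E')) 𝓘(ℂ, E') ω (fun x : Gc × M => x.1 • x.2))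
    {G : Subgroup Gc} (hG : IsClosed (G : Set Gc)) (p : M) :
    IsClosed (isotropy G p : Set Gc) :=
  hG.inter (isClosed_eq (contMDiff_smul_const hact p).continuous continuous_const)

lemma IsOneParam.hasVelocity_smul_add
    (hact : ContMDiff (𝓘(ℂ, E).prod 𝓘(ℂ, E')) 𝓘(ℂ, E') ω (fun x : Gc × M => x.1 • x.2))
    {γ : ℝ → Gc} {X : E} (hγ : IsOneParam γ X) (p : M) (t : ℝ) :
    HasVelocity (fun s => γ (s + t) • p) (γ t • p)
      (tmap E' E' (fun x : M => γ t • x) p (gen Gc E' X p)) := by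
  have h1 := hγ.2.comp (f := fun g : Gc => g • p)
    ((contMDiff_smul_const hact p).mdifferentiableAt (by simp))
  simp only [one_smul] at h1
  have h2 := h1.comp (f := fun x : M => γ t • x)
    ((contMDiff_const_smul_of_prod hact (γ t)).mdifferentiableAt (by simp))
  have h3 : (fun s => γ (s + t) • p) = fun s => γ t • γ s • p := by
    funext s
    rw [add_comm, hγ.1, mul_smul]
  rw [h3]
  exact h2

/-- The Lie algebra of the isotropy group. -/
lemma mem_lieAlg_isotropy_iff [T2Space M]
    (hact : ContMDiff (𝓘(ℂ, E).prod 𝓘(ℂ, E')) 𝓘(ℂ, E') ω (fun x : Gc × M => x.1 • x.2))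
    {G : Subgroup Gc} (hG : IsClosed (G : Set Gc)) {p : M} {X : E} :
    X ∈ lieAlg (Gc := Gc) E (isotropy G p) ↔ X ∈ lieAlg (Gc := Gc) E G ∧ gen Gc E' X p = 0 := by
  constructor
  · intro h
    refine ⟨lieAlg_mono (inf_le_left : isotropy G p ≤ G) h, ?_⟩
    obtain ⟨γ, hγ, hγS⟩ := exists_isOneParam_of_mem_lieAlg (isClosed_isotropy hact hG p) h
    have h1 := hγ.2.comp (f := fun g : Gc => g • p)
      ((contMDiff_smul_const hact p).mdifferentiableAt (by simp))
    have h2 : (fun s => γ s • p) = fun _ => p := funext fun s => (hγS s).2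
    rw [h2] at h1
    simp only [one_smul] at h1
    exact h1.unique (hasVelocity_const p)
  · rintro ⟨h, h0⟩
    obtain ⟨γ, hγ, hγS⟩ := exists_isOneParam_of_mem_lieAlg hG h
    refine hγ.mem_lieAlg fun t => ⟨hγS t, ?_⟩
    have h1 := eq_of_hasVelocity_zero (E := E') (c := fun t => γ t • p) (fun t => by
      have := hγ.hasVelocity_smul_add hact p t
      rwa [h0, map_zero] at this) t
    simp only [map_zero_of_map_add hγ.1, one_smul] at h1
    exact h1

/-- The adjoint action of a group element. -/
def adjointMap (E : Type*) [NormedAddCommGroup E] [NormedSpace ℂ E] {Gc : Type*}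
    [TopologicalSpace Gc] [ChartedSpace E Gc] [Group Gc] (g : Gc) : E →L[ℂ] E :=
  tmap E E (fun h : Gc => g * h * g⁻¹) 1

lemma HasVelocity.adjointMap {c : ℝ → Gc} {X : E} (h : HasVelocity c 1 X) (g : Gc) :
    HasVelocity (fun s => g * c s * g⁻¹) 1 (adjointMap E g X) := by
  have h1 : ContMDiff 𝓘(ℂ, E) 𝓘(ℂ, E) ω (fun h : Gc => g * h * g⁻¹) :=
    contMDiff_conj_pair.comp (contMDiff_const.prodMk contMDiff_id)
  have h2 := h.comp (h1.mdifferentiableAt (by simp))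
  simp only [mul_one, mul_inv_cancel] at h2
  exact h2

lemma adjointMap_injective (g : Gc) : Function.Injective (adjointMap E g) := by
  refine Function.LeftInverse.injective (g := adjointMap E g⁻¹) fun X => ?_
  obtain ⟨c, hc⟩ := exists_hasVelocity (1 : Gc) X
  have h1 := (hc.adjointMap g).adjointMap g⁻¹
  have h2 : (fun s => g⁻¹ * (g * c s * g⁻¹) * g⁻¹⁻¹) = c := by
    funext s
    group
  rw [h2] at h1
  exact h1.unique hc

/-- If a closed group is conjugate to a subgroup of another, then its Lie algebra has at most the
dimension of the other Lie algebra. -/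
lemma finrank_lieAlg_le_of_conj {S S' : Subgroup Gc} (hS : IsClosed (S : Set Gc))
    (hS' : IsClosed (S' : Set Gc)) {g : Gc} (h : ∀ k ∈ S, g * k * g⁻¹ ∈ S') :
    Module.finrank ℝ (lieAlg (Gc := Gc) E S : Submodule ℝ E) ≤
      Module.finrank ℝ (lieAlg (Gc := Gc) E S' : Submodule ℝ E) := by
  have : FiniteDimensional ℝ E := FiniteDimensional.complexToReal E
  have hmem : ∀ X ∈ (lieAlg (Gc := Gc) E S : Submodule ℝ E),
      (adjointMap E g).restrictScalars ℝ X ∈ (lieAlg (Gc := Gc) E S' : Submodule ℝ E) := by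
    intro X hX
    obtain ⟨γ, hγ, hγS⟩ := exists_isOneParam_of_mem_lieAlg hS hX
    have h1 : HasVelocity (E := E) γ 1 X := hγ.2
    exact mem_lieAlg_of_hasVelocity (E := E) hS' (HasVelocity.adjointMap (E := E) h1 g)
      (Filter.Eventually.of_forall fun s => h _ (hγS s))
  refine LinearMap.finrank_le_finrank_of_injective (f :=
    ((adjointMap E g).restrictScalars ℝ : E →ₗ[ℝ] E).restrict hmem) ?_
  intro X Y hXY
  exact Subtype.ext (adjointMap_injective (E := E) g (congrArg Subtype.val hXY))

end Isotropy

/-! ### The central elements as coordinates on the torus -/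

section CentralBasis

variable {E : Type*} [NormedAddCommGroup E] [NormedSpace ℂ E] [FiniteDimensional ℂ E]
  {Gc : Type*} [TopologicalSpace Gc] [ChartedSpace E Gc] [Group Gc] [LieGroup 𝓘(ℂ, E) ω Gc]
  [T2Space Gc] {P G : Subgroup Gc} {m : ℕ} {τ : P →* (Fin m → ℂˣ)}
  {Z : Fin m → GroupLieAlgebra 𝓘(ℂ, E) Gc}

lemma IsCentralBasis.killingForm_sum (hZ : IsCentralBasis G τ Z) (c : Fin m → ℂ) (j : Fin m) :
    killingForm ℂ _ (Z j) (∑ i, c i • Z i) = -c j := by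
  simp [map_sum, hZ.orthonormal]

lemma IsCentralBasis.sum_mem (hZ : IsCentralBasis G τ Z) (c : Fin m → ℝ) :
    ∑ i, (c i : ℂ) • Z i ∈ lieAlg E (G ⊓ P) :=
  Submodule.sum_mem _ fun i _ => Submodule.smul_mem _ (c i) (hZ.mem i)

/-- The differential of `τ` maps the span of the central elements onto the Lie algebra of the
compact torus. -/
lemma IsCentralBasis.exists_differential_eq (hZ : IsCentralBasis G τ Z)
    {D : E →L[ℂ] (Fin m → ℂ)} (hD : IsTorusDifferential τ D) (hτ : IsHolomorphicHom E τ)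
    (hG : IsCompact (G : Set Gc)) (hP : IsClosed (P : Set Gc)) (b : Fin m → ℝ) :
    ∃ c : Fin m → ℝ, D (∑ i, (c i : ℂ) • Z i : GroupLieAlgebra 𝓘(ℂ, E) Gc) =
      Complex.I • fun j => (b j : ℂ) := by
  -- `D` is imaginary on `Lie K`, so its imaginary part carries all the information on the real span
  -- of the `Z_i`.
  let f : (Fin m → ℝ) →ₗ[ℝ] (Fin m → ℝ) :=
    { toFun := fun c j => (∑ i, (c i : ℂ) * D (Z i) j).im
      map_add' := fun c d => by
        funext j
        simp [add_mul, Finset.sum_add_distrib]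
      map_smul' := fun r c => by
        funext j
        simp [Finset.mul_sum, mul_assoc] }
  have hDsum : ∀ c : Fin m → ℝ, ∀ j, D (∑ i, (c i : ℂ) • Z i : GroupLieAlgebra 𝓘(ℂ, E) Gc) j =
      ∑ i, (c i : ℂ) * D (Z i) j := by
    intro c j
    have h1 : D (∑ i, (c i : ℂ) • Z i : GroupLieAlgebra 𝓘(ℂ, E) Gc) = ∑ i, (c i : ℂ) • D (Z i) :=
      (map_sum D (fun i => ((c i : ℂ) • Z i : E)) _).trans
        (Finset.sum_congr rfl fun i _ => D.map_smul (c i : ℂ) (Z i : E))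
    rw [h1]
    simp [Finset.sum_apply]
  have hf : ∀ c : Fin m → ℝ, D (∑ i, (c i : ℂ) • Z i : GroupLieAlgebra 𝓘(ℂ, E) Gc) =
      Complex.I • fun j => (f c j : ℂ) := by
    intro c
    funext j
    have hre := hD.re_eq_zero hτ hG hP (hZ.sum_mem c) j
    rw [hDsum] at hre ⊢
    refine Complex.ext ?_ ?_
    · simpa using hre
    · simp [f]
  -- A combination of the `Z_i` killed by `D` lies in `Lie (ker τ ∩ G)`, to which the `Z_i` are
  -- orthogonal; pairing with each `Z_j` kills its coefficients. Injectivity gives surjectivity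
  -- because there are exactly `m` elements `Z_i`.
  have hinj : Function.Injective f := by
    refine (injective_iff_map_eq_zero f).2 fun c hc => ?_
    have h1 : D (∑ i, (c i : ℂ) • Z i : GroupLieAlgebra 𝓘(ℂ, E) Gc) = 0 := by
      rw [hf, hc]
      funext j
      simp
    have h2 := hD.mem_kerSubgroup hG.isClosed hP (hZ.sum_mem c) h1
    funext j
    have h3 := hZ.perp j _ h2
    have h4 := hZ.killingForm_sum (fun i => (c i : ℂ)) j
    have h5 := h4.symm.trans h3
    simpa using h5
  obtain ⟨c, hc⟩ := (LinearMap.injective_iff_surjective.1 hinj) b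
  exact ⟨c, by rw [hf, hc]⟩

lemma differential_sum (D : E →L[ℂ] (Fin m → ℂ)) (c : Fin m → ℂ) :
    D (∑ i, c i • Z i : GroupLieAlgebra 𝓘(ℂ, E) Gc) = ∑ i, c i • D (Z i) :=
  (map_sum D (fun i => (c i • Z i : E)) _).trans
    (Finset.sum_congr rfl fun i _ => D.map_smul (c i : ℂ) (Z i : E))

/-- The images of the central elements are a complex basis. -/
lemma IsCentralBasis.exists_differential_eq_complex (hZ : IsCentralBasis G τ Z)
    {D : E →L[ℂ] (Fin m → ℂ)} (hD : IsTorusDifferential τ D) (hτ : IsHolomorphicHom E τ)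
    (hG : IsCompact (G : Set Gc)) (hP : IsClosed (P : Set Gc)) (d : Fin m → ℂ) :
    ∃ c : Fin m → ℂ, ∑ i, c i • D (Z i) = d := by
  obtain ⟨a, ha⟩ := hZ.exists_differential_eq hD hτ hG hP fun j => (d j).im
  obtain ⟨b, hb⟩ := hZ.exists_differential_eq hD hτ hG hP fun j => -(d j).re
  rw [differential_sum D] at ha hb
  -- The real span maps onto the imaginary vectors, so its multiple by `i` supplies the real part of
  -- `d`; this explains the sign chosen for `b`.
  refine ⟨fun i => a i + Complex.I * b i, ?_⟩
  simp only [add_smul, Finset.sum_add_distrib, mul_smul, ← Finset.smul_sum]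
  rw [ha, hb]
  funext j
  apply Complex.ext <;> simp

lemma IsCentralBasis.linearIndependent_differential (hZ : IsCentralBasis G τ Z)
    {D : E →L[ℂ] (Fin m → ℂ)} (hD : IsTorusDifferential τ D) (hτ : IsHolomorphicHom E τ)
    (hG : IsCompact (G : Set Gc)) (hP : IsClosed (P : Set Gc)) {c : Fin m → ℂ}
    (hc : ∑ i, c i • D (Z i) = 0) : c = 0 := by
  have hs : Function.Surjective (Fintype.linearCombination ℂ fun i => D (Z i)) := fun d =>
    hZ.exists_differential_eq_complex hD hτ hG hP d
  exact (injective_iff_map_eq_zero _).1 (LinearMap.injective_iff_surjective.2 hs) c hc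

/-- The decomposition of an element of the Lie algebra of `K`. -/
lemma IsCentralBasis.exists_sub_mem (hZ : IsCentralBasis G τ Z)
    {D : E →L[ℂ] (Fin m → ℂ)} (hD : IsTorusDifferential τ D) (hτ : IsHolomorphicHom E τ)
    (hG : IsCompact (G : Set Gc)) (hP : IsClosed (P : Set Gc))
    {X : GroupLieAlgebra 𝓘(ℂ, E) Gc} (hX : X ∈ lieAlg E (G ⊓ P)) :
    ∃ c : Fin m → ℝ, X - ∑ i, (c i : ℂ) • Z i ∈ lieAlg E (kerSubgroup G τ) := by
  obtain ⟨c, hc⟩ := hZ.exists_differential_eq hD hτ hG hP fun j => (D X j).im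
  refine ⟨c, hD.mem_kerSubgroup hG.isClosed hP (Submodule.sub_mem _ hX (hZ.sum_mem c)) ?_⟩
  have h1 : D (X - ∑ i, (c i : ℂ) • Z i : GroupLieAlgebra 𝓘(ℂ, E) Gc) =
      D X - D (∑ i, (c i : ℂ) • Z i : GroupLieAlgebra 𝓘(ℂ, E) Gc) := map_sub D _ _
  rw [h1, hc, sub_eq_zero]
  funext j
  have := hD.re_eq_zero hτ hG hP hX j
  apply Complex.ext <;> simp [this]

end CentralBasis

/-! ### Isotropy algebras at principal points of the fibre -/

section Principal

variable {EG : Type*} [NormedAddCommGroup EG] [NormedSpace ℂ EG] [FiniteDimensional ℂ EG]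
  {Gc : Type*} [TopologicalSpace Gc] [ChartedSpace EG Gc] [Group Gc] [LieGroup 𝓘(ℂ, EG) ω Gc]
  [T2Space Gc] {P G : Subgroup Gc} {m : ℕ} {τ : P →* (Fin m → ℂˣ)}
  {EF : Type*} [NormedAddCommGroup EF] [NormedSpace ℂ EF] [FiniteDimensional ℂ EF]
  {F : Type*} [TopologicalSpace F] [ChartedSpace EF F] [IsManifold 𝓘(ℂ, EF) ω F]
  [MulAction (Fin m → ℂˣ) F] [ConnectedSpace F]
  {EM : Type*} [NormedAddCommGroup EM] [NormedSpace ℂ EM] [FiniteDimensional ℂ EM]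
  {M : Type*} [TopologicalSpace M] [ChartedSpace EM M] [IsManifold 𝓘(ℂ, EM) ω M] [T2Space M]
  [MulAction Gc M] {q : Gc × F → M} {D : EG →L[ℂ] (Fin m → ℂ)}
  {Z : Fin m → GroupLieAlgebra 𝓘(ℂ, EG) Gc}

/-- At principal points of the fibre the isotropy algebra is that of `ker τ ∩ G`. -/
lemma IsAssociatedBundle.mem_kerSubgroup_of_principal (hM : IsAssociatedBundle EG EF EM τ q)
    (hF : IsToricKahler EF m F) (hD : IsTorusDifferential τ D) (hG : IsClosed (G : Set Gc))
    (hP : IsClosed (P : Set Gc)) {x : F} (hx : q (1, x) ∈ principalPoints M G) {X : EG}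
    (hX : X ∈ lieAlg (Gc := Gc) EG G) (hX0 : gen Gc EM X (q (1, x)) = 0) :
    X ∈ lieAlg (Gc := Gc) EG (kerSubgroup G τ) := by
  obtain ⟨y, hy⟩ := hF.exists_free
  have hact := hM.contMDiff_smul
  -- At the free point `y` the isotropy algebra is contained in `Lie (ker τ ∩ G)`, which in turn is
  -- contained in the isotropy algebra at every point of the fibre.
  have h1 : (lieAlg (Gc := Gc) EG (isotropy G (q (1, y))) : Submodule ℝ EG) ≤
      lieAlg (Gc := Gc) EG (kerSubgroup G τ) := by
    intro Y hY
    obtain ⟨h2, h3⟩ := (mem_lieAlg_isotropy_iff hact hG).1 hY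
    obtain ⟨h4, h5⟩ := (hM.gen_eq_zero_iff hF.holomorphic hD hP).1 h3
    exact hD.mem_kerSubgroup hG hP (mem_lieAlg_inf hG hP h2 h4) (hy _ h5)
  have h2 : (lieAlg (Gc := Gc) EG (kerSubgroup G τ) : Submodule ℝ EG) ≤
      lieAlg (Gc := Gc) EG (isotropy G (q (1, x))) := by
    intro Y hY
    refine (mem_lieAlg_isotropy_iff hact hG).2
      ⟨lieAlg_mono (inf_le_left : kerSubgroup G τ ≤ G) hY, ?_⟩
    refine (hM.gen_eq_zero_iff hF.holomorphic hD hP).2 ⟨?_, ?_⟩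
    · refine lieAlg_mono (fun g hg => ?_ : kerSubgroup G τ ≤ P) hY
      obtain ⟨p, -, rfl⟩ := hg.2
      exact p.2
    · rw [hD.apply_eq_zero_of_mem_kerSubgroup hY, torusGen_zero]
  have : FiniteDimensional ℝ EG := FiniteDimensional.complexToReal EG
  -- Principality bounds the dimension at `x` by the dimension at `y`, so the inclusions are
  -- equalities.
  obtain ⟨g, hgG, hg⟩ := hx (q (1, y))
  have h3 := finrank_lieAlg_le_of_conj (E := EG) (isClosed_isotropy hact hG (q (1, x)))
    (isClosed_isotropy hact hG (q (1, y))) (g := g) (fun k hk =>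
      ⟨G.mul_mem (G.mul_mem hgG hk.1) (G.inv_mem hgG), hg k hk.1 hk.2⟩)
  have h4 := Submodule.eq_of_le_of_finrank_le h2 (h3.trans (Submodule.finrank_mono h1))
  exact h4.symm.le ((mem_lieAlg_isotropy_iff hact hG).2 ⟨hX, hX0⟩)

/-- The torus acts infinitesimally freely at principal points of the fibre. -/
lemma IsAssociatedBundle.free_of_principal (hM : IsAssociatedBundle EG EF EM τ q)
    (hF : IsToricKahler EF m F) (hD : IsTorusDifferential τ D) (hτ : IsHolomorphicHom EG τ)
    (hZ : IsCentralBasis G τ Z) (hG : IsCompact (G : Set Gc))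
    (hP : IsClosed (P : Set Gc)) {x : F} (hx : q (1, x) ∈ principalPoints M G) {c : Fin m → ℂ}
    (hc : torusGen EF c x = 0) : c = 0 := by
  have hreal : ∀ b : Fin m → ℝ, torusGen EF (fun j => (b j : ℂ)) x = 0 → b = 0 := by
    intro b hb
    -- A real torus direction that acts trivially at `x` is lifted to an isotropic element of `Lie
    -- K`; the previous result puts it into the kernel of `D`.
    obtain ⟨a, ha⟩ := hZ.exists_differential_eq hD hτ hG hP b
    have hmem := hZ.sum_mem a
    have h1 : gen (E := EG) Gc EM (∑ i, (a i : ℂ) • Z i : GroupLieAlgebra 𝓘(ℂ, EG) Gc)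
        (q (1, x)) = 0 := by
      refine (hM.gen_eq_zero_iff hF.holomorphic hD hP).2 ⟨lieAlg_mono inf_le_right hmem, ?_⟩
      rw [ha, torusGen_smul, hb, smul_zero]
    have h2 := hM.mem_kerSubgroup_of_principal hF hD hG.isClosed hP hx
      (lieAlg_mono inf_le_left hmem) h1
    rw [hD.apply_eq_zero_of_mem_kerSubgroup h2] at ha
    funext j
    have := congrFun ha j
    simpa using this.symm
  obtain ⟨h1, h2⟩ := hF.torusGen_re_im_eq_zero hc
  have h3 := hreal _ h1
  have h4 := hreal _ h2
  funext j
  exact Complex.ext (congrFun h3 j) (congrFun h4 j)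

end Principal

/-! ### The tangent spaces along the fibre -/

section Setting

variable {EG : Type*} [NormedAddCommGroup EG] [NormedSpace ℂ EG] [FiniteDimensional ℂ EG]
  {Gc : Type*} [TopologicalSpace Gc] [ChartedSpace EG Gc] [Group Gc] [LieGroup 𝓘(ℂ, EG) ω Gc]
  {P G : Subgroup Gc} {m : ℕ} {τ : P →* (Fin m → ℂˣ)}
  {EF : Type*} [NormedAddCommGroup EF] [NormedSpace ℂ EF] [FiniteDimensional ℂ EF]
  {F : Type*} [TopologicalSpace F] [ChartedSpace EF F] [IsManifold 𝓘(ℂ, EF) ω F]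
  [MulAction (Fin m → ℂˣ) F]
  {EM : Type*} [NormedAddCommGroup EM] [NormedSpace ℂ EM] [FiniteDimensional ℂ EM]
  {M : Type*} [TopologicalSpace M] [ChartedSpace EM M] [IsManifold 𝓘(ℂ, EM) ω M]
  [MulAction Gc M] {q : Gc × F → M}
  {Z : Fin m → GroupLieAlgebra 𝓘(ℂ, EG) Gc}
  {H : LieSubalgebra ℂ (GroupLieAlgebra 𝓘(ℂ, EG) Gc)} [H.IsCartanSubalgebra]
  {Ep Em : PosRoot P H → GroupLieAlgebra 𝓘(ℂ, EG) Gc}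
  {D : EG →L[ℂ] (Fin m → ℂ)}

variable (EG EM) in
/-- The value at `p` of the fundamental vector fields. -/
def fund (p : M) : GroupLieAlgebra 𝓘(ℂ, EG) Gc →ₗ[ℂ] EM :=
  ((tmap EG EM (fun g : Gc => g • p) 1 : EG →L[ℂ] EM) : EG →ₗ[ℂ] EM)

variable (Gc) in
/-- A linear map on the model space, as a linear map on the Lie algebra. -/
def onLieAlgebra (D : EG →L[ℂ] (Fin m → ℂ)) :
    GroupLieAlgebra 𝓘(ℂ, EG) Gc →ₗ[ℂ] (Fin m → ℂ) := (D : EG →ₗ[ℂ] (Fin m → ℂ))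

variable (EG EF EM q τ G Z Ep Em D) in
/-- The data of the main theorem together with the differential of `τ`. -/
structure IsFlagBundle : Prop where
  realForm : IsCompactRealForm EG G
  parabolic : IsParabolic EG P
  holomorphicHom : IsHolomorphicHom EG τ
  toric : IsToricKahler EF m F
  bundle : IsAssociatedBundle EG EF EM τ q
  central : IsCentralBasis G τ Z
  torus : IsComplexifiedTorus G P H
  roots : IsRootBasis G Ep Em
  differential : IsTorusDifferential τ D

variable [T2Space Gc] [ConnectedSpace F]

/-- The Lie algebra of a closed subgroup, as a complex Lie subalgebra if it is a complex
subspace. -/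
def complexLieAlg (hP : IsClosed (P : Set Gc))
    (hc : ∀ (a : ℂ) (X : GroupLieAlgebra 𝓘(ℂ, EG) Gc), X ∈ lieAlg EG P → a • X ∈ lieAlg EG P) :
    LieSubalgebra ℂ (GroupLieAlgebra 𝓘(ℂ, EG) Gc) where
  carrier := lieAlg EG P
  add_mem' := (lieAlg EG P).add_mem
  zero_mem' := (lieAlg EG P).zero_mem
  smul_mem' a X hX := hc a X hX
  lie_mem' hX hY := lie_mem_lieAlg hP hX hY

namespace IsFlagBundle

variable [T2Space M] [LieAlgebra.IsSemisimple ℂ (GroupLieAlgebra 𝓘(ℂ, EG) Gc)]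

lemma isClosed (h : IsFlagBundle EG G τ EF EM q Z Ep Em D) : IsClosed (G : Set Gc) :=
  h.realForm.isCompact.isClosed

lemma smul_mem (h : IsFlagBundle EG G τ EF EM q Z Ep Em D) (a : ℂ)
    (X : GroupLieAlgebra 𝓘(ℂ, EG) Gc) (hX : X ∈ lieAlg EG P) : a • X ∈ lieAlg EG P :=
  h.bundle.smul_mem h.toric.holomorphic h.differential h.parabolic.isClosed a hX

/-- The Lie algebra of the parabolic subgroup. -/
def parabolicAlgebra (h : IsFlagBundle EG G τ EF EM q Z Ep Em D) :
    LieSubalgebra ℂ (GroupLieAlgebra 𝓘(ℂ, EG) Gc) :=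
  complexLieAlg h.parabolic.isClosed h.smul_mem

lemma torus_le (h : IsFlagBundle EG G τ EF EM q Z Ep Em D) : H ≤ h.parabolicAlgebra := by
  intro X hX
  obtain ⟨Y, -, W, -, hY, hW, rfl⟩ := h.torus X hX
  exact h.parabolicAlgebra.add_mem (lieAlg_mono inf_le_right hY)
    (h.parabolicAlgebra.smul_mem _ (lieAlg_mono inf_le_right hW))

/-- For a Borel subalgebra `b` of `p`, one has `p^⊥ ⊆ b^⊥ ⊆ b ⊆ p`. -/
lemma mem_of_perp (h : IsFlagBundle EG G τ EF EM q Z Ep Em D)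
    (X : GroupLieAlgebra 𝓘(ℂ, EG) Gc) (hX : ∀ Y ∈ h.parabolicAlgebra, killingForm ℂ _ X Y = 0) :
    X ∈ h.parabolicAlgebra := by
  obtain ⟨b, hb, hmax, hbP⟩ := h.parabolic.borel
  exact hbP X (mem_of_perp_maximal_solvable b hb hmax fun Y hY => hX Y (hbP Y hY))

lemma Em_mem (h : IsFlagBundle EG G τ EF EM q Z Ep Em D) (α : PosRoot P H) :
    Em α ∈ lieAlg EG P :=
  HomogeneousToric.Em_mem (p := h.parabolicAlgebra) (Em := Em) h.torus_le h.mem_of_perp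
    h.roots.mem_neg α

lemma killingForm_Em (h : IsFlagBundle EG G τ EF EM q Z Ep Em D) (α : PosRoot P H)
    {V : GroupLieAlgebra 𝓘(ℂ, EG) Gc} (hV : V ∈ lieAlg EG P) : killingForm ℂ _ V (Em α) = 0 :=
  killingForm_Em_eq_zero (p := h.parabolicAlgebra) (Em := Em) h.torus_le h.roots.mem_neg α hV

open Classical in
lemma killingForm_Ep_Em (h : IsFlagBundle EG G τ EF EM q Z Ep Em D) (α β : PosRoot P H) :
    killingForm ℂ _ (Ep α) (Em β) = if α = β then 1 else 0 :=
  HomogeneousToric.killingForm_Ep_Em (p := h.parabolicAlgebra) (Ep := Ep) (Em := Em)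
    h.roots.mem_pos h.roots.mem_neg h.roots.normalized α β

lemma killingForm_Ep_Ep (h : IsFlagBundle EG G τ EF EM q Z Ep Em D) (α β : PosRoot P H) :
    killingForm ℂ _ (Ep α) (Ep β) = 0 :=
  HomogeneousToric.killingForm_Ep_Ep (p := h.parabolicAlgebra) (Ep := Ep) (Em := Em) h.torus_le
    h.mem_of_perp h.roots.mem_pos h.roots.mem_neg h.roots.normalized α β

lemma sub_sum_mem (h : IsFlagBundle EG G τ EF EM q Z Ep Em D)
    (Y : GroupLieAlgebra 𝓘(ℂ, EG) Gc) :
    Y - ∑ α, killingForm ℂ _ Y (Em α) • Ep α ∈ lieAlg EG P :=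
  letI : Fintype (RootsOutside H h.parabolicAlgebra) := (inferInstance : Fintype (PosRoot P H))
  sub_sum_Ep_mem (p := h.parabolicAlgebra) (Ep := Ep) (Em := Em) h.torus_le h.roots.mem_pos
    h.roots.mem_neg h.roots.normalized Y

lemma apply_lie (h : IsFlagBundle EG G τ EF EM q Z Ep Em D)
    {X Y : GroupLieAlgebra 𝓘(ℂ, EG) Gc} (hX : X ∈ lieAlg EG P) (hY : Y ∈ lieAlg EG P) :
    onLieAlgebra Gc D ⁅X, Y⁆ = 0 :=
  h.differential.apply_lie h.parabolic.isClosed hX hY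

/-- `E_{-α}` is a bracket of elements of `Lie P`, and the target of `τ` is abelian. -/
lemma apply_Em (h : IsFlagBundle EG G τ EF EM q Z Ep Em D) (α : PosRoot P H) :
    onLieAlgebra Gc D (Em α) = 0 := by
  obtain ⟨X, hX, hXE⟩ := exists_lie_Em (p := h.parabolicAlgebra) (Em := Em) h.roots.mem_neg α
  rw [← hXE]
  exact h.apply_lie (h.torus_le hX) (h.Em_mem α)

lemma fund_of_mem (h : IsFlagBundle EG G τ EF EM q Z Ep Em D)
    {Y : GroupLieAlgebra 𝓘(ℂ, EG) Gc} (hY : Y ∈ lieAlg EG P) (x : F) :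
    fund EG EM (q (1, x)) Y =
      tmap EF EM (fun y : F => q (1, y)) x (torusGen EF (onLieAlgebra Gc D Y) x) :=
  h.bundle.gen_of_mem h.toric.holomorphic h.differential h.parabolic.isClosed hY x

lemma fund_eq_zero (h : IsFlagBundle EG G τ EF EM q Z Ep Em D)
    {Y : GroupLieAlgebra 𝓘(ℂ, EG) Gc} (hY : Y ∈ lieAlg EG P) (hDY : onLieAlgebra Gc D Y = 0)
    (x : F) : fund EG EM (q (1, x)) Y = 0 := by
  rw [h.fund_of_mem hY, hDY, torusGen_zero, map_zero]

lemma fund_Em (h : IsFlagBundle EG G τ EF EM q Z Ep Em D) (α : PosRoot P H) (x : F) :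
    fund EG EM (q (1, x)) (Em α) = 0 :=
  h.fund_eq_zero (h.Em_mem α) (h.apply_Em α) x

lemma fund_lie (h : IsFlagBundle EG G τ EF EM q Z Ep Em D)
    {X Y : GroupLieAlgebra 𝓘(ℂ, EG) Gc} (hX : X ∈ lieAlg EG P) (hY : Y ∈ lieAlg EG P) (x : F) :
    fund EG EM (q (1, x)) ⁅X, Y⁆ = 0 :=
  h.fund_eq_zero (h.parabolicAlgebra.lie_mem hX hY) (h.apply_lie hX hY) x

lemma Z_mem (h : IsFlagBundle EG G τ EF EM q Z Ep Em D) (i : Fin m) : Z i ∈ lieAlg EG P :=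
  lieAlg_mono inf_le_right (h.central.mem i)

/-- The `D (Z i)` span `ℂ^m`, so every torus field on the fibre comes from a complex combination of
the central elements. -/
lemma fund_tangent (h : IsFlagBundle EG G τ EF EM q Z Ep Em D) (d : Fin m → ℂ) (x : F) :
    ∃ c : Fin m → ℂ, tmap EF EM (fun y : F => q (1, y)) x (torusGen EF d x) =
      ∑ i, c i • fund EG EM (q (1, x)) (Z i) := by
  obtain ⟨c, hc⟩ := h.central.exists_differential_eq_complex h.differential h.holomorphicHom
    h.realForm.isCompact h.parabolic.isClosed d
  refine ⟨c, ?_⟩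
  have hmem : ∑ i, c i • Z i ∈ lieAlg EG P :=
    h.parabolicAlgebra.toSubmodule.sum_mem fun i _ => h.smul_mem _ _ (h.Z_mem i)
  have h1 := h.fund_of_mem hmem x
  have h2 : onLieAlgebra Gc D (∑ i, c i • Z i) = d := (differential_sum D c).trans hc
  rw [h2, map_sum] at h1
  rw [← h1]
  exact Finset.sum_congr rfl fun i _ => by rw [map_smul]

lemma frame_inl (i : Fin m) : frame Ep Em Z (Sum.inl i) = Z i := rfl

lemma frame_inr (α : PosRoot P H) :
    frame Ep Em Z (Sum.inr α) = (1 / ((√2 : ℝ) : ℂ)) • (Ep α - Em α) := rfl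

lemma fund_frame_inr (h : IsFlagBundle EG G τ EF EM q Z Ep Em D) (α : PosRoot P H) (x : F) :
    fund EG EM (q (1, x)) (frame Ep Em Z (Sum.inr α)) =
      (1 / ((√2 : ℝ) : ℂ)) • fund EG EM (q (1, x)) (Ep α) := by
  rw [frame_inr, map_smul, map_sub, h.fund_Em, sub_zero]

lemma sqrt_two_ne_zero : ((√2 : ℝ) : ℂ) ≠ 0 := by
  exact_mod_cast (Real.sqrt_pos.2 two_pos).ne'

lemma fund_Ep (h : IsFlagBundle EG G τ EF EM q Z Ep Em D) (α : PosRoot P H) (x : F) :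
    fund EG EM (q (1, x)) (Ep α) =
      ((√2 : ℝ) : ℂ) • fund EG EM (q (1, x)) (frame Ep Em Z (Sum.inr α)) := by
  rw [h.fund_frame_inr, smul_smul, mul_one_div_cancel sqrt_two_ne_zero, one_smul]

/-- The fundamental fields at a point of the fibre in terms of the frame. -/
lemma exists_fund_eq (h : IsFlagBundle EG G τ EF EM q Z Ep Em D)
    (Y : GroupLieAlgebra 𝓘(ℂ, EG) Gc) (x : F) :
    ∃ c : Fin m → ℂ, fund EG EM (q (1, x)) Y =
      ∑ a, Sum.elim c (fun α => ((√2 : ℝ) : ℂ) * killingForm ℂ _ Y (Em α)) a •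
        fund EG EM (q (1, x)) (frame Ep Em Z a) := by
  obtain ⟨c, hc⟩ := h.fund_tangent (onLieAlgebra Gc D
    (Y - ∑ α, killingForm ℂ _ Y (Em α) • Ep α)) x
  refine ⟨c, ?_⟩
  rw [← h.fund_of_mem (h.sub_sum_mem Y), map_sub, sub_eq_iff_eq_add, map_sum] at hc
  rw [hc, Fintype.sum_sum_type]
  congr 1
  refine Finset.sum_congr rfl fun α _ => ?_
  rw [map_smul, h.fund_Ep, smul_smul, mul_comm]
  rfl

/-- At principal points of the fibre the frame is linearly independent. -/
lemma linearIndependent_frame (h : IsFlagBundle EG G τ EF EM q Z Ep Em D) {x : F}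
    (hx : q (1, x) ∈ principalPoints M G) :
    LinearIndependent ℂ fun a => fund EG EM (q (1, x)) (frame Ep Em Z a) := by
  classical
  refine Fintype.linearIndependent_iff.2 fun c hc => ?_
  set X := ∑ a, c a • frame Ep Em Z a with hX
  have hX0 : fund EG EM (q (1, x)) X = 0 := by
    rw [hX, map_sum, ← hc]
    exact Finset.sum_congr rfl fun a _ => map_smul _ _ _
  obtain ⟨hXP, hDX⟩ := (h.bundle.gen_eq_zero_iff h.toric.holomorphic h.differential
    h.parabolic.isClosed).1 hX0
  have hDX0 := h.bundle.free_of_principal h.toric h.differential h.holomorphicHom h.central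
    h.realForm.isCompact h.parabolic.isClosed hx hDX
  have hr : ∀ β, c (Sum.inr β) = 0 := by
    intro β
    have h1 := h.killingForm_Em β hXP
    have h2 : killingForm ℂ _ X (Em β) = c (Sum.inr β) * (1 / ((√2 : ℝ) : ℂ)) := by
      rw [hX, Fintype.sum_sum_type]
      simp only [map_add, map_sum, map_smul, LinearMap.add_apply, LinearMap.sum_apply,
        LinearMap.smul_apply, frame_inl, frame_inr, map_sub, LinearMap.sub_apply,
        h.killingForm_Em β (h.Z_mem _), h.killingForm_Em β (h.Em_mem _), h.killingForm_Ep_Em,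
        smul_eq_mul, mul_zero, Finset.sum_const_zero, sub_zero, zero_add, mul_ite, mul_one,
        Finset.sum_ite_eq', Finset.mem_univ, if_true]
    rw [h2] at h1
    exact (mul_eq_zero.1 h1).resolve_right (one_div_ne_zero sqrt_two_ne_zero)
  have hXZ : X = ∑ i, c (Sum.inl i) • Z i := by
    rw [hX, Fintype.sum_sum_type]
    simp [hr, frame_inl]
  have hl : (fun i => c (Sum.inl i)) = 0 :=
    h.central.linearIndependent_differential h.differential h.holomorphicHom
      h.realForm.isCompact h.parabolic.isClosed (by
        rw [← differential_sum D, ← hXZ]; exact hDX0)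
  rintro (i | β)
  · exact congrFun hl i
  · exact hr β

/-- Tangent vectors of `M` are sums of fundamental vectors and vectors along the fibre. The latter
are torus fields at a principal point, because the infinitesimal action is free and `F` has
dimension `m`. -/
lemma span_frame (h : IsFlagBundle EG G τ EF EM q Z Ep Em D) {x : F}
    (hx : q (1, x) ∈ principalPoints M G) :
    ⊤ ≤ Submodule.span ℂ (Set.range fun a => fund EG EM (q (1, x)) (frame Ep Em Z a)) := by
  rintro v -
  obtain ⟨⟨Y, ξ⟩, hv⟩ : ∃ y, tmap₂ EG EF EM q (1, x) y = v := h.bundle.submersion (1, x) v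
  rw [h.bundle.tmap₂_eq] at hv
  rw [← hv]
  have hY : gen Gc EM Y (q (1, x)) = fund EG EM (q (1, x)) Y := rfl
  refine Submodule.add_mem _ ?_ ?_
  · obtain ⟨c, hc⟩ := h.exists_fund_eq Y x
    rw [hY, hc]
    exact Submodule.sum_mem _ fun a _ => Submodule.smul_mem _ _ (Submodule.subset_span ⟨a, rfl⟩)
  · let T : (Fin m → ℂ) →ₗ[ℂ] EF :=
      (tmap (Fin m → ℂ) EF (fun g : TorusCover m => g • x) 1 : (Fin m → ℂ) →L[ℂ] EF)
    have hinj : Function.Injective T := (injective_iff_map_eq_zero _).2 fun c hc =>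
      h.bundle.free_of_principal h.toric h.differential h.holomorphicHom h.central
        h.realForm.isCompact h.parabolic.isClosed hx hc
    obtain ⟨d, hd⟩ := (LinearMap.injective_iff_surjective_of_finrank_eq_finrank
      (by rw [h.toric.dim, Module.finrank_fin_fun])).1 hinj ξ
    obtain ⟨c, hc⟩ := h.fund_tangent d x
    rw [← hd]
    change tmap EF EM (fun y : F => q (1, y)) x (torusGen EF d x) ∈ _
    rw [hc]
    exact Submodule.sum_mem _ fun i _ => Submodule.smul_mem _ _
      (Submodule.subset_span ⟨Sum.inl i, rfl⟩)

/-- The frame of the tangent space at a principal point of the fibre. -/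
def basis (h : IsFlagBundle EG G τ EF EM q Z Ep Em D) {x : F}
    (hx : q (1, x) ∈ principalPoints M G) : Module.Basis (Fin m ⊕ PosRoot P H) ℂ EM :=
  Module.Basis.mk (h.linearIndependent_frame hx) (h.span_frame hx)

lemma basis_apply (h : IsFlagBundle EG G τ EF EM q Z Ep Em D) {x : F}
    (hx : q (1, x) ∈ principalPoints M G) (a : Fin m ⊕ PosRoot P H) :
    h.basis hx a = fund EG EM (q (1, x)) (frame Ep Em Z a) :=
  Module.Basis.mk_apply _ _ _

lemma basis_repr_inr (h : IsFlagBundle EG G τ EF EM q Z Ep Em D) {x : F}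
    (hx : q (1, x) ∈ principalPoints M G) (Y : GroupLieAlgebra 𝓘(ℂ, EG) Gc) (α : PosRoot P H) :
    (h.basis hx).repr (fund EG EM (q (1, x)) Y) (Sum.inr α) =
      ((√2 : ℝ) : ℂ) * killingForm ℂ _ Y (Em α) := by
  obtain ⟨c, hc⟩ := h.exists_fund_eq Y x
  rw [hc]
  simp only [← h.basis_apply hx]
  rw [Module.Basis.repr_sum_self]
  rfl

/-- The trace of the isotropy representation. -/
lemma sum_repr_lie (h : IsFlagBundle EG G τ EF EM q Z Ep Em D) {x : F}
    (hx : q (1, x) ∈ principalPoints M G) {X : GroupLieAlgebra 𝓘(ℂ, EG) Gc}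
    (hX : X ∈ lieAlg EG P) :
    ∑ a, (h.basis hx).repr (fund EG EM (q (1, x)) ⁅X, frame Ep Em Z a⁆) a =
      killingForm ℂ _ X (∑ α, coH Ep Em α) := by
  rw [Fintype.sum_sum_type, map_sum]
  -- Brackets inside `Lie P` act trivially on the fibre, so only root vectors contribute to the
  -- trace; the two factors `√2` cancel and leave `B ([X, E_α], E_{-α}) = B (X, H_α)`.
  have h1 : ∀ i, fund EG EM (q (1, x)) ⁅X, frame Ep Em Z (Sum.inl i)⁆ = 0 := fun i =>
    h.fund_lie hX (h.Z_mem i) x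
  simp only [h1, map_zero, Finsupp.coe_zero, Pi.zero_apply, Finset.sum_const_zero, zero_add]
  refine Finset.sum_congr rfl fun α _ => ?_
  rw [h.basis_repr_inr, frame_inr, lie_smul, lie_sub, map_smul, map_sub, LinearMap.smul_apply,
    LinearMap.sub_apply,
    h.killingForm_Em α (h.parabolicAlgebra.lie_mem (show X ∈ h.parabolicAlgebra from hX)
      (show Em α ∈ h.parabolicAlgebra from h.Em_mem α)), sub_zero, smul_eq_mul, ← mul_assoc,
    mul_one_div_cancel sqrt_two_ne_zero, one_mul, killingForm_lie_left]
  rfl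

end IsFlagBundle

end Setting

/-! ### The volume function on the fibre -/

section RealFunctions

variable {E : Type*} [NormedAddCommGroup E] [NormedSpace ℂ E]
  {M : Type*} [TopologicalSpace M] [ChartedSpace E M]

/-- `u` is differentiable at `p` with differential `L`. -/
def HasDifferential (u : M → ℝ) (p : M) (L : E → ℝ) : Prop :=
  MDifferentiableAt 𝓘(ℝ, E) 𝓘(ℝ, ℝ) u p ∧ ∀ v : E, dirDeriv u p v = L v

lemma hasDifferential_iff {u : M → ℝ} {p : M} {L : E → ℝ} : HasDifferential u p L ↔
    ContinuousAt u p ∧ ∃ L' : E →L[ℝ] ℝ, (∀ v, L' v = L v) ∧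
      HasFDerivAt (fun z => u ((chartAt E p).symm z)) L' (chartAt E p p) := by
  constructor
  · rintro ⟨h1, h2⟩
    obtain ⟨h3, h4⟩ := mdifferentiableAt_real_iff.1 h1
    exact ⟨h3, _, fun v => by rw [← h2, dirDeriv_eq h1], h4.hasFDerivAt⟩
  · rintro ⟨h1, L', h2, h3⟩
    have h4 : MDifferentiableAt 𝓘(ℝ, E) 𝓘(ℝ, ℝ) u p :=
      mdifferentiableAt_real_iff.2 ⟨h1, h3.differentiableAt⟩
    exact ⟨h4, fun v => by rw [dirDeriv_eq h4, h3.fderiv, h2]⟩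

lemma HasDifferential.congr {u u' : M → ℝ} {p : M} {L L' : E → ℝ} (hu : HasDifferential u p L)
    (h : ∀ y, u' y = u y) (h' : ∀ v, L' v = L v) : HasDifferential u' p L' := by
  obtain rfl : u' = u := funext h
  exact ⟨hu.1, fun v => (hu.2 v).trans (h' v).symm⟩

lemma HasDifferential.add {u w : M → ℝ} {p : M} {L L' : E → ℝ} (hu : HasDifferential u p L)
    (hw : HasDifferential w p L') :
    HasDifferential (fun x => u x + w x) p fun v => L v + L' v := by
  obtain ⟨h1, A, h2, h3⟩ := hasDifferential_iff.1 hu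
  obtain ⟨h1', A', h2', h3'⟩ := hasDifferential_iff.1 hw
  exact hasDifferential_iff.2 ⟨h1.add h1', A + A', fun v => by simp [h2, h2'], h3.add h3'⟩

lemma HasDifferential.const_mul {u : M → ℝ} {p : M} {L : E → ℝ} (hu : HasDifferential u p L)
    (r : ℝ) : HasDifferential (fun x => r * u x) p fun v => r * L v := by
  obtain ⟨h1, A, h2, h3⟩ := hasDifferential_iff.1 hu
  exact hasDifferential_iff.2 ⟨h1.const_mul r, r • A, fun v => by simp [h2], h3.const_mul r⟩

lemma hasDifferential_const (r : ℝ) (p : M) : HasDifferential (fun _ => r) p fun _ : E => 0 :=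
  hasDifferential_iff.2 ⟨continuousAt_const, 0, fun _ => rfl, hasFDerivAt_const _ _⟩

lemma HasDifferential.comp {E' : Type*} [NormedAddCommGroup E'] [NormedSpace ℂ E']
    {N : Type*} [TopologicalSpace N] [ChartedSpace E' N] [IsManifold 𝓘(ℂ, E') ω N]
    {u : M → ℝ} {f : N → M} {x : N} {L : E → ℝ}
    (hu : HasDifferential u (f x) L) (hf : ContMDiff 𝓘(ℂ, E') 𝓘(ℂ, E) ω f) :
    HasDifferential (fun y => u (f y)) x fun v : E' => L (tmap E' E f x v) := by
  have h1 : MDifferentiableAt 𝓘(ℝ, E') 𝓘(ℝ, ℝ) (fun y => u (f y)) x :=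
    hu.1.comp x ((contMDiff_restrictScalars hf).mdifferentiableAt (by simp))
  refine ⟨h1, fun v => ?_⟩
  obtain ⟨c, hc⟩ := exists_hasVelocity x v
  have h2 := hc.comp_real h1
  have h3 := (hc.comp (hf.mdifferentiableAt (by simp))).comp_real hu.1
  rw [h2.unique h3]
  exact hu.2 _

end RealFunctions

/-! ### The algebraic representative of a Kähler form and its volume along the fibre -/

section Setting

variable {EG : Type*} [NormedAddCommGroup EG] [NormedSpace ℂ EG] [FiniteDimensional ℂ EG]
  {Gc : Type*} [TopologicalSpace Gc] [ChartedSpace EG Gc] [Group Gc] [LieGroup 𝓘(ℂ, EG) ω Gc]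
  {P G : Subgroup Gc} {m : ℕ} {τ : P →* (Fin m → ℂˣ)}
  {EF : Type*} [NormedAddCommGroup EF] [NormedSpace ℂ EF] [FiniteDimensional ℂ EF]
  {F : Type*} [TopologicalSpace F] [ChartedSpace EF F] [IsManifold 𝓘(ℂ, EF) ω F]
  [MulAction (Fin m → ℂˣ) F]
  {EM : Type*} [NormedAddCommGroup EM] [NormedSpace ℂ EM] [FiniteDimensional ℂ EM]
  {M : Type*} [TopologicalSpace M] [ChartedSpace EM M] [IsManifold 𝓘(ℂ, EM) ω M]
  [MulAction Gc M] {q : Gc × F → M}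
  {Z : Fin m → GroupLieAlgebra 𝓘(ℂ, EG) Gc}
  {H : LieSubalgebra ℂ (GroupLieAlgebra 𝓘(ℂ, EG) Gc)} [H.IsCartanSubalgebra]
  {Ep Em : PosRoot P H → GroupLieAlgebra 𝓘(ℂ, EG) Gc}
  {D : EG →L[ℂ] (Fin m → ℂ)} [T2Space Gc] [ConnectedSpace F]
  [T2Space M] [LieAlgebra.IsSemisimple ℂ (GroupLieAlgebra 𝓘(ℂ, EG) Gc)]

namespace IsFlagBundle

/-- The algebraic representative in terms of the model spaces. -/
lemma algRep_apply {ψ : TwoForm EM M} {p : M} {W X Y : GroupLieAlgebra 𝓘(ℂ, EG) Gc}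
    (hW : IsAlgRepAt G ψ p W) (hX : X ∈ lieAlg EG G) (hY : Y ∈ lieAlg EG G) :
    (((ψ p : EM [⋀^Fin 2]→L[ℝ] ℝ) ![fund EG EM p X, fund EG EM p Y] : ℝ) : ℂ) =
      killingForm ℂ _ W ⁅X, Y⁆ := hW.2 X hX Y hY

lemma exists_decomposition (h : IsFlagBundle EG G τ EF EM q Z Ep Em D)
    (X : GroupLieAlgebra 𝓘(ℂ, EG) Gc) :
    ∃ Y ∈ lieAlg EG G, ∃ W ∈ lieAlg EG G, X = Y + Complex.I • W := by
  obtain ⟨Y, hY, -⟩ := h.realForm.complexification X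
  exact ⟨Y.1, hY.1, Y.2, hY.2.1, hY.2.2⟩

lemma eq_zero_of_killingForm (h : IsFlagBundle EG G τ EF EM q Z Ep Em D)
    {X : GroupLieAlgebra 𝓘(ℂ, EG) Gc} (hX : ∀ Y ∈ lieAlg EG G, killingForm ℂ _ X Y = 0) :
    X = 0 := by
  refine (LieAlgebra.IsKilling.killingForm_nondegenerate ℂ _).1 _ fun Y => ?_
  obtain ⟨A, hA, B, hB, rfl⟩ := h.exists_decomposition Y
  rw [map_add, map_smul, hX A hA, hX B hB, smul_zero, add_zero]

lemma mem_real_of_mem_inf {X : GroupLieAlgebra 𝓘(ℂ, EG) Gc} (hX : X ∈ lieAlg EG (G ⊓ P)) :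
    X ∈ lieAlg EG G := lieAlg_mono inf_le_left hX

lemma kerSubgroup_le : kerSubgroup G τ ≤ G ⊓ P := by
  rintro g ⟨hg, p, -, rfl⟩
  exact ⟨hg, p.2⟩

lemma fund_of_mem_kerSubgroup (h : IsFlagBundle EG G τ EF EM q Z Ep Em D)
    {X : GroupLieAlgebra 𝓘(ℂ, EG) Gc} (hX : X ∈ lieAlg EG (kerSubgroup G τ)) (x : F) :
    fund EG EM (q (1, x)) X = 0 :=
  h.fund_eq_zero (lieAlg_mono (kerSubgroup_le.trans inf_le_right) hX)
    (h.differential.apply_eq_zero_of_mem_kerSubgroup hX) x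

/-- A representative in the Lie algebra of `K` of the form of the theorem commutes with `K`. -/
lemma lie_eq_zero_of_algRep (h : IsFlagBundle EG G τ EF EM q Z Ep Em D) {ψ : TwoForm EM M} {x : F}
    {c : Fin m → ℝ} {I : GroupLieAlgebra 𝓘(ℂ, EG) Gc} (hI : I ∈ lieAlg EG (kerSubgroup G τ))
    (hW : IsAlgRepAt G ψ (q (1, x)) (∑ i, (c i : ℂ) • Z i + I))
    {X : GroupLieAlgebra 𝓘(ℂ, EG) Gc} (hX : X ∈ lieAlg EG (G ⊓ P)) :
    ⁅∑ i, (c i : ℂ) • Z i + I, X⁆ = 0 := by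
  set W := ∑ i, (c i : ℂ) • Z i + I with hWdef
  have hWk : W ∈ lieAlg EG (G ⊓ P) :=
    Submodule.add_mem _ (h.central.sum_mem c) (lieAlg_mono kerSubgroup_le hI)
  -- The fundamental field of `X` vanishes on the fibre, so `B ([W, X], Y) = B (W, [X, Y]) = ψ (X̂,
  -- Ŷ) = 0` for all `Y` in `Lie G`.
  have hker : ∀ X ∈ lieAlg EG (kerSubgroup G τ), ⁅W, X⁆ = 0 := by
    intro X hX
    refine h.eq_zero_of_killingForm fun Y hY => ?_
    rw [killingForm_lie_left, ← algRep_apply hW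
      (mem_real_of_mem_inf (P := P) (lieAlg_mono kerSubgroup_le hX)) hY,
      h.fund_of_mem_kerSubgroup hX x]
    have h0 : ∀ (θ : EM [⋀^Fin 2]→L[ℝ] ℝ) (v : EM), ((θ ![0, v] : ℝ) : ℂ) = 0 := fun θ v => by
      rw [twoForm_zero_left, Complex.ofReal_zero]
    exact h0 _ _
  have hZ : ∀ i, ⁅W, Z i⁆ = 0 := fun i => by
    rw [← lie_skew, h.central.central i W hWk, neg_zero]
  obtain ⟨a, ha⟩ := h.central.exists_sub_mem h.differential h.holomorphicHom h.realForm.isCompact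
    h.parabolic.isClosed hX
  have h1 := hker _ ha
  have h2 : ⁅W, ∑ i, (a i : ℂ) • Z i⁆ = 0 := by
    rw [lie_sum]
    exact Finset.sum_eq_zero fun i _ => by rw [lie_smul, hZ, smul_zero]
  rwa [lie_sub, h2, sub_zero] at h1

/-- `H` is the complexification of its part in `Lie K`, so commuting with `Lie K` means centralizing
the Cartan subalgebra. -/
lemma mem_torus_of_lie_eq_zero (h : IsFlagBundle EG G τ EF EM q Z Ep Em D)
    {W : GroupLieAlgebra 𝓘(ℂ, EG) Gc} (hW : ∀ X ∈ lieAlg EG (G ⊓ P), ⁅W, X⁆ = 0) : W ∈ H := by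
  refine mem_cartan_of_lie_eq_zero fun X hX => ?_
  obtain ⟨Y, -, V, -, hY, hV, rfl⟩ := h.torus X hX
  rw [← lie_skew, lie_add, lie_smul, hW Y hY, hW V hV, smul_zero, add_zero, neg_zero]

/-- The second real root vector `i (E_α + E_{-α}) / √2`. -/
def conjFrame (Ep Em : PosRoot P H → GroupLieAlgebra 𝓘(ℂ, EG) Gc) (α : PosRoot P H) :
    GroupLieAlgebra 𝓘(ℂ, EG) Gc := (1 / ((√2 : ℝ) : ℂ)) • (Complex.I • (Ep α + Em α))

lemma real_smul_mem {X : GroupLieAlgebra 𝓘(ℂ, EG) Gc} (hX : X ∈ lieAlg EG G) (r : ℝ) :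
    (r : ℂ) • X ∈ lieAlg EG G := Submodule.smul_mem _ r hX

lemma one_div_sqrt_two : (1 / ((√2 : ℝ) : ℂ)) = ((1 / √2 : ℝ) : ℂ) := by push_cast; rfl

lemma frame_mem (h : IsFlagBundle EG G τ EF EM q Z Ep Em D) (a : Fin m ⊕ PosRoot P H) :
    frame Ep Em Z a ∈ lieAlg EG G := by
  rcases a with i | α
  · exact mem_real_of_mem_inf (h.central.mem i)
  · rw [frame_inr, one_div_sqrt_two]
    exact real_smul_mem (h.roots.sub_mem α) _

lemma conjFrame_mem (h : IsFlagBundle EG G τ EF EM q Z Ep Em D) (α : PosRoot P H) :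
    conjFrame Ep Em α ∈ lieAlg EG G := by
  rw [conjFrame, one_div_sqrt_two]
  exact real_smul_mem (h.roots.add_mem α) _

/-- Since the field of `E_{-α}` vanishes on the fibre, its sign may be reversed; this turns `i`
times a real element into a real one, on which the representative can be evaluated. -/
lemma I_smul_fund_frame (h : IsFlagBundle EG G τ EF EM q Z Ep Em D) (α : PosRoot P H) (x : F) :
    Complex.I • fund EG EM (q (1, x)) (frame Ep Em Z (Sum.inr α)) =
      fund EG EM (q (1, x)) (conjFrame Ep Em α) := by
  rw [h.fund_frame_inr, conjFrame, map_smul, map_smul, map_add, h.fund_Em, add_zero, smul_comm]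

lemma lie_torus_Ep (h : IsFlagBundle EG G τ EF EM q Z Ep Em D) (α : PosRoot P H)
    {W : GroupLieAlgebra 𝓘(ℂ, EG) Gc} (hW : W ∈ H) :
    ⁅W, Ep α⁆ = rootValue Ep Em α W • Ep α ∧ ⁅W, Em α⁆ = -rootValue Ep Em α W • Em α :=
  lie_Ep (p := h.parabolicAlgebra) (Ep := Ep) (Em := Em) h.roots.mem_pos h.roots.mem_neg
    h.roots.normalized α hW

lemma killingForm_Em_Em (h : IsFlagBundle EG G τ EF EM q Z Ep Em D) (α β : PosRoot P H) :
    killingForm ℂ _ (Em α) (Em β) = 0 := h.killingForm_Em β (h.Em_mem α)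

open Classical in
lemma killingForm_Em_Ep (h : IsFlagBundle EG G τ EF EM q Z Ep Em D) (α β : PosRoot P H) :
    killingForm ℂ _ (Em α) (Ep β) = if α = β then 1 else 0 := by
  rw [LieModule.traceForm_comm]
  refine (h.killingForm_Ep_Em β α).trans ?_
  simp only [eq_comm]

/-- `[W, E_α - E_{-α}]` is proportional to `E_α + E_{-α}`, and its pairings with `E_β` and `-E_{-β}`
cancel. -/
lemma killingForm_lie_frame_frame (h : IsFlagBundle EG G τ EF EM q Z Ep Em D) {α β : PosRoot P H}
    {W : GroupLieAlgebra 𝓘(ℂ, EG) Gc} (hW : W ∈ H) :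
    killingForm ℂ _ W ⁅frame Ep Em Z (Sum.inr α), frame Ep Em Z (Sum.inr β)⁆ = 0 := by
  classical
  obtain ⟨h1, h2⟩ := h.lie_torus_Ep α hW
  rw [← killingForm_lie_left, frame_inr, frame_inr, lie_smul, lie_sub, h1, h2]
  simp only [map_smul, map_sub, LinearMap.smul_apply, LinearMap.sub_apply, h.killingForm_Ep_Ep,
    h.killingForm_Em_Em, h.killingForm_Em_Ep, h.killingForm_Ep_Em, smul_eq_mul]
  ring

open Classical in
lemma killingForm_lie_frame_conjFrame (h : IsFlagBundle EG G τ EF EM q Z Ep Em D)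
    {α β : PosRoot P H} {W : GroupLieAlgebra 𝓘(ℂ, EG) Gc} (hW : W ∈ H) :
    killingForm ℂ _ W ⁅frame Ep Em Z (Sum.inr α), conjFrame Ep Em β⁆ =
      if α = β then Complex.I * rootValue Ep Em α W else 0 := by
  obtain ⟨h1, h2⟩ := h.lie_torus_Ep α hW
  have hs : ((√2 : ℝ) : ℂ) * ((√2 : ℝ) : ℂ) = 2 := by
    rw [← Complex.ofReal_mul, Real.mul_self_sqrt zero_le_two]; norm_num
  have hs0 := sqrt_two_ne_zero
  rw [← killingForm_lie_left, frame_inr, conjFrame, lie_smul, lie_sub, h1, h2]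
  simp only [map_smul, map_sub, map_add, LinearMap.smul_apply, LinearMap.sub_apply,
    h.killingForm_Ep_Ep, h.killingForm_Em_Em, h.killingForm_Em_Ep, h.killingForm_Ep_Em,
    smul_eq_mul]
  split_ifs
  · field_simp
    rw [sq, hs]
    ring
  · ring

lemma fund_lie_apply (h : IsFlagBundle EG G τ EF EM q Z Ep Em D) {η : TwoForm EM M}
    (hη : IsKahlerForm η) (hinv : IsInvariantUnder (G : Set Gc) η)
    {X Y : GroupLieAlgebra 𝓘(ℂ, EG) Gc} (hX : X ∈ lieAlg EG G) (hY : Y ∈ lieAlg EG G) (p : M) :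
    HasDifferential (fun p => (η p : EM [⋀^Fin 2]→L[ℝ] ℝ) ![fund EG EM p X, fund EG EM p Y]) p
      fun v : EM => (η p : EM [⋀^Fin 2]→L[ℝ] ℝ) ![fund EG EM p ⁅X, Y⁆, v] :=
  dirDeriv_apply_gen (E := EG) h.bundle.contMDiff_smul h.isClosed hη hinv hX hY p

/-- The differential of the components of the algebraic representative. -/
lemma hasDifferential_killingForm (h : IsFlagBundle EG G τ EF EM q Z Ep Em D) {η : TwoForm EM M}
    (hη : IsKahlerForm η) (hinv : IsInvariantUnder (G : Set Gc) η)
    {W : F → GroupLieAlgebra 𝓘(ℂ, EG) Gc} (hW : ∀ x, IsAlgRepAt G η (q (1, x)) (W x))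
    {X : GroupLieAlgebra 𝓘(ℂ, EG) Gc} (hX : X ∈ lieAlg EG G) (x : F) :
    HasDifferential (fun x => (killingForm ℂ _ (W x) X).re) x fun v : EF =>
      (η (q (1, x)) : EM [⋀^Fin 2]→L[ℝ] ℝ)
        ![fund EG EM (q (1, x)) X, tmap EF EM (fun y : F => q (1, y)) x v] := by
  -- `X` is a sum of brackets `[A, B]`, and on these the function is `η (Â, B̂)`, whose differential
  -- is known.
  have hspan := mem_span_lie_of_mem h.realForm.complexification
    (fun X hX Y hY => lie_mem_lieAlg h.isClosed hX hY) hX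
  have hι : ContMDiff 𝓘(ℂ, EF) 𝓘(ℂ, EM) ω (fun y : F => q (1, y)) :=
    h.bundle.holomorphic.comp (contMDiff_const.prodMk contMDiff_id)
  obtain ⟨θ, hθ⟩ : ∃ θ : EM [⋀^Fin 2]→L[ℝ] ℝ, θ = η (q (1, x)) := ⟨_, rfl⟩
  rw [← hθ]
  clear hX
  induction hspan using Submodule.span_induction with
  | mem X hX =>
    obtain ⟨A, hA, B, hB, rfl⟩ := hX
    have h1 := (h.fund_lie_apply hη hinv hA hB (q (1, x))).comp (x := x)
      (f := fun y : F => q (1, y)) hι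
    have h2 : (fun x => (killingForm ℂ _ (W x) ⁅A, B⁆).re) = fun x =>
        (η (q (1, x)) : EM [⋀^Fin 2]→L[ℝ] ℝ)
          ![fund EG EM (q (1, x)) A, fund EG EM (q (1, x)) B] := by
      funext y
      rw [← algRep_apply (hW y) hA hB, Complex.ofReal_re]
    rw [h2, hθ]
    exact h1
  | zero =>
    refine (hasDifferential_const 0 x).congr (fun y => by simp) fun v => ?_
    rw [map_zero]
    exact twoForm_zero_left θ _
  | add X Y _ _ hX hY =>
    refine (hX.add hY).congr (fun y => by simp) fun v => ?_
    rw [map_add]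
    exact twoForm_add_left θ _ _ _
  | smul r X _ hX =>
    have h1 : ∀ y, (killingForm ℂ _ (W y) (r • X)).re = r * (killingForm ℂ _ (W y) X).re := by
      intro y
      have : r • X = (r : ℂ) • X := rfl
      rw [this, map_smul, smul_eq_mul, Complex.re_ofReal_mul]
    have h2 : fund EG EM (q (1, x)) (r • X) = r • fund EG EM (q (1, x)) X :=
      map_smul (fund EG EM (q (1, x))) (r : ℂ) X
    refine (hX.const_mul r).congr h1 fun v => ?_
    rw [h2]
    exact twoForm_smul_left θ _ _ _

lemma volumeFunction_eq (η : TwoForm EM M) (fr : Fin m ⊕ PosRoot P H → GroupLieAlgebra 𝓘(ℂ, EG) Gc)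
    (p : M) : volumeFunction η fr p = wedgePow (η p : EM [⋀^Fin 2]→L[ℝ] ℝ)
      (fun j : (Fin m ⊕ PosRoot P H) × Fin 2 =>
        if j.2 = 0 then fund EG EM p (fr j.1) else Complex.I • fund EG EM p (fr j.1)) := rfl

open Classical in
/-- The explicit form of the volume function on the fibre. -/
theorem volumeFunction_fibre (h : IsFlagBundle EG G τ EF EM q Z Ep Em D) {η : TwoForm EM M}
    (hη : IsKahlerForm η) (hinv : IsInvariantUnder (G : Set Gc) η)
    (f : Fin m → F → ℝ) (I : GroupLieAlgebra 𝓘(ℂ, EG) Gc)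
    (hI : I ∈ lieAlg EG (kerSubgroup G τ))
    (hW : ∀ x, IsAlgRepAt G η (q (1, x)) (∑ i, (f i x : ℂ) • Z i + I)) (x : F) :
    ((volumeFunction η (frame Ep Em Z) (q (1, x)) : ℝ) : ℂ) =
      ((wedgeConst (Fin m ⊕ PosRoot P H) * (-1) ^ m : ℝ) : ℂ) *
        (((Matrix.of fun i j : Fin m =>
          dirDeriv (E := EF) (f i) x (Complex.I • fibreField (E'' := EM) q (Z j) x)).det : ℝ) : ℂ) *
        ∏ α : PosRoot P H, (∑ i, rootValue Ep Em α (Complex.I • Z i) * (f i x : ℂ)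
          + rootValue Ep Em α (Complex.I • I)) := by
  set W := ∑ i, (f i x : ℂ) • Z i + I with hWdef
  set T := fund (Gc := Gc) EG EM (q (1, x)) with hT
  obtain ⟨θ, hθ⟩ : ∃ θ : EM [⋀^Fin 2]→L[ℝ] ℝ, θ = η (q (1, x)) := ⟨_, rfl⟩
  have hJ : ∀ v w : EM, θ ![Complex.I • v, Complex.I • w] = θ ![v, w] := by
    rw [hθ]; exact hη.map_J _
  have hrep : ∀ {X Y}, X ∈ lieAlg EG G → Y ∈ lieAlg EG G →
      ((θ ![T X, T Y] : ℝ) : ℂ) = killingForm ℂ _ W ⁅X, Y⁆ := fun hX hY => by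
    rw [hθ]; exact algRep_apply (hW x) hX hY
  have hcomm : ∀ X ∈ lieAlg EG (G ⊓ P), ⁅W, X⁆ = 0 := fun X hX =>
    h.lie_eq_zero_of_algRep hI (hW x) hX
  have hWH : W ∈ H := h.mem_torus_of_lie_eq_zero hcomm
  -- `B (W, [Z_i, Y]) = B ([W, Z_i], Y)`, and `W` commutes with `Z_i`.
  have hZθ : ∀ i Y, Y ∈ lieAlg EG G → θ ![T (Z i), T Y] = 0 := by
    intro i Y hY
    have h1 := hrep (mem_real_of_mem_inf (h.central.mem i)) hY
    rw [← killingForm_lie_left, hcomm _ (h.central.mem i)] at h1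
    simpa using h1
  have hv : ∀ a b, θ ![T (frame Ep Em Z a), T (frame Ep Em Z b)] = 0 := by
    rintro (i | α) b
    · exact hZθ i _ (h.frame_mem b)
    rcases b with j | β
    · rw [twoForm_swap]
      exact neg_eq_zero.2 (hZθ j _ (h.frame_mem _))
    · have h1 := hrep (h.frame_mem (Sum.inr α)) (h.frame_mem (Sum.inr β))
      rw [h.killingForm_lie_frame_frame hWH] at h1
      exact_mod_cast h1
  have hG : ∀ α, Complex.I • T (frame Ep Em Z (Sum.inr α)) = T (conjFrame Ep Em α) := fun α =>
    h.I_smul_fund_frame α x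
  set d : PosRoot P H → ℝ := fun α => θ ![T (frame Ep Em Z (Sum.inr α)), T (conjFrame Ep Em α)]
    with hd
  have hdval : ∀ α, (d α : ℂ) = ∑ i, rootValue Ep Em α (Complex.I • Z i) * (f i x : ℂ)
      + rootValue Ep Em α (Complex.I • I) := by
    intro α
    rw [hd, hrep (h.frame_mem _) (h.conjFrame_mem _), h.killingForm_lie_frame_conjFrame hWH,
      if_pos rfl, hWdef]
    simp only [rootValue, map_add, map_sum, map_smul, smul_eq_mul, mul_add, Finset.mul_sum]
    congr 1
    exact Finset.sum_congr rfl fun i _ => by ring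
  -- By orthonormality `f_i = -B (W, Z_i)`; the minus sign is that of the negative definite Killing
  -- form and yields the factor `(-1)^m`.
  have hf : ∀ i j, dirDeriv (E := EF) (f i) x (Complex.I • fibreField (E'' := EM) q (Z j) x) =
      -θ ![T (Z i), Complex.I • T (Z j)] := by
    intro i j
    have h1 := (h.hasDifferential_killingForm hη hinv hW
      (mem_real_of_mem_inf (h.central.mem i)) x).const_mul (-1)
    have h2 : (fun y => -1 * (killingForm ℂ _ (∑ i, (f i y : ℂ) • Z i + I) (Z i)).re) = f i := by
      funext y
      have h3 := h.central.killingForm_sum (fun i => (f i y : ℂ)) i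
      have h4 := h.central.perp i I hI
      rw [LieModule.traceForm_comm]
      have h5 : killingForm ℂ _ (Z i) (∑ i, (f i y : ℂ) • Z i + I) = -(f i y : ℂ) := by
        rw [map_add, h3, h4, add_zero]
      have h6 := congrArg (fun c : ℂ => -1 * c.re) h5
      simpa using h6
    rw [h2, ← hθ] at h1
    have h7 : fibreField (E := EG) (E' := EF) (E'' := EM) q (Z j) x =
        torusGen EF (onLieAlgebra Gc D (Z j)) x :=
      h.bundle.fibreField_eq h.toric.holomorphic h.differential h.parabolic.isClosed (h.Z_mem j) x
    have h8 : dirDeriv (E := EF) (f i) x (Complex.I • torusGen EF (onLieAlgebra Gc D (Z j)) x) =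
        -1 * θ ![fund EG EM (q (1, x)) (Z i), tmap EF EM (fun y : F => q (1, y)) x
          (Complex.I • torusGen EF (onLieAlgebra Gc D (Z j)) x)] := h1.2 (Complex.I • torusGen EF (onLieAlgebra Gc D (Z j)) x)
    rw [map_smul, ← h.fund_of_mem (h.Z_mem j), neg_one_mul] at h8
    refine (congrArg (fun v : EF => dirDeriv (f i) x (Complex.I • v)) h7).trans h8
  have hvol := wedgePow_of_isotropic θ (fun a => T (frame Ep Em Z a))
    (fun a => Complex.I • T (frame Ep Em Z a)) hv (fun a b => by rw [hJ, hv])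
  -- The vectors `J F̂_α` are fundamental vectors of real elements, so the mixed blocks vanish by
  -- `hZθ`, and distinct roots are orthogonal.
  have hblock : (Matrix.of fun a b => θ ![T (frame Ep Em Z a), Complex.I • T (frame Ep Em Z b)]) =
      Matrix.fromBlocks (-Matrix.of fun i j : Fin m =>
        dirDeriv (E := EF) (f i) x (Complex.I • fibreField (E'' := EM) q (Z j) x)) 0 0
        (Matrix.diagonal d) := by
    ext a b
    rcases a with i | α <;> rcases b with j | β
    · simp [hf, frame_inl]
    · simp only [Matrix.of_apply, Matrix.fromBlocks_apply₁₂, Matrix.zero_apply, hG, frame_inl]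
      exact hZθ i _ (h.conjFrame_mem β)
    · simp only [Matrix.of_apply, Matrix.fromBlocks_apply₂₁, Matrix.zero_apply]
      rw [← neg_eq_zero, ← twoForm_I_left θ hJ, hG, twoForm_swap, neg_eq_zero]
      exact hZθ j _ (h.conjFrame_mem α)
    · simp only [Matrix.of_apply, Matrix.fromBlocks_apply₂₂, Matrix.diagonal_apply, hG]
      split_ifs with hαβ
      · rw [hαβ]
      · have h1 := hrep (h.frame_mem (Sum.inr α)) (h.conjFrame_mem β)
        rw [h.killingForm_lie_frame_conjFrame hWH, if_neg hαβ] at h1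
        exact_mod_cast h1
  rw [volumeFunction_eq, ← hθ]
  refine (congrArg _ hvol).trans ?_
  rw [hblock, Matrix.det_fromBlocks_zero₂₁, Matrix.det_neg, Matrix.det_diagonal, Fintype.card_fin]
  simp only [← hdval]
  push_cast
  ring

end IsFlagBundle

end Setting

/-! ### The representative of the Ricci form -/

section Volume

variable {E : Type*} [NormedAddCommGroup E] [NormedSpace ℂ E] [FiniteDimensional ℂ E]
  {Gc : Type*} [TopologicalSpace Gc] [ChartedSpace E Gc] [Group Gc] [LieGroup 𝓘(ℂ, E) ω Gc]
  {E' : Type*} [NormedAddCommGroup E'] [NormedSpace ℂ E'] [FiniteDimensional ℂ E']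
  {M : Type*} [TopologicalSpace M] [ChartedSpace E' M] [IsManifold 𝓘(ℂ, E') ω M]
  [MulAction Gc M] [T2Space Gc] {ι : Type*} [Fintype ι] [DecidableEq ι]

/-- The value of the top power of a form on fundamental fields and their images under `J`. -/
def volumeGen (η : TwoForm E' M) (fr : ι → E) (p : M) : ℝ :=
  wedgePow (η p : E' [⋀^Fin 2]→L[ℝ] ℝ) fun j : ι × Fin 2 =>
    if j.2 = 0 then gen Gc E' (fr j.1) p else Complex.I • gen Gc E' (fr j.1) p

lemma wedgePow_eq_det_hermGram_re (θ : E' [⋀^Fin 2]→L[ℝ] ℝ)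
    (hJ : ∀ v w : E', θ ![Complex.I • v, Complex.I • w] = θ ![v, w]) (v : ι → E') :
    wedgePow θ (fun j : ι × Fin 2 => if j.2 = 0 then v j.1 else Complex.I • v j.1) =
      wedgeConst ι * (hermGram θ v).det.re := by
  have h1 := wedgePow_eq_det_hermGram θ hJ v
  rw [← det_hermGram_real θ hJ, ← Complex.ofReal_mul] at h1
  exact Complex.ofReal_injective h1

lemma det_hermGram_re_ne_zero (θ : E' [⋀^Fin 2]→L[ℝ] ℝ)
    (hJ : ∀ v w : E', θ ![Complex.I • v, Complex.I • w] = θ ![v, w])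
    (hpos : ∀ v : E', v ≠ 0 → 0 < θ ![v, Complex.I • v]) {e : ι → E'}
    (he : LinearIndependent ℂ e) : (hermGram θ e).det.re ≠ 0 := fun h =>
  det_hermGram_ne_zero θ hJ hpos he (by rw [← det_hermGram_real θ hJ, h, Complex.ofReal_zero])

lemma volumeGen_eq {η : TwoForm E' M} (hη : IsKahlerForm η) (fr : ι → E) (p : M) :
    volumeGen (Gc := Gc) η fr p = wedgeConst ι *
      (hermGram (η p : E' [⋀^Fin 2]→L[ℝ] ℝ) fun a => gen Gc E' (fr a) p).det.re := by
  have hJ : ∀ v w : E', (η p : E' [⋀^Fin 2]→L[ℝ] ℝ) ![Complex.I • v, Complex.I • w] =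
    (η p : E' [⋀^Fin 2]→L[ℝ] ℝ) ![v, w] := hη.map_J p
  have h1 : ∀ θ : E' [⋀^Fin 2]→L[ℝ] ℝ,
      (∀ v w : E', θ ![Complex.I • v, Complex.I • w] = θ ![v, w]) →
      wedgePow θ (fun j : ι × Fin 2 => if j.2 = 0 then gen Gc E' (fr j.1) p else
        Complex.I • gen Gc E' (fr j.1) p) =
      wedgeConst ι * (hermGram θ fun a => gen Gc E' (fr a) p).det.re :=
    fun θ hJ => wedgePow_eq_det_hermGram_re θ hJ fun a => gen Gc E' (fr a) p
  exact h1 (η p) hJ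

lemma hermGram_localForm {η : TwoForm E' M} {p₀ p : M} (hp : p ∈ (chartAt E' p₀).source)
    (v : ι → E') : hermGram (localForm η p₀ (chartAt E' p₀ p))
      (fun a => tmap E' E' (chartAt E' p₀) p (v a)) = hermGram (η p : E' [⋀^Fin 2]→L[ℝ] ℝ) v := by
  ext a b
  have h1 := localForm_chart η hp (v a) (v b)
  have h2 := localForm_chart η hp (v a) (Complex.I • v b)
  rw [map_smul] at h2
  simp only [hermGram, Matrix.of_apply, h1, h2]
  rfl

/-- The volume function of a frame of fundamental fields does not vanish and its logarithmic
derivative is given by the derivatives of the frame. -/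
lemma volumeGen_logDeriv
    (hact : ContMDiff (𝓘(ℂ, E).prod 𝓘(ℂ, E')) 𝓘(ℂ, E') ω (fun x : Gc × M => x.1 • x.2))
    {η : TwoForm E' M} (hη : IsKahlerForm η) (fr : ι → E) (p : M) (b : Module.Basis ι ℂ E')
    (hb : ∀ a, b a = gen Gc E' (fr a) p) :
    volumeGen (Gc := Gc) η fr p ≠ 0 ∧
    MDifferentiableAt 𝓘(ℝ, E') 𝓘(ℝ, ℝ) (volumeGen (Gc := Gc) η fr) p ∧
    HasDifferential (fun x => Real.log |volumeGen (Gc := Gc) η fr x|) p fun v : E' =>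
      fderiv ℝ (logDet (localForm η p) (Module.finBasis ℂ E')) (chartAt E' p p) v +
        2 * (∑ a, b.repr (fderiv ℂ (genField Gc E' p (fr a)) (chartAt E' p p) v) a).re := by
  have hz := chart_mem_target (E' := E') p
  have hwc := (wedgeConst_pos ι).ne'
  set z := chartAt E' p p with hzdef
  set k : E' → ℝ := fun y => wedgeConst ι *
    (hermGram (localForm η p y) fun a => genField Gc E' p (fr a) y).det.re with hk
  obtain ⟨f', hf', hfv⟩ := fderiv_log_det_hermGram_frame (hη.contDiffAt_localForm hz)
    (.of_forall fun y => hη.localForm_map_J p y) (fun v hv => hη.localForm_pos hz hv)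
    (Module.finBasis ℂ E') b (fun a => differentiableAt_genField hact p (fr a))
    (fun a => by rw [hb, gen_eq_genField hact]) (wedgeConst ι) hwc
  have hup : volumeGen (Gc := Gc) η fr =ᶠ[𝓝 p] fun x => k (chartAt E' p x) := by
    filter_upwards [eventually_tmap_chart_gen hact p] with x hx
    rw [volumeGen_eq hη, hk]
    simp only [← hx.2]
    rw [hermGram_localForm hx.1]
  have hsymm : Filter.Tendsto (chartAt E' p).symm (𝓝 z) (𝓝 p) := by
    have := ((chartAt E' p).symm.continuousAt hz).tendsto
    rwa [(chartAt E' p).left_inv (mem_chart_source E' p)] at this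
  have huz : (fun y => volumeGen (Gc := Gc) η fr ((chartAt E' p).symm y)) =ᶠ[𝓝 z] k := by
    filter_upwards [hsymm.eventually hup, eventually_mem_chart_target (E' := E') p] with y h1 h2
    rw [h1, (chartAt E' p).right_inv h2]
  have hkd : DifferentiableAt ℝ k z := by
    have hθ : DifferentiableAt ℝ (localForm η p) z :=
      (hη.contDiffAt_localForm hz).differentiableAt (by simp)
    have hF : ∀ a, DifferentiableAt ℝ (genField Gc E' p (fr a)) z := fun a =>
      (differentiableAt_genField hact p (fr a)).restrictScalars ℝ
    have hent : ∀ u w : E' → E', DifferentiableAt ℝ u z → DifferentiableAt ℝ w z →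
        DifferentiableAt ℝ (fun y => ((localForm η p y ![u y, w y] : ℝ) : ℂ)) z := by
      intro u w hu hw
      obtain ⟨f', hf', -⟩ := hasFDerivAt_twoForm_apply hθ.hasFDerivAt hu.hasFDerivAt hw.hasFDerivAt
      exact Complex.ofRealCLM.differentiableAt.comp z hf'.differentiableAt
    have h2 : ∀ a c, DifferentiableAt ℝ
        (fun y => hermGram (localForm η p y) (fun a => genField Gc E' p (fr a) y) a c) z :=
      fun a c => (hent _ _ (hF a) ((hF c).const_smul Complex.I)).sub
        ((hent _ _ (hF a) (hF c)).const_mul _)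
    refine (Complex.reCLM.differentiableAt.comp z ?_).const_mul _
    simp only [Matrix.det_apply']
    exact DifferentiableAt.fun_sum fun σ _ => DifferentiableAt.const_mul
      (HasFDerivAt.finsetProd fun i _ => (h2 (σ i) i).hasFDerivAt).differentiableAt _
  have hmd : MDifferentiableAt 𝓘(ℝ, E') 𝓘(ℝ, ℝ) (volumeGen (Gc := Gc) η fr) p := by
    rw [mdifferentiableAt_real_iff]
    refine ⟨?_, hkd.congr_of_eventuallyEq huz⟩
    have h1 : ContinuousAt (fun x => k (chartAt E' p x)) p :=
      ContinuousAt.comp (g := k) hkd.continuousAt ((chartAt E' p).continuousAt (mem_chart_source E' p))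
    exact h1.congr hup.symm
  have hne : volumeGen (Gc := Gc) η fr p ≠ 0 := by
    have h1 : (fun a => gen Gc E' (fr a) p) = b := funext fun a => (hb a).symm
    have h2 : ∀ θ : E' [⋀^Fin 2]→L[ℝ] ℝ,
        (∀ v w : E', θ ![Complex.I • v, Complex.I • w] = θ ![v, w]) →
        (∀ v : E', v ≠ 0 → 0 < θ ![v, Complex.I • v]) → (hermGram θ b).det.re ≠ 0 :=
      fun θ hJ hpos => det_hermGram_re_ne_zero θ hJ hpos b.linearIndependent
    rw [volumeGen_eq hη, h1]
    exact mul_ne_zero hwc (h2 _ (hη.map_J p) (hη.pos p))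
  refine ⟨hne, hmd, hasDifferential_iff.2 ⟨?_, f', hfv, ?_⟩⟩
  · exact (hmd.continuousAt.abs).log (abs_ne_zero.2 hne)
  · refine hf'.congr_of_eventuallyEq ?_
    filter_upwards [huz] with y hy
    rw [hy]

/-- The divergence of the fundamental fields in a chart, as a linear function. -/
def chartDivergence
    (hact : ContMDiff (𝓘(ℂ, E).prod 𝓘(ℂ, E')) 𝓘(ℂ, E') ω (fun x : Gc × M => x.1 • x.2)) (p : M) :
    E →ₗ[ℂ] ℂ where
  toFun X := LinearMap.trace ℂ E' (fderiv ℂ (genField Gc E' p X) (chartAt E' p p))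
  map_add' X Y := by
    have h1 : genField Gc E' p (X + Y) = genField Gc E' p X + genField Gc E' p Y :=
      funext fun z => genField_add p X Y z
    rw [h1, fderiv_add (differentiableAt_genField hact p X) (differentiableAt_genField hact p Y),
      ContinuousLinearMap.toLinearMap_add, map_add]
  map_smul' c X := by
    have h1 : genField Gc E' p (c • X) = c • genField Gc E' p X :=
      funext fun z => genField_smul p c X z
    rw [h1, fderiv_const_smul (differentiableAt_genField hact p X),
      ContinuousLinearMap.toLinearMap_smul, map_smul]
    rfl

/-- The invariance of `η` under the flow of `X̂`, read off from the volume density in the chart. -/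
lemma fderiv_logDet_gen
    (hact : ContMDiff (𝓘(ℂ, E).prod 𝓘(ℂ, E')) 𝓘(ℂ, E') ω (fun x : Gc × M => x.1 • x.2))
    {G : Subgroup Gc} (hG : IsClosed (G : Set Gc)) {η : TwoForm E' M} (hη : IsKahlerForm η)
    (hinv : IsInvariantUnder (G : Set Gc) η) {X : E} (hX : X ∈ lieAlg (Gc := Gc) E G) (p : M) :
    fderiv ℝ (logDet (localForm η p) (Module.finBasis ℂ E')) (chartAt E' p p) (gen Gc E' X p) =
      -2 * (chartDivergence hact p X).re := by
  have hz := chart_mem_target (E' := E') p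
  rw [gen_eq_genField hact]
  exact fderiv_logDet_of_lieInvariantAt (hη.contDiffAt_localForm hz)
    (differentiableAt_genField hact p X) (hη.localForm_map_J p _)
    (lieInvariantAt_of_mem_lieAlg hact hG hη hinv hz (contDiffAt_localAct hact p) hX) _
    (det_hermGram_ne_zero (localForm η p _) (hη.localForm_map_J p _)
      (fun v hv => hη.localForm_pos hz hv) (Module.finBasis ℂ E').linearIndependent)

/-- The divergence of a fundamental field in terms of a frame of fundamental fields. -/
lemma chartDivergence_eq
    (hact : ContMDiff (𝓘(ℂ, E).prod 𝓘(ℂ, E')) 𝓘(ℂ, E') ω (fun x : Gc × M => x.1 • x.2))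
    (fr : ι → E) (p : M) (b : Module.Basis ι ℂ E') (hb : ∀ a, b a = gen Gc E' (fr a) p) (X : E) :
    chartDivergence hact p X =
      ∑ a, b.repr (gen Gc E' (lieBr Gc X (fr a)) p) a +
      ∑ a, b.repr (fderiv ℂ (genField Gc E' p (fr a)) (chartAt E' p p) (gen Gc E' X p)) a := by
  -- The commutator formula expresses the derivative of `X̂` on a frame vector by the field of the
  -- bracket and the derivative of the frame along `X̂`; taking traces gives the two sums.
  have h1 : ∀ a, gen Gc E' (lieBr Gc X (fr a)) p = fderiv ℂ (genField Gc E' p X) (chartAt E' p p)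
      (b a) - fderiv ℂ (genField Gc E' p (fr a)) (chartAt E' p p) (gen Gc E' X p) := by
    intro a
    rw [hb, gen_eq_genField hact, gen_eq_genField hact, gen_eq_genField hact]
    exact (fderiv_genField_commutator hact (chart_mem_target (E' := E') p)
      (contDiffAt_localAct hact p) X (fr a)).symm
  simp only [h1, map_sub, Finsupp.coe_sub, Pi.sub_apply, Finset.sum_sub_distrib, sub_add_cancel]
  change LinearMap.trace ℂ E' _ = _
  rw [LinearMap.trace_eq_matrix_trace ℂ b, Matrix.trace]
  exact Finset.sum_congr rfl fun a _ => by rw [Matrix.diag_apply, LinearMap.toMatrix_apply]; rfl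

end Volume

/-! ### The Ricci form and the logarithmic derivative of the volume function -/

section Setting

variable {EG : Type*} [NormedAddCommGroup EG] [NormedSpace ℂ EG] [FiniteDimensional ℂ EG]
  {Gc : Type*} [TopologicalSpace Gc] [ChartedSpace EG Gc] [Group Gc] [LieGroup 𝓘(ℂ, EG) ω Gc]
  {P G : Subgroup Gc} {m : ℕ} {τ : P →* (Fin m → ℂˣ)}
  {EF : Type*} [NormedAddCommGroup EF] [NormedSpace ℂ EF] [FiniteDimensional ℂ EF]
  {F : Type*} [TopologicalSpace F] [ChartedSpace EF F] [IsManifold 𝓘(ℂ, EF) ω F]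
  [MulAction (Fin m → ℂˣ) F]
  {EM : Type*} [NormedAddCommGroup EM] [NormedSpace ℂ EM] [FiniteDimensional ℂ EM]
  {M : Type*} [TopologicalSpace M] [ChartedSpace EM M] [IsManifold 𝓘(ℂ, EM) ω M]
  [MulAction Gc M] {q : Gc × F → M}
  {Z : Fin m → GroupLieAlgebra 𝓘(ℂ, EG) Gc}
  {H : LieSubalgebra ℂ (GroupLieAlgebra 𝓘(ℂ, EG) Gc)} [H.IsCartanSubalgebra]
  {Ep Em : PosRoot P H → GroupLieAlgebra 𝓘(ℂ, EG) Gc}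
  {D : EG →L[ℂ] (Fin m → ℂ)} [T2Space Gc] [ConnectedSpace F]
  [T2Space M] [LieAlgebra.IsSemisimple ℂ (GroupLieAlgebra 𝓘(ℂ, EG) Gc)]

namespace IsFlagBundle


open ComplexConjugate

lemma lie_mem_real (h : IsFlagBundle EG G τ EF EM q Z Ep Em D)
    {X Y : GroupLieAlgebra 𝓘(ℂ, EG) Gc} (hX : X ∈ lieAlg EG G) (hY : Y ∈ lieAlg EG G) :
    ⁅X, Y⁆ ∈ lieAlg EG G := lie_mem_lieAlg h.isClosed hX hY

lemma coH_mem (h : IsFlagBundle EG G τ EF EM q Z Ep Em D) (α : PosRoot P H) :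
    coH Ep Em α ∈ H :=
  lie_Ep_Em_mem (p := h.parabolicAlgebra) (Ep := Ep) (Em := Em) h.roots.mem_pos h.roots.mem_neg α

lemma sum_coH_mem (h : IsFlagBundle EG G τ EF EM q Z Ep Em D) : ∑ α, coH Ep Em α ∈ H :=
  sum_mem fun α _ => h.coH_mem α

/-- `[E_α - E_{-α}, i (E_α + E_{-α})] = 2 i H_α` is a bracket of elements of `Lie G`. -/
lemma I_smul_coH_mem (h : IsFlagBundle EG G τ EF EM q Z Ep Em D) (α : PosRoot P H) :
    Complex.I • coH Ep Em α ∈ lieAlg EG G := by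
  have h1 := real_smul_mem (h.lie_mem_real (h.roots.sub_mem α) (h.roots.add_mem α)) (1 / 2)
  have h2 : ⁅Ep α - Em α, Complex.I • (Ep α + Em α)⁆ =
      (2 * Complex.I) • ⁅Ep α, Em α⁆ := by
    rw [lie_smul, sub_lie, lie_add, lie_add, lie_self, lie_self, ← lie_skew (Ep α) (Em α),
      zero_add, add_zero]
    module
  rw [h2, smul_smul] at h1
  rw [coH]
  convert h1 using 2
  push_cast
  ring

lemma ZV_eq : (ZV Ep Em : GroupLieAlgebra 𝓘(ℂ, EG) Gc) =
    ((-(1 / (2 * Real.pi)) : ℝ) : ℂ) • (Complex.I • ∑ α : PosRoot P H, coH Ep Em α) := by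
  rw [ZV, ← Finset.smul_sum]
  push_cast
  rfl

lemma I_smul_sum_coH_mem (h : IsFlagBundle EG G τ EF EM q Z Ep Em D) :
    Complex.I • ∑ α, coH Ep Em α ∈ lieAlg EG G := by
  rw [Finset.smul_sum]
  exact Submodule.sum_mem _ fun α _ => h.I_smul_coH_mem α

lemma ZV_mem (h : IsFlagBundle EG G τ EF EM q Z Ep Em D) : ZV Ep Em ∈ lieAlg EG G := by
  rw [ZV_eq]
  exact real_smul_mem h.I_smul_sum_coH_mem _

lemma central_mem_torus (h : IsFlagBundle EG G τ EF EM q Z Ep Em D) (i : Fin m) : Z i ∈ H :=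
  h.mem_torus_of_lie_eq_zero (h.central.central i)

lemma killingForm_torus_root (h : IsFlagBundle EG G τ EF EM q Z Ep Em D)
    {W : GroupLieAlgebra 𝓘(ℂ, EG) Gc} (hW : W ∈ H) (α : PosRoot P H) :
    killingForm ℂ _ W (Ep α) = 0 ∧ killingForm ℂ _ W (Em α) = 0 := by
  have hW0 : W ∈ LieAlgebra.rootSpace H (0 : H → ℂ) :=
    LieAlgebra.toLieSubmodule_le_rootSpace_zero ℂ _ H hW
  have hα : (α.1 : H → ℂ) ≠ 0 := α.2.1
  exact ⟨killingForm_eq_zero_of_rootSpace hW0 (h.roots.mem_pos α) (by rwa [zero_add]),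
    killingForm_eq_zero_of_rootSpace hW0 (h.roots.mem_neg α) (by rwa [zero_add, neg_ne_zero])⟩

/-- The real combinations of root vectors. -/
def rootSum (Ep Em : PosRoot P H → GroupLieAlgebra 𝓘(ℂ, EG) Gc) (c : PosRoot P H → ℂ) :
    GroupLieAlgebra 𝓘(ℂ, EG) Gc := ∑ α, (c α • Ep α - conj (c α) • Em α)

lemma rootSum_mem (h : IsFlagBundle EG G τ EF EM q Z Ep Em D) (c : PosRoot P H → ℂ) :
    rootSum Ep Em c ∈ lieAlg EG G := by
  refine Submodule.sum_mem _ fun α _ => ?_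
  have h1 : c α • Ep α - conj (c α) • Em α =
      ((c α).re : ℂ) • (Ep α - Em α) + ((c α).im : ℂ) • (Complex.I • (Ep α + Em α)) := by
    conv_lhs => rw [← Complex.re_add_im (c α)]
    simp only [map_add, map_mul, Complex.conj_ofReal, Complex.conj_I]
    module
  rw [h1]
  exact Submodule.add_mem _ (real_smul_mem (h.roots.sub_mem α) _)
    (real_smul_mem (h.roots.add_mem α) _)

lemma killingForm_torus_rootSum (h : IsFlagBundle EG G τ EF EM q Z Ep Em D)
    {W : GroupLieAlgebra 𝓘(ℂ, EG) Gc} (hW : W ∈ H) (c : PosRoot P H → ℂ) :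
    killingForm ℂ _ W (rootSum Ep Em c) = 0 := by
  rw [rootSum, map_sum]
  refine Finset.sum_eq_zero fun α _ => ?_
  rw [map_sub, map_smul, map_smul, (h.killingForm_torus_root hW α).1,
    (h.killingForm_torus_root hW α).2, smul_zero, smul_zero, sub_zero]

/-- With `c_α = B (W, E_{-α})` the `E_α`-components of `W` outside `Lie P` are removed, and the
conjugate `E_{-α}`-terms are in `Lie P`; the difference is in both `Lie G` and `Lie P`. -/
lemma exists_sub_rootSum_mem (h : IsFlagBundle EG G τ EF EM q Z Ep Em D)
    {W : GroupLieAlgebra 𝓘(ℂ, EG) Gc} (hW : W ∈ lieAlg EG G) :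
    ∃ c, W - rootSum Ep Em c ∈ lieAlg EG (G ⊓ P) := by
  refine ⟨fun α => killingForm ℂ _ W (Em α), mem_lieAlg_inf h.isClosed h.parabolic.isClosed
    (Submodule.sub_mem _ hW (h.rootSum_mem _)) ?_⟩
  have h1 := h.sub_sum_mem W
  have h2 : ∑ α, conj (killingForm ℂ _ W (Em α)) • Em α ∈ lieAlg EG P :=
    Submodule.sum_mem _ fun α _ => h.smul_mem _ _ (h.Em_mem α)
  have h3 := Submodule.add_mem _ h1 h2
  rw [rootSum, Finset.sum_sub_distrib]
  convert h3 using 1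
  abel

lemma fund_rootSum (h : IsFlagBundle EG G τ EF EM q Z Ep Em D) (c : PosRoot P H → ℂ) (x : F) :
    fund EG EM (q (1, x)) (rootSum Ep Em c) = ∑ α, c α • fund EG EM (q (1, x)) (Ep α) := by
  rw [rootSum, map_sum]
  refine Finset.sum_congr rfl fun α _ => ?_
  rw [map_sub, map_smul, map_smul, h.fund_Em, smul_zero, sub_zero]

lemma fund_rootSum_I (h : IsFlagBundle EG G τ EF EM q Z Ep Em D) (c : PosRoot P H → ℂ) (x : F) :
    fund EG EM (q (1, x)) (rootSum Ep Em fun α => Complex.I * c α) =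
      Complex.I • fund EG EM (q (1, x)) (rootSum Ep Em c) := by
  rw [h.fund_rootSum, h.fund_rootSum, Finset.smul_sum]
  simp only [mul_smul]

lemma rootSum_I_sub_mem (h : IsFlagBundle EG G τ EF EM q Z Ep Em D) (c : PosRoot P H → ℂ) :
    Complex.I • rootSum Ep Em c - rootSum Ep Em (fun α => Complex.I * c α) ∈ lieAlg EG P := by
  have h1 : Complex.I • rootSum Ep Em c - rootSum Ep Em (fun α => Complex.I * c α) =
      ∑ α, (-2 * Complex.I * conj (c α)) • Em α := by
    rw [rootSum, rootSum, Finset.smul_sum, ← Finset.sum_sub_distrib]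
    refine Finset.sum_congr rfl fun α _ => ?_
    simp only [map_mul, Complex.conj_I]
    module
  rw [h1]
  exact Submodule.sum_mem _ fun α _ => h.smul_mem _ _ (h.Em_mem α)

lemma killingForm_rootSum_sum_coH (h : IsFlagBundle EG G τ EF EM q Z Ep Em D)
    (c : PosRoot P H → ℂ) : killingForm ℂ _ (rootSum Ep Em c) (∑ α, coH Ep Em α) = 0 := by
  rw [LieModule.traceForm_comm]
  exact h.killingForm_torus_rootSum h.sum_coH_mem c

/-- The divergence of the fundamental fields in the chart at `p`. -/
def divergence (h : IsFlagBundle EG G τ EF EM q Z Ep Em D) (p : M) :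
    GroupLieAlgebra 𝓘(ℂ, EG) Gc →ₗ[ℂ] ℂ :=
  (chartDivergence (Gc := Gc) h.bundle.contMDiff_smul p : EG →ₗ[ℂ] ℂ)

variable (EM) in
/-- The differential of the logarithm of the volume density in the chart at `p`. -/
def dLogDet (η : TwoForm EM M) (p : M) : EM →L[ℝ] ℝ :=
  fderiv ℝ (logDet (localForm η p) (Module.finBasis ℂ EM)) (chartAt EM p p)

lemma ricciForm_fund (h : IsFlagBundle EG G τ EF EM q Z Ep Em D) {η : TwoForm EM M}
    (hη : IsKahlerForm η) (hinv : IsInvariantUnder (G : Set Gc) η)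
    {X Y : GroupLieAlgebra 𝓘(ℂ, EG) Gc} (hX : X ∈ lieAlg EG G) (hY : Y ∈ lieAlg EG G) (p : M) :
    (ricciForm η p : EM [⋀^Fin 2]→L[ℝ] ℝ) ![fund EG EM p X, fund EG EM p Y] =
      -(1 / (4 * Real.pi)) * (dLogDet EM η p (Complex.I • fund EG EM p ⁅X, Y⁆) +
        2 * (Complex.I * h.divergence p ⁅X, Y⁆).re) :=
  ricciForm_gen (E := EG) h.bundle.contMDiff_smul h.isClosed hη hinv hX hY p

lemma dLogDet_fund (h : IsFlagBundle EG G τ EF EM q Z Ep Em D) {η : TwoForm EM M}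
    (hη : IsKahlerForm η) (hinv : IsInvariantUnder (G : Set Gc) η)
    {X : GroupLieAlgebra 𝓘(ℂ, EG) Gc} (hX : X ∈ lieAlg EG G) (p : M) :
    dLogDet EM η p (fund EG EM p X) = -2 * (h.divergence p X).re :=
  fderiv_logDet_gen (E := EG) h.bundle.contMDiff_smul h.isClosed hη hinv hX p

/-- The sum of the diagonal coefficients of the derivatives of the frame. -/
def frameDerivative (h : IsFlagBundle EG G τ EF EM q Z Ep Em D) {x : F}
    (hx : q (1, x) ∈ principalPoints M G) : EM →ₗ[ℂ] ℂ :=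
  ∑ a, ((h.basis hx).coord a) ∘ₗ
    ((fderiv ℂ (genField (E := EG) Gc EM (q (1, x)) (frame Ep Em Z a))
      (chartAt EM (q (1, x)) (q (1, x))) : EM →L[ℂ] EM) : EM →ₗ[ℂ] EM)

lemma frameDerivative_apply (h : IsFlagBundle EG G τ EF EM q Z Ep Em D) {x : F}
    (hx : q (1, x) ∈ principalPoints M G) (v : EM) : h.frameDerivative hx v =
      ∑ a, (h.basis hx).repr (fderiv ℂ (genField (E := EG) Gc EM (q (1, x)) (frame Ep Em Z a))
        (chartAt EM (q (1, x)) (q (1, x))) v) a := by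
  simp [frameDerivative]

/-- For `X` in `Lie P`, the trace of `ad X` on the frame is the trace of the isotropy
representation, and the rest is the derivative of the frame along `X̂`. -/
lemma divergence_eq (h : IsFlagBundle EG G τ EF EM q Z Ep Em D) {x : F}
    (hx : q (1, x) ∈ principalPoints M G) {X : GroupLieAlgebra 𝓘(ℂ, EG) Gc}
    (hX : X ∈ lieAlg EG P) : h.divergence (q (1, x)) X =
      killingForm ℂ _ X (∑ α, coH Ep Em α) +
        h.frameDerivative hx (fund EG EM (q (1, x)) X) := by
  classical
  rw [← h.sum_repr_lie hx hX, h.frameDerivative_apply]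
  exact chartDivergence_eq (E := EG) h.bundle.contMDiff_smul (frame Ep Em Z) _ _
    (h.basis_apply hx) X

lemma divergence_of_fund_eq_zero (h : IsFlagBundle EG G τ EF EM q Z Ep Em D) {x : F}
    (hx : q (1, x) ∈ principalPoints M G) {X : GroupLieAlgebra 𝓘(ℂ, EG) Gc}
    (hX : X ∈ lieAlg EG P) (h0 : fund EG EM (q (1, x)) X = 0) : h.divergence (q (1, x)) X =
      killingForm ℂ _ X (∑ α, coH Ep Em α) := by
  rw [h.divergence_eq hx hX, h0, map_zero, add_zero]

/-- The volume function is differentiable and does not vanish at principal points. -/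
lemma volumeFunction_logDeriv (h : IsFlagBundle EG G τ EF EM q Z Ep Em D) {η : TwoForm EM M}
    (hη : IsKahlerForm η) {x : F} (hx : q (1, x) ∈ principalPoints M G) :
    volumeFunction η (frame Ep Em Z) (q (1, x)) ≠ 0 ∧
    MDifferentiableAt 𝓘(ℝ, EM) 𝓘(ℝ, ℝ) (volumeFunction η (frame Ep Em Z)) (q (1, x)) ∧
    HasDifferential (fun p => Real.log |volumeFunction η (frame Ep Em Z) p|) (q (1, x))
      fun v : EM => dLogDet EM η (q (1, x)) v + 2 * (h.frameDerivative hx v).re := by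
  classical
  have h1 := volumeGen_logDeriv (E := EG) (Gc := Gc) h.bundle.contMDiff_smul hη (frame Ep Em Z)
    (q (1, x)) (h.basis hx) (h.basis_apply hx)
  simp only [← h.frameDerivative_apply hx] at h1
  exact h1

/-- The Ricci potential in terms of the logarithmic derivative of the volume function. -/
lemma dLogDet_add_divergence (h : IsFlagBundle EG G τ EF EM q Z Ep Em D) {η : TwoForm EM M}
    (hη : IsKahlerForm η) (hinv : IsInvariantUnder (G : Set Gc) η) {x : F}
    (hx : q (1, x) ∈ principalPoints M G) {u : EM → ℝ}
    (hu : ∀ v, u v = dLogDet EM η (q (1, x)) v + 2 * (h.frameDerivative hx v).re)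
    {W : GroupLieAlgebra 𝓘(ℂ, EG) Gc} (hW : W ∈ lieAlg EG G) :
    ((-(1 / (4 * Real.pi)) * (dLogDet EM η (q (1, x)) (Complex.I • fund EG EM (q (1, x)) W) +
        2 * (Complex.I * h.divergence (q (1, x)) W).re) : ℝ) : ℂ) =
      killingForm ℂ _ (∑ i, ((u (Complex.I • fund EG EM (q (1, x)) (Z i)) / (4 * Real.pi) : ℝ) : ℂ)
        • Z i + ZV Ep Em) W := by
  set S := ∑ α, coH Ep Em α with hS
  obtain ⟨c, hc⟩ := h.exists_sub_rootSum_mem hW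
  set w := rootSum Ep Em c with hw
  set V := W - w with hV
  have hWV : W = w + V := by rw [hV]; abel
  have hVP : V ∈ lieAlg EG P := lieAlg_mono inf_le_right hc
  obtain ⟨a, ha⟩ := h.central.exists_sub_mem h.differential h.holomorphicHom h.realForm.isCompact
    h.parabolic.isClosed hc
  -- the contribution of the root vectors vanishes
  have hwpart : dLogDet EM η (q (1, x)) (Complex.I • fund EG EM (q (1, x)) w) +
      2 * (Complex.I * h.divergence (q (1, x)) w).re = 0 := by
    have h1 := h.dLogDet_fund hη hinv (h.rootSum_mem fun α => Complex.I * c α) (q (1, x))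
    -- On the fibre `J ŵ` is the field of the real element `w'` with coefficients `i c_α`. The
    -- difference `i w - w'` lies in `Lie P` with vanishing field and is orthogonal to `∑ H_α`, so
    -- `i w` and `w'` have the same divergence; invariance along `w'` then cancels the two terms.
    have h2 := h.divergence_of_fund_eq_zero hx (h.rootSum_I_sub_mem c) (by
      rw [map_sub, map_smul, h.fund_rootSum_I, sub_self])
    rw [map_sub, map_sub, map_smul, map_smul, LinearMap.sub_apply, LinearMap.smul_apply,
      h.killingForm_rootSum_sum_coH, h.killingForm_rootSum_sum_coH, smul_zero, sub_zero,
      sub_eq_zero, smul_eq_mul] at h2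
    rw [h.fund_rootSum_I, ← h2] at h1
    rw [h1]
    ring
  -- For the part in `Lie K` the derivative of the frame along `J V̂` is absorbed into `u`, the
  -- differential of the logarithm of the volume function.
  have hVpart : dLogDet EM η (q (1, x)) (Complex.I • fund EG EM (q (1, x)) V) +
      2 * (Complex.I * h.divergence (q (1, x)) V).re =
      u (Complex.I • fund EG EM (q (1, x)) V) + 2 * (Complex.I * killingForm ℂ _ V S).re := by
    rw [hu, h.divergence_eq hx hVP, (h.frameDerivative hx).map_smul, smul_eq_mul, mul_add,
      Complex.add_re]
    ring
  have hfV : fund EG EM (q (1, x)) V = ∑ i, a i • fund EG EM (q (1, x)) (Z i) := by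
    have h1 := h.fund_of_mem_kerSubgroup ha x
    rw [map_sub, sub_eq_zero, map_sum] at h1
    rw [h1]
    exact Finset.sum_congr rfl fun i _ => map_smul _ _ _
  have huV : u (Complex.I • fund EG EM (q (1, x)) V) =
      ∑ i, a i * u (Complex.I • fund EG EM (q (1, x)) (Z i)) := by
    have hre : ∀ (r : ℝ) (v : EM), (h.frameDerivative hx (r • v)).re =
        r * (h.frameDerivative hx v).re := fun r v => by
      rw [← Complex.coe_smul, (h.frameDerivative hx).map_smul, smul_eq_mul, Complex.re_ofReal_mul]
    rw [hfV, Finset.smul_sum, hu]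
    simp only [hu, map_sum, smul_comm Complex.I, hre, Complex.re_sum, mul_add,
      (dLogDet EM η (q (1, x))).map_smul, Finset.sum_add_distrib, Finset.mul_sum, smul_eq_mul]
    congr 1
    exact Finset.sum_congr rfl fun i _ => by ring
  have hZW : ∀ i, killingForm ℂ _ (Z i) W = -(a i : ℂ) := by
    intro i
    have h1 := h.central.perp i _ ha
    have h2 := h.central.killingForm_sum (fun i => (a i : ℂ)) i
    rw [map_sub, sub_eq_zero, h2] at h1
    rw [hWV, map_add, h.killingForm_torus_rootSum (h.central_mem_torus i), zero_add, h1]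
  have hSW : killingForm ℂ _ S W = killingForm ℂ _ V S := by
    rw [hWV, map_add, h.killingForm_torus_rootSum h.sum_coH_mem, zero_add,
      LieModule.traceForm_comm]
  -- Both `V` and `i ∑ H_α` are in `Lie G`, where the Killing form is real, so taking the real part
  -- loses nothing.
  have hreal : (((Complex.I * killingForm ℂ _ V S).re : ℝ) : ℂ) =
      Complex.I * killingForm ℂ _ V S := by
    have h1 := killingForm_real h.realForm.complexification (fun X hX Y hY => h.lie_mem_real hX hY)
      (mem_real_of_mem_inf hc) h.I_smul_sum_coH_mem
    rwa [map_smul, smul_eq_mul] at h1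
  have hΛ : dLogDet EM η (q (1, x)) (Complex.I • fund EG EM (q (1, x)) W) +
      2 * (Complex.I * h.divergence (q (1, x)) W).re =
      ∑ i, a i * u (Complex.I • fund EG EM (q (1, x)) (Z i)) +
        2 * (Complex.I * killingForm ℂ _ V S).re := by
    rw [← huV, ← hVpart, hWV, map_add, map_add, smul_add, map_add, mul_add, Complex.add_re]
    linarith
  rw [hΛ, ZV_eq, ← hS]
  clear_value S
  simp only [map_add, map_sum, map_smul, LinearMap.add_apply, LinearMap.sum_apply,
    LinearMap.smul_apply, hZW, smul_eq_mul]
  rw [hSW, ← hreal, Complex.ofReal_re]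
  push_cast
  rw [mul_add, Finset.mul_sum]
  have hpi : (Real.pi : ℂ) ≠ 0 := by exact_mod_cast Real.pi_ne_zero
  congr 1
  · refine Finset.sum_congr rfl fun i _ => ?_
    field_simp
  · field_simp
    ring

/-- The algebraic representative of the Ricci form at principal points of the fibre. -/
theorem isAlgRepAt_ricciForm_iff (h : IsFlagBundle EG G τ EF EM q Z Ep Em D) {η : TwoForm EM M}
    (hη : IsKahlerForm η) (hinv : IsInvariantUnder (G : Set Gc) η) {x : F}
    (hx : q (1, x) ∈ principalPoints M G) (W : GroupLieAlgebra 𝓘(ℂ, EG) Gc) :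
    IsAlgRepAt G (ricciForm η) (q (1, x)) W ↔
      W = ∑ i, ((dirDeriv (fun p => Real.log |volumeFunction η (frame Ep Em Z) p|)
          (q (1, x)) (Complex.I • hat EM (Z i) (q (1, x))) / (4 * Real.pi) : ℝ) : ℂ) • Z i
        + ZV Ep Em := by
  obtain ⟨-, -, -, hd⟩ := h.volumeFunction_logDeriv hη hx
  have hrep : IsAlgRepAt G (ricciForm η) (q (1, x))
      (∑ i, ((dirDeriv (fun p => Real.log |volumeFunction η (frame Ep Em Z) p|)
          (q (1, x)) (Complex.I • hat EM (Z i) (q (1, x))) / (4 * Real.pi) : ℝ) : ℂ) • Z i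
        + ZV Ep Em) := by
    refine ⟨Submodule.add_mem _ (Submodule.sum_mem _ fun i _ =>
      real_smul_mem (mem_real_of_mem_inf (h.central.mem i)) _) h.ZV_mem, fun X hX Y hY => ?_⟩
    refine Eq.trans (congrArg Complex.ofReal (h.ricciForm_fund hη hinv hX hY (q (1, x)))) ?_
    exact h.dLogDet_add_divergence hη hinv hx hd (h.lie_mem_real hX hY)
  refine ⟨fun hW => ?_, fun hW => hW ▸ hrep⟩
  -- Two representatives differ by an element orthogonal to all brackets of `Lie G`.
  refine sub_eq_zero.1 (eq_zero_of_killingForm_lie_eq_zero h.exists_decomposition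
    fun X hX Y hY => ?_)
  rw [map_sub, LinearMap.sub_apply, ← hW.2 X hX Y hY, ← hrep.2 X hX Y hY, sub_self]

end IsFlagBundle

end Setting

end

end HomogeneousToric

open HomogeneousToric in
theorem proposition3p2
    -- the complex group, the compact group and the parabolic subgroup
    {EG : Type*} [NormedAddCommGroup EG] [NormedSpace ℂ EG] [FiniteDimensional ℂ EG]
    {Gc : Type*} [TopologicalSpace Gc] [ChartedSpace EG Gc] [Group Gc]
    [LieGroup 𝓘(ℂ, EG) ω Gc] [T2Space Gc] [ConnectedSpace Gc]
    [LieAlgebra.IsSemisimple ℂ (GroupLieAlgebra 𝓘(ℂ, EG) Gc)]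
    (G P : Subgroup Gc) (hG : IsCompactRealForm EG G) (hP : IsParabolic EG P)
    -- the homomorphism and the fibre
    {m : ℕ} (τ : P →* (Fin m → ℂˣ)) (hτ : IsHolomorphicHom EG τ)
    (hτs : Function.Surjective τ)
    {EF : Type*} [NormedAddCommGroup EF] [NormedSpace ℂ EF] [FiniteDimensional ℂ EF]
    {F : Type*} [TopologicalSpace F] [ChartedSpace EF F] [IsManifold 𝓘(ℂ, EF) ω F]
    [T2Space F] [CompactSpace F] [ConnectedSpace F] [MulAction (Fin m → ℂˣ) F]
    (hF : IsToricKahler EF m F)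
    -- the bundle
    {EM : Type*} [NormedAddCommGroup EM] [NormedSpace ℂ EM] [FiniteDimensional ℂ EM]
    {M : Type*} [TopologicalSpace M] [ChartedSpace EM M] [IsManifold 𝓘(ℂ, EM) ω M]
    [T2Space M] [MulAction Gc M]
    (q : Gc × F → M) (hM : IsAssociatedBundle EG EF EM τ q)
    -- the basis of the central part and the root vectors
    (Z : Fin m → GroupLieAlgebra 𝓘(ℂ, EG) Gc) (hZ : IsCentralBasis G τ Z)
    (H : LieSubalgebra ℂ (GroupLieAlgebra 𝓘(ℂ, EG) Gc)) [H.IsCartanSubalgebra]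
    (hH : IsComplexifiedTorus G P H)
    (Ep Em : PosRoot P H → GroupLieAlgebra 𝓘(ℂ, EG) Gc) (hE : IsRootBasis G Ep Em) :
    ∃ K : ℝ, K ≠ 0 ∧
      ∀ η : TwoForm EM M, IsKahlerForm η → IsInvariantUnder (G : Set Gc) η →
        -- the representative of the Ricci form on the regular part of the fibre
        (∀ x : F, q (1, x) ∈ principalPoints M G →
          volumeFunction η (frame Ep Em Z) (q (1, x)) ≠ 0 ∧
          MDifferentiableAt 𝓘(ℝ, EM) 𝓘(ℝ, ℝ) (volumeFunction η (frame Ep Em Z)) (q (1, x)) ∧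
          ∀ W : GroupLieAlgebra 𝓘(ℂ, EG) Gc,
            IsAlgRepAt G (ricciForm η) (q (1, x)) W ↔
              W = ∑ i, ((dirDeriv (fun p => Real.log |volumeFunction η (frame Ep Em Z) p|)
                    (q (1, x)) (Complex.I • hat EM (Z i) (q (1, x))) / (4 * Real.pi) : ℝ) : ℂ) • Z i
                + ZV Ep Em) ∧
        -- the explicit form of the volume function on the fibre
        (∀ (f : Fin m → F → ℝ) (I : GroupLieAlgebra 𝓘(ℂ, EG) Gc), I ∈ lieAlg EG (kerSubgroup G τ) →
          (∀ x : F, IsAlgRepAt G η (q (1, x)) (∑ i, (f i x : ℂ) • Z i + I)) →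
          ∀ x : F, ((volumeFunction η (frame Ep Em Z) (q (1, x)) : ℝ) : ℂ) =
            (K : ℂ) *
            (((Matrix.of fun i j : Fin m =>
              dirDeriv (E := EF) (f i) x (Complex.I • fibreField (E'' := EM) q (Z j) x)).det : ℝ) : ℂ) *
            ∏ α : PosRoot P H, (∑ i, rootValue Ep Em α (Complex.I • Z i) * (f i x : ℂ)
              + rootValue Ep Em α (Complex.I • I))) := by
  classical
  obtain ⟨D, hD⟩ := hτ.exists_differential
  have h : IsFlagBundle EG G τ EF EM q Z Ep Em D :=
    ⟨hG, hP, hτ, hF, hM, hZ, hH, hE, hD⟩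
  -- The constant depends only on `m` and the number of roots: the first factor comes from the
  -- Pfaffian sum, the sign from the negated central block.
  refine ⟨wedgeConst (Fin m ⊕ PosRoot P H) * (-1) ^ m,
    mul_ne_zero (wedgeConst_pos _).ne' (pow_ne_zero _ (neg_ne_zero.2 one_ne_zero)),
    fun η hη hinv => ⟨fun x hx => ?_, fun f I hI hW x => ?_⟩⟩
  · obtain ⟨h1, h2, -⟩ := h.volumeFunction_logDeriv hη hx
    exact ⟨h1, h2, h.isAlgRepAt_ricciForm_iff hη hinv hx⟩
  · convert h.volumeFunction_fibre hη hinv f I hI hW x
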